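/- **Setting.** Let $k\ge 0$ and let $\mathfrak g[k]=\bigoplus_{i\le k}\mathfrak g_i$ be a truncated transitive graded Lie algebra over $\mathbb R$ ($\dim\mathfrak g_-<\infty$ for $\mathfrak g_-=\bigoplus_{p<0}\mathfrak g_p$, and $X\in\mathfrak g_i$, $i\ge 0$, $[X,\mathfrak g_-]=0$ imply $X=0$). Let $\mathfrak g=\bigoplus_i\mathfrak g_i$ be its prolongation: the transitive graded Lie algebra with truncation $\mathfrak g[k]$ in which, for $r>k$, $\mathfrak g_r$ consists of all derivations $\mathfrak g_-\to\mathfrak g$ of degree $r$. Put $F^p\mathfrak g=\bigoplus_{i\ge p}\mathfrak g_i$, $E^{(n)}=\bigoplus_{i\le n}\mathfrak g_i\cong\mathfrak g/F^{n+1}\mathfrak g$ and $E_+^{(n)}=\bigoplus_{0\le i\le n}\mathfrak g_i$. Let $\partial$ be the coboundary of the complex $\mathfrak g\to\mathrm{Hom}(\mathfrak g_-,\mathfrak g)\to\mathrm{Hom}(\wedge^2\mathfrak g_-,\mathfrak g)$, and let a subscript $r$ denote maps of degree $r$. Fix subspaces $W=\{W^1_\ell,W^2_{\ell+1}\}_{\ell\ge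 k}$ with $$\mathrm{Hom}(\mathfrak g_-,\mathfrak g)_\ell=W^1_\ell\oplus\partial\mathfrak g_\ell,\qquad \mathrm{Hom}(\wedge^2\mathfrak g_-,\mathfrak g)_{\ell+1}=W^2_{\ell+1}\oplus\partial\,\mathrm{Hom}(\mathfrak g_-,\mathfrak g)_{\ell+1}.$$ A *geometric structure of order $-1$* is a filtered manifold $Q^{(-1)}=(M,F)$ of constant symbol $\mathfrak g_-$. A (normal) *geometric structure of order $n\ge0$* of type $(\mathfrak g_-,G_0,\dots,G_n)$ consists of one of order $n-1$ and a principal $G_n$-bundle $Q^{(n)}\to Q^{(n-1)}$ that is a principal subbundle of the universal frame bundle $\mathscr S^{(n)}Q^{(n-1)}$. Here the tangent spaces of $Q^{(n)}$ are filtered by letting $F^pTQ^{(n)}$ be the preimage of $F^pTQ^{(n-1)}$ for $p\le n$ and $0$ for $p>n$. A point of $\mathscr S^{(n)}Q^{(n-1)}$ over $y$ is a class $[\zeta]$, modulo $F^{n+1}GL(E^{(n-1)})$, of filtration preserving isomorphisms $\zeta:E^{(n-1)}\to T_yQ^{(n-1)}$ (linear frames) such that $\mathrm{gr}\,\zeta$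 is an isomorphism of graded Lie algebras if $n=0$, and, if $n\ge1$, $\zeta(A)=\frac{d}{dt}|_{t=0}\,y\exp(tA)$ for $A\in\mathfrak g_{n-1}$ and the truncation $E^{(n-2)}\to TQ^{(n-2)}$ of $\zeta$ belongs to the class $y$. $G_n$ is a Lie group with Lie algebra $\mathfrak g_n$, embedded as a Lie subgroup of the structure group of $\mathscr S^{(n)}Q^{(n-1)}$ with differential the adjoint action of $\mathfrak g_n$ on $E^{(n-1)}$ modulo $F^{n+1}$; for $\ell>k$, $G_\ell$ is the vector group $\mathfrak g_\ell$. A structure of type $(\mathfrak g_-,G_0,\dots,G_n)$ is said to be of type $\mathfrak g[n]$. An isomorphism of order $-1$ is an isomorphism of filtered manifolds; one of order $n$ is a diffeomorphism $Q^{(n)}\to Q'^{(n)}$ which is the restriction of the lift $\mathscr S^{(n)}\varphi:[\zeta]\mapsto[\varphi_*\zeta]$ of an isomorphism $\varphi$ of order $n-1$. The *canonical Pfaff class* $[\theta^{(n-1)}]$ of $Q^{(n)}$ at $z$ is the set of all $\zeta^{-1}\circ\pi_*:T_zQ^{(n)}\to E^{(n-1)}$, $\zeta\in z$, where $\pi:Q^{(n)}\to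 Q^{(n-1)}$. The *structure functions* at $[\zeta]\in\mathscr S^{(n)}Q^{(n-1)}$ over $y$ are obtained from a smooth local field $Z$ of linear frames with $[Z_y]=[\zeta]$ and $\gamma(X,Y)=Z_y^{-1}[ZX,ZY]_y$: $\kappa_{[n]}(X,Y)$ is the $\mathfrak g_{p+q+n}$-component of $\gamma(X,Y)$ for $X\in\mathfrak g_p$, $Y\in\mathfrak g_q$, $p,q<0$, and $\tau_{[n]}(A,Y)$ is the $\mathfrak g_{q+n-1}$-component of $\gamma(A,Y)$ for $A\in E_+^{(n-2)}$, $Y\in\mathfrak g_q$, $q<0$. **Theorem.** (a) Every normal geometric structure $Q^{(k)}$ of type $\mathfrak g[k]$ has a tower of normal geometric structures $\mathscr S_W^{(\ell)}Q^{(k)}$, $\ell=k+1,\dots,\infty$, of type $\mathfrak g[\ell]$, each prolonging the preceding one, with $\mathscr S_W^{(k)}Q^{(k)}=Q^{(k)}$, such that all points satisfy $$\kappa_{[\ell]}\in W^2_\ell,\qquad \tau_{[\ell]}\in\mathrm{Hom}(E_+^{(\ell-2)},W^1_{\ell-1})\qquad(k<\ell<\infty).$$ For any such tower, $\kappa_{[\ell]}$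 and $\tau_{[\ell]}$ are well defined on $\mathscr S^{(\ell)}\mathscr S_W^{(\ell-1)}Q^{(k)}$ (independent of $Z$), with values in $\mathrm{Hom}(\wedge^2\mathfrak g_-,\mathfrak g)_\ell$ and $\mathrm{Hom}(E_+^{(\ell-2)},\mathrm{Hom}(\mathfrak g_-,\mathfrak g)_{\ell-1})$, and $\mathscr S_W^{(\ell)}Q^{(k)}$ is maximal: it is the set of all points of $\mathscr S^{(\ell)}\mathscr S_W^{(\ell-1)}Q^{(k)}$ satisfying these conditions. The tower is unique up to unique isomorphism over $Q^{(k)}$. (b) For every isomorphism $\varphi:P^{(k)}\to Q^{(k)}$ of such structures (of the same type) and every $\ell=k+1,\dots,\infty$ there is a unique isomorphism $\mathscr S_W^{(\ell)}\varphi:\mathscr S_W^{(\ell)}P^{(k)}\to\mathscr S_W^{(\ell)}Q^{(k)}$ prolonging $\varphi$. (c) Conversely, let $G_0,\dots,G_k$ be connected. If, for some $\ell=k+1,\dots,\infty$, $\Phi:\mathscr S_W^{(\ell)}P^{(k)}\to\mathscr S_W^{(\ell)}Q^{(k)}$ is a diffeomorphism with $\Phi^*[\theta^{(\ell-1)}]_Q=[\theta^{(\ell-1)}]_P$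 (for $\ell=\infty$: $\Phi^*\theta_Q=\theta_P$), then there is an isomorphism $\varphi:P^{(k)}\to Q^{(k)}$ such that $\Phi$ is an isomorphism of geometric structures prolonging $\varphi$. (d) On the projective limit $\mathscr S_WQ^{(k)}=\varprojlim_\ell\mathscr S_W^{(\ell)}Q^{(k)}$ the Pfaff classes define a $\prod_i\mathfrak g_i$-valued 1-form $\theta$, which is an absolute parallelism, and the isomorphism of (b) for $\ell=\infty$ preserves it. Hence, if $G_0,\dots,G_k$ are connected, $P^{(k)}$ and $Q^{(k)}$ are isomorphic if and only if there is a diffeomorphism $\Phi:\mathscr S_WP^{(k)}\to\mathscr S_WQ^{(k)}$ with $\Phi^*\theta_Q=\theta_P$. If $\dim\mathfrak g<\infty$, then $\mathscr S_W^{(\ell+1)}Q^{(k)}\to\mathscr S_W^{(\ell)}Q^{(k)}$ is a diffeomorphism for all large $\ell$, so $\mathscr S_WQ^{(k)}$ is finite dimensional, and $\dim\mathscr S_WQ^{(k)}=\dim\mathfrak g$. -/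

import Mathlib

open scoped Manifold ContDiff Topology

universe u v

namespace NormalProlongation

/-! ### Transitive graded Lie algebras, prolongation, Spencer complex -/

section Algebra

variable {L : Type v} [LieRing L] [LieAlgebra ℝ L] (𝒜 : ℤ → Submodule ℝ L)

/-- The filtration `F^p 𝔤 = ⨁_{i ≥ p} 𝔤_i` of a graded Lie algebra `𝔤 = ⨁ 𝔤_i`. -/
def filt (p : ℤ) : Submodule ℝ L := ⨆ i : ℤ, ⨆ _ : p ≤ i, 𝒜 i

variable [GradedLieAlgebra 𝒜]

/-- The negative part `𝔤₋ = ⨁_{p < 0} 𝔤_p`, a Lie subalgebra. -/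
def gNeg : LieSubalgebra ℝ L where
  toSubmodule := ⨆ i : {i : ℤ // i < 0}, 𝒜 i.1
  lie_mem' := by
    intro x y hx hy
    change x ∈ (⨆ i : {i : ℤ // i < 0}, 𝒜 i.1) at hx
    change y ∈ (⨆ i : {i : ℤ // i < 0}, 𝒜 i.1) at hy
    change ⁅x, y⁆ ∈ (⨆ i : {i : ℤ // i < 0}, 𝒜 i.1)
    induction hx using Submodule.iSup_induction' with
    | mem i x hx =>
      induction hy using Submodule.iSup_induction' with
      | mem j y hy =>
        exact Submodule.mem_iSup_of_mem (p := fun i : {i : ℤ // i < 0} => 𝒜 i.1)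
          ⟨i.1 + j.1, by have := i.2; have := j.2; omega⟩
          (SetLike.GradedBracket.bracket_mem hx hy)
      | zero => simp
      | add y y' _ _ h h' => rw [lie_add]; exact add_mem h h'
    | zero => simp
    | add x x' _ _ h h' => rw [add_lie]; exact add_mem h h'

/-- A graded Lie algebra is transitive if `dim 𝔤₋ < ∞` and no nonzero element of degree `≥ 0`
centralizes `𝔤₋`. -/
structure IsTransitive : Prop where
  finite_neg : FiniteDimensional ℝ (gNeg 𝒜)
  trans : ∀ i : ℤ, 0 ≤ i → ∀ X ∈ 𝒜 i, (∀ v : gNeg 𝒜, ⁅X, (v : L)⁆ = 0) → X = 0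

open LieModule.Cohomology in
/-- `Hom(𝔤₋, 𝔤)_r`: the linear maps of degree `r`. -/
def hom1 (r : ℤ) : Submodule ℝ (oneCochain ℝ (gNeg 𝒜) L) where
  carrier := {f | ∀ p : ℤ, ∀ v : gNeg 𝒜, (v : L) ∈ 𝒜 p → f v ∈ 𝒜 (p + r)}
  add_mem' hf hg p v hv := add_mem (hf p v hv) (hg p v hv)
  zero_mem' _ _ _ := zero_mem _
  smul_mem' c _ hf p v hv := Submodule.smul_mem _ c (hf p v hv)

open LieModule.Cohomology in
/-- `Hom(∧² 𝔤₋, 𝔤)_r`: the alternating bilinear maps of degree `r`. -/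
def hom2 (r : ℤ) : Submodule ℝ (twoCochain ℝ (gNeg 𝒜) L) where
  carrier := {f | ∀ p q : ℤ, ∀ v w : gNeg 𝒜, (v : L) ∈ 𝒜 p → (w : L) ∈ 𝒜 q →
    f v w ∈ 𝒜 (p + q + r)}
  add_mem' hf hg p q v w hv hw := add_mem (hf p q v w hv hw) (hg p q v w hv hw)
  zero_mem' _ _ _ _ _ _ := zero_mem _
  smul_mem' c _ hf p q v w hv hw := Submodule.smul_mem _ c (hf p q v w hv hw)

open LieModule.Cohomology in
/-- The coboundary `∂ : 𝔤 → Hom(𝔤₋, 𝔤)`, `(∂ A)(v) = [v, A]`. The next coboundary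
`∂ : Hom(𝔤₋, 𝔤) → Hom(∧² 𝔤₋, 𝔤)` is Mathlib's `LieModule.Cohomology.d₁₂`. -/
def d₀ : L →ₗ[ℝ] oneCochain ℝ (gNeg 𝒜) L where
  toFun A :=
    { toFun := fun v => ⁅(v : L), A⁆
      map_add' := fun v w => by simp
      map_smul' := fun c v => by simp }
  map_add' A B := by ext v; simp
  map_smul' c A := by ext v; simp

/-- `𝔤` is the prolongation of its truncation `𝔤[k] = ⨁_{i ≤ k} 𝔤_i`: in each degree `r > k`
the component `𝔤_r` consists of all derivations `𝔤₋ → 𝔤` of degree `r`. -/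
def IsProlongation (k : ℕ) : Prop :=
  ∀ r : ℤ, (k : ℤ) < r → ∀ f ∈ hom1 𝒜 r,
    (∀ u v : gNeg 𝒜, f ⁅u, v⁆ = ⁅f u, (v : L)⁆ + ⁅(u : L), f v⁆) →
    ∃ A ∈ 𝒜 r, ∀ v : gNeg 𝒜, f v = ⁅A, (v : L)⁆

open LieModule.Cohomology in
/-- A choice `W = {W¹_ℓ, W²_{ℓ+1}}_{ℓ ≥ k}` of complements
`Hom(𝔤₋, 𝔤)_ℓ = W¹_ℓ ⊕ ∂ 𝔤_ℓ` and
`Hom(∧² 𝔤₋, 𝔤)_{ℓ+1} = W²_{ℓ+1} ⊕ ∂ Hom(𝔤₋, 𝔤)_{ℓ+1}`. -/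
structure IsComplementSystem (k : ℕ)
    (W1 : ℤ → Submodule ℝ (oneCochain ℝ (gNeg 𝒜) L))
    (W2 : ℤ → Submodule ℝ (twoCochain ℝ (gNeg 𝒜) L)) : Prop where
  sup1 : ∀ l : ℤ, (k : ℤ) ≤ l → W1 l ⊔ (𝒜 l).map (d₀ 𝒜) = hom1 𝒜 l
  inf1 : ∀ l : ℤ, (k : ℤ) ≤ l → W1 l ⊓ (𝒜 l).map (d₀ 𝒜) = ⊥
  sup2 : ∀ l : ℤ, (k : ℤ) ≤ l →
    W2 (l + 1) ⊔ (hom1 𝒜 (l + 1)).map (d₁₂ ℝ (gNeg 𝒜) L) = hom2 𝒜 (l + 1)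
  inf2 : ∀ l : ℤ, (k : ℤ) ≤ l →
    W2 (l + 1) ⊓ (hom1 𝒜 (l + 1)).map (d₁₂ ℝ (gNeg 𝒜) L) = ⊥

/-! ### The structure groups

`E^{(n-1)} = 𝔤₋ ⊕ 𝔤_0 ⊕ ⋯ ⊕ 𝔤_{n-1}` is identified with `𝔤 / F^n 𝔤`; accordingly an endomorphism of
the filtered space `E^{(n-1)}` is given by a linear map `𝔤 → 𝔤`, taken modulo `F^n 𝔤`. -/

/-- `α` and `β` have the same class modulo `F^{n+1} GL(E^{(n-1)})`. -/
def RepEquiv (n : ℕ) (α β : L →ₗ[ℝ] L) : Prop :=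
  ∀ p : ℤ, ∀ x ∈ filt 𝒜 p, α x - β x ∈ filt 𝒜 (min (p + n + 1) n)

/-- `α` represents an element of `Ĝ_n`, the structure group of the universal linear frame bundle
of a geometric structure of order `n - 1`: a filtration preserving automorphism of `E^{(n-1)}`
which, for `n = 0`, induces a graded Lie algebra automorphism of `gr 𝔤₋ = 𝔤₋`, and, for
`n = m + 1`, is the identity on `𝔤_m` and induces on `E^{(m-1)}` a map in
`F^{m+1} GL(E^{(m-1)})`. -/
def IsLinearGroupElt : (n : ℕ) → (L →ₗ[ℝ] L) → Prop
  | 0, α =>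
    (∀ p : ℤ, p ≤ 0 → (filt 𝒜 p).map α ⊔ filt 𝒜 0 = filt 𝒜 p) ∧
    ∀ p q : ℤ, p < 0 → q < 0 → ∀ X ∈ 𝒜 p, ∀ Y ∈ 𝒜 q,
      α ⁅X, Y⁆ - ⁅α X, α Y⁆ ∈ filt 𝒜 (p + q + 1)
  | m + 1, α =>
    (∀ p : ℤ, p ≤ ((m + 1 : ℕ) : ℤ) →
      (filt 𝒜 p).map α ⊔ filt 𝒜 ((m + 1 : ℕ) : ℤ) = filt 𝒜 p) ∧
    (∀ A ∈ 𝒜 (m : ℤ), α A - A ∈ filt 𝒜 ((m + 1 : ℕ) : ℤ)) ∧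
    RepEquiv 𝒜 m α LinearMap.id

end Algebra

/-- The type `(𝔤₋, G_0, …, G_k)` of a normal geometric structure of type `𝔤[k]`, together with the
vector groups `G_l = 𝔤_l` for `l > k`. Every `G_n` is a Lie group with Lie algebra `𝔤_n` (through
`lam`) and is a Lie subgroup of `Ĝ_n / F^{n+1}`: the injective homomorphism
`G_n → Ĝ_n / F^{n+1}` sends `a` to the class of `rho n a`, is smooth, and its differential at `1` is
the adjoint action of `𝔤_n` on `E^{(n-1)}` modulo `F^{n+1}`. -/
structure StructureType {L : Type v} [LieRing L] [LieAlgebra ℝ L] (𝒜 : ℤ → Submodule ℝ L)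
    [GradedLieAlgebra 𝒜] (k : ℕ) where
  G : ℕ → Type u
  VG : ℕ → Type u
  [grp : ∀ n, Group (G n)]
  [normed : ∀ n, NormedAddCommGroup (VG n)]
  [space : ∀ n, NormedSpace ℝ (VG n)]
  [fd : ∀ n, FiniteDimensional ℝ (VG n)]
  [top : ∀ n, TopologicalSpace (G n)]
  [t2 : ∀ n, T2Space (G n)]
  [sc : ∀ n, SecondCountableTopology (G n)]
  [charted : ∀ n, ChartedSpace (VG n) (G n)]
  [lie : ∀ n, LieGroup 𝓘(ℝ, VG n) ∞ (G n)]
  /-- the identification of `𝔤_n` with the Lie algebra of `G_n` -/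
  lam : ∀ n : ℕ, 𝒜 (n : ℤ) ≃ₗ[ℝ] TangentSpace 𝓘(ℝ, VG n) (1 : G n)
  rho : ∀ n : ℕ, G n → (L →ₗ[ℝ] L)
  rho_mem : ∀ n a, IsLinearGroupElt 𝒜 n (rho n a)
  rho_mul : ∀ n a b, RepEquiv 𝒜 n (rho n (a * b)) (rho n a ∘ₗ rho n b)
  rho_inj : ∀ n a, RepEquiv 𝒜 n (rho n a) LinearMap.id → a = 1
  rho_smooth : ∀ (n : ℕ) (p : ℤ), ∀ x ∈ filt 𝒜 p, ∀ f : L →ₗ[ℝ] ℝ,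
    (∀ y ∈ filt 𝒜 (min (p + n + 1) n), f y = 0) →
    ContMDiff 𝓘(ℝ, VG n) 𝓘(ℝ, ℝ) ∞ (fun a : G n => f (rho n a x))
  rho_deriv : ∀ (n : ℕ) (p : ℤ), ∀ x ∈ filt 𝒜 p, ∀ f : L →ₗ[ℝ] ℝ,
    (∀ y ∈ filt 𝒜 (min (p + n + 1) n), f y = 0) → ∀ A : 𝒜 (n : ℤ),
    mfderiv 𝓘(ℝ, VG n) 𝓘(ℝ, ℝ) (fun a : G n => f (rho n a x)) 1 (lam n A) = f ⁅(A : L), x⁆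
  /-- for `n > k` the Lie group `G_n` is the vector group `𝔤_n`, acting by `x ↦ x + [A, x]` -/
  vector : ∀ n : ℕ, k < n → ∃ e : 𝒜 (n : ℤ) ≃+ Additive (G n),
    (∀ A : 𝒜 (n : ℤ), RepEquiv 𝒜 n (rho n (e A).toMul)
      (LinearMap.id + (LieAlgebra.ad ℝ L (A : L) : L →ₗ[ℝ] L))) ∧
    (∀ w : VG n →ₗ[ℝ] 𝒜 (n : ℤ),
      ContMDiff 𝓘(ℝ, VG n) 𝓘(ℝ, VG n) ∞ (fun x : VG n => (e (w x)).toMul)) ∧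
    (∀ f : 𝒜 (n : ℤ) →ₗ[ℝ] ℝ,
      ContMDiff 𝓘(ℝ, VG n) 𝓘(ℝ, ℝ) ∞ (fun a : G n => f (e.symm (Additive.ofMul a))))

attribute [instance] StructureType.grp StructureType.normed StructureType.space StructureType.fd
  StructureType.top StructureType.t2 StructureType.sc StructureType.charted StructureType.lie

variable {L : Type v} [LieRing L] [LieAlgebra ℝ L] {𝒜 : ℤ → Submodule ℝ L}
  [GradedLieAlgebra 𝒜] {k : ℕ}

/-- The data underlying a geometric structure. Level `n` is the manifold `Q n = Q^{(n-1)}`, so that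
`Q 0 = M` is the base; `F` is the tangential filtration of `M`; `π n : Q^{(n)} → Q^{(n-1)}` is the
projection; `act n` is the right action of `G_n` on `Q^{(n)}`. A point `z` of `Q^{(n)}` is a class of
linear frames `E^{(n-1)} → T Q^{(n-1)}` at `π n z`, and `frames n z` is this class. A linear frame at
`y : Q n` is written as a linear map from `𝔤` to `T_y (Q n)` that vanishes on `F^n 𝔤`; recall that in
Mathlib `TangentSpace 𝓘(ℝ, V) y` is a synonym of the model space `V`. A structure of order `l` only
concerns the levels `≤ l + 1`; see `Tower.IsGeometric` for the laws. -/
structure Tower (𝒯 : StructureType.{u} 𝒜 k) where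
  Q : ℕ → Type u
  V : ℕ → Type u
  [normed : ∀ n, NormedAddCommGroup (V n)]
  [space : ∀ n, NormedSpace ℝ (V n)]
  [fd : ∀ n, FiniteDimensional ℝ (V n)]
  [top : ∀ n, TopologicalSpace (Q n)]
  [t2 : ∀ n, T2Space (Q n)]
  [sc : ∀ n, SecondCountableTopology (Q n)]
  [charted : ∀ n, ChartedSpace (V n) (Q n)]
  [mfd : ∀ n, IsManifold 𝓘(ℝ, V n) ∞ (Q n)]
  F : ℤ → Q 0 → Submodule ℝ (V 0)
  π : ∀ n, Q (n + 1) → Q n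
  act : ∀ n, Q (n + 1) → 𝒯.G n → Q (n + 1)
  frames : ∀ n, Q (n + 1) → Set (L →ₗ[ℝ] V n)

attribute [instance] Tower.normed Tower.space Tower.fd Tower.top Tower.t2 Tower.sc Tower.charted
  Tower.mfd

namespace Tower

variable {𝒯 : StructureType.{u} 𝒜 k} (T : Tower 𝒯)

/-- `ξ` is a smooth vector field on the subset `U` of level `n`. -/
def SmoothFieldOn (n : ℕ) (ξ : ∀ y : T.Q n, TangentSpace 𝓘(ℝ, T.V n) y) (U : Set (T.Q n)) : Prop :=
  ContMDiffOn 𝓘(ℝ, T.V n) 𝓘(ℝ, T.V n).tangent ∞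
    (fun y => (⟨y, ξ y⟩ : TangentBundle 𝓘(ℝ, T.V n) (T.Q n))) U

/-- The Lie bracket of vector fields at a point of level `n`. -/
noncomputable def bracket (n : ℕ) (ξ η : ∀ y : T.Q n, TangentSpace 𝓘(ℝ, T.V n) y) (y : T.Q n) : T.V n :=
  VectorField.mlieBracket 𝓘(ℝ, T.V n) ξ η y

/-- The differential of `π n : Q (n + 1) → Q n`. -/
noncomputable def dπ (n : ℕ) (z : T.Q (n + 1)) : T.V (n + 1) →ₗ[ℝ] T.V n :=
  (mfderiv 𝓘(ℝ, T.V (n + 1)) 𝓘(ℝ, T.V n) (T.π n) z :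
    T.V (n + 1) →L[ℝ] T.V n).toLinearMap

/-- The fundamental vector `Ã_z = d/dt|_{t=0} z exp(tA)`, for `A ∈ 𝔤_n`. -/
noncomputable def fundamental (n : ℕ) (A : 𝒜 (n : ℤ)) (z : T.Q (n + 1)) : T.V (n + 1) :=
  mfderiv 𝓘(ℝ, 𝒯.VG n) 𝓘(ℝ, T.V (n + 1)) (fun a : 𝒯.G n => T.act n z a) 1 (𝒯.lam n A)

/-- The canonical filtration of the tangent spaces: `F^p T Q^{(n)}` is the preimage of
`F^p T Q^{(n-1)}` for `p ≤ n`, and `F^p T Q^{(n)} = 0` for `p > n`. -/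
noncomputable def tanFilt : (n : ℕ) → ℤ → T.Q n → Submodule ℝ (T.V n)
  | 0, p, x => T.F p x
  | n + 1, p, z =>
    if p ≤ (n : ℤ) then (tanFilt n p (T.π n z)).comap (T.dπ n z) else ⊥

/-- `ζ` is an element over `y` of the universal linear frame bundle `Ŝ^{(n)} Q^{(n-1)}`: a filtration
preserving isomorphism `E^{(n-1)} → T_y Q^{(n-1)}` such that, if `n = 0`, the map
`gr ζ : 𝔤₋ → gr T_y M` is an isomorphism of graded Lie algebras (the bracket of `gr T_y M` being
induced by the bracket of vector fields), and, if `n = m + 1`, `ζ(A) = Ã_y` for `A ∈ 𝔤_m` and the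
truncation of `ζ` belongs to the class `y`. -/
def IsLinearFrame : (n : ℕ) → T.Q n → (L →ₗ[ℝ] T.V n) → Prop
  | 0, x, ζ =>
    LinearMap.ker ζ = filt 𝒜 0 ∧ (∀ p : ℤ, (filt 𝒜 p).map ζ = T.tanFilt 0 p x) ∧
    ∀ p q : ℤ, p < 0 → q < 0 → ∀ X ∈ 𝒜 p, ∀ Y ∈ 𝒜 q,
      ∀ (U : Set (T.Q 0)) (ξ η : T.Q 0 → T.V 0), IsOpen U → x ∈ U →
      T.SmoothFieldOn 0 ξ U → T.SmoothFieldOn 0 η U →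
      (∀ y ∈ U, ξ y ∈ T.F p y) → (∀ y ∈ U, η y ∈ T.F q y) → ξ x = ζ X → η x = ζ Y →
      T.bracket 0 ξ η x - ζ ⁅X, Y⁆ ∈ T.F (p + q + 1) x
  | m + 1, y, ζ =>
    LinearMap.ker ζ = filt 𝒜 ((m + 1 : ℕ) : ℤ) ∧
    (∀ p : ℤ, (filt 𝒜 p).map ζ = T.tanFilt (m + 1) p y) ∧
    (∀ A : 𝒜 (m : ℤ), ζ A = T.fundamental m A y) ∧
    T.dπ m y ∘ₗ ζ ∈ T.frames m y

/-- Two linear frames at `y` are congruent modulo `F^{n+1} GL(E^{(n-1)})`, that is, they define the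
same point of the universal frame bundle `S^{(n)} Q^{(n-1)}`. -/
def FrameEquiv (n : ℕ) (y : T.Q n) (ζ ζ' : L →ₗ[ℝ] T.V n) : Prop :=
  ∀ p : ℤ, ∀ x ∈ filt 𝒜 p, ζ' x - ζ x ∈ T.tanFilt n (p + n + 1) y

/-- `(M, F)` is a filtered manifold of constant symbol of type `𝔤₋`. -/
structure IsFilteredManifold : Prop where
  antitone : ∀ x (p : ℤ), T.F (p + 1) x ≤ T.F p x
  zero : ∀ x, T.F 0 x = ⊥
  exhaustive : ∀ x, ∃ p : ℤ, T.F p x = ⊤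
  /-- each `F^p` is a smooth subbundle: it has smooth local bases -/
  subbundle : ∀ (p : ℤ) (x : T.Q 0), ∃ (U : Set (T.Q 0)) (r : ℕ) (s : Fin r → T.Q 0 → T.V 0),
    IsOpen U ∧ x ∈ U ∧ (∀ i, T.SmoothFieldOn 0 (s i) U) ∧
    ∀ y ∈ U, LinearIndependent ℝ (fun i => s i y) ∧
      Submodule.span ℝ (Set.range fun i => s i y) = T.F p y
  bracket_mem : ∀ (p q : ℤ) (U : Set (T.Q 0)) (ξ η : T.Q 0 → T.V 0), IsOpen U →
    T.SmoothFieldOn 0 ξ U → T.SmoothFieldOn 0 η U →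
    (∀ y ∈ U, ξ y ∈ T.F p y) → (∀ y ∈ U, η y ∈ T.F q y) →
    ∀ y ∈ U, T.bracket 0 ξ η y ∈ T.F (p + q) y
  symbol : ∀ x, ∃ ζ, T.IsLinearFrame 0 x ζ

/-- `Q^{(n)} → Q^{(n-1)}` is a principal fibre bundle with structure group `G_n` and a principal
subbundle of the universal frame bundle `S^{(n)} Q^{(n-1)}`. -/
structure IsFrameReduction (n : ℕ) : Prop where
  smooth_π : ContMDiff 𝓘(ℝ, T.V (n + 1)) 𝓘(ℝ, T.V n) ∞ (T.π n)
  smooth_act : ContMDiff (𝓘(ℝ, T.V (n + 1)).prod 𝓘(ℝ, 𝒯.VG n)) 𝓘(ℝ, T.V (n + 1)) ∞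
    (fun p : T.Q (n + 1) × 𝒯.G n => T.act n p.1 p.2)
  act_one : ∀ z, T.act n z 1 = z
  act_mul : ∀ z a b, T.act n z (a * b) = T.act n (T.act n z a) b
  π_act : ∀ z a, T.π n (T.act n z a) = T.π n z
  free : ∀ z a, T.act n z a = z → a = 1
  transitive : ∀ z w, T.π n z = T.π n w → ∃ a, T.act n z a = w
  /-- local triviality: a smooth local section `s` and the smooth fibre coordinate `δ` -/
  locallyTrivial : ∀ y₀ : T.Q n, ∃ (U : Set (T.Q n)) (s : T.Q n → T.Q (n + 1))
    (δ : T.Q (n + 1) → 𝒯.G n), IsOpen U ∧ y₀ ∈ U ∧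
    ContMDiffOn 𝓘(ℝ, T.V n) 𝓘(ℝ, T.V (n + 1)) ∞ s U ∧ (∀ y ∈ U, T.π n (s y) = y) ∧
    ContMDiffOn 𝓘(ℝ, T.V (n + 1)) 𝓘(ℝ, 𝒯.VG n) ∞ δ (T.π n ⁻¹' U) ∧
    ∀ z, T.π n z ∈ U → T.act n (s (T.π n z)) (δ z) = z
  frames_nonempty : ∀ z, (T.frames n z).Nonempty
  /-- `frames n z` is a full class of linear frames modulo `F^{n+1}` -/
  frames_class : ∀ z, ∀ ζ ∈ T.frames n z, ∀ ζ',
    ζ' ∈ T.frames n z ↔ T.IsLinearFrame n (T.π n z) ζ' ∧ T.FrameEquiv n (T.π n z) ζ ζ'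
  frames_act : ∀ z a, ∀ ζ ∈ T.frames n z, ζ ∘ₗ 𝒯.rho n a ∈ T.frames n (T.act n z a)
  /-- the inclusion `Q^{(n)} → S^{(n)} Q^{(n-1)}` is smooth -/
  frames_smooth : ∀ z₀ : T.Q (n + 1), ∃ (U : Set (T.Q (n + 1)))
    (Z : T.Q (n + 1) → (L →ₗ[ℝ] T.V n)), IsOpen U ∧ z₀ ∈ U ∧ (∀ z ∈ U, Z z ∈ T.frames n z) ∧
    ∀ x : L, ContMDiffOn 𝓘(ℝ, T.V (n + 1)) 𝓘(ℝ, T.V n).tangent ∞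
      (fun z => (⟨T.π n z, Z z x⟩ : TangentBundle 𝓘(ℝ, T.V n) (T.Q n))) U

/-- The levels `≤ l + 1` form a (normal) geometric structure `Q^{(l)}` of order `l` of type
`(𝔤₋, G_0, …, G_l)`. -/
structure IsGeometric (l : ℕ) : Prop where
  filtered : T.IsFilteredManifold
  reduction : ∀ n, n ≤ l → T.IsFrameReduction n

/-! ### Structure functions -/

/-- `Z` is a smooth section over the open set `U` of the universal linear frame bundle
`Ŝ^{(n)} Q^{(n-1)}`. -/
structure IsFrameField (n : ℕ) (U : Set (T.Q n)) (Z : T.Q n → (L →ₗ[ℝ] T.V n)) : Prop where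
  isOpen : IsOpen U
  linear : ∀ y ∈ U, T.IsLinearFrame n y (Z y)
  smooth : ∀ x : L, T.SmoothFieldOn n (fun y => Z y x) U

/-- `Z` is a local section of the universal linear frame bundle passing at `y` through the class
`[ζ]` in the universal frame bundle `S^{(n)} Q^{(n-1)}`. -/
def IsFrameFieldThrough (n : ℕ) (y : T.Q n) (ζ : L →ₗ[ℝ] T.V n)
    (Z : T.Q n → (L →ₗ[ℝ] T.V n)) : Prop :=
  (∃ U, T.IsFrameField n U Z ∧ y ∈ U) ∧ T.FrameEquiv n y ζ (Z y)

/-- `c` is the component in `𝔤_i` of `γ(X, Y) = θ([Z X, Z Y])` at `y`, where `θ = Z⁻¹` is the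
canonical form pulled back by the section `Z`; so `dθ + ½ γ(θ, θ) = 0`. The value of `γ(X, Y)` lies
in `E^{(n-1)} = 𝔤 / F^n 𝔤`, and only components of degree `i < n` are used. -/
def IsGammaComponent (n : ℕ) (y : T.Q n) (Z : T.Q n → (L →ₗ[ℝ] T.V n)) (X Y : L) (i : ℤ)
    (c : L) : Prop :=
  ∀ u : L, Z y u = T.bracket n (fun x => Z x X) (fun x => Z x Y) y →
    (DirectSum.decompose 𝒜 u i : L) = c

/-- `K` is the structure function `κ_{[n]}`, the part of `γ` on `∧² 𝔤₋` of degree `n`. -/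
def IsKappa (n : ℕ) (y : T.Q n) (Z : T.Q n → (L →ₗ[ℝ] T.V n))
    (K : LieModule.Cohomology.twoCochain ℝ (gNeg 𝒜) L) : Prop :=
  ∀ p q : ℤ, p < 0 → q < 0 → ∀ X Y : gNeg 𝒜, (X : L) ∈ 𝒜 p → (Y : L) ∈ 𝒜 q →
    T.IsGammaComponent n y Z X Y (p + q + n) (K X Y)

/-- `t` is `τ_{[n]}(A, ·)`, the part of modified degree `n` of `γ(A, ·)` on `𝔤₋`, for `A ∈ E_+`: for
`Y ∈ 𝔤_q`, `q < 0`, it is the component of `γ(A, Y)` in `𝔤_{q + n - 1}`. -/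
def IsTau (n : ℕ) (y : T.Q n) (Z : T.Q n → (L →ₗ[ℝ] T.V n)) (A : L)
    (t : LieModule.Cohomology.oneCochain ℝ (gNeg 𝒜) L) : Prop :=
  ∀ q : ℤ, q < 0 → ∀ Y : gNeg 𝒜, (Y : L) ∈ 𝒜 q →
    T.IsGammaComponent n y Z A Y (q + n - 1) (t Y)

variable (𝒜) in
/-- `E_+^{(m)} = 𝔤_0 ⊕ ⋯ ⊕ 𝔤_m`, which is `0` for `m < 0`. -/
def Eplus (m : ℤ) : Submodule ℝ L := ⨆ i : ℤ, ⨆ _ : 0 ≤ i ∧ i ≤ m, 𝒜 i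

/-- The class of `ζ` in `S^{(n)} Q^{(n-1)}` satisfies `κ_{[n]} ∈ W²_n` and
`τ_{[n]} ∈ Hom(E_+^{(n-2)}, W¹_{n-1})`. -/
def IsWNormal (W1 : ℤ → Submodule ℝ (LieModule.Cohomology.oneCochain ℝ (gNeg 𝒜) L))
    (W2 : ℤ → Submodule ℝ (LieModule.Cohomology.twoCochain ℝ (gNeg 𝒜) L))
    (n : ℕ) (y : T.Q n) (ζ : L →ₗ[ℝ] T.V n) : Prop :=
  ∀ Z, T.IsFrameFieldThrough n y ζ Z →
    (∃ K ∈ W2 n, T.IsKappa n y Z K) ∧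
    ∀ A ∈ Eplus 𝒜 ((n : ℤ) - 2), ∃ t ∈ W1 ((n : ℤ) - 1), T.IsTau n y Z A t

/-- The structure functions `κ_{[n]}` and `τ_{[n]}` are well defined on `S^{(n)} Q^{(n-1)}`: local
sections through every linear frame exist, and the values depend only on its class. -/
def StructureFunctionsWellDefined (n : ℕ) : Prop :=
  ∀ (y : T.Q n) (ζ : L →ₗ[ℝ] T.V n), T.IsLinearFrame n y ζ →
    (∃ Z, T.IsFrameFieldThrough n y ζ Z ∧ Z y = ζ) ∧
    (∃ K ∈ hom2 𝒜 n, ∀ Z, T.IsFrameFieldThrough n y ζ Z → T.IsKappa n y Z K) ∧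
    ∀ A ∈ Eplus 𝒜 ((n : ℤ) - 2), ∃ t ∈ hom1 𝒜 ((n : ℤ) - 1),
      ∀ Z, T.IsFrameFieldThrough n y ζ Z → T.IsTau n y Z A t

/-! ### Isomorphisms, prolongations, canonical Pfaff classes -/

/-- The projection from level `m + d` to level `m`. -/
def proj (m : ℕ) : (d : ℕ) → T.Q (m + d) → T.Q m
  | 0, z => z
  | d + 1, z => proj m d (T.π (m + d) z)

end Tower

variable {𝒯 : StructureType.{u} 𝒜 k}

/-- Diffeomorphisms between the `n`-th levels. -/
abbrev LevelDiffeo (S T : Tower 𝒯) (n : ℕ) : Type u :=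
  Diffeomorph 𝓘(ℝ, S.V n) 𝓘(ℝ, T.V n) (S.Q n) (T.Q n) ∞

/-- The differential of a diffeomorphism of levels. -/
noncomputable def LevelDiffeo.d {S T : Tower 𝒯} {n : ℕ} (φ : LevelDiffeo S T n) (y : S.Q n) :
    S.V n →ₗ[ℝ] T.V n :=
  (mfderiv 𝓘(ℝ, S.V n) 𝓘(ℝ, T.V n) φ y : S.V n →L[ℝ] T.V n).toLinearMap

/-- Isomorphisms of geometric structures. At level `0` (order `-1`) these are the isomorphisms of
filtered manifolds; at level `n + 1` (order `n`) these are the diffeomorphisms that are the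
restriction of the lift `[ζ] ↦ [φ_* ∘ ζ]` of an isomorphism `φ` of order `n - 1`. -/
def IsIso (S T : Tower 𝒯) : (n : ℕ) → LevelDiffeo S T n → Prop
  | 0, φ => ∀ (p : ℤ) (x : S.Q 0), (S.F p x).map (φ.d x) = T.F p (φ x)
  | n + 1, Φ => ∃ φ : LevelDiffeo S T n, IsIso S T n φ ∧
      ∀ z, T.π n (Φ z) = φ (S.π n z) ∧
        T.frames n (Φ z) = (fun ζ => φ.d (S.π n z) ∘ₗ ζ) '' S.frames n z

/-- `S`, together with the isomorphism `ι` of its truncation of order `k` onto `Q^{(k)}`, is a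
geometric structure of order `l` of type `𝔤[l]` prolonging `Q^{(k)}` whose structure functions satisfy
`κ_{[n]} ∈ W²_n` and `τ_{[n]} ∈ Hom(E_+^{(n-2)}, W¹_{n-1})` for `k < n ≤ l`. -/
structure IsWProlongation
    (W1 : ℤ → Submodule ℝ (LieModule.Cohomology.oneCochain ℝ (gNeg 𝒜) L))
    (W2 : ℤ → Submodule ℝ (LieModule.Cohomology.twoCochain ℝ (gNeg 𝒜) L))
    (Q S : Tower 𝒯) (ι : LevelDiffeo S Q (k + 1)) (l : ℕ) : Prop where
  geometric : S.IsGeometric l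
  base : IsIso S Q (k + 1) ι
  normal : ∀ n, k < n → n ≤ l → ∀ z : S.Q (n + 1), ∀ ζ ∈ S.frames n z,
    S.IsWNormal W1 W2 n (S.π n z) ζ

/-- `Φ` (between levels `k + 1 + d`, that is, in order `k + d`) prolongs `φ : P^{(k)} → Q^{(k)}`. -/
def Prolongs {P Q S T : Tower 𝒯} (ι : LevelDiffeo S P (k + 1)) (j : LevelDiffeo T Q (k + 1))
    (φ : LevelDiffeo P Q (k + 1)) (d : ℕ) (Φ : LevelDiffeo S T (k + 1 + d)) : Prop :=
  ∀ z, j (T.proj (k + 1) d (Φ z)) = φ (ι (S.proj (k + 1) d z))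

/-- The canonical Pfaff class `[θ^{(n-1)}]` of `Q^{(n)} → Q^{(n-1)}` at `z`: the set of all
`ζ⁻¹ ∘ π_* : T_z Q^{(n)} → E^{(n-1)} = 𝔤 / F^n 𝔤`, where `ζ` runs through the frames in the
class `z`. -/
def pfaffClass (S : Tower 𝒯) (n : ℕ) (z : S.Q (n + 1)) :
    Set (S.V (n + 1) →ₗ[ℝ] L ⧸ filt 𝒜 (n : ℤ)) :=
  {η | ∃ ζ ∈ S.frames n z, ∀ (w : S.V (n + 1)) (u : L),
    η w = Submodule.Quotient.mk u ↔ ζ u = S.dπ n z w}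

/-- `Φ^* [θ^{(n-1)}]_T = [θ^{(n-1)}]_S`. -/
def PreservesPfaffClass (S T : Tower 𝒯) (n : ℕ) (Φ : LevelDiffeo S T (n + 1)) : Prop :=
  ∀ z, (fun η => η ∘ₗ Φ.d z) '' pfaffClass T n (Φ z) = pfaffClass S n z

/-! ### The projective limit and its canonical form -/

/-- The projective limit `lim Q^{(l)}`. -/
def Lim (S : Tower 𝒯) : Type u := {p : ∀ n, S.Q n // ∀ n, S.π n (p (n + 1)) = p n}

/-- The tangent space of the projective limit: the projective limit of the tangent spaces. -/
def limTangent (S : Tower 𝒯) (p : Lim S) : Submodule ℝ (∀ n, S.V n) where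
  carrier := {w | ∀ n, S.dπ n (p.1 (n + 1)) (w (n + 1)) = w n}
  add_mem' hv hw n := by simp [hv n, hw n]
  zero_mem' n := by simp
  smul_mem' c w hw n := by simp [hw n]

/-- `e = θ(w)`, where `θ` is the canonical form of the projective limit, with values in
`E = lim E^{(l)} = ∏ 𝔤_i`: the component of `e` in `𝔤_i` is that of `ζ⁻¹(w_n) ∈ 𝔤 / F^n 𝔤`, for all
sufficiently large `n` and all linear frames `ζ` in the class `p_{n+1}`. -/
def IsTheta (S : Tower 𝒯) (p : Lim S) (w : ∀ n, S.V n) (e : ∀ i : ℤ, 𝒜 i) : Prop :=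
  ∀ i : ℤ, ∃ N : ℕ, ∀ n, N ≤ n → ∀ ζ ∈ S.frames n (p.1 (n + 1)), ∀ u : L, ζ u = w n →
    DirectSum.decompose 𝒜 u i = e i

/-- `θ` is an absolute parallelism on `lim Q^{(l)}`: it gives a linear isomorphism of every tangent
space onto `∏ 𝔤_i`, and the vector fields that are constant with respect to `θ` are smooth, i.e. each
component of such a field is locally a smooth function on some finite level. -/
structure IsAbsoluteParallelism (S : Tower 𝒯) : Prop where
  iso : ∀ p : Lim S, ∃ Θ : limTangent S p ≃ₗ[ℝ] (∀ i : ℤ, 𝒜 i),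
    ∀ w e, IsTheta S p w.1 e ↔ Θ w = e
  smooth : ∀ (e : ∀ i : ℤ, 𝒜 i) (m : ℕ) (p : Lim S), ∃ (n : ℕ) (U : Set (S.Q n))
    (X : S.Q n → TangentBundle 𝓘(ℝ, S.V m) (S.Q m)), U ∈ 𝓝 (p.1 n) ∧
    ContMDiffOn 𝓘(ℝ, S.V n) 𝓘(ℝ, S.V m).tangent ∞ X U ∧
    ∀ q : Lim S, q.1 n ∈ U → ∀ w ∈ limTangent S q, IsTheta S q w e →
      X (q.1 n) = (⟨q.1 m, w m⟩ : TangentBundle 𝓘(ℝ, S.V m) (S.Q m))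

/-- `f`, defined on the neighbourhood `U` of `p_n`, represents near `p` the component at level `m` of
the map `Φ` between projective limits. -/
def Represents {S T : Tower 𝒯} (Φ : Lim S → Lim T) (p : Lim S) (m n : ℕ)
    (f : S.Q n → T.Q m) (U : Set (S.Q n)) : Prop :=
  U ∈ 𝓝 (p.1 n) ∧ ContMDiffOn 𝓘(ℝ, S.V n) 𝓘(ℝ, T.V m) ∞ f U ∧
    ∀ q : Lim S, q.1 n ∈ U → (Φ q).1 m = f (q.1 n)

/-- Smooth maps between projective limits: locally each component factors smoothly through some finite
level. -/
def IsLimSmooth {S T : Tower 𝒯} (Φ : Lim S → Lim T) : Prop :=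
  ∀ (p : Lim S) (m : ℕ), ∃ n f U, Represents Φ p m n f U

/-- `w' = Φ_* w` for `w` a tangent vector of the projective limit at `p`. -/
def IsPushforward {S T : Tower 𝒯} (Φ : Lim S → Lim T) (p : Lim S) (w : ∀ n, S.V n)
    (w' : ∀ n, T.V n) : Prop :=
  ∀ m, ∃ n f U, Represents Φ p m n f U ∧
    w' m = (mfderiv 𝓘(ℝ, S.V n) 𝓘(ℝ, T.V m) f (p.1 n) : S.V n →L[ℝ] T.V m) (w n)

/-- `Φ` is an isomorphism of absolute parallelisms: a diffeomorphism with `Φ^* θ_T = θ_S`. -/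
structure IsParallelismIso {S T : Tower 𝒯} (Φ : Lim S ≃ Lim T) : Prop where
  smooth : IsLimSmooth Φ
  smooth_symm : IsLimSmooth Φ.symm
  theta : ∀ (p : Lim S), ∀ w ∈ limTangent S p, ∀ w', IsPushforward Φ p w w' →
    ∀ e, IsTheta T (Φ p) w' e ↔ IsTheta S p w e

/-- `Φ` is an isomorphism of geometric structures of order `∞`: it is induced by isomorphisms of all
finite orders. -/
def IsLimIso {S T : Tower 𝒯} (Φ : Lim S ≃ Lim T) : Prop :=
  ∃ φ : ∀ n, LevelDiffeo S T n, (∀ n, IsIso S T n (φ n)) ∧ ∀ p n, (Φ p).1 n = φ n (p.1 n)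

/-- `Φ` (in order `∞`) prolongs `φ : P^{(k)} → Q^{(k)}`. -/
def LimProlongs {P Q S T : Tower 𝒯} (ι : LevelDiffeo S P (k + 1)) (j : LevelDiffeo T Q (k + 1))
    (φ : LevelDiffeo P Q (k + 1)) (Φ : Lim S ≃ Lim T) : Prop :=
  ∀ p, j ((Φ p).1 (k + 1)) = φ (ι (p.1 (k + 1)))

end NormalProlongation

/-! The heart of the matter is one step, from level `n`, which is Q^{(n-1)}, to level `n + 1`.
Modulo `F^{n+1}`, two linear frames at a point of level `n` differ by a map `f` of degree `n` from
𝔤₋ to 𝔤 and a map `g` from E_+^{(n-2)} to 𝔤_{n-1}. To the order at which κ and τ are read, brackets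
of frame fields imitate the bracket of 𝔤 (`bracket_neg`, `bracket_nonneg`, `lieB_tensorial`). Hence
a change of frame acts by κ ↦ κ + ∂f and τ(A) ↦ τ(A) - ∂(g(A)) (`kap_change`, `tau_change`), and
both functions depend only on the class of the frame.

The complements W² and W¹ make it possible to solve for `f` and `g`. Transitivity makes ∂ injective
on 𝔤_{n-1}, so `g` is unique. The map `f` is unique up to cocycles of degree `n`, which are
derivations and therefore, for `n > k`, elements of 𝔤_n by prolongation. Thus the normal frames at a
point form an affine space over 𝔤_n (`isWNormal_iff_of_isWNormal`), which gives maximality.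

The corrections can be chosen linearly in κ and τ, so normal frame fields exist locally
(`Geo.exists_local_normal`). Since the normal frames are convex, a partition of unity gives a global
field (`Geo.exists_global_normal`). The next level is then the product with the vector group 𝔤_n
(`exists_extension`), and a diagonal construction assembles all levels into one tower.

Structure functions are natural, so an isomorphism carries normal frames to normal frames and lifts,
uniquely because a point is determined by its frames (`IsIso.exists_lift`). Conversely, the Pfaff
class knows the vertical vectors; with connected groups a diffeomorphism preserving it descends from
level to level, and carrying some linear frame to a linear frame everywhere already makes it an
isomorphism (`isIso_of_frames`).

On the limit, frames in one class become equal after projection down by the depth μ of 𝔤₋, so a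
point of the limit determines genuine frames at all levels; their inverses form the parallelism θ. A
diffeomorphism of limits preserving θ maps, at each level, vertical vectors to vertical vectors, so
it is induced by maps of the finite levels (`IsParallelismIso.exists_component`). -/

set_option linter.unusedSectionVars false

namespace NormalProlongation

/-! ### Calculus on manifolds -/

section Calculus

open VectorField Filter

variable {E : Type*} [NormedAddCommGroup E] [NormedSpace ℝ E]
  {M : Type*} [TopologicalSpace M] [ChartedSpace E M]
  {F : Type*} [NormedAddCommGroup F] [NormedSpace ℝ F]
  {N : Type*} [TopologicalSpace N] [ChartedSpace F N]
  {E' : Type*} [NormedAddCommGroup E'] [NormedSpace ℝ E']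
  {M' : Type*} [TopologicalSpace M'] [ChartedSpace E' M']

/-- The differential of a map of manifolds, as a map between the model spaces. -/
noncomputable def dmap (f : N → M) (w : N) : F →L[ℝ] E := mfderiv 𝓘(ℝ, F) 𝓘(ℝ, E) f w

/-- Smoothness at a point. -/
abbrev SmoothAt (f : N → M) (w : N) : Prop := ContMDiffAt 𝓘(ℝ, F) 𝓘(ℝ, E) ∞ f w

/-- The Lie bracket of vector fields with values in the model space. -/
noncomputable def lieB (ξ η : N → F) (w : N) : F := mlieBracket 𝓘(ℝ, F) (M := N) ξ η w

theorem SmoothAt.mdiff {f : N → M} {w : N} (h : SmoothAt (E := E) (F := F) f w) :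
    MDifferentiableAt 𝓘(ℝ, F) 𝓘(ℝ, E) f w := h.mdifferentiableAt (by simp)

theorem dmap_comp {g : M → M'} {f : N → M} {w : N} (hg : MDifferentiableAt 𝓘(ℝ, E) 𝓘(ℝ, E') g (f w))
    (hf : MDifferentiableAt 𝓘(ℝ, F) 𝓘(ℝ, E) f w) :
    (dmap (fun x => g (f x)) w : F →L[ℝ] E') =
      (dmap g (f w) : E →L[ℝ] E').comp (dmap f w : F →L[ℝ] E) :=
  mfderiv_comp w hg hf

theorem dmap_congr {f g : N → M} {w : N} (h : f =ᶠ[𝓝 w] g) :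
    (dmap f w : F →L[ℝ] E) = dmap g w := by
  unfold dmap; exact h.mfderiv_eq

/-- The differential at `y` of the preferred chart at `y₀`. -/
noncomputable def dch (y₀ y : M) : E →L[ℝ] E := dmap (extChartAt 𝓘(ℝ, E) y₀) y

variable [IsManifold 𝓘(ℝ, E) ∞ M]

/-- Smoothness at a point of a vector field along a map. -/
abbrev SmoothAlongAt (f : N → M) (v : N → E) (w : N) : Prop :=
  ContMDiffAt 𝓘(ℝ, F) 𝓘(ℝ, E).tangent ∞ (fun w => (⟨f w, v w⟩ : TangentBundle 𝓘(ℝ, E) M)) w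

theorem dch_eq {y₀ y : M} (h : y ∈ (chartAt E y₀).source) :
    (dch y₀ y : E →L[ℝ] E) = tangentCoordChange 𝓘(ℝ, E) y y₀ y := by
  have := mfderiv_chartAt_eq_tangentCoordChange (I := 𝓘(ℝ, E)) h
  rw [← this]; rfl

theorem dch_self (y : M) : (dch y y : E →L[ℝ] E) = ContinuousLinearMap.id ℝ E := by
  ext v
  rw [dch_eq (mem_chart_source E y)]
  exact tangentCoordChange_self (by simp)

theorem triv_eq_dch {y₀ y : M} (h : y ∈ (chartAt E y₀).source) (v : E) :
    (trivializationAt E (TangentSpace 𝓘(ℝ, E)) y₀ (⟨y, v⟩ : TangentBundle 𝓘(ℝ, E) M)).2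
      = (dch y₀ y : E →L[ℝ] E) v := by
  rw [dch_eq h]; rfl

/-- Reading the vectors in the chart at `f w` turns smoothness in the tangent bundle into smoothness
of a map to the fixed space `E`, where linear algebra applies. -/
theorem smoothAlongAt_iff {f : N → M} {v : N → E} {w : N} :
    SmoothAlongAt (E := E) (F := F) f v w ↔ SmoothAt (E := E) (F := F) f w ∧
      SmoothAt (E := E) (F := F) (fun x => (dch (f w) (f x) : E →L[ℝ] E) (v x)) w := by
  unfold SmoothAlongAt
  rw [Bundle.contMDiffAt_totalSpace]
  refine and_congr_right fun hf => ?_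
  have : ∀ᶠ x in 𝓝 w, f x ∈ (chartAt E (f w)).source :=
    hf.continuousAt.eventually ((chartAt E (f w)).open_source.mem_nhds (mem_chart_source E _))
  refine Filter.EventuallyEq.contMDiffAt_iff ?_
  filter_upwards [this] with x hx
  exact triv_eq_dch hx _

variable [IsManifold 𝓘(ℝ, F) ∞ N]

/-- The bracket is defined by pulling the fields back along the inverse chart and transporting the
result to the manifold. At the centre of the preferred chart the differential is the identity, so
the transport disappears. -/
theorem mlieBracket_eq_chart [CompleteSpace F] (ξ η : Π x : N, TangentSpace 𝓘(ℝ, F) x) (w : N) :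
    mlieBracket 𝓘(ℝ, F) ξ η w = lieBracket ℝ
      (fun e => mfderiv 𝓘(ℝ, F) 𝓘(ℝ, F) (extChartAt 𝓘(ℝ, F) w) ((extChartAt 𝓘(ℝ, F) w).symm e)
        (ξ ((extChartAt 𝓘(ℝ, F) w).symm e)))
      (fun e => mfderiv 𝓘(ℝ, F) 𝓘(ℝ, F) (extChartAt 𝓘(ℝ, F) w) ((extChartAt 𝓘(ℝ, F) w).symm e)
        (η ((extChartAt 𝓘(ℝ, F) w).symm e)))
      (extChartAt 𝓘(ℝ, F) w w) := by
  have key : ∀ ξ : Π x : N, TangentSpace 𝓘(ℝ, F) x,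
      mpullbackWithin 𝓘(ℝ, F) 𝓘(ℝ, F) (extChartAt 𝓘(ℝ, F) w).symm ξ
      (Set.range 𝓘(ℝ, F)) =ᶠ[𝓝 (extChartAt 𝓘(ℝ, F) w w)]
      (fun e => mfderiv 𝓘(ℝ, F) 𝓘(ℝ, F) (extChartAt 𝓘(ℝ, F) w) ((extChartAt 𝓘(ℝ, F) w).symm e)
        (ξ ((extChartAt 𝓘(ℝ, F) w).symm e))) := by
    intro ξ
    filter_upwards [extChartAt_target_mem_nhds (I := 𝓘(ℝ, F)) w] with e he
    rw [mpullbackWithin_apply]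
    have h1 := mfderiv_extChartAt_comp_mfderivWithin_extChartAt_symm (I := 𝓘(ℝ, F)) he
    have h2 := mfderivWithin_extChartAt_symm_comp_mfderiv_extChartAt (I := 𝓘(ℝ, F)) he
    rw [ContinuousLinearMap.inverse_eq h2 h1]
    rfl
  unfold mlieBracket
  rw [mlieBracketWithin_apply]
  have h0 : (mfderiv 𝓘(ℝ, F) 𝓘(ℝ, F) (extChartAt 𝓘(ℝ, F) w) w).inverse = ContinuousLinearMap.id ℝ F := by
    have : (mfderiv 𝓘(ℝ, F) 𝓘(ℝ, F) (extChartAt 𝓘(ℝ, F) w) w) = ContinuousLinearMap.id ℝ F :=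
      dch_self w
    rw [this]
    exact ContinuousLinearMap.inverse_id
  have hr : Set.univ ∩ Set.range 𝓘(ℝ, F) = Set.univ := by simp
  rw [Set.preimage_univ, hr]
  refine (congrArg (fun A : F →L[ℝ] F => A _) h0).trans ?_
  exact (congrFun lieBracketWithin_univ _).trans ((key ξ).lieBracket_vectorField_eq (key η))

theorem lieB_eq [CompleteSpace F] {ξ η : N → F} {w : N} :
    lieB ξ η w = lieBracket ℝ
      (fun e => (dch w ((extChartAt 𝓘(ℝ, F) w).symm e) : F →L[ℝ] F)
        (ξ ((extChartAt 𝓘(ℝ, F) w).symm e)))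
      (fun e => (dch w ((extChartAt 𝓘(ℝ, F) w).symm e) : F →L[ℝ] F)
        (η ((extChartAt 𝓘(ℝ, F) w).symm e)))
      (extChartAt 𝓘(ℝ, F) w w) :=
  mlieBracket_eq_chart ξ η w

theorem dmap_eq_fderiv_comp_dch {G : N → E'} {w₀ w : N} (hw : w ∈ (chartAt F w₀).source)
    (hG : MDifferentiableAt 𝓘(ℝ, F) 𝓘(ℝ, E') G w) :
    (dmap G w : F →L[ℝ] E') =
      (fderiv ℝ (fun e => G ((extChartAt 𝓘(ℝ, F) w₀).symm e)) (extChartAt 𝓘(ℝ, F) w₀ w)).comp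
        (dch w₀ w : F →L[ℝ] F) := by
  have hw' : w ∈ (extChartAt 𝓘(ℝ, F) w₀).source := by simpa using hw
  have e1 : (extChartAt 𝓘(ℝ, F) w₀).symm (extChartAt 𝓘(ℝ, F) w₀ w) = w :=
    (extChartAt 𝓘(ℝ, F) w₀).left_inv hw'
  have h1 : MDifferentiableAt 𝓘(ℝ, F) 𝓘(ℝ, F) (extChartAt 𝓘(ℝ, F) w₀) w :=
    mdifferentiableAt_extChartAt hw
  have h2 : MDifferentiableAt 𝓘(ℝ, F) 𝓘(ℝ, F) (extChartAt 𝓘(ℝ, F) w₀).symm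
      (extChartAt 𝓘(ℝ, F) w₀ w) := by
    have := mdifferentiableWithinAt_extChartAt_symm (I := 𝓘(ℝ, F))
      ((extChartAt 𝓘(ℝ, F) w₀).map_source hw')
    rwa [modelWithCornersSelf_coe, Set.range_id, mdifferentiableWithinAt_univ] at this
  have h3 : MDifferentiableAt 𝓘(ℝ, F) 𝓘(ℝ, E')
      (fun e => G ((extChartAt 𝓘(ℝ, F) w₀).symm e)) (extChartAt 𝓘(ℝ, F) w₀ w) := by
    refine MDifferentiableAt.comp (I' := 𝓘(ℝ, F)) _ ?_ h2
    rwa [e1]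
  have h4 := dmap_comp (g := fun e => G ((extChartAt 𝓘(ℝ, F) w₀).symm e)) h3 h1
  have h5 : (dmap (fun e => G ((extChartAt 𝓘(ℝ, F) w₀).symm e)) (extChartAt 𝓘(ℝ, F) w₀ w)
      : F →L[ℝ] E') =
      fderiv ℝ (fun e => G ((extChartAt 𝓘(ℝ, F) w₀).symm e)) (extChartAt 𝓘(ℝ, F) w₀ w) :=
    mfderiv_eq_fderiv
  rw [h5] at h4
  rw [dch, ← h4]
  refine dmap_congr ?_
  filter_upwards [(isOpen_extChartAt_source (I := 𝓘(ℝ, F)) w₀).mem_nhds hw'] with x hx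
  rw [(extChartAt 𝓘(ℝ, F) w₀).left_inv hx]

theorem contDiffAt_chart_symm {G : N → E'} {w : N} (hG : SmoothAt (E := E') (F := F) G w) :
    ContDiffAt ℝ ∞ (fun e => G ((extChartAt 𝓘(ℝ, F) w).symm e)) (extChartAt 𝓘(ℝ, F) w w) := by
  have h2 : ContMDiffAt 𝓘(ℝ, F) 𝓘(ℝ, F) ∞ (extChartAt 𝓘(ℝ, F) w).symm
      (extChartAt 𝓘(ℝ, F) w w) := by
    have := contMDiffWithinAt_extChartAt_symm_range (I := 𝓘(ℝ, F)) (n := ∞) w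
      ((extChartAt 𝓘(ℝ, F) w).map_source (mem_extChartAt_source w))
    rwa [modelWithCornersSelf_coe, Set.range_id, contMDiffWithinAt_univ] at this
  rw [← contMDiffAt_iff_contDiffAt]
  refine ContMDiffAt.comp (I' := 𝓘(ℝ, F)) _ ?_ h2
  rw [(extChartAt 𝓘(ℝ, F) w).left_inv (mem_extChartAt_source w)]
  exact hG

theorem smoothAt_field_iff {ξ : N → F} {w : N} :
    SmoothAlongAt (E := F) (F := F) (fun x : N => x) ξ w ↔
      SmoothAt (E := F) (F := F) (fun x => (dch w x : F →L[ℝ] F) (ξ x)) w := by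
  rw [smoothAlongAt_iff]
  exact and_iff_right contMDiffAt_id

/-- In the chart, both iterated derivatives contain the second derivative of `G` applied to the two
fields. These terms cancel by symmetry, and what remains is `G` differentiated along the bracket.
Taking for `G` a chart of a target composed with a map reduces brackets along maps to this formula.
-/
theorem dmap_lieB [CompleteSpace F] {G : N → E'} {ξ η : N → F} {w : N}
    (hG : SmoothAt (E := E') (F := F) G w)
    (hξ : SmoothAlongAt (E := F) (F := F) (fun x : N => x) ξ w)
    (hη : SmoothAlongAt (E := F) (F := F) (fun x : N => x) η w) :
    (dmap G w : F →L[ℝ] E') (lieB ξ η w) =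
      (dmap (fun x => (dmap G x : F →L[ℝ] E') (η x)) w : F →L[ℝ] E') (ξ w) -
      (dmap (fun x => (dmap G x : F →L[ℝ] E') (ξ x)) w : F →L[ℝ] E') (η w) := by
  rw [smoothAt_field_iff] at hξ hη
  have hξ' := contDiffAt_chart_symm hξ
  have hη' := contDiffAt_chart_symm hη
  have hG' := contDiffAt_chart_symm hG
  set e₀ := extChartAt 𝓘(ℝ, F) w w
  set Gt : F → E' := fun e => G ((extChartAt 𝓘(ℝ, F) w).symm e) with hGt
  have hdG : ContDiffAt ℝ ∞ (fderiv ℝ Gt) e₀ := hG'.fderiv_right (by simp)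
  have hGev : ∀ᶠ x in 𝓝 w, MDifferentiableAt 𝓘(ℝ, F) 𝓘(ℝ, E') G x := by
    have h1 : ContMDiffAt 𝓘(ℝ, F) 𝓘(ℝ, E') 1 G w := hG.of_le (by simp)
    filter_upwards [(contMDiffAt_iff_contMDiffAt_nhds (by simp)).1 h1] with x hx
      using hx.mdifferentiableAt (by simp)
  have hsrc : ∀ᶠ x in 𝓝 w, x ∈ (chartAt F w).source :=
    (chartAt F w).open_source.mem_nhds (mem_chart_source F w)
  have key : ∀ ζ : N → F, ContDiffAt ℝ ∞ (fun e => (dch w ((extChartAt 𝓘(ℝ, F) w).symm e) :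
      F →L[ℝ] F) (ζ ((extChartAt 𝓘(ℝ, F) w).symm e))) e₀ →
      (dmap (fun x => (dmap G x : F →L[ℝ] E') (ζ x)) w : F →L[ℝ] E') =
      fderiv ℝ (fun e => fderiv ℝ Gt e ((dch w ((extChartAt 𝓘(ℝ, F) w).symm e) :
      F →L[ℝ] F) (ζ ((extChartAt 𝓘(ℝ, F) w).symm e)))) e₀ := by
    intro ζ hζ
    have hH : ContDiffAt ℝ ∞ (fun e => fderiv ℝ Gt e ((dch w ((extChartAt 𝓘(ℝ, F) w).symm e) :
      F →L[ℝ] F) (ζ ((extChartAt 𝓘(ℝ, F) w).symm e)))) e₀ := hdG.clm_apply hζ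
    have h1 : (fun x => (dmap G x : F →L[ℝ] E') (ζ x)) =ᶠ[𝓝 w] fun x =>
        (fun e => fderiv ℝ Gt e ((dch w ((extChartAt 𝓘(ℝ, F) w).symm e) :
      F →L[ℝ] F) (ζ ((extChartAt 𝓘(ℝ, F) w).symm e)))) (extChartAt 𝓘(ℝ, F) w x) := by
      filter_upwards [hGev, hsrc] with x hx hx'
      rw [dmap_eq_fderiv_comp_dch hx' hx]
      have : (extChartAt 𝓘(ℝ, F) w).symm (extChartAt 𝓘(ℝ, F) w x) = x :=
        (extChartAt 𝓘(ℝ, F) w).left_inv (by simpa using hx')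
      simp only [this, ContinuousLinearMap.comp_apply]
      rfl
    rw [dmap_congr h1, dmap_comp (f := extChartAt 𝓘(ℝ, F) w) (g := fun e => fderiv ℝ Gt e
      ((dch w ((extChartAt 𝓘(ℝ, F) w).symm e) :
      F →L[ℝ] F) (ζ ((extChartAt 𝓘(ℝ, F) w).symm e))))
      (mdifferentiableAt_iff_differentiableAt.2 (hH.differentiableAt (by simp)))
      (mdifferentiableAt_extChartAt (mem_chart_source F w))]
    have h2 : (dmap (extChartAt 𝓘(ℝ, F) w) w : F →L[ℝ] F) = ContinuousLinearMap.id ℝ F :=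
      dch_self w
    rw [h2, ContinuousLinearMap.comp_id]
    exact mfderiv_eq_fderiv
  rw [key ξ hξ', key η hη', lieB_eq]
  change (dmap G w : F →L[ℝ] E') (lieBracket ℝ _ _ e₀) = _
  have hsymm : IsSymmSndFDerivAt ℝ Gt e₀ := hG'.isSymmSndFDerivAt (by
    simp only [minSmoothness_of_isRCLikeNormedField]
    exact WithTop.coe_le_coe.2 (le_top : (2 : ℕ∞) ≤ ⊤))
  have hw : (dmap G w : F →L[ℝ] E') = fderiv ℝ Gt e₀ := by
    rw [dmap_eq_fderiv_comp_dch (mem_chart_source F w) hG.mdiff, dch_self]; rfl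
  have hl : (extChartAt 𝓘(ℝ, F) w).symm e₀ = w :=
    (extChartAt 𝓘(ℝ, F) w).left_inv (mem_extChartAt_source w)
  rw [hw, lieBracket, fderiv_clm_apply (hdG.differentiableAt (by simp))
    (hξ'.differentiableAt (by simp)), fderiv_clm_apply (hdG.differentiableAt (by simp))
    (hη'.differentiableAt (by simp))]
  simp only [add_apply, ContinuousLinearMap.comp_apply,
    ContinuousLinearMap.flip_apply, hl, dch_self, ContinuousLinearMap.id_apply, map_sub]
  rw [hsymm (ξ w) (η w)]
  abel

end Calculus
end NormalProlongation


/-! ### Smooth coefficients and vector fields along maps. -/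

set_option linter.unusedSectionVars false

namespace NormalProlongation

section Calculus

open VectorField Filter

variable {E : Type*} [NormedAddCommGroup E] [NormedSpace ℝ E]
  {M : Type*} [TopologicalSpace M] [ChartedSpace E M]
  {F : Type*} [NormedAddCommGroup F] [NormedSpace ℝ F]
  {N : Type*} [TopologicalSpace N] [ChartedSpace F N]
  {E' : Type*} [NormedAddCommGroup E'] [NormedSpace ℝ E']
  {M' : Type*} [TopologicalSpace M'] [ChartedSpace E' M']
  {ι : Type*} [Fintype ι]

/-- Coefficients of a smooth vector function with respect to smooth independent ones are smooth. -/
theorem smoothAt_coeff [FiniteDimensional ℝ E'] {A : ι → N → E'} {B : N → E'} {c : ι → N → ℝ}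
    {w : N} (hA : ∀ i, SmoothAt (E := E') (F := F) (A i) w) (hB : SmoothAt (E := E') (F := F) B w)
    (hi : LinearIndependent ℝ (fun i => A i w))
    (hc : ∀ᶠ x in 𝓝 w, B x = ∑ i, c i x • A i x) (i : ι) :
    SmoothAt (E := ℝ) (F := F) (c i) w := by
  classical
  let Λ : N → ((ι → ℝ) →L[ℝ] E') := fun x => ∑ i, (ContinuousLinearMap.proj (R := ℝ)
    (φ := fun _ : ι => ℝ) i).smulRight (A i x)
  have hΛapp : ∀ x v, Λ x v = ∑ i, v i • A i x := by
    intro x v; simp [Λ]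
  have hΛ : ContMDiffAt 𝓘(ℝ, F) 𝓘(ℝ, (ι → ℝ) →L[ℝ] E') ∞ Λ w := by
    have : ContMDiffAt 𝓘(ℝ, F) 𝓘(ℝ, (ι → ℝ) →L[ℝ] E') ∞ (fun x => ∑ i,
        ContinuousLinearMap.smulRightL ℝ (ι → ℝ) E' (ContinuousLinearMap.proj (R := ℝ)
        (φ := fun _ : ι => ℝ) i) (A i x)) w := by
      refine ContMDiffAt.sum fun i _ => ?_
      exact ((ContinuousLinearMap.smulRightL ℝ (ι → ℝ) E' (ContinuousLinearMap.proj (R := ℝ)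
        (φ := fun _ : ι => ℝ) i)).contMDiff.contMDiffAt).comp w (hA i)
    exact this
  have hinj : LinearMap.ker (Λ w : (ι → ℝ) →ₗ[ℝ] E') = ⊥ := by
    rw [LinearMap.ker_eq_bot']
    intro v hv
    have hv' : ∑ i, v i • A i w = 0 := by rw [← hΛapp]; exact hv
    funext i
    exact Fintype.linearIndependent_iff.1 hi v hv' i
  -- A left inverse of the matrix at `w`, kept fixed. Its product with the matrix at nearby points
  -- stays invertible, and inversion is smooth, which solves smoothly for the coefficients.
  obtain ⟨P₀, hP₀⟩ := LinearMap.exists_leftInverse_of_injective (Λ w : (ι → ℝ) →ₗ[ℝ] E') hinj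
  let P : E' →L[ℝ] (ι → ℝ) := LinearMap.toContinuousLinearMap P₀
  have hPw : P.comp (Λ w) = 1 := by
    ext1 v
    exact congrArg (fun f : (ι → ℝ) →ₗ[ℝ] (ι → ℝ) => f v) hP₀
  have hPΛ : ContMDiffAt 𝓘(ℝ, F) 𝓘(ℝ, (ι → ℝ) →L[ℝ] (ι → ℝ)) ∞ (fun x => P.comp (Λ x)) w :=
    ContMDiffAt.clm_comp contMDiffAt_const hΛ
  have hinv : ContMDiffAt 𝓘(ℝ, F) 𝓘(ℝ, (ι → ℝ) →L[ℝ] (ι → ℝ)) ∞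
      (fun x => Ring.inverse (P.comp (Λ x))) w := by
    have h1 : ContDiffAt ℝ ∞ (Ring.inverse : ((ι → ℝ) →L[ℝ] (ι → ℝ)) → _) (P.comp (Λ w)) := by
      rw [hPw]
      exact contDiffAt_ringInverse ℝ (1 : ((ι → ℝ) →L[ℝ] (ι → ℝ))ˣ)
    exact ContMDiffAt.comp w (contMDiffAt_iff_contDiffAt.2 h1) hPΛ
  have hunit : ∀ᶠ x in 𝓝 w, IsUnit (P.comp (Λ x)) := by
    have : {f : (ι → ℝ) →L[ℝ] (ι → ℝ) | IsUnit f} ∈ 𝓝 (P.comp (Λ w)) :=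
      Units.isOpen.mem_nhds (by rw [hPw]; exact isUnit_one)
    exact hPΛ.continuousAt.eventually this
  have hfin : ContMDiffAt 𝓘(ℝ, F) 𝓘(ℝ, ι → ℝ) ∞
      (fun x => Ring.inverse (P.comp (Λ x)) (P (B x))) w :=
    hinv.clm_apply (P.contMDiff.contMDiffAt.comp w hB)
  have hci : ContMDiffAt 𝓘(ℝ, F) 𝓘(ℝ, ℝ) ∞
      (fun x => (Ring.inverse (P.comp (Λ x)) (P (B x))) i) w :=
    (contMDiffAt_pi_space.1 hfin) i
  refine hci.congr_of_eventuallyEq ?_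
  filter_upwards [hc, hunit] with x hx hu
  have : P (B x) = (P.comp (Λ x)) (fun i => c i x) := by
    rw [hx, ContinuousLinearMap.comp_apply, hΛapp]
  rw [this, ← mul_apply_eq_comp, Ring.inverse_mul_cancel _ hu]
  rfl

theorem linearIndependent_eventually [FiniteDimensional ℝ E'] {A : ι → N → E'} {w : N}
    (hA : ∀ i, ContinuousAt (A i) w) (hi : LinearIndependent ℝ (fun i => A i w)) :
    ∀ᶠ x in 𝓝 w, LinearIndependent ℝ (fun i => A i x) := by
  have : ContinuousAt (fun x => (fun i => A i x : ι → E')) w := continuousAt_pi.2 hA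
  exact this.eventually (isOpen_setOfPred_linearIndependent.mem_nhds hi)

section Along

variable [IsManifold 𝓘(ℝ, E) ∞ M]

theorem SmoothAlongAt.base {f : N → M} {v : N → E} {w : N}
    (h : SmoothAlongAt (E := E) (F := F) f v w) : SmoothAt (E := E) (F := F) f w :=
  (smoothAlongAt_iff.1 h).1

theorem SmoothAlongAt.congr {f : N → M} {v v' : N → E} {w : N}
    (h : SmoothAlongAt (E := E) (F := F) f v w) (hv : ∀ᶠ x in 𝓝 w, v' x = v x) :
    SmoothAlongAt (E := E) (F := F) f v' w := by
  refine ContMDiffAt.congr_of_eventuallyEq h ?_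
  filter_upwards [hv] with x hx
  rw [hx]

theorem SmoothAlongAt.add {f : N → M} {v v' : N → E} {w : N}
    (h : SmoothAlongAt (E := E) (F := F) f v w) (h' : SmoothAlongAt (E := E) (F := F) f v' w) :
    SmoothAlongAt (E := E) (F := F) f (fun x => v x + v' x) w := by
  rw [smoothAlongAt_iff] at *
  refine ⟨h.1, ?_⟩
  simp only [map_add]
  exact ContMDiffAt.add h.2 h'.2

theorem SmoothAlongAt.smul {f : N → M} {v : N → E} {a : N → ℝ} {w : N}
    (ha : SmoothAt (E := ℝ) (F := F) a w) (h : SmoothAlongAt (E := E) (F := F) f v w) :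
    SmoothAlongAt (E := E) (F := F) f (fun x => a x • v x) w := by
  rw [smoothAlongAt_iff] at *
  refine ⟨h.1, ?_⟩
  simp only [map_smul]
  exact ContMDiffAt.smul ha h.2

theorem SmoothAlongAt.const_smul {f : N → M} {v : N → E} (a : ℝ) {w : N}
    (h : SmoothAlongAt (E := E) (F := F) f v w) :
    SmoothAlongAt (E := E) (F := F) f (fun x => a • v x) w :=
  SmoothAlongAt.smul (a := fun _ => a) contMDiffAt_const h

theorem SmoothAlongAt.sub {f : N → M} {v v' : N → E} {w : N}
    (h : SmoothAlongAt (E := E) (F := F) f v w) (h' : SmoothAlongAt (E := E) (F := F) f v' w) :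
    SmoothAlongAt (E := E) (F := F) f (fun x => v x - v' x) w := by
  rw [smoothAlongAt_iff] at *
  refine ⟨h.1, ?_⟩
  simp only [map_sub]
  exact ContMDiffAt.sub h.2 h'.2

theorem SmoothAlongAt.sum {κ : Type*} (s : Finset κ) {f : N → M} {v : κ → N → E} {w : N}
    (hf : SmoothAt (E := E) (F := F) f w)
    (h : ∀ i ∈ s, SmoothAlongAt (E := E) (F := F) f (v i) w) :
    SmoothAlongAt (E := E) (F := F) f (fun x => ∑ i ∈ s, v i x) w := by
  rw [smoothAlongAt_iff]
  refine ⟨hf, ?_⟩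
  simp only [map_sum]
  exact ContMDiffAt.sum fun i hi => (smoothAlongAt_iff.1 (h i hi)).2

theorem SmoothAlongAt.comp {f : N → M} {v : N → E} {g : M' → N} {w : M'}
    (h : SmoothAlongAt (E := E) (F := F) f v (g w)) (hg : SmoothAt (E := F) (F := E') g w) :
    SmoothAlongAt (E := E) (F := E') (fun x => f (g x)) (fun x => v (g x)) w :=
  ContMDiffAt.comp w h hg

/-- Coefficients of a smooth vector field along a map with respect to smooth independent ones. -/
theorem SmoothAlongAt.coeff [FiniteDimensional ℝ E] {f : N → M} {A : ι → N → E} {B : N → E}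
    {c : ι → N → ℝ} {w : N} (hA : ∀ i, SmoothAlongAt (E := E) (F := F) f (A i) w)
    (hB : SmoothAlongAt (E := E) (F := F) f B w) (hi : LinearIndependent ℝ (fun i => A i w))
    (hc : ∀ᶠ x in 𝓝 w, B x = ∑ i, c i x • A i x) (i : ι) :
    SmoothAt (E := ℝ) (F := F) (c i) w := by
  refine smoothAt_coeff (A := fun i x => (dch (f w) (f x) : E →L[ℝ] E) (A i x))
    (B := fun x => (dch (f w) (f x) : E →L[ℝ] E) (B x)) (c := c)
    (fun i => (smoothAlongAt_iff.1 (hA i)).2) (smoothAlongAt_iff.1 hB).2 ?_ ?_ i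
  · simpa only [dch_self, ContinuousLinearMap.id_apply] using hi
  · filter_upwards [hc] with x hx
    rw [hx]; simp

theorem SmoothAlongAt.linearIndependent_eventually [FiniteDimensional ℝ E] {f : N → M}
    {A : ι → N → E} {w : N} (hA : ∀ i, SmoothAlongAt (E := E) (F := F) f (A i) w)
    (hi : LinearIndependent ℝ (fun i => A i w)) :
    ∀ᶠ x in 𝓝 w, LinearIndependent ℝ (fun i => A i x) := by
  have := NormalProlongation.linearIndependent_eventually
    (A := fun i x => (dch (f w) (f x) : E →L[ℝ] E) (A i x)) (w := w)
    (fun i => (smoothAlongAt_iff.1 (hA i)).2.continuousAt) (by simpa only [dch_self, ContinuousLinearMap.id_apply] using hi)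
  filter_upwards [this] with x hx
  exact LinearIndependent.of_comp (dch (f w) (f x) : E →L[ℝ] E).toLinearMap hx

theorem SmoothAlongAt.dmap_apply [IsManifold 𝓘(ℝ, E') ∞ M'] {f : N → M} {v : N → E} {w : N}
    {g : M → M'} {U : Set M} (hU : IsOpen U) (hw : f w ∈ U)
    (hg : ∀ y ∈ U, SmoothAt (E := E') (F := E) g y)
    (h : SmoothAlongAt (E := E) (F := F) f v w) :
    SmoothAlongAt (E := E') (F := F) (fun x => g (f x)) (fun x => (dmap g (f x) : E →L[ℝ] E') (v x)) w := by
  have hgU : ContMDiffOn 𝓘(ℝ, E) 𝓘(ℝ, E') ∞ g U := fun y hy => (hg y hy).contMDiffWithinAt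
  have h1 := hgU.contMDiffOn_tangentMapWithin (m := ∞) (by simp) hU.uniqueMDiffOn
  have h2 : ContMDiffAt 𝓘(ℝ, E).tangent 𝓘(ℝ, E').tangent ∞ (tangentMapWithin 𝓘(ℝ, E) 𝓘(ℝ, E') g U)
      (⟨f w, v w⟩ : TangentBundle 𝓘(ℝ, E) M) := by
    refine h1.contMDiffAt ?_
    exact (hU.preimage (FiberBundle.continuous_proj E (TangentSpace 𝓘(ℝ, E)))).mem_nhds hw
  have h3 := ContMDiffAt.comp w h2 h
  refine h3.congr_of_eventuallyEq ?_
  filter_upwards [(h.base).continuousAt.eventually (hU.mem_nhds hw)] with x hx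
  simp only [Function.comp_apply, tangentMapWithin, mfderivWithin_of_isOpen hU hx]
  rfl

end Along

end Calculus
end NormalProlongation


/-! ### Lie brackets, related fields, and maps with zero differential. -/

set_option linter.unusedSectionVars false

namespace NormalProlongation

section Calculus

open VectorField Filter

variable {E : Type*} [NormedAddCommGroup E] [NormedSpace ℝ E]
  {M : Type*} [TopologicalSpace M] [ChartedSpace E M]
  {F : Type*} [NormedAddCommGroup F] [NormedSpace ℝ F]
  {N : Type*} [TopologicalSpace N] [ChartedSpace F N]

section Bracket

variable [IsManifold 𝓘(ℝ, F) ∞ N] [IsManifold 𝓘(ℝ, E) ∞ M]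

/-- Smoothness at a point of a vector field. -/
abbrev SmoothFieldAt (ξ : N → F) (w : N) : Prop :=
  SmoothAlongAt (E := F) (F := F) (fun x : N => x) ξ w

theorem lieB_congr {ξ ξ' η η' : N → F} {w : N} (h : ∀ᶠ x in 𝓝 w, ξ x = ξ' x)
    (h' : ∀ᶠ x in 𝓝 w, η x = η' x) : lieB ξ η w = lieB ξ' η' w :=
  Filter.EventuallyEq.mlieBracket_vectorField_eq (I := 𝓘(ℝ, F)) (M := N) h h'

theorem lieB_swap {ξ η : N → F} {w : N} : lieB ξ η w = - lieB η ξ w :=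
  mlieBracket_swap_apply (I := 𝓘(ℝ, F)) (M := N)

variable [CompleteSpace F] [CompleteSpace E]

theorem SmoothFieldAt.mdiff {ξ : N → F} {w : N} (h : SmoothFieldAt (F := F) ξ w) :
    MDifferentiableAt 𝓘(ℝ, F) 𝓘(ℝ, F).tangent
      (fun x => (⟨x, ξ x⟩ : TangentBundle 𝓘(ℝ, F) N)) w :=
  ContMDiffAt.mdifferentiableAt h (by simp)

theorem lieB_add_left {ξ ξ' η : N → F} {w : N} (h : SmoothFieldAt (F := F) ξ w)
    (h' : SmoothFieldAt (F := F) ξ' w) :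
    lieB (fun x => ξ x + ξ' x) η w = lieB ξ η w + lieB ξ' η w :=
  mlieBracket_add_left (I := 𝓘(ℝ, F)) (M := N) h.mdiff h'.mdiff

theorem lieB_add_right {ξ ξ' η : N → F} {w : N} (h : SmoothFieldAt (F := F) ξ w)
    (h' : SmoothFieldAt (F := F) ξ' w) :
    lieB η (fun x => ξ x + ξ' x) w = lieB η ξ w + lieB η ξ' w :=
  mlieBracket_add_right (I := 𝓘(ℝ, F)) (M := N) h.mdiff h'.mdiff

theorem lieB_smul_left {a : N → ℝ} {ξ η : N → F} {w : N}
    (ha : SmoothAt (E := ℝ) (F := F) a w) (h : SmoothFieldAt (F := F) ξ w) :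
    lieB (fun x => a x • ξ x) η w =
      a w • lieB ξ η w - ((dmap a w : F →L[ℝ] ℝ) (η w)) • ξ w := by
  have := mlieBracket_smul_left (I := 𝓘(ℝ, F)) (M := N) (W := η) ha.mdiff h.mdiff
  have e : ∀ (c d : ℝ) (u v : F), -c • u + d • v = d • v - c • u := fun c d u v => by
    rw [neg_smul, neg_add_eq_sub]
  exact Eq.trans this (e _ _ _ _)

theorem lieB_const_smul_left (a : ℝ) {ξ η : N → F} {w : N} (h : SmoothFieldAt (F := F) ξ w) :
    lieB (fun x => a • ξ x) η w = a • lieB ξ η w :=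
  mlieBracket_const_smul_left (I := 𝓘(ℝ, F)) (M := N) h.mdiff

theorem lieB_const_smul_right (a : ℝ) {ξ η : N → F} {w : N} (h : SmoothFieldAt (F := F) ξ w) :
    lieB η (fun x => a • ξ x) w = a • lieB η ξ w :=
  mlieBracket_const_smul_right (I := 𝓘(ℝ, F)) (M := N) h.mdiff

theorem lieB_zero_left {η : N → F} {w : N} : lieB (fun _ => (0 : F)) η w = 0 :=
  congrFun (mlieBracket_zero_left (I := 𝓘(ℝ, F)) (M := N) (W := η)) w

theorem lieB_sum_left {κ : Type*} (s : Finset κ) {ξ : κ → N → F} {η : N → F} {w : N}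
    (h : ∀ i ∈ s, SmoothFieldAt (F := F) (ξ i) w) :
    lieB (fun x => ∑ i ∈ s, ξ i x) η w = ∑ i ∈ s, lieB (ξ i) η w := by
  classical
  induction s using Finset.induction_on with
  | empty => simpa using lieB_zero_left
  | insert a s ha ih =>
    simp only [Finset.sum_insert ha]
    rw [lieB_add_left (h a (Finset.mem_insert_self a s))
      (SmoothAlongAt.sum s contMDiffAt_id fun i hi => h i (Finset.mem_insert_of_mem hi)),
      ih fun i hi => h i (Finset.mem_insert_of_mem hi)]

theorem smoothFieldAt_lieB {ξ η : N → F} {w : N} (h : SmoothFieldAt (F := F) ξ w)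
    (h' : SmoothFieldAt (F := F) η w) : SmoothFieldAt (F := F) (lieB ξ η) w := by
  have : IsManifold 𝓘(ℝ, F) ((⊤ : ℕ∞) + 1) N := by
    have e : (((⊤ : ℕ∞) : WithTop ℕ∞) + 1) = ∞ := rfl
    rw [e]; infer_instance
  have : IsManifold 𝓘(ℝ, F) (minSmoothness ℝ 2) N := by
    refine IsManifold.of_le (n := ∞) ?_
    simp only [minSmoothness_of_isRCLikeNormedField]
    exact WithTop.coe_le_coe.2 (le_top : (2 : ℕ∞) ≤ ⊤)
  exact ContMDiffAt.mlieBracket_vectorField (I := 𝓘(ℝ, F)) (n := ⊤) (m := ⊤) (U := ξ) (V := η)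
    h h' (by simp)

/-- Related vector fields have related brackets. -/
theorem dmap_lieB_related {f : N → M} {ξ η : N → F} {ξ' η' : M → E} {w : N}
    (hf : ∀ᶠ x in 𝓝 w, SmoothAt (E := E) (F := F) f x)
    (hξ : SmoothFieldAt (F := F) ξ w) (hη : SmoothFieldAt (F := F) η w)
    (hξ' : SmoothFieldAt (F := E) ξ' (f w)) (hη' : SmoothFieldAt (F := E) η' (f w))
    (rξ : ∀ᶠ x in 𝓝 w, (dmap f x : F →L[ℝ] E) (ξ x) = ξ' (f x))
    (rη : ∀ᶠ x in 𝓝 w, (dmap f x : F →L[ℝ] E) (η x) = η' (f x)) :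
    (dmap f w : F →L[ℝ] E) (lieB ξ η w) = lieB ξ' η' (f w) := by
  have hfw := hf.self_of_nhds
  have hch : ∀ y ∈ (chartAt E (f w)).source,
      SmoothAt (E := E) (F := E) (extChartAt 𝓘(ℝ, E) (f w)) y :=
    fun y hy => contMDiffAt_extChartAt' hy
  have hsrc : ∀ᶠ x in 𝓝 w, f x ∈ (chartAt E (f w)).source :=
    hfw.continuousAt.eventually ((chartAt E (f w)).open_source.mem_nhds (mem_chart_source E _))
  have hG : SmoothAt (E := E) (F := F) (fun x => extChartAt 𝓘(ℝ, E) (f w) (f x)) w :=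
    ContMDiffAt.comp w (hch _ (mem_chart_source E _)) hfw
  -- Upstairs the formula is applied to the chart composed with `f`, downstairs to the chart.
  -- Relatedness makes the right hand sides equal.
  have h1 := dmap_lieB hG hξ hη
  have h2 := dmap_lieB (hch _ (mem_chart_source E _)) hξ' hη'
  have key : ∀ (ζ : N → F) (ζ' : M → E) (v : F), SmoothFieldAt (F := E) ζ' (f w) →
      (∀ᶠ x in 𝓝 w, (dmap f x : F →L[ℝ] E) (ζ x) = ζ' (f x)) →
      (dmap (fun x => (dmap (fun x => extChartAt 𝓘(ℝ, E) (f w) (f x)) x : F →L[ℝ] E) (ζ x)) w :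
        F →L[ℝ] E) v = (dmap (fun y => (dmap (extChartAt 𝓘(ℝ, E) (f w)) y : E →L[ℝ] E) (ζ' y)) (f w) :
        E →L[ℝ] E) ((dmap f w : F →L[ℝ] E) v) := by
    intro ζ ζ' v hζ' r
    have e : (fun x => (dmap (fun x => extChartAt 𝓘(ℝ, E) (f w) (f x)) x : F →L[ℝ] E) (ζ x))
        =ᶠ[𝓝 w] fun x => (fun y => (dmap (extChartAt 𝓘(ℝ, E) (f w)) y : E →L[ℝ] E) (ζ' y)) (f x) := by
      filter_upwards [hf, hsrc, r] with x hx hs hr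
      rw [dmap_comp (f := f) (g := extChartAt 𝓘(ℝ, E) (f w)) (hch _ hs).mdiff hx.mdiff]
      simp only [ContinuousLinearMap.comp_apply, hr]
    rw [dmap_congr e, dmap_comp (f := f)
      (g := fun y => (dmap (extChartAt 𝓘(ℝ, E) (f w)) y : E →L[ℝ] E) (ζ' y))
      (smoothAt_field_iff.1 hζ').mdiff hfw.mdiff]
    rfl
  rw [key η η' _ hη' rη, key ξ ξ' _ hξ' rξ, rξ.self_of_nhds, rη.self_of_nhds, ← h2] at h1
  rw [dmap_comp (f := f) (g := extChartAt 𝓘(ℝ, E) (f w))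
    (hch _ (mem_chart_source E _)).mdiff hfw.mdiff] at h1
  have h3 : (dmap (extChartAt 𝓘(ℝ, E) (f w)) (f w) : E →L[ℝ] E) = ContinuousLinearMap.id ℝ E :=
    dch_self (f w)
  simpa only [h3, ContinuousLinearMap.comp_apply, ContinuousLinearMap.id_apply] using h1

end Bracket

/-- A map with zero differential on a connected manifold is constant. -/
theorem constant_of_dmap_eq_zero [IsManifold 𝓘(ℝ, F) ∞ N] [IsManifold 𝓘(ℝ, E) ∞ M]
    [PreconnectedSpace N] {f : N → M}
    (hf : ∀ x, SmoothAt (E := E) (F := F) f x) (h0 : ∀ x, (dmap f x : F →L[ℝ] E) = 0) (x y : N) :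
    f x = f y := by
  have hloc : IsLocallyConstant f := by
    rw [IsLocallyConstant.iff_eventually_eq]
    intro w
    set φ := extChartAt 𝓘(ℝ, F) w
    set ψ := extChartAt 𝓘(ℝ, E) (f w)
    have hfc : Continuous f := continuous_iff_continuousAt.2 fun x => (hf x).continuousAt
    have hopen : IsOpen (f ⁻¹' ψ.source) := (isOpen_extChartAt_source _).preimage hfc
    have hO : φ.target ∩ φ.symm ⁻¹' (f ⁻¹' ψ.source) ∈ 𝓝 (φ w) := by
      refine Filter.inter_mem (extChartAt_target_mem_nhds w) ?_
      have hc : ContinuousAt φ.symm (φ w) := continuousAt_extChartAt_symm w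
      refine hc.eventually (hopen.mem_nhds ?_)
      rw [(extChartAt 𝓘(ℝ, F) w).left_inv (mem_extChartAt_source w)]
      exact mem_extChartAt_source (f w)
    -- A ball is chosen because vanishing of the derivative gives constancy on convex sets.
    obtain ⟨r, hr, hball⟩ := Metric.mem_nhds_iff.1 hO
    have hd : ∀ e ∈ Metric.ball (φ w) r, HasFDerivAt (fun e => ψ (f (φ.symm e))) (0 : F →L[ℝ] E) e := by
      intro e he
      have he1 := (hball he).1
      have he2 := (hball he).2
      have hs : φ.symm e ∈ (chartAt F w).source := by
        have := φ.map_target he1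
        simpa [φ] using this
      have hs2 : f (φ.symm e) ∈ (chartAt E (f w)).source := by
        have : f (φ.symm e) ∈ ψ.source := he2
        simpa [ψ] using this
      have m1 : MDifferentiableAt 𝓘(ℝ, F) 𝓘(ℝ, F) φ.symm e := by
        have := mdifferentiableWithinAt_extChartAt_symm (I := 𝓘(ℝ, F)) he1
        rwa [modelWithCornersSelf_coe, Set.range_id, mdifferentiableWithinAt_univ] at this
      have m2 : MDifferentiableAt 𝓘(ℝ, F) 𝓘(ℝ, E) (fun e => f (φ.symm e)) e :=
        MDifferentiableAt.comp e (hf (φ.symm e)).mdiff m1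
      have m3 : MDifferentiableAt 𝓘(ℝ, E) 𝓘(ℝ, E) ψ (f (φ.symm e)) :=
        mdifferentiableAt_extChartAt hs2
      have m4 : MDifferentiableAt 𝓘(ℝ, F) 𝓘(ℝ, E) (fun e => ψ (f (φ.symm e))) e :=
        MDifferentiableAt.comp (g := ψ) (f := fun e => f (φ.symm e)) e m3 m2
      have hz : (dmap (fun e => ψ (f (φ.symm e))) e : F →L[ℝ] E) = 0 := by
        rw [dmap_comp (g := ψ) (f := fun e => f (φ.symm e)) m3 m2,
          dmap_comp (g := f) (f := φ.symm) (hf (φ.symm e)).mdiff m1, h0]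
        simp
      have hz' : fderiv ℝ (fun e => ψ (f (φ.symm e))) e = 0 := by
        rw [← hz]; exact mfderiv_eq_fderiv.symm
      have := (mdifferentiableAt_iff_differentiableAt.1 m4).hasFDerivAt
      rwa [hz'] at this
    have hconst : ∀ e ∈ Metric.ball (φ w) r, ψ (f (φ.symm e)) = ψ (f (φ.symm (φ w))) := by
      intro e he
      refine (convex_ball (φ w) r).is_const_of_fderivWithin_eq_zero (𝕜 := ℝ)
        (f := fun e => ψ (f (φ.symm e))) (fun e he => (hd e he).differentiableAt.differentiableWithinAt)
        (fun e he => ?_) he (Metric.mem_ball_self hr)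
      rw [fderivWithin_of_isOpen Metric.isOpen_ball he, (hd e he).fderiv]
    have hev : ∀ᶠ x in 𝓝 w, φ x ∈ Metric.ball (φ w) r :=
      (continuousAt_extChartAt (I := 𝓘(ℝ, F)) w).eventually (Metric.ball_mem_nhds _ hr)
    filter_upwards [hev, (isOpen_extChartAt_source (I := 𝓘(ℝ, F)) w).mem_nhds
      (mem_extChartAt_source w), hopen.mem_nhds (mem_extChartAt_source (f w))] with x hx hx2 hx3
    have h1 := hconst _ hx
    rw [φ.left_inv hx2, φ.left_inv (mem_extChartAt_source w)] at h1
    exact ψ.injOn hx3 (mem_extChartAt_source (f w)) h1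
  exact hloc.apply_eq_of_preconnectedSpace x y

end Calculus
end NormalProlongation


set_option linter.unusedSectionVars false

namespace NormalProlongation

/-! ### Homogeneous components and homogeneous bases -/

section Graded

variable {L : Type v} [LieRing L] [LieAlgebra ℝ L] (𝒜 : ℤ → Submodule ℝ L) [GradedLieAlgebra 𝒜]

/-- The homogeneous component of degree `i`. -/
noncomputable def hc (i : ℤ) : L →ₗ[ℝ] L :=
  (𝒜 i).subtype ∘ₗ DirectSum.component ℝ ℤ (fun i => 𝒜 i) i ∘ₗ
    (DirectSum.decomposeLinearEquiv 𝒜).toLinearMap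

theorem hc_apply (i : ℤ) (x : L) : hc 𝒜 i x = (DirectSum.decompose 𝒜 x i : L) := rfl

theorem hc_mem (i : ℤ) (x : L) : hc 𝒜 i x ∈ 𝒜 i := (DirectSum.decompose 𝒜 x i).2

variable {𝒜}

theorem hc_of_mem {i : ℤ} {x : L} (h : x ∈ 𝒜 i) : hc 𝒜 i x = x :=
  DirectSum.decompose_of_mem_same 𝒜 h

theorem hc_of_mem_ne {i j : ℤ} {x : L} (h : x ∈ 𝒜 i) (hij : i ≠ j) : hc 𝒜 j x = 0 :=
  DirectSum.decompose_of_mem_ne 𝒜 h hij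

theorem hc_ext {x y : L} (h : ∀ i, hc 𝒜 i x = hc 𝒜 i y) : x = y := by
  apply (DirectSum.decompose 𝒜).injective
  ext i
  exact h i

open Classical in
theorem sum_hc (x : L) : ∑ i ∈ (DirectSum.decompose 𝒜 x).support, hc 𝒜 i x = x :=
  DirectSum.sum_support_decompose 𝒜 x

/-- Replaces a supremum of subspaces by the vanishing of finitely supported components, the form in
which the filtration is handled throughout. -/
theorem mem_filt_iff {p : ℤ} {x : L} : x ∈ filt 𝒜 p ↔ ∀ i, i < p → hc 𝒜 i x = 0 := by
  constructor
  · intro hx i hi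
    unfold filt at hx
    have : (⨆ j : ℤ, ⨆ _ : p ≤ j, 𝒜 j) ≤ LinearMap.ker (hc 𝒜 i) := by
      refine iSup_le fun j => iSup_le fun hj y hy => ?_
      exact hc_of_mem_ne hy (by omega)
    exact this hx
  · intro h
    rw [← sum_hc (𝒜 := 𝒜) x]
    refine Submodule.sum_mem _ fun i _ => ?_
    by_cases hi : i < p
    · rw [h i hi]; exact zero_mem _
    · exact Submodule.mem_iSup_of_mem i (Submodule.mem_iSup_of_mem (by omega) (hc_mem 𝒜 i x))

theorem filt_anti {p q : ℤ} (h : p ≤ q) : filt 𝒜 q ≤ filt 𝒜 p := fun _ hx =>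
  mem_filt_iff.2 fun i hi => mem_filt_iff.1 hx i (lt_of_lt_of_le hi h)

theorem mem_filt_of_mem {p i : ℤ} (h : p ≤ i) {x : L} (hx : x ∈ 𝒜 i) : x ∈ filt 𝒜 p :=
  mem_filt_iff.2 fun j hj => hc_of_mem_ne hx (by omega)

theorem sub_hc_mem_filt {p : ℤ} {x : L} (hx : x ∈ filt 𝒜 p) : x - hc 𝒜 p x ∈ filt 𝒜 (p + 1) := by
  refine mem_filt_iff.2 fun i hi => ?_
  rw [map_sub]
  rcases eq_or_ne i p with rfl | hip
  · rw [hc_of_mem (hc_mem 𝒜 i x), sub_self]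
  · rw [hc_of_mem_ne (hc_mem 𝒜 p x) (Ne.symm hip), mem_filt_iff.1 hx i (by omega), sub_zero]

theorem filt_induction {p : ℤ} {P : Submodule ℝ L} (h : ∀ i, p ≤ i → 𝒜 i ≤ P) : filt 𝒜 p ≤ P :=
  iSup_le fun i => iSup_le fun hi => h i hi

theorem lie_mem_deg {i j : ℤ} {x y : L} (hx : x ∈ 𝒜 i) (hy : y ∈ 𝒜 j) : ⁅x, y⁆ ∈ 𝒜 (i + j) :=
  SetLike.GradedBracket.bracket_mem hx hy

theorem lie_mem_filt {p q : ℤ} {x y : L} (hx : x ∈ filt 𝒜 p) (hy : y ∈ filt 𝒜 q) :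
    ⁅x, y⁆ ∈ filt 𝒜 (p + q) := by
  have h1 : ∀ i, p ≤ i → ∀ x ∈ 𝒜 i, ∀ y ∈ filt 𝒜 q, ⁅x, y⁆ ∈ filt 𝒜 (p + q) := by
    intro i hi x hx y hy
    have : filt 𝒜 q ≤ (filt 𝒜 (p + q)).comap (LieAlgebra.ad ℝ L x : L →ₗ[ℝ] L) :=
      filt_induction fun j hj y hy => mem_filt_of_mem (by omega) (lie_mem_deg hx hy)
    exact this hy
  have : filt 𝒜 p ≤ (filt 𝒜 (p + q)).comap (LieAlgebra.ad ℝ L y : L →ₗ[ℝ] L) := by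
    refine filt_induction fun i hi x hx => ?_
    have := h1 i hi x hx y hy
    rw [Submodule.mem_comap, LieAlgebra.ad_apply, ← lie_skew]
    exact neg_mem this
  have h2 := this hx
  rw [Submodule.mem_comap, LieAlgebra.ad_apply, ← lie_skew] at h2
  simpa using neg_mem h2

theorem mem_gNeg_iff {x : L} : x ∈ gNeg 𝒜 ↔ ∀ i, 0 ≤ i → hc 𝒜 i x = 0 := by
  change x ∈ (⨆ i : {i : ℤ // i < 0}, 𝒜 i.1) ↔ _
  constructor
  · intro hx i hi
    have : (⨆ i : {i : ℤ // i < 0}, 𝒜 i.1) ≤ LinearMap.ker (hc 𝒜 i) :=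
      iSup_le fun j y hy => hc_of_mem_ne hy (by have := j.2; omega)
    exact this hx
  · intro h
    rw [← sum_hc (𝒜 := 𝒜) x]
    refine Submodule.sum_mem _ fun i _ => ?_
    by_cases hi : i < 0
    · exact Submodule.mem_iSup_of_mem (p := fun i : {i : ℤ // i < 0} => 𝒜 i.1) ⟨i, hi⟩ (hc_mem 𝒜 i x)
    · rw [h i (by omega)]; exact zero_mem _

theorem mem_gNeg_of_mem {i : ℤ} (hi : i < 0) {x : L} (hx : x ∈ 𝒜 i) : x ∈ gNeg 𝒜 :=
  mem_gNeg_iff.2 fun j hj => hc_of_mem_ne hx (by omega)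

/-- Finitely many generators of 𝔤₋ involve finitely many degrees, and in every other negative degree
the component map vanishes on 𝔤₋. -/
theorem exists_depth (h : FiniteDimensional ℝ (gNeg 𝒜)) :
    ∃ μ : ℕ, ∀ i : ℤ, i < -(μ : ℤ) → 𝒜 i = ⊥ := by
  classical
  obtain ⟨s, hs⟩ := (Module.finite_def.1 h : (⊤ : Submodule ℝ (gNeg 𝒜)).FG)
  let t : Finset ℤ := s.biUnion fun x => (DirectSum.decompose 𝒜 (x : L)).support
  have ht : ∀ i, i < 0 → i ∉ t → 𝒜 i = ⊥ := by
    intro i hi hit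
    have h1 : Submodule.span ℝ (s : Set (gNeg 𝒜)) ≤
        LinearMap.ker (hc 𝒜 i ∘ₗ (gNeg 𝒜).toSubmodule.subtype) := by
      refine Submodule.span_le.2 fun x hx => ?_
      change hc 𝒜 i (x : L) = 0
      by_contra hne
      refine hit (Finset.mem_biUnion.2 ⟨x, hx, ?_⟩)
      rw [DFinsupp.mem_support_iff]
      intro h0
      exact hne (by rw [hc_apply, h0]; rfl)
    rw [hs] at h1
    refine (Submodule.eq_bot_iff _).2 fun x hx => ?_
    have := h1 (Submodule.mem_top : (⟨x, mem_gNeg_of_mem hi hx⟩ : gNeg 𝒜) ∈ ⊤)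
    have h2 : hc 𝒜 i x = 0 := this
    rwa [hc_of_mem hx] at h2
  refine ⟨t.sup fun i => i.natAbs, fun i hi => ht i (by omega) fun hit => ?_⟩
  have : i.natAbs ≤ t.sup fun i => i.natAbs := Finset.le_sup (f := fun i : ℤ => i.natAbs) hit
  omega

theorem filt_eq_top {μ : ℕ} (hμ : ∀ i : ℤ, i < -(μ : ℤ) → 𝒜 i = ⊥) {p : ℤ} (hp : p ≤ -(μ : ℤ)) :
    filt 𝒜 p = ⊤ := by
  refine (Submodule.eq_top_iff').2 fun x => mem_filt_iff.2 fun i hi => ?_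
  have := hc_mem 𝒜 i x
  rw [hμ i (by omega)] at this
  exact (Submodule.mem_bot ℝ).1 this

variable (𝒜) in
/-- A homogeneous basis of `⨁_{i < n} 𝔤_i`, together with the coordinate functionals. -/
structure HomBasis (n : ℤ) where
  ι : Type
  [fintype : Fintype ι]
  [deq : DecidableEq ι]
  b : ι → L
  deg : ι → ℤ
  c : ι → (L →ₗ[ℝ] ℝ)
  mem : ∀ j, b j ∈ 𝒜 (deg j)
  deg_lt : ∀ j, deg j < n
  dual : ∀ j l, c j (b l) = if j = l then 1 else 0
  span : ∀ x, x - ∑ j, c j x • b j ∈ filt 𝒜 n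
  c_hc : ∀ j x, c j x = c j (hc 𝒜 (deg j) x)

attribute [instance] HomBasis.fintype HomBasis.deq

/-- Only the degrees from `-μ` to `n - 1` contribute, so bases of finitely many finite dimensional
pieces suffice. Composing with the projection to a degree extends the coordinates to all of `L`. -/
theorem nonempty_homBasis (htr : FiniteDimensional ℝ (gNeg 𝒜))
    (hfd : ∀ i : ℤ, 0 ≤ i → FiniteDimensional ℝ (𝒜 i)) (n : ℤ) : Nonempty (HomBasis 𝒜 n) := by
  classical
  obtain ⟨μ, hμ⟩ := exists_depth htr
  have hfd' : ∀ i : ℤ, FiniteDimensional ℝ (𝒜 i) := by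
    intro i
    by_cases hi : 0 ≤ i
    · exact hfd i hi
    · have : 𝒜 i ≤ (gNeg 𝒜).toSubmodule := fun x hx => mem_gNeg_of_mem (by omega) hx
      have : FiniteDimensional ℝ (gNeg 𝒜).toSubmodule := htr
      exact Submodule.finiteDimensional_of_le ‹𝒜 i ≤ (gNeg 𝒜).toSubmodule›
  let B : ∀ i, Module.Basis (Fin (Module.finrank ℝ (𝒜 i))) ℝ (𝒜 i) := fun i => Module.finBasis ℝ (𝒜 i)
  let comp : ∀ i : ℤ, L →ₗ[ℝ] 𝒜 i := fun i => DirectSum.component ℝ ℤ (fun i => 𝒜 i) i ∘ₗ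
    (DirectSum.decomposeLinearEquiv 𝒜).toLinearMap
  have hcomp : ∀ i x, (comp i x : L) = hc 𝒜 i x := fun _ _ => rfl
  refine ⟨{
    ι := Σ i : {i // i ∈ Finset.Ico (-(μ : ℤ)) n}, Fin (Module.finrank ℝ (𝒜 i.1))
    b := fun j => (B j.1.1 j.2 : L)
    deg := fun j => j.1.1
    c := fun j => (B j.1.1).coord j.2 ∘ₗ comp j.1.1
    mem := fun j => (B j.1.1 j.2).2
    deg_lt := fun j => (Finset.mem_Ico.1 j.1.2).2
    dual := ?_
    span := ?_
    c_hc := ?_ }⟩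
  · rintro ⟨⟨i, hi⟩, j⟩ ⟨⟨i', hi'⟩, j'⟩
    by_cases h : i = i'
    · subst h
      have : comp i (B i j' : L) = B i j' := Subtype.ext (hc_of_mem (B i j').2)
      simp only [LinearMap.comp_apply, this, Module.Basis.coord_apply, Module.Basis.repr_self,
        Finsupp.single_apply]
      by_cases hj : j = j'
      · subst hj; simp
      · rw [if_neg (Ne.symm hj), if_neg]
        intro h; apply hj; simpa using h
    · have : comp i (B i' j' : L) = 0 := Subtype.ext (hc_of_mem_ne (B i' j').2 (Ne.symm h))
      simp only [LinearMap.comp_apply, this, map_zero]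
      rw [if_neg]
      intro h'; apply h; simpa using congrArg (fun s => s.1.1) h'
  · intro x
    refine mem_filt_iff.2 fun i hi => ?_
    have hs : ∑ j : (Σ i : {i // i ∈ Finset.Ico (-(μ : ℤ)) n}, Fin (Module.finrank ℝ (𝒜 i.1))),
        ((B j.1.1).coord j.2 ∘ₗ comp j.1.1) x • (B j.1.1 j.2 : L) =
        ∑ i ∈ (Finset.Ico (-(μ : ℤ)) n), hc 𝒜 i x := by
      rw [Fintype.sum_sigma, ← Finset.sum_coe_sort (Finset.Ico (-(μ : ℤ)) n) fun i => hc 𝒜 i x]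
      refine Fintype.sum_congr _ _ fun i => ?_
      have := congrArg (fun y : 𝒜 i.1 => (y : L)) ((B i.1).sum_repr (comp i.1 x))
      rw [← hcomp]
      refine Eq.trans ?_ this
      rw [AddSubmonoidClass.coe_finsetSum]
      rfl
    rw [hs, map_sub, map_sum]
    by_cases hi' : -(μ : ℤ) ≤ i
    · rw [Finset.sum_eq_single i, hc_of_mem (hc_mem 𝒜 i x), sub_self]
      · intro j _ hj
        exact hc_of_mem_ne (hc_mem 𝒜 j x) hj
      · intro h; exact absurd (Finset.mem_Ico.2 ⟨hi', hi⟩) h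
    · have hz : ∀ y, hc 𝒜 i y = 0 := fun y => by
        have := hc_mem 𝒜 i y
        rw [hμ i (by omega)] at this
        exact (Submodule.mem_bot ℝ).1 this
      rw [hz, Finset.sum_eq_zero (s := Finset.Ico (-(μ : ℤ)) n)
        (f := fun j => hc 𝒜 i (hc 𝒜 j x)) fun j _ => hz _, sub_zero]
  · rintro ⟨⟨i, hi⟩, j⟩ x
    have : comp i (hc 𝒜 i x) = comp i x := Subtype.ext (hc_of_mem (hc_mem 𝒜 i x))
    simp only [LinearMap.comp_apply, this]

namespace HomBasis

variable {n : ℤ} (β : HomBasis 𝒜 n)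

theorem c_eq_zero_of_filt {p : ℤ} {x : L} (hx : x ∈ filt 𝒜 p) {j : β.ι} (hj : β.deg j < p) :
    β.c j x = 0 := by
  rw [β.c_hc, mem_filt_iff.1 hx _ hj, map_zero]

theorem c_eq_zero_of_mem {i : ℤ} {x : L} (hx : x ∈ 𝒜 i) {j : β.ι} (hj : β.deg j ≠ i) :
    β.c j x = 0 := by
  rw [β.c_hc, hc_of_mem_ne hx (Ne.symm hj), map_zero]

theorem eq_sum_of_mem {i : ℤ} (hi : i < n) {x : L} (hx : x ∈ 𝒜 i) : x = ∑ j, β.c j x • β.b j := by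
  have h := β.span x
  refine hc_ext (𝒜 := 𝒜) fun l => ?_
  by_cases hl : l < n
  · have := mem_filt_iff.1 h l hl
    rwa [map_sub, sub_eq_zero] at this
  · rw [hc_of_mem_ne hx (by omega), map_sum, Finset.sum_eq_zero]
    intro j _
    rw [map_smul, hc_of_mem_ne (β.mem j) (by have := β.deg_lt j; omega), smul_zero]

end HomBasis

end Graded

end NormalProlongation


set_option linter.unusedSectionVars false

namespace NormalProlongation

/-! ### Towers: projections, tangential filtration, linear frames -/

variable {L : Type v} [LieRing L] [LieAlgebra ℝ L] {𝒜 : ℤ → Submodule ℝ L}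
  [GradedLieAlgebra 𝒜] {k : ℕ}

variable (𝒜) in
/-- A number `μ` with `𝔤_i = 0` for `i < -μ`. -/
noncomputable def depth [htr : Fact (IsTransitive 𝒜)] : ℕ := (exists_depth htr.out.finite_neg).choose

theorem depth_spec [htr : Fact (IsTransitive 𝒜)] (i : ℤ) (h : i < -(depth 𝒜 : ℤ)) : 𝒜 i = ⊥ :=
  (exists_depth htr.out.finite_neg).choose_spec i h

theorem filt_depth [htr : Fact (IsTransitive 𝒜)] {p : ℤ} (h : p ≤ -(depth 𝒜 : ℤ)) :
    filt 𝒜 p = ⊤ := filt_eq_top (fun i hi => depth_spec i hi) h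

theorem StructureType.finiteDimensional (𝒯 : StructureType.{u} 𝒜 k) (i : ℤ) (hi : 0 ≤ i) :
    FiniteDimensional ℝ (𝒜 i) := by
  obtain ⟨n, rfl⟩ := Int.eq_ofNat_of_zero_le hi
  have : FiniteDimensional ℝ (TangentSpace 𝓘(ℝ, 𝒯.VG n) (1 : 𝒯.G n)) :=
    inferInstanceAs (FiniteDimensional ℝ (𝒯.VG n))
  exact (𝒯.lam n).symm.finiteDimensional

/-- A chosen homogeneous basis of `⨁_{i < n} 𝔤_i`. -/
noncomputable def StructureType.hb [htr : Fact (IsTransitive 𝒜)] (𝒯 : StructureType.{u} 𝒜 k) (n : ℤ) :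
    HomBasis 𝒜 n :=
  Classical.choice (nonempty_homBasis htr.out.finite_neg 𝒯.finiteDimensional n)

namespace Tower

variable {𝒯 : StructureType.{u} 𝒜 k} (T : Tower 𝒯)

theorem bracket_eq (n : ℕ) (ξ η : T.Q n → T.V n) (y : T.Q n) : T.bracket n ξ η y = lieB ξ η y := rfl

theorem smoothFieldOn_iff {n : ℕ} {ξ : T.Q n → T.V n} {U : Set (T.Q n)} (hU : IsOpen U) :
    T.SmoothFieldOn n ξ U ↔ ∀ y ∈ U, SmoothFieldAt (F := T.V n) ξ y :=
  ⟨fun h _ hy => h.contMDiffAt (hU.mem_nhds hy), fun h y hy => (h y hy).contMDiffWithinAt⟩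

/-- The levels `≤ n` carry a geometric structure of order `n - 1`. -/
structure Geo (n : ℕ) : Prop where
  filtered : T.IsFilteredManifold
  reduction : ∀ m, m < n → T.IsFrameReduction m

variable {T}

theorem IsGeometric.geo {l n : ℕ} (h : T.IsGeometric l) (hn : n ≤ l + 1) : T.Geo n :=
  ⟨h.filtered, fun m hm => h.reduction m (by omega)⟩

theorem Geo.mono {n m : ℕ} (h : T.Geo n) (hm : m ≤ n) : T.Geo m :=
  ⟨h.filtered, fun l hl => h.reduction l (by omega)⟩

variable (T)

/-- The projection from level `n` to level `m`. -/
def pr {m n : ℕ} (h : m ≤ n) : T.Q n → T.Q m :=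
  Nat.leRec (motive := fun n _ => T.Q n → T.Q m) (fun z => z) (fun n _ f z => f (T.π n z)) h

theorem pr_self {m : ℕ} (h : m ≤ m) (z : T.Q m) : T.pr h z = z := by
  unfold pr; rw [Nat.leRec_self]

theorem pr_succ {m n : ℕ} (h : m ≤ n) (h' : m ≤ n + 1) (z : T.Q (n + 1)) :
    T.pr h' z = T.pr h (T.π n z) := by
  unfold pr; rw [Nat.leRec_succ]

theorem π_pr {m n : ℕ} (h : m + 1 ≤ n) (h' : m ≤ n) (z : T.Q n) :
    T.π m (T.pr h z) = T.pr h' z := by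
  induction n, h using Nat.le_induction with
  | base => rw [pr_self, T.pr_succ le_rfl, pr_self]
  | succ n h ih => rw [T.pr_succ h, T.pr_succ (by omega : m ≤ n), ih]

/-- `pr` is indexed by a proof of `m ≤ n`, so levels need not be rewritten in the form `m + d`. This
passes to the `proj` of the statement. -/
theorem proj_eq_pr (m d : ℕ) (z : T.Q (m + d)) : T.proj m d z = T.pr (Nat.le_add_right m d) z := by
  induction d with
  | zero => exact (T.pr_self _ z).symm
  | succ d ih =>
    rw [T.pr_succ (Nat.le_add_right m d), ← ih]; rfl

/-- The differential of `pr`. -/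
noncomputable def dpr {m n : ℕ} (h : m ≤ n) (z : T.Q n) : T.V n →ₗ[ℝ] T.V m :=
  (dmap (T.pr h) z : T.V n →L[ℝ] T.V m).toLinearMap

variable {T}

theorem IsFrameReduction.smoothAt_π {n : ℕ} (h : T.IsFrameReduction n) (z : T.Q (n + 1)) :
    SmoothAt (E := T.V n) (F := T.V (n + 1)) (T.π n) z := h.smooth_π z

theorem Geo.smoothAt_pr {m n : ℕ} (hT : T.Geo n) (h : m ≤ n) (z : T.Q n) :
    SmoothAt (E := T.V m) (F := T.V n) (T.pr h) z := by
  induction n, h using Nat.le_induction with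
  | base =>
    have : T.pr (le_refl m) = fun z => z := funext (T.pr_self _)
    rw [this]; exact contMDiffAt_id
  | succ n h ih =>
    have : T.pr (Nat.le_succ_of_le h) = fun z => T.pr h (T.π n z) := funext (T.pr_succ h _)
    rw [this]
    exact ContMDiffAt.comp z (ih (hT.mono (Nat.le_succ n)) _)
      ((hT.reduction n (Nat.lt_succ_self n)).smoothAt_π z)

theorem dpr_self {m : ℕ} (h : m ≤ m) (z : T.Q m) : T.dpr h z = LinearMap.id := by
  have : T.pr h = fun z => z := funext (T.pr_self _)
  unfold dpr
  rw [this]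
  have : (dmap (fun z : T.Q m => z) z : T.V m →L[ℝ] T.V m) = ContinuousLinearMap.id ℝ _ :=
    mfderiv_id
  rw [this]; rfl

theorem Geo.dpr_succ {m n : ℕ} (hT : T.Geo (n + 1)) (h : m ≤ n) (h' : m ≤ n + 1) (z : T.Q (n + 1)) :
    T.dpr h' z = T.dpr h (T.π n z) ∘ₗ T.dπ n z := by
  have : T.pr h' = fun z => T.pr h (T.π n z) := funext (T.pr_succ h _)
  unfold dpr
  rw [this, dmap_comp (g := T.pr h) (f := T.π n)
    ((hT.mono (Nat.le_succ n)).smoothAt_pr h _).mdiff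
    ((hT.reduction n (Nat.lt_succ_self n)).smoothAt_π z).mdiff]
  rfl

theorem Geo.dπ_dpr {m n : ℕ} (hT : T.Geo n) (h : m + 1 ≤ n) (h' : m ≤ n) (z : T.Q n) :
    T.dπ m (T.pr h z) ∘ₗ T.dpr h z = T.dpr h' z := by
  have : T.pr h' = fun z => T.π m (T.pr h z) := funext fun z => (T.π_pr h _ z).symm
  unfold dpr
  rw [this, dmap_comp (g := T.π m) (f := T.pr h)
    ((hT.reduction m (by omega)).smoothAt_π _).mdiff (hT.smoothAt_pr h z).mdiff]
  rfl

/-! #### The filtration -/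

theorem tanFilt_succ_of_le {n : ℕ} {p : ℤ} (h : p ≤ n) (z : T.Q (n + 1)) :
    T.tanFilt (n + 1) p z = (T.tanFilt n p (T.π n z)).comap (T.dπ n z) := by
  rw [tanFilt, if_pos h]

theorem tanFilt_succ_of_lt {n : ℕ} {p : ℤ} (h : (n : ℤ) < p) (z : T.Q (n + 1)) :
    T.tanFilt (n + 1) p z = ⊥ := by
  rw [tanFilt, if_neg (not_le.2 h)]

theorem IsFilteredManifold.anti (h : T.IsFilteredManifold) (x : T.Q 0) {p q : ℤ} (hpq : p ≤ q) :
    T.F q x ≤ T.F p x := by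
  induction q, hpq using Int.leInduction with
  | base => exact le_rfl
  | succ q _ ih => exact (h.antitone x q).trans ih

theorem tanFilt_anti (h : T.IsFilteredManifold) {n : ℕ} (y : T.Q n) {p q : ℤ} (hpq : p ≤ q) :
    T.tanFilt n q y ≤ T.tanFilt n p y := by
  induction n with
  | zero => exact h.anti y hpq
  | succ n ih =>
    by_cases hq : q ≤ n
    · rw [tanFilt_succ_of_le hq, tanFilt_succ_of_le (hpq.trans hq)]
      exact Submodule.comap_mono (ih _)
    · rw [tanFilt_succ_of_lt (not_le.1 hq)]; exact bot_le

theorem tanFilt_eq_bot (h : T.IsFilteredManifold) {n : ℕ} (y : T.Q n) {p : ℤ} (hp : (n : ℤ) ≤ p) :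
    T.tanFilt n p y = ⊥ := by
  cases n with
  | zero => exact le_bot_iff.1 ((h.anti y hp).trans (h.zero y).le)
  | succ n => exact tanFilt_succ_of_lt (by push_cast at hp; omega) y

theorem tanFilt_exhaustive (h : T.IsFilteredManifold) {n : ℕ} (y : T.Q n) :
    ∃ p : ℤ, T.tanFilt n p y = ⊤ := by
  induction n with
  | zero => exact h.exhaustive y
  | succ n ih =>
    obtain ⟨p, hp⟩ := ih (T.π n y)
    refine ⟨min p n, ?_⟩
    rw [tanFilt_succ_of_le (min_le_right _ _), eq_top_iff, ← Submodule.comap_top (T.dπ n y), ← hp]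
    exact Submodule.comap_mono (tanFilt_anti h _ (min_le_left _ _))

theorem Geo.tanFilt_pr {m n : ℕ} (hT : T.Geo n) (h : m ≤ n) {p : ℤ} (hp : p ≤ m) (z : T.Q n) :
    T.tanFilt n p z = (T.tanFilt m p (T.pr h z)).comap (T.dpr h z) := by
  induction n, h using Nat.le_induction with
  | base => rw [dpr_self, pr_self]; rfl
  | succ n h ih =>
    rw [tanFilt_succ_of_le (by omega), ih (hT.mono (Nat.le_succ n)), hT.dpr_succ h, T.pr_succ h]
    rfl

theorem Geo.mem_tanFilt_pr {m n : ℕ} (hT : T.Geo n) (h : m ≤ n) {p : ℤ} (hp : p ≤ m) {z : T.Q n}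
    {v : T.V n} : v ∈ T.tanFilt n p z ↔ T.dpr h z v ∈ T.tanFilt m p (T.pr h z) := by
  rw [hT.tanFilt_pr h hp]; rfl

/-- `F^m` vanishes at level `m` and is pulled back from there, so upstairs it is the space of
vectors vertical over level `m`. Congruence modulo `F^m` means equality after projection. -/
theorem Geo.mem_tanFilt_iff_dpr {m n : ℕ} (hT : T.Geo n) (h : m ≤ n) {z : T.Q n} {v : T.V n} :
    v ∈ T.tanFilt n m z ↔ T.dpr h z v = 0 := by
  rw [hT.mem_tanFilt_pr h le_rfl, tanFilt_eq_bot hT.filtered _ le_rfl, Submodule.mem_bot]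

theorem Geo.dπ_mem {n : ℕ} (_ : T.Geo (n + 1)) {p : ℤ} {z : T.Q (n + 1)} {v : T.V (n + 1)}
    (h : v ∈ T.tanFilt (n + 1) p z) : T.dπ n z v ∈ T.tanFilt n p (T.π n z) := by
  by_cases hp : p ≤ n
  · rwa [tanFilt_succ_of_le hp] at h
  · rw [tanFilt_succ_of_lt (not_le.1 hp), Submodule.mem_bot] at h
    rw [h, map_zero]; exact zero_mem _

/-! #### Linear frames -/

theorem IsLinearFrame.ker {n : ℕ} {y : T.Q n} {ζ : L →ₗ[ℝ] T.V n} (h : T.IsLinearFrame n y ζ) :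
    LinearMap.ker ζ = filt 𝒜 n := by
  cases n with
  | zero => exact h.1
  | succ n => exact h.1

theorem IsLinearFrame.map {n : ℕ} {y : T.Q n} {ζ : L →ₗ[ℝ] T.V n} (h : T.IsLinearFrame n y ζ)
    (p : ℤ) : (filt 𝒜 p).map ζ = T.tanFilt n p y := by
  cases n with
  | zero => exact h.2.1 p
  | succ n => exact h.2.1 p

theorem IsLinearFrame.apply_eq_zero_iff {n : ℕ} {y : T.Q n} {ζ : L →ₗ[ℝ] T.V n}
    (h : T.IsLinearFrame n y ζ) {x : L} : ζ x = 0 ↔ x ∈ filt 𝒜 n := by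
  rw [← h.ker, LinearMap.mem_ker]

theorem IsLinearFrame.apply_mem {n : ℕ} {y : T.Q n} {ζ : L →ₗ[ℝ] T.V n}
    (h : T.IsLinearFrame n y ζ) {p : ℤ} {x : L} (hx : x ∈ filt 𝒜 p) : ζ x ∈ T.tanFilt n p y := by
  rw [← h.map p]; exact Submodule.mem_map_of_mem hx

theorem IsLinearFrame.mem_iff {n : ℕ} {y : T.Q n} {ζ : L →ₗ[ℝ] T.V n}
    (h : T.IsLinearFrame n y ζ) {p : ℤ} (hp : p ≤ n) {x : L} :
    ζ x ∈ T.tanFilt n p y ↔ x ∈ filt 𝒜 p := by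
  refine ⟨fun hx => ?_, h.apply_mem⟩
  rw [← h.map p] at hx
  obtain ⟨x', hx', he⟩ := hx
  have : x - x' ∈ filt 𝒜 n := by rw [← h.apply_eq_zero_iff, map_sub, he, sub_self]
  have := add_mem (filt_anti hp this) hx'
  simpa using this

theorem IsLinearFrame.surjective (hT : T.IsFilteredManifold) {n : ℕ} {y : T.Q n}
    {ζ : L →ₗ[ℝ] T.V n} (h : T.IsLinearFrame n y ζ) : Function.Surjective ζ := by
  obtain ⟨p, hp⟩ := tanFilt_exhaustive hT y
  intro v
  have hv : v ∈ T.tanFilt n p y := by rw [hp]; trivial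
  rw [← h.map p] at hv
  obtain ⟨x, -, hx⟩ := hv
  exact ⟨x, hx⟩

theorem Geo.mem_frames_iff {n : ℕ} (hT : T.Geo (n + 1)) {z : T.Q (n + 1)} {ζ₀ ζ : L →ₗ[ℝ] T.V n}
    (h₀ : ζ₀ ∈ T.frames n z) :
    ζ ∈ T.frames n z ↔ T.IsLinearFrame n (T.π n z) ζ ∧ T.FrameEquiv n (T.π n z) ζ₀ ζ :=
  (hT.reduction n (Nat.lt_succ_self n)).frames_class z ζ₀ h₀ ζ

theorem Geo.isLinearFrame_of_mem {n : ℕ} (hT : T.Geo (n + 1)) {z : T.Q (n + 1)} {ζ : L →ₗ[ℝ] T.V n}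
    (h : ζ ∈ T.frames n z) : T.IsLinearFrame n (T.π n z) ζ :=
  ((hT.mem_frames_iff h).1 h).1

theorem IsLinearFrame.trunc_mem {n : ℕ} {y : T.Q (n + 1)} {ζ : L →ₗ[ℝ] T.V (n + 1)}
    (h : T.IsLinearFrame (n + 1) y ζ) : T.dπ n y ∘ₗ ζ ∈ T.frames n y := h.2.2.2

theorem IsLinearFrame.trunc {n : ℕ} (hT : T.Geo (n + 1)) {y : T.Q (n + 1)} {ζ : L →ₗ[ℝ] T.V (n + 1)}
    (h : T.IsLinearFrame (n + 1) y ζ) : T.IsLinearFrame n (T.π n y) (T.dπ n y ∘ₗ ζ) :=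
  hT.isLinearFrame_of_mem h.trunc_mem

theorem IsLinearFrame.pr {m n : ℕ} (hT : T.Geo n) (hmn : m ≤ n) {y : T.Q n} {ζ : L →ₗ[ℝ] T.V n}
    (h : T.IsLinearFrame n y ζ) : T.IsLinearFrame m (T.pr hmn y) (T.dpr hmn y ∘ₗ ζ) := by
  induction n, hmn using Nat.le_induction with
  | base => rw [dpr_self, pr_self]; exact h
  | succ n hmn ih =>
    rw [hT.dpr_succ hmn, T.pr_succ hmn]
    exact ih (hT.mono (Nat.le_succ n)) (h.trunc hT)

theorem IsLinearFrame.pr_mem {m n : ℕ} (hT : T.Geo n) (hmn : m + 1 ≤ n) (hmn' : m ≤ n) {y : T.Q n}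
    {ζ : L →ₗ[ℝ] T.V n} (h : T.IsLinearFrame n y ζ) :
    T.dpr hmn' y ∘ₗ ζ ∈ T.frames m (T.pr hmn y) := by
  rw [← hT.dπ_dpr hmn hmn']
  exact (h.pr hT hmn).trunc_mem

theorem FrameEquiv.symm {n : ℕ} {y : T.Q n} {ζ ζ' : L →ₗ[ℝ] T.V n} (h : T.FrameEquiv n y ζ ζ') :
    T.FrameEquiv n y ζ' ζ := fun p x hx => by
  have := neg_mem (h p x hx)
  rwa [neg_sub] at this

theorem FrameEquiv.refl {n : ℕ} (y : T.Q n) (ζ : L →ₗ[ℝ] T.V n) : T.FrameEquiv n y ζ ζ :=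
  fun p x hx => by rw [sub_self]; exact zero_mem _

theorem FrameEquiv.trans {n : ℕ} {y : T.Q n} {ζ ζ' ζ'' : L →ₗ[ℝ] T.V n}
    (h : T.FrameEquiv n y ζ ζ') (h' : T.FrameEquiv n y ζ' ζ'') : T.FrameEquiv n y ζ ζ'' :=
  fun p x hx => by
    have e : ζ'' x - ζ x = (ζ' x - ζ x) + (ζ'' x - ζ' x) := by abel
    rw [e]
    exact add_mem (h p x hx) (h' p x hx)

section Perturb

variable [htr : Fact (IsTransitive 𝒜)]

/-- A perturbation that raises the filtration is unipotent relative to `ζ`. For the kernel one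
climbs from `-μ`, where `F` is everything, up to `n`. For the image one descends from `n`, where the
filtration of the tangent space is zero. -/
theorem map_add_of_raising (hT : T.IsFilteredManifold) {n : ℕ} {y : T.Q n} {ζ D : L →ₗ[ℝ] T.V n}
    (hk : LinearMap.ker ζ = filt 𝒜 n) (hm : ∀ p : ℤ, (filt 𝒜 p).map ζ = T.tanFilt n p y)
    (hD : ∀ p : ℤ, ∀ x ∈ filt 𝒜 p, D x ∈ T.tanFilt n (p + 1) y) :
    LinearMap.ker (ζ + D) = filt 𝒜 n ∧ ∀ p : ℤ, (filt 𝒜 p).map (ζ + D) = T.tanFilt n p y := by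
  have hle : ∀ p : ℤ, (filt 𝒜 p).map (ζ + D) ≤ T.tanFilt n p y := by
    intro p
    rintro _ ⟨x, hx, rfl⟩
    refine add_mem ?_ (tanFilt_anti hT y (by omega) (hD p x hx))
    rw [← hm p]; exact Submodule.mem_map_of_mem hx
  constructor
  · refine le_antisymm (fun x hx => ?_) (fun x hx => ?_)
    · have hx0 : ζ x + D x = 0 := hx
      have key : ∀ p : ℤ, -(depth 𝒜 : ℤ) ≤ p → p ≤ n → x ∈ filt 𝒜 p := by
        intro p hp
        induction p, hp using Int.leInduction with
        | base => intro _; rw [filt_depth le_rfl]; trivial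
        | succ p hp ih =>
          intro hpn
          have h1 := hD p x (ih (by omega))
          have h2 : ζ x ∈ T.tanFilt n (p + 1) y := by
            rw [eq_neg_of_add_eq_zero_left hx0]; exact neg_mem h1
          rw [← hm] at h2
          obtain ⟨x', hx', he⟩ := h2
          have h3 : x - x' ∈ filt 𝒜 n := by
            rw [← hk, LinearMap.mem_ker, map_sub, he, sub_self]
          simpa using add_mem (filt_anti hpn h3) hx'
      exact key n (by omega) le_rfl
    · have h1 := hD n x hx
      rw [tanFilt_eq_bot hT y (by omega), Submodule.mem_bot] at h1
      have h2 : ζ x = 0 := by rwa [← hk] at hx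
      rw [LinearMap.mem_ker, LinearMap.add_apply, h1, h2, add_zero]
  · have key : ∀ (d : ℕ) (p : ℤ), (n : ℤ) - d ≤ p → T.tanFilt n p y ≤ (filt 𝒜 p).map (ζ + D) := by
      intro d
      induction d with
      | zero =>
        intro p hp
        rw [tanFilt_eq_bot hT y (by push_cast at hp; omega)]; exact bot_le
      | succ d ih =>
        intro p hp v hv
        have hv' := hv
        rw [← hm p] at hv'
        obtain ⟨x, hx, rfl⟩ := hv'
        obtain ⟨x', hx', he⟩ := ih (p + 1) (by push_cast at hp; omega) (hD p x hx)
        refine ⟨x - x', sub_mem hx (filt_anti (by omega) hx'), ?_⟩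
        rw [map_sub, he, LinearMap.add_apply, add_sub_cancel_right]
    intro p
    exact le_antisymm (hle p) (key (n - p).toNat p (by omega))

/-- Only the bracket condition needs an argument. The differences of the two frames lie one step
higher and extend to local sections of that subbundle. Subtracting these from the given fields
leaves fields adapted to `ζ`, and the remaining brackets lie in `F^{p+q+1}`. -/
theorem isLinearFrame_zero_of_frameEquiv (hT : T.IsFilteredManifold) {x : T.Q 0}
    {ζ ζ' : L →ₗ[ℝ] T.V 0} (h : T.IsLinearFrame 0 x ζ) (he : T.FrameEquiv 0 x ζ ζ') :
    T.IsLinearFrame 0 x ζ' := by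
  have hD : ∀ p : ℤ, ∀ X ∈ filt 𝒜 p, ζ' X - ζ X ∈ T.F (p + 1) x := by
    intro p X hX
    have := he p X hX
    simpa [tanFilt] using this
  have h1 := map_add_of_raising hT (D := ζ' - ζ) h.ker h.map (fun p X hX => hD p X hX)
  rw [add_sub_cancel] at h1
  refine ⟨h1.1, h1.2, ?_⟩
  intro p q hp hq X hX Y hY U ξ η hU hx hξ hη hξF hηF hξx hηx
  have ext : ∀ (r : ℤ) (v : T.V 0), v ∈ T.F r x → ∃ (U' : Set (T.Q 0)) (s : T.Q 0 → T.V 0),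
      IsOpen U' ∧ x ∈ U' ∧ T.SmoothFieldOn 0 s U' ∧ (∀ y ∈ U', s y ∈ T.F r y) ∧ s x = v := by
    intro r v hv
    obtain ⟨U', m, s, hU', hx', hs, hs2⟩ := hT.subbundle r x
    rw [← (hs2 x hx').2, Submodule.mem_span_range_iff_exists_fun] at hv
    obtain ⟨c, hc⟩ := hv
    refine ⟨U', fun y => ∑ i, c i • s i y, hU', hx', ?_, ?_, hc⟩
    · rw [T.smoothFieldOn_iff hU']
      intro y hy
      exact SmoothAlongAt.sum _ contMDiffAt_id fun i _ =>
        SmoothAlongAt.const_smul _ ((T.smoothFieldOn_iff hU').1 (hs i) y hy)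
    · intro y hy
      rw [← (hs2 y hy).2]
      exact Submodule.sum_mem _ fun i _ => Submodule.smul_mem _ _ (Submodule.subset_span ⟨i, rfl⟩)
  obtain ⟨U₁, ξ₁, hU₁, hx₁, hξ₁, hξ₁F, hξ₁x⟩ := ext (p + 1) _ (hD p X (mem_filt_of_mem le_rfl hX))
  obtain ⟨U₂, η₁, hU₂, hx₂, hη₁, hη₁F, hη₁x⟩ := ext (q + 1) _ (hD q Y (mem_filt_of_mem le_rfl hY))
  have hO : IsOpen (U ∩ U₁ ∩ U₂) := (hU.inter hU₁).inter hU₂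
  have hxO : x ∈ U ∩ U₁ ∩ U₂ := ⟨⟨hx, hx₁⟩, hx₂⟩
  have mono : ∀ {ξ : T.Q 0 → T.V 0} {U' : Set (T.Q 0)}, T.SmoothFieldOn 0 ξ U' →
      U ∩ U₁ ∩ U₂ ⊆ U' → T.SmoothFieldOn 0 ξ (U ∩ U₁ ∩ U₂) := fun h hs => ContMDiffOn.mono h hs
  have hξO := mono hξ (fun y hy => hy.1.1)
  have hηO := mono hη (fun y hy => hy.1.1)
  have hξ₁O := mono hξ₁ (fun y hy => hy.1.2)
  have hη₁O := mono hη₁ (fun y hy => hy.2)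
  have sξ := (T.smoothFieldOn_iff hO).1 hξO
  have sη := (T.smoothFieldOn_iff hO).1 hηO
  have sξ₁ := (T.smoothFieldOn_iff hO).1 hξ₁O
  have sη₁ := (T.smoothFieldOn_iff hO).1 hη₁O
  have hξ₂ : T.SmoothFieldOn 0 (fun y => ξ y - ξ₁ y) (U ∩ U₁ ∩ U₂) :=
    (T.smoothFieldOn_iff hO).2 fun y hy => (sξ y hy).sub (sξ₁ y hy)
  have hη₂ : T.SmoothFieldOn 0 (fun y => η y - η₁ y) (U ∩ U₁ ∩ U₂) :=
    (T.smoothFieldOn_iff hO).2 fun y hy => (sη y hy).sub (sη₁ y hy)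
  have hξ₂F : ∀ y ∈ U ∩ U₁ ∩ U₂, ξ y - ξ₁ y ∈ T.F p y := fun y hy =>
    sub_mem (hξF y hy.1.1) (hT.anti y (by omega) (hξ₁F y hy.1.2))
  have hη₂F : ∀ y ∈ U ∩ U₁ ∩ U₂, η y - η₁ y ∈ T.F q y := fun y hy =>
    sub_mem (hηF y hy.1.1) (hT.anti y (by omega) (hη₁F y hy.2))
  have b0 := h.2.2 p q hp hq X hX Y hY _ _ _ hO hxO hξ₂ hη₂ hξ₂F hη₂F
    (by rw [hξx, hξ₁x]; abel) (by rw [hηx, hη₁x]; abel)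
  have b1 := hT.bracket_mem (p + 1) q _ _ _ hO hξ₁O hη₂ (fun y hy => hξ₁F y hy.1.2) hη₂F x hxO
  have b2 := hT.bracket_mem p (q + 1) _ _ _ hO hξ₂ hη₁O hξ₂F (fun y hy => hη₁F y hy.2) x hxO
  have b3 := hT.bracket_mem (p + 1) (q + 1) _ _ _ hO hξ₁O hη₁O (fun y hy => hξ₁F y hy.1.2)
    (fun y hy => hη₁F y hy.2) x hxO
  have b4 := hD (p + q) ⁅X, Y⁆ (mem_filt_of_mem le_rfl (lie_mem_deg hX hY))
  simp only [bracket_eq] at b0 b1 b2 b3 ⊢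
  have e : lieB ξ η x = lieB (fun y => ξ y - ξ₁ y) (fun y => η y - η₁ y) x
      + lieB ξ₁ (fun y => η y - η₁ y) x + lieB (fun y => ξ y - ξ₁ y) η₁ x + lieB ξ₁ η₁ x := by
    have s1 := sξ x hxO
    have s2 := sη x hxO
    have s3 := sξ₁ x hxO
    have s4 := sη₁ x hxO
    rw [← lieB_add_left (s1.sub s3) s3]
    have : (fun y => ξ y - ξ₁ y + ξ₁ y) = ξ := by funext y; abel
    rw [this, add_assoc, ← lieB_add_left (s1.sub s3) s3, this, ← lieB_add_right (s2.sub s4) s4]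
    have : (fun y => η y - η₁ y + η₁ y) = η := by funext y; abel
    rw [this]
  have hfin : lieB ξ η x - ζ' ⁅X, Y⁆ = (lieB (fun y => ξ y - ξ₁ y) (fun y => η y - η₁ y) x - ζ ⁅X, Y⁆)
      + lieB ξ₁ (fun y => η y - η₁ y) x + lieB (fun y => ξ y - ξ₁ y) η₁ x + lieB ξ₁ η₁ x
      - (ζ' ⁅X, Y⁆ - ζ ⁅X, Y⁆) := by rw [e]; abel
  rw [hfin]
  have c1 : p + 1 + q = p + q + 1 := by ring
  have c2 : p + (q + 1) = p + q + 1 := by ring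
  rw [c1] at b1
  rw [c2] at b2
  refine sub_mem (add_mem (add_mem (add_mem b0 b1) b2) (hT.anti x (by omega) b3)) b4

/-- The two bounds play different roles. Raising the degree by one keeps the frame invertible and
leaves it unchanged on 𝔤_m, where its values are prescribed. The second bound keeps the truncation
in its class modulo `F^{m+1}`. The hypothesis `ih` is the case of level `m` of
`IsLinearFrame.of_frameEquiv`, whose induction step this is. -/
theorem IsLinearFrame.perturb {m : ℕ} (hT : T.Geo (m + 1)) {y : T.Q (m + 1)}
    {ζ D : L →ₗ[ℝ] T.V (m + 1)} (h : T.IsLinearFrame (m + 1) y ζ)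
    (ih : ∀ ζ', T.FrameEquiv m (T.π m y) (T.dπ m y ∘ₗ ζ) ζ' → T.IsLinearFrame m (T.π m y) ζ')
    (h1 : ∀ p : ℤ, ∀ x ∈ filt 𝒜 p, D x ∈ T.tanFilt (m + 1) (p + 1) y)
    (h2 : ∀ p : ℤ, ∀ x ∈ filt 𝒜 p, D x ∈ T.tanFilt (m + 1) (min (p + m + 1) m) y) :
    T.IsLinearFrame (m + 1) y (ζ + D) := by
  have hu := map_add_of_raising hT.filtered h.ker h.map h1
  have hfe : T.FrameEquiv m (T.π m y) (T.dπ m y ∘ₗ ζ) (T.dπ m y ∘ₗ (ζ + D)) := by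
    intro p x hx
    have e : (T.dπ m y ∘ₗ (ζ + D)) x - (T.dπ m y ∘ₗ ζ) x = T.dπ m y (D x) := by
      simp
    rw [e]
    have h3 := hT.dπ_mem (h2 p x hx)
    rcases le_total (p + m + 1 : ℤ) m with hle | hle
    · rwa [min_eq_left hle] at h3
    · rw [min_eq_right hle, tanFilt_eq_bot hT.filtered _ le_rfl, Submodule.mem_bot] at h3
      rw [h3]; exact zero_mem _
  refine ⟨hu.1, hu.2, fun A => ?_, ?_⟩
  · have h3 := h1 m A (mem_filt_of_mem le_rfl A.2)
    rw [tanFilt_eq_bot hT.filtered _ (by push_cast; omega), Submodule.mem_bot] at h3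
    rw [LinearMap.add_apply, h3, add_zero]
    exact h.2.2.1 A
  · exact (hT.mem_frames_iff h.trunc_mem).2 ⟨ih _ hfe, hfe⟩

theorem IsLinearFrame.of_frameEquiv {n : ℕ} (hT : T.Geo n) {y : T.Q n} {ζ ζ' : L →ₗ[ℝ] T.V n}
    (h : T.IsLinearFrame n y ζ) (he : T.FrameEquiv n y ζ ζ') : T.IsLinearFrame n y ζ' := by
  induction n with
  | zero => exact isLinearFrame_zero_of_frameEquiv hT.filtered h he
  | succ m ih =>
    have h3 := h.perturb (D := ζ' - ζ) hT
      (fun ζ'' h'' => ih (hT.mono (Nat.le_succ m)) (h.trunc hT) h'')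
      (fun p x hx => tanFilt_anti hT.filtered y (by push_cast; omega) (he p x hx))
      (fun p x hx => tanFilt_anti hT.filtered y (by push_cast; omega) (he p x hx))
    rwa [add_sub_cancel] at h3

theorem IsLinearFrame.add_of_raising {m : ℕ} (hT : T.Geo (m + 1)) {y : T.Q (m + 1)}
    {ζ D : L →ₗ[ℝ] T.V (m + 1)} (h : T.IsLinearFrame (m + 1) y ζ)
    (h1 : ∀ p : ℤ, ∀ x ∈ filt 𝒜 p, D x ∈ T.tanFilt (m + 1) (p + 1) y)
    (h2 : ∀ p : ℤ, ∀ x ∈ filt 𝒜 p, D x ∈ T.tanFilt (m + 1) (min (p + m + 1) m) y) :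
    T.IsLinearFrame (m + 1) y (ζ + D) :=
  h.perturb hT (fun _ h'' => (h.trunc hT).of_frameEquiv (hT.mono (Nat.le_succ m)) h'') h1 h2

theorem Geo.mem_frames_of_frameEquiv {n : ℕ} (hT : T.Geo (n + 1)) {z : T.Q (n + 1)}
    {ζ₀ ζ : L →ₗ[ℝ] T.V n} (h₀ : ζ₀ ∈ T.frames n z) (he : T.FrameEquiv n (T.π n z) ζ₀ ζ) :
    ζ ∈ T.frames n z :=
  (hT.mem_frames_iff h₀).2
    ⟨(hT.isLinearFrame_of_mem h₀).of_frameEquiv (hT.mono (Nat.le_succ n)) he, he⟩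

/-- Two linear frames at the same point differ by a map that raises the filtration. -/
theorem IsLinearFrame.sub_mem {m : ℕ} (hT : T.Geo (m + 1)) {y : T.Q (m + 1)}
    {ζ ζ' : L →ₗ[ℝ] T.V (m + 1)} (h : T.IsLinearFrame (m + 1) y ζ)
    (h' : T.IsLinearFrame (m + 1) y ζ') {p : ℤ} {x : L} (hx : x ∈ filt 𝒜 p) :
    ζ' x - ζ x ∈ T.tanFilt (m + 1) (min (p + m + 1) m) y := by
  have h1 := ((hT.mem_frames_iff h.trunc_mem).1 h'.trunc_mem).2 p x hx
  rw [tanFilt_succ_of_le (min_le_right _ _), Submodule.mem_comap, map_sub]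
  exact tanFilt_anti hT.filtered _ (min_le_left _ _) h1

/-- Both frames send 𝔤_m to fundamental vectors and kill `F^{m+1}`. -/
theorem IsLinearFrame.sub_eq_zero {m : ℕ} (_ : T.Geo (m + 1)) {y : T.Q (m + 1)}
    {ζ ζ' : L →ₗ[ℝ] T.V (m + 1)} (h : T.IsLinearFrame (m + 1) y ζ)
    (h' : T.IsLinearFrame (m + 1) y ζ') {x : L} (hx : x ∈ filt 𝒜 m) : ζ' x - ζ x = 0 := by
  have h1 := sub_hc_mem_filt hx
  have e : x = hc 𝒜 m x + (x - hc 𝒜 m x) := by abel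
  have h2 := h.apply_eq_zero_iff.2 (by push_cast; exact h1)
  have h3 := h'.apply_eq_zero_iff.2 (by push_cast; exact h1)
  rw [e, map_add, map_add, h2, h3, add_zero, add_zero]
  have h4 := h.2.2.1 ⟨_, hc_mem 𝒜 m x⟩
  have h5 := h'.2.2.1 ⟨_, hc_mem 𝒜 m x⟩
  exact _root_.sub_eq_zero.2 (h5.trans h4.symm)

theorem IsLinearFrame.sub_mem_succ {m : ℕ} (hT : T.Geo (m + 1)) {y : T.Q (m + 1)}
    {ζ ζ' : L →ₗ[ℝ] T.V (m + 1)} (h : T.IsLinearFrame (m + 1) y ζ)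
    (h' : T.IsLinearFrame (m + 1) y ζ') {p : ℤ} {x : L} (hx : x ∈ filt 𝒜 p) :
    ζ' x - ζ x ∈ T.tanFilt (m + 1) (p + 1) y := by
  by_cases hp : (m : ℤ) ≤ p
  · rw [h.sub_eq_zero hT h' (filt_anti hp hx)]; exact zero_mem _
  · exact tanFilt_anti hT.filtered y (by omega) (h.sub_mem hT h' hx)

end Perturb

end Tower
end NormalProlongation


/-! ### Partial derivatives, extension and lifting of vector fields. -/

set_option linter.unusedSectionVars false

namespace NormalProlongation

section Calculus

variable {E : Type*} [NormedAddCommGroup E] [NormedSpace ℝ E]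
  {M : Type*} [TopologicalSpace M] [ChartedSpace E M]
  {F : Type*} [NormedAddCommGroup F] [NormedSpace ℝ F]
  {N : Type*} [TopologicalSpace N] [ChartedSpace F N]
  {E' : Type*} [NormedAddCommGroup E'] [NormedSpace ℝ E']
  {M' : Type*} [TopologicalSpace M'] [ChartedSpace E' M']
  [IsManifold 𝓘(ℝ, E) ∞ M] [IsManifold 𝓘(ℝ, F) ∞ N] [IsManifold 𝓘(ℝ, E') ∞ M']

/-- A partial derivative of a smooth map, in a fixed direction, is smooth. -/
theorem SmoothAlongAt.partial {f : N → M' → M} {w : N} {g : M'} (v : E')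
    (hf : ContMDiffAt (𝓘(ℝ, F).prod 𝓘(ℝ, E')) 𝓘(ℝ, E) ∞ (fun p : N × M' => f p.1 p.2) (w, g)) :
    SmoothAlongAt (E := E) (F := F) (fun x => f x g)
      (fun x => (dmap (f x) g : E' →L[ℝ] E) v) w := by
  have hb : SmoothAt (E := E) (F := F) (fun x => f x g) w :=
    ContMDiffAt.comp (g := fun p : N × M' => f p.1 p.2) (f := fun x => (x, g)) w hf
      (contMDiffAt_id.prodMk contMDiffAt_const)
  refine smoothAlongAt_iff.2 ⟨hb, ?_⟩
  have h1 := ContMDiffAt.mfderiv (m := ∞) (n := ∞) (I := 𝓘(ℝ, E')) (I' := 𝓘(ℝ, E)) (J := 𝓘(ℝ, F))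
    f (fun _ => g) hf contMDiffAt_const (by simp)
  have h2 := h1.clm_apply (contMDiffAt_const (c := v))
  refine h2.congr_of_eventuallyEq ?_
  filter_upwards [hb.continuousAt.eventually
    ((chartAt E (f w g)).open_source.mem_nhds (mem_chart_source E _))] with x hx
  have h4 := inTangentCoordinates_eq (I := 𝓘(ℝ, E')) (I' := 𝓘(ℝ, E)) (fun _ : N => g)
    (fun x => f x g) (fun x => (dmap (f x) g : E' →L[ℝ] E)) (x₀ := w) (x := x)
    (mem_chart_source _ _) hx
  refine Eq.trans ?_ (congrArg (fun B : E' →L[ℝ] E => B v) h4).symm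
  rw [dch_eq hx]
  have h3 : (tangentCoordChange 𝓘(ℝ, E') g g g : E' →L[ℝ] E') v = v :=
    tangentCoordChange_self (by simp)
  change _ = (tangentCoordChange 𝓘(ℝ, E) (f x g) (f w g) (f x g))
    ((dmap (f x) g : E' →L[ℝ] E) (tangentCoordChange 𝓘(ℝ, E') g g g v))
  rw [h3]

/-- The differential of `x ↦ F (f x) (g x)`. -/
theorem dmap_uncurry {E₁ : Type*} [NormedAddCommGroup E₁] [NormedSpace ℝ E₁]
    {M₁ : Type*} [TopologicalSpace M₁] [ChartedSpace E₁ M₁] {F' : M → M' → M₁} {f : N → M}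
    {g : N → M'} {w : N}
    (hF : ContMDiffAt (𝓘(ℝ, E).prod 𝓘(ℝ, E')) 𝓘(ℝ, E₁) ∞ (fun p : M × M' => F' p.1 p.2) (f w, g w))
    (hf : SmoothAt (E := E) (F := F) f w) (hg : SmoothAt (E := E') (F := F) g w) (v : F) :
    (dmap (fun x => F' (f x) (g x)) w : F →L[ℝ] E₁) v =
      (dmap (fun y => F' y (g w)) (f w) : E →L[ℝ] E₁) ((dmap f w : F →L[ℝ] E) v) +
      (dmap (fun y => F' (f w) y) (g w) : E' →L[ℝ] E₁) ((dmap g w : F →L[ℝ] E') v) := by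
  have hF' := hF.mdifferentiableAt (by simp)
  have h4 := HasMFDerivAt.prodMk hf.mdiff.hasMFDerivAt hg.mdiff.hasMFDerivAt
  have h6 := (hF'.hasMFDerivAt.comp w h4).mfderiv
  have h7 := mfderiv_prod_eq_add_apply (v := ((dmap f w : F →L[ℝ] E) v, (dmap g w : F →L[ℝ] E') v)) hF'
  exact (congrArg (fun B : F →L[ℝ] E₁ => B v) h6).trans h7

/-- Every tangent vector extends to a smooth local vector field. -/
theorem exists_smoothField_extension (y₀ : M) (v : E) : ∃ (U : Set M) (ξ : M → E), IsOpen U ∧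
    y₀ ∈ U ∧ ξ y₀ = v ∧ ∀ y ∈ U, SmoothFieldAt (F := E) ξ y := by
  let e := trivializationAt E (TangentSpace 𝓘(ℝ, E) (M := M)) y₀
  refine ⟨e.baseSet, fun y => e.symm y v, e.open_baseSet, mem_baseSet_trivializationAt _ _ _, ?_, ?_⟩
  · have h1 : (e (⟨y₀, e.symm y₀ v⟩ : TangentBundle 𝓘(ℝ, E) M)).2 = v := by
      rw [e.apply_mk_symm (mem_baseSet_trivializationAt _ _ _)]
    have h2 := triv_eq_dch (E := E) (mem_chart_source E y₀) (e.symm y₀ v)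
    rw [dch_self] at h2
    exact h2.symm.trans h1
  · intro y hy
    have h1 : ContMDiffAt 𝓘(ℝ, E) 𝓘(ℝ, E).tangent ∞
        (fun y : M => e.toOpenPartialHomeomorph.symm (y, v)) y := by
      refine ContMDiffAt.comp y ((e.contMDiffOn_symm (n := ∞) (IB := 𝓘(ℝ, E))).contMDiffAt
        (e.open_target.mem_nhds ?_)) (contMDiffAt_id.prodMk contMDiffAt_const)
      rw [e.target_eq]; exact ⟨hy, trivial⟩
    refine h1.congr_of_eventuallyEq ?_
    filter_upwards [e.open_baseSet.mem_nhds hy] with x hx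
    exact e.mk_symm hx v

/-- Smooth local lifts along a submersion. -/
theorem exists_smooth_lift [FiniteDimensional ℝ E] {f : N → M} {w : N}
    (hf : ∀ x, SmoothAt (E := E) (F := F) f x)
    (hs : Function.Surjective (dmap f w : F →L[ℝ] E)) :
    ∃ (U : Set N) (lift : N → E →ₗ[ℝ] F), IsOpen U ∧ w ∈ U ∧
      (∀ x ∈ U, ∀ v, (dmap f x : F →L[ℝ] E) (lift x v) = v) ∧
      ∀ (v : N → E), ∀ x ∈ U, SmoothAlongAt (E := E) (F := F) f v x →
        SmoothFieldAt (F := F) (fun x => lift x (v x)) x := by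
  classical
  let b := Module.finBasis ℝ E
  choose r hr using fun i => hs (b i)
  choose U ξ hU hwU hξw hξ using fun i => exists_smoothField_extension (M := N) w (r i)
  let A : Fin (Module.finrank ℝ E) → N → E := fun i x => (dmap f x : F →L[ℝ] E) (ξ i x)
  have hAs : ∀ i, ∀ x ∈ ⋂ i, U i, SmoothAlongAt (E := E) (F := F) f (A i) x := fun i x hx =>
    SmoothAlongAt.dmap_apply (f := fun x : N => x) isOpen_univ trivial (fun y _ => hf y)
      (hξ i x (Set.mem_iInter.1 hx i))
  have hO : IsOpen (⋂ i, U i) := isOpen_iInter_of_finite hU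
  have hwO : w ∈ ⋂ i, U i := Set.mem_iInter.2 hwU
  have hli : LinearIndependent ℝ (fun i => A i w) := by
    have : (fun i => A i w) = b := by
      funext i
      simp only [A, hξw, hr]
    rw [this]; exact b.linearIndependent
  have hev := SmoothAlongAt.linearIndependent_eventually (fun i => hAs i w hwO) hli
  obtain ⟨U', hU', hO', hwU'⟩ := eventually_nhds_iff.1 hev
  -- Where the images are dependent the basis `b` is a mere default; only points of `U'` are used.
  let B : N → Module.Basis (Fin (Module.finrank ℝ E)) ℝ E := fun x =>
    if h : LinearIndependent ℝ (fun i => A i x) then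
      basisOfLinearIndependentOfCardEqFinrank' _ h (by simp) else b
  have hB : ∀ x ∈ U', ∀ i, B x i = A i x := by
    intro x hx i
    simp only [B, dif_pos (hU' x hx)]
    simp
  refine ⟨(⋂ i, U i) ∩ U', fun x => ∑ i, ((B x).coord i).smulRight (ξ i x), hO.inter hO',
    ⟨hwO, hwU'⟩, ?_, ?_⟩
  · intro x hx v
    conv_rhs => rw [← (B x).sum_repr v]
    simp only [LinearMap.sum_apply, LinearMap.smulRight_apply, map_sum, map_smul,
      Module.Basis.coord_apply, hB x hx.2]
    rfl
  · intro v x hx hv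
    have : (fun x => (∑ i, ((B x).coord i).smulRight (ξ i x)) (v x)) =
        fun x => ∑ i, ((B x).coord i (v x)) • ξ i x := by
      funext x; simp
    rw [this]
    refine SmoothAlongAt.sum _ contMDiffAt_id fun i _ => SmoothAlongAt.smul ?_
      (hξ i x (Set.mem_iInter.1 hx.1 i))
    refine SmoothAlongAt.coeff (f := f) (A := A) (B := v) (c := fun i x => (B x).coord i (v x))
      (fun i => hAs i x hx.1) hv (hU' x hx.2) ?_ i
    filter_upwards [hO'.mem_nhds hx.2] with y hy
    conv_lhs => rw [← (B y).sum_repr (v y)]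
    simp only [hB y hy]
    rfl

end Calculus

variable {L : Type v} [LieRing L] [LieAlgebra ℝ L] {𝒜 : ℤ → Submodule ℝ L}
  [GradedLieAlgebra 𝒜] {k : ℕ}

namespace Tower

variable {𝒯 : StructureType.{u} 𝒜 k} {T : Tower 𝒯}

/-! #### The principal bundles -/

namespace IsFrameReduction

variable {m : ℕ}

theorem smoothAt_act_left (h : T.IsFrameReduction m) (a : 𝒯.G m) (z : T.Q (m + 1)) :
    SmoothAt (E := T.V (m + 1)) (F := T.V (m + 1)) (fun z => T.act m z a) z :=
  ContMDiffAt.comp (g := fun p : T.Q (m + 1) × 𝒯.G m => T.act m p.1 p.2) (f := fun z => (z, a)) z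
    (h.smooth_act _) (contMDiffAt_id.prodMk contMDiffAt_const)

theorem smoothAt_act_right (h : T.IsFrameReduction m) (z : T.Q (m + 1)) (a : 𝒯.G m) :
    SmoothAt (E := T.V (m + 1)) (F := 𝒯.VG m) (fun a => T.act m z a) a :=
  ContMDiffAt.comp (g := fun p : T.Q (m + 1) × 𝒯.G m => T.act m p.1 p.2) (f := fun a => (z, a)) a
    (h.smooth_act _) (contMDiffAt_const.prodMk contMDiffAt_id)

/-- A local trivialisation adapted to a point. -/
theorem exists_trivialization (h : T.IsFrameReduction m) (z₀ : T.Q (m + 1)) : ∃ (U : Set (T.Q m)) (s : T.Q m → T.Q (m + 1))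
    (δ : T.Q (m + 1) → 𝒯.G m), IsOpen U ∧ T.π m z₀ ∈ U ∧ s (T.π m z₀) = z₀ ∧ δ z₀ = 1 ∧
    (∀ y ∈ U, SmoothAt (E := T.V (m + 1)) (F := T.V m) s y) ∧ (∀ y ∈ U, T.π m (s y) = y) ∧
    (∀ z, T.π m z ∈ U → SmoothAt (E := 𝒯.VG m) (F := T.V (m + 1)) δ z) ∧
    (∀ z, T.π m z ∈ U → T.act m (s (T.π m z)) (δ z) = z) ∧
    ∀ z a, T.π m z ∈ U → δ (T.act m z a) = δ z * a := by
  obtain ⟨U, s, δ, hU, hy, hs, hsπ, hδ, hsδ⟩ := h.locallyTrivial (T.π m z₀)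
  have hsδ' : ∀ z, T.π m z ∈ U →
      T.act m (T.act m (s (T.π m z)) (δ z₀)) ((δ z₀)⁻¹ * δ z) = z := by
    intro z hz
    rw [← h.act_mul, mul_inv_cancel_left, hsδ z hz]
  -- Translating the section by `δ z₀`, and correcting the fibre coordinate by its inverse, makes
  -- the section pass through `z₀`.
  refine ⟨U, fun y => T.act m (s y) (δ z₀), fun z => (δ z₀)⁻¹ * δ z, hU, hy, hsδ z₀ hy,
    inv_mul_cancel _, ?_, ?_, ?_, hsδ', ?_⟩
  · intro y hy
    exact ContMDiffAt.comp (g := fun z => T.act m z (δ z₀)) y (h.smoothAt_act_left _ _)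
      (hs.contMDiffAt (hU.mem_nhds hy))
  · intro y hy
    rw [h.π_act, hsπ y hy]
  · intro z hz
    have h1 : ContMDiffAt 𝓘(ℝ, T.V (m + 1)) 𝓘(ℝ, 𝒯.VG m) ∞ δ z :=
      hδ.contMDiffAt ((hU.preimage h.smooth_π.continuous).mem_nhds hz)
    exact contMDiffAt_const.mul h1
  · intro z a hz
    have h1 := hsδ z hz
    have h2 := hsδ (T.act m z a) (by rwa [h.π_act])
    rw [h.π_act] at h2
    have h3 : T.act m (s (T.π m z)) (δ (T.act m z a)) = T.act m (s (T.π m z)) (δ z * a) := by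
      rw [h2, h.act_mul, h1]
    -- Freeness of the action forces the fibre coordinate to be equivariant.
    have h4 : T.act m (s (T.π m z)) (δ (T.act m z a) * (δ z * a)⁻¹) = s (T.π m z) := by
      rw [h.act_mul, h3, ← h.act_mul, mul_inv_cancel, h.act_one]
    have h5 := mul_inv_eq_one.1 (h.free _ _ h4)
    change (δ z₀)⁻¹ * _ = _
    rw [h5, mul_assoc]

theorem dπ_surjective (h : T.IsFrameReduction m) (z : T.Q (m + 1)) : Function.Surjective (T.dπ m z) := by
  obtain ⟨U, s, δ, hU, hy, hs0, -, hs, hsπ, -, -, -⟩ := h.exists_trivialization z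
  intro v
  refine ⟨(dmap s (T.π m z) : T.V m →L[ℝ] T.V (m + 1)) v, ?_⟩
  have h1 : (dmap (fun y => T.π m (s y)) (T.π m z) : T.V m →L[ℝ] T.V m) =
      ContinuousLinearMap.id ℝ _ := by
    rw [dmap_congr (g := fun y => y)]
    · exact mfderiv_id
    · filter_upwards [hU.mem_nhds hy] with y hy using hsπ y hy
  rw [dmap_comp (h.smoothAt_π _).mdiff (hs _ hy).mdiff, hs0] at h1
  exact congrArg (fun A : T.V m →L[ℝ] T.V m => A v) h1

theorem dπ_fundamental (h : T.IsFrameReduction m) (A : 𝒜 (m : ℤ)) (z : T.Q (m + 1)) : T.dπ m z (T.fundamental m A z) = 0 := by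
  have h1 : (dmap (fun a => T.π m (T.act m z a)) 1 : 𝒯.VG m →L[ℝ] T.V m) = 0 := by
    have : (fun a => T.π m (T.act m z a)) = fun _ => T.π m z := funext fun a => h.π_act z a
    rw [this]; exact mfderiv_const
  rw [dmap_comp (h.smoothAt_π _).mdiff (h.smoothAt_act_right _ _).mdiff, h.act_one] at h1
  exact congrArg (fun B : 𝒯.VG m →L[ℝ] T.V m => B (𝒯.lam m A)) h1

/-- Differentiate the identity `act (s (π z)) (δ z) = z` along a vertical vector. The section
contributes nothing, and the rest is the action applied to the derivative of `δ`. -/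
theorem exists_fundamental_eq (h : T.IsFrameReduction m) {z : T.Q (m + 1)} {v : T.V (m + 1)} (hv : T.dπ m z v = 0) :
    ∃ A : 𝒜 (m : ℤ), T.fundamental m A z = v := by
  obtain ⟨U, s, δ, hU, hy, hs0, hδ0, hs, hsπ, hδ, hsδ, -⟩ := h.exists_trivialization z
  let w : 𝒯.VG m := (dmap δ z : T.V (m + 1) →L[ℝ] 𝒯.VG m) v
  refine ⟨(𝒯.lam m).symm w, ?_⟩
  have h1 : (dmap (fun z => T.act m (s (T.π m z)) (δ z)) z : T.V (m + 1) →L[ℝ] T.V (m + 1)) =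
      ContinuousLinearMap.id ℝ _ := by
    rw [dmap_congr (g := fun y => y)]
    · exact mfderiv_id
    · filter_upwards [(hU.preimage h.smooth_π.continuous).mem_nhds hy] with y hy using hsδ y hy
  have hsm : SmoothAt (E := T.V (m + 1)) (F := T.V (m + 1)) (fun z => s (T.π m z)) z :=
    ContMDiffAt.comp z (hs _ hy) (h.smoothAt_π z)
  have h3 : (dmap (fun z => s (T.π m z)) z : T.V (m + 1) →L[ℝ] T.V (m + 1)) v = 0 := by
    rw [dmap_comp (hs _ hy).mdiff (h.smoothAt_π z).mdiff, ContinuousLinearMap.comp_apply]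
    have : (dmap (T.π m) z : T.V (m + 1) →L[ℝ] T.V m) v = 0 := hv
    rw [this, map_zero]
  have h4 := dmap_uncurry (F' := fun z a => T.act m z a) (h.smooth_act _) hsm (hδ z hy) v
  rw [h1, h3, map_zero, zero_add, hδ0, hs0] at h4
  have h5 : 𝒯.lam m ((𝒯.lam m).symm w) = w := LinearEquiv.apply_symm_apply _ _
  exact (congrArg (dmap (fun a => T.act m z a) 1 : 𝒯.VG m →L[ℝ] T.V (m + 1)) h5).trans h4.symm

/-- Along the orbit of `z` the fibre coordinate is the identity of the group, so its differential
recovers `A` from the fundamental vector. -/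
theorem fundamental_injective (h : T.IsFrameReduction m) {z : T.Q (m + 1)} {A : 𝒜 (m : ℤ)} (hA : T.fundamental m A z = 0) :
    A = 0 := by
  obtain ⟨U, s, δ, hU, hy, hs0, hδ0, hs, hsπ, hδ, hsδ, hδa⟩ := h.exists_trivialization z
  have h1 : (dmap (fun a => δ (T.act m z a)) 1 : 𝒯.VG m →L[ℝ] 𝒯.VG m) =
      ContinuousLinearMap.id ℝ _ := by
    have : (fun a => δ (T.act m z a)) = fun a => a :=
      funext fun a => by rw [hδa z a hy, hδ0, one_mul]
    rw [this]; exact mfderiv_id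
  rw [dmap_comp (hδ _ (by rwa [h.π_act])).mdiff (h.smoothAt_act_right _ _).mdiff, h.act_one] at h1
  have h2 : (dmap δ z : T.V (m + 1) →L[ℝ] 𝒯.VG m) ((dmap (fun a => T.act m z a) 1 :
      𝒯.VG m →L[ℝ] T.V (m + 1)) (𝒯.lam m A)) = 𝒯.lam m A :=
    congrArg (fun B : 𝒯.VG m →L[ℝ] 𝒯.VG m => B (𝒯.lam m A)) h1
  have h3 : (dmap (fun a => T.act m z a) 1 : 𝒯.VG m →L[ℝ] T.V (m + 1)) (𝒯.lam m A) = 0 := hA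
  rw [h3, map_zero] at h2
  exact (𝒯.lam m).map_eq_zero_iff.1 h2.symm

theorem smoothFieldAt_fundamental (h : T.IsFrameReduction m) (A : 𝒜 (m : ℤ)) (z : T.Q (m + 1)) :
    SmoothFieldAt (F := T.V (m + 1)) (fun z => T.fundamental m A z) z := by
  have := SmoothAlongAt.partial (f := fun z a => T.act m z a) (w := z) (g := (1 : 𝒯.G m))
    (show 𝒯.VG m from 𝒯.lam m A) (h.smooth_act (z, 1))
  have e : (fun x => T.act m x 1) = fun x : T.Q (m + 1) => x := funext h.act_one
  rw [e] at this
  exact this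

end IsFrameReduction

variable (T) in
/-- The fundamental vector as a linear map. -/
noncomputable def fundMap (m : ℕ) (z : T.Q (m + 1)) : 𝒜 (m : ℤ) →ₗ[ℝ] T.V (m + 1) :=
  (dmap (fun a : 𝒯.G m => T.act m z a) 1 : 𝒯.VG m →L[ℝ] T.V (m + 1)).toLinearMap ∘ₗ
    (𝒯.lam m).toLinearMap

theorem fundMap_apply (m : ℕ) (z : T.Q (m + 1)) (A : 𝒜 (m : ℤ)) :
    T.fundMap m z A = T.fundamental m A z := rfl

/-- A lift of a linear frame in the class of `y` extends to a linear frame at `y`. -/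
theorem Geo.isLinearFrame_lift {m : ℕ} (hT : T.Geo (m + 1)) {y : T.Q (m + 1)} {ζ : L →ₗ[ℝ] T.V m}
    (hζ : ζ ∈ T.frames m y) {ζ' : L →ₗ[ℝ] T.V (m + 1)}
    (h1 : ∀ x, T.dπ m y (ζ' x) = ζ x)
    (h2 : ∀ x ∈ filt 𝒜 m, ζ' x = T.fundamental m ⟨hc 𝒜 m x, hc_mem 𝒜 m x⟩ y) :
    T.IsLinearFrame (m + 1) y ζ' := by
  have hred := hT.reduction m (Nat.lt_succ_self m)
  have hlin := hT.isLinearFrame_of_mem hζ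
  have h3 : ∀ A : 𝒜 (m : ℤ), ζ' A = T.fundamental m A y := by
    intro A
    rw [h2 A (mem_filt_of_mem le_rfl A.2)]
    congr 2
    exact hc_of_mem A.2
  have hker : ∀ x, ζ' x = 0 ↔ x ∈ filt 𝒜 ((m + 1 : ℕ) : ℤ) := by
    intro x
    constructor
    · intro hx
      have hxm : x ∈ filt 𝒜 m := by
        rw [← hlin.apply_eq_zero_iff, ← h1, hx, map_zero]
      have h4 := hred.fundamental_injective ((h2 x hxm).symm.trans hx)
      have h5 : hc 𝒜 m x = 0 := congrArg Subtype.val h4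
      have h6 := sub_hc_mem_filt hxm
      rw [h5, sub_zero] at h6
      exact_mod_cast h6
    · intro hx
      have h5 : (⟨hc 𝒜 m x, hc_mem 𝒜 m x⟩ : 𝒜 (m : ℤ)) = 0 :=
        Subtype.ext (mem_filt_iff.1 hx m (by push_cast; omega))
      rw [h2 x (filt_anti (by push_cast; omega) hx), h5, ← fundMap_apply, map_zero]
  refine ⟨Submodule.ext hker, fun p => ?_, h3, ?_⟩
  · by_cases hp : p ≤ m
    · rw [tanFilt_succ_of_le hp]
      refine le_antisymm ?_ fun v hv => ?_
      · rintro _ ⟨x, hx, rfl⟩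
        rw [Submodule.mem_comap, h1]
        exact hlin.apply_mem hx
      · rw [Submodule.mem_comap, ← hlin.map p] at hv
        obtain ⟨x, hx, he⟩ := hv
        -- The defect is vertical, hence a fundamental vector, and it is absorbed by an element of
        -- 𝔤_m.
        obtain ⟨A, hA⟩ := hred.exists_fundamental_eq (z := y) (v := v - ζ' x)
          (by rw [map_sub, h1, he, sub_self])
        refine ⟨x + A, add_mem hx (mem_filt_of_mem hp A.2), ?_⟩
        rw [map_add, h3, hA, add_sub_cancel]
    · rw [tanFilt_succ_of_lt (not_le.1 hp), eq_bot_iff]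
      rintro _ ⟨x, hx, rfl⟩
      exact (hker x).2 (filt_anti (by push_cast; omega) hx)
  · have : T.dπ m y ∘ₗ ζ' = ζ := LinearMap.ext h1
    rwa [this]

/-- Smooth local fields of linear frames exist. -/
theorem Geo.exists_isFrameField {m : ℕ} (hT : T.Geo (m + 1)) (y : T.Q (m + 1)) :
    ∃ U Z, T.IsFrameField (m + 1) U Z ∧ y ∈ U := by
  have hred := hT.reduction m (Nat.lt_succ_self m)
  obtain ⟨U, Z, hU, hy, hZ, hZs⟩ := hred.frames_smooth y
  obtain ⟨U', lift, hU', hy', hl, hls⟩ := exists_smooth_lift (f := T.π m) (w := y)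
    (fun z => hred.smoothAt_π z) (hred.dπ_surjective y)
  let c : L →ₗ[ℝ] 𝒜 (m : ℤ) := (hc 𝒜 m).codRestrict _ (hc_mem 𝒜 m)
  -- A horizontal lift of the frames in the class of `z`, completed by the fundamental vectors on
  -- 𝔤_m.
  refine ⟨U ∩ U', fun z => lift z ∘ₗ Z z + T.fundMap m z ∘ₗ c, ⟨hU.inter hU', ?_, ?_⟩, hy, hy'⟩
  · intro z hz
    refine hT.isLinearFrame_lift (hZ z hz.1) (fun x => ?_) (fun x hx => ?_)
    · rw [LinearMap.add_apply, map_add, LinearMap.comp_apply, LinearMap.comp_apply, fundMap_apply,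
        hred.dπ_fundamental, add_zero]
      exact hl z hz.2 _
    · rw [LinearMap.add_apply, LinearMap.comp_apply,
        (hT.isLinearFrame_of_mem (hZ z hz.1)).apply_eq_zero_iff.2 hx, map_zero, zero_add]
      rfl
  · intro x
    rw [T.smoothFieldOn_iff (hU.inter hU')]
    intro z hz
    exact (hls (fun z => Z z x) z hz.2 ((hZs x).contMDiffAt (hU.mem_nhds hz.1))).add
      (hred.smoothFieldAt_fundamental (c x) z)

end Tower
end NormalProlongation


/-! ### Derivatives of vector fields along maps, with a chart in the role of a connection. -/

set_option linter.unusedSectionVars false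

namespace NormalProlongation

section Calculus

variable {E : Type*} [NormedAddCommGroup E] [NormedSpace ℝ E]
  {M : Type*} [TopologicalSpace M] [ChartedSpace E M]
  {F : Type*} [NormedAddCommGroup F] [NormedSpace ℝ F]
  {N : Type*} [TopologicalSpace N] [ChartedSpace F N]
  [IsManifold 𝓘(ℝ, E) ∞ M] [IsManifold 𝓘(ℝ, F) ∞ N]

/-- Smooth coefficients of a vector field along a map with values in a subbundle. -/
theorem exists_smooth_coeff [FiniteDimensional ℝ E] {ι : Type*} [Fintype ι] {s : ι → M → E}
    {U : Set M} (hs : ∀ i, ∀ y ∈ U, SmoothFieldAt (F := E) (s i) y)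
    (hli : ∀ y ∈ U, LinearIndependent ℝ fun i => s i y) {f : N → M} {v : N → E} {O : Set N}
    (hO : IsOpen O) (hOU : ∀ x ∈ O, f x ∈ U)
    (hv : ∀ x ∈ O, SmoothAlongAt (E := E) (F := F) f v x)
    (hvs : ∀ x ∈ O, v x ∈ Submodule.span ℝ (Set.range fun i => s i (f x))) :
    ∃ c : ι → N → ℝ, (∀ i, ∀ x ∈ O, SmoothAt (E := ℝ) (F := F) (c i) x) ∧
      ∀ x ∈ O, v x = ∑ i, c i x • s i (f x) := by
  have h1 : ∀ x, ∃ c : ι → ℝ, x ∈ O → v x = ∑ i, c i • s i (f x) := by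
    intro x
    by_cases hx : x ∈ O
    · obtain ⟨c, hc⟩ := (Submodule.mem_span_range_iff_exists_fun ℝ).1 (hvs x hx)
      exact ⟨c, fun _ => hc.symm⟩
    · exact ⟨0, fun h => absurd h hx⟩
  choose c hc using h1
  refine ⟨fun i x => c x i, fun i x hx => ?_, hc⟩
  refine SmoothAlongAt.coeff (f := f) (A := fun i x => s i (f x)) (B := v) (c := fun i x => c x i)
    (fun i => (hs i _ (hOU x hx)).comp (hv x hx).base) (hv x hx) (hli _ (hOU x hx)) ?_ i
  filter_upwards [hO.mem_nhds hx] with y hy using hc y hy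

/-- The derivative in a chart of a vector field along a map. -/
noncomputable def dAlong (f : N → M) (v : N → E) (w : N) : F →L[ℝ] E :=
  dmap (fun x => (dch (f w) (f x) : E →L[ℝ] E) (v x)) w

theorem dAlong_congr {f : N → M} {v v' : N → E} {w : N} (h : ∀ᶠ x in 𝓝 w, v x = v' x) :
    (dAlong f v w : F →L[ℝ] E) = dAlong f v' w := by
  refine dmap_congr ?_
  filter_upwards [h] with x hx
  rw [hx]

theorem dAlong_zero {f : N → M} {w : N} : (dAlong f (fun _ => (0 : E)) w : F →L[ℝ] E) = 0 := by
  have : (fun x => (dch (f w) (f x) : E →L[ℝ] E) (0 : E)) = fun _ : N => (0 : E) := by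
    funext x; exact map_zero _
  unfold dAlong
  rw [this]; exact mfderiv_const

theorem dAlong_add {f : N → M} {v v' : N → E} {w : N}
    (h : SmoothAlongAt (E := E) (F := F) f v w) (h' : SmoothAlongAt (E := E) (F := F) f v' w) :
    (dAlong f (fun x => v x + v' x) w : F →L[ℝ] E) = dAlong f v w + dAlong f v' w := by
  have h1 := (smoothAlongAt_iff.1 h).2.mdiff
  have h2 := (smoothAlongAt_iff.1 h').2.mdiff
  have e : (fun x => (dch (f w) (f x) : E →L[ℝ] E) (v x + v' x)) =
      (fun x => (dch (f w) (f x) : E →L[ℝ] E) (v x)) +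
      fun x => (dch (f w) (f x) : E →L[ℝ] E) (v' x) := by
    funext x; exact map_add _ _ _
  unfold dAlong
  rw [e]
  exact mfderiv_add h1 h2

theorem dAlong_smul {f : N → M} {v : N → E} {a : N → ℝ} {w : N}
    (ha : SmoothAt (E := ℝ) (F := F) a w) (h : SmoothAlongAt (E := E) (F := F) f v w) (e : F) :
    (dAlong f (fun x => a x • v x) w : F →L[ℝ] E) e =
      a w • (dAlong f v w : F →L[ℝ] E) e + (dmap a w : F →L[ℝ] ℝ) e • v w := by
  have h1 := (smoothAlongAt_iff.1 h).2.mdiff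
  have e1 : (fun x => (dch (f w) (f x) : E →L[ℝ] E) (a x • v x)) =
      fun x => a x • (dch (f w) (f x) : E →L[ℝ] E) (v x) := by
    funext x; exact map_smul _ _ _
  unfold dAlong
  rw [e1]
  have h2 := dmap_uncurry (F' := fun (r : ℝ) (u : E) => r • u) (f := a)
    (g := fun x => (dch (f w) (f x) : E →L[ℝ] E) (v x)) (w := w)
    (contMDiff_fst.smul contMDiff_snd _) ha (smoothAlongAt_iff.1 h).2 e
  rw [h2, add_comm]
  have h3 : (dmap (fun u : E => a w • u) ((dch (f w) (f w) : E →L[ℝ] E) (v w)) : E →L[ℝ] E) =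
      a w • ContinuousLinearMap.id ℝ E :=
    mfderiv_eq_fderiv.trans (a w • ContinuousLinearMap.id ℝ E).fderiv
  have h4 : (dmap (fun r : ℝ => r • (dch (f w) (f w) : E →L[ℝ] E) (v w)) (a w) : ℝ →L[ℝ] E) =
      (ContinuousLinearMap.id ℝ ℝ).smulRight ((dch (f w) (f w) : E →L[ℝ] E) (v w)) :=
    mfderiv_eq_fderiv.trans ((ContinuousLinearMap.id ℝ ℝ).smulRight _).fderiv
  rw [h3, h4, dch_self]
  rfl

theorem dAlong_sum_smul {ι : Type*} (t : Finset ι) {f : N → M} {v : ι → N → E} {a : ι → N → ℝ}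
    {w : N} (hf : SmoothAt (E := E) (F := F) f w)
    (ha : ∀ i ∈ t, SmoothAt (E := ℝ) (F := F) (a i) w)
    (h : ∀ i ∈ t, SmoothAlongAt (E := E) (F := F) f (v i) w) (e : F) :
    (dAlong f (fun x => ∑ i ∈ t, a i x • v i x) w : F →L[ℝ] E) e =
      ∑ i ∈ t, a i w • (dAlong f (v i) w : F →L[ℝ] E) e +
        ∑ i ∈ t, (dmap (a i) w : F →L[ℝ] ℝ) e • v i w := by
  classical
  induction t using Finset.induction_on with
  | empty => simp only [Finset.sum_empty, dAlong_zero]; simp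
  | insert i t hi ih =>
    have ih := ih (fun j hj => ha j (Finset.mem_insert_of_mem hj))
      (fun j hj => h j (Finset.mem_insert_of_mem hj))
    simp only [Finset.sum_insert hi]
    rw [dAlong_add (SmoothAlongAt.smul (ha i (Finset.mem_insert_self i t))
      (h i (Finset.mem_insert_self i t))) (SmoothAlongAt.sum _ hf fun j hj =>
      SmoothAlongAt.smul (ha j (Finset.mem_insert_of_mem hj)) (h j (Finset.mem_insert_of_mem hj)))]
    rw [add_apply, ih, dAlong_smul (ha i (Finset.mem_insert_self i t))
      (h i (Finset.mem_insert_self i t))]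
    abel

theorem dAlong_comp {f : N → M} {s : M → E} {w : N} (hf : SmoothAt (E := E) (F := F) f w)
    (hs : SmoothFieldAt (F := E) s (f w)) (e : F) :
    (dAlong f (fun x => s (f x)) w : F →L[ℝ] E) e =
      (dAlong (fun y : M => y) s (f w) : E →L[ℝ] E) ((dmap f w : F →L[ℝ] E) e) := by
  unfold dAlong
  rw [dmap_comp (g := fun y => (dch (f w) y : E →L[ℝ] E) (s y)) (f := f)
    (smoothAlongAt_iff.1 hs).2.mdiff hf.mdiff]
  rfl

/-- A chart is a torsion free local connection, so the antisymmetrised derivative along `f` is the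
image of the bracket. This computes projections of brackets to lower levels even when the fields are
not projectable. -/
theorem dmap_lieB_eq_dAlong [CompleteSpace F] {f : N → M} {ξ η : N → F} {w : N}
    (hf : ∀ x, SmoothAt (E := E) (F := F) f x)
    (hξ : SmoothFieldAt (F := F) ξ w) (hη : SmoothFieldAt (F := F) η w) :
    (dmap f w : F →L[ℝ] E) (lieB ξ η w) =
      (dAlong f (fun x => (dmap f x : F →L[ℝ] E) (η x)) w : F →L[ℝ] E) (ξ w) -
      (dAlong f (fun x => (dmap f x : F →L[ℝ] E) (ξ x)) w : F →L[ℝ] E) (η w) := by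
  have hsrc : ∀ᶠ x in 𝓝 w, f x ∈ (chartAt E (f w)).source := (hf w).continuousAt.eventually
    ((chartAt E (f w)).open_source.mem_nhds (mem_chart_source E _))
  have hG : SmoothAt (E := E) (F := F) (fun x => extChartAt 𝓘(ℝ, E) (f w) (f x)) w :=
    ContMDiffAt.comp w (contMDiffAt_extChartAt' (mem_chart_source E _)) (hf w)
  have h1 := dmap_lieB hG hξ hη
  have h2 : ∀ x, f x ∈ (chartAt E (f w)).source →
      (dmap (fun x => extChartAt 𝓘(ℝ, E) (f w) (f x)) x : F →L[ℝ] E) =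
      (dch (f w) (f x) : E →L[ℝ] E).comp (dmap f x) := fun x hx =>
    dmap_comp (mdifferentiableAt_extChartAt hx) (hf x).mdiff
  have h3 : ∀ ζ : N → F, (dmap (fun x => (dmap (fun x => extChartAt 𝓘(ℝ, E) (f w) (f x)) x :
      F →L[ℝ] E) (ζ x)) w : F →L[ℝ] E) = dAlong f (fun x => (dmap f x : F →L[ℝ] E) (ζ x)) w := by
    intro ζ
    refine dmap_congr ?_
    filter_upwards [hsrc] with x hx
    rw [h2 x hx]; rfl
  rw [h3, h3, h2 w (mem_chart_source E _), dch_self] at h1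
  exact h1

theorem lieB_eq_dAlong [CompleteSpace E] {s t : M → E} {y : M} (hs : SmoothFieldAt (F := E) s y)
    (ht : SmoothFieldAt (F := E) t y) :
    lieB s t y = (dAlong (fun y : M => y) t y : E →L[ℝ] E) (s y) -
      (dAlong (fun y : M => y) s y : E →L[ℝ] E) (t y) := by
  have h1 := dmap_lieB_eq_dAlong (f := fun y : M => y) (fun _ => contMDiffAt_id) hs ht
  have h2 : ∀ x : M, (dmap (fun y : M => y) x : E →L[ℝ] E) = ContinuousLinearMap.id ℝ E :=
    fun x => mfderiv_id
  simpa only [h2, ContinuousLinearMap.id_apply] using h1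

end Calculus

variable {L : Type v} [LieRing L] [LieAlgebra ℝ L] {𝒜 : ℤ → Submodule ℝ L}
  [GradedLieAlgebra 𝒜] {k : ℕ}

namespace Tower

variable {𝒯 : StructureType.{u} 𝒜 k} {T : Tower 𝒯}

open Classical in
/-- A linear right inverse of a surjective linear frame. -/
noncomputable def frInv {V : Type*} [AddCommGroup V] [Module ℝ V] (ζ : L →ₗ[ℝ] V) : V →ₗ[ℝ] L :=
  if h : ∃ g : V →ₗ[ℝ] L, ∀ v, ζ (g v) = v then h.choose else 0

theorem IsLinearFrame.apply_frInv (hT : T.IsFilteredManifold) {n : ℕ} {y : T.Q n}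
    {ζ : L →ₗ[ℝ] T.V n} (h : T.IsLinearFrame n y ζ) (v : T.V n) : ζ (frInv ζ v) = v := by
  have hex : ∃ g : T.V n →ₗ[ℝ] L, ∀ v, ζ (g v) = v := by
    obtain ⟨g, hg⟩ := LinearMap.exists_rightInverse_of_surjective ζ
      (LinearMap.range_eq_top.2 (h.surjective hT))
    exact ⟨g, fun v => congrArg (fun A : T.V n →ₗ[ℝ] T.V n => A v) hg⟩
  unfold frInv
  rw [dif_pos hex]
  exact hex.choose_spec v

theorem IsLinearFrame.frInv_apply_sub (hT : T.IsFilteredManifold) {n : ℕ} {y : T.Q n}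
    {ζ : L →ₗ[ℝ] T.V n} (h : T.IsLinearFrame n y ζ) (x : L) : frInv ζ (ζ x) - x ∈ filt 𝒜 n := by
  rw [← h.apply_eq_zero_iff, map_sub, h.apply_frInv hT, sub_self]

theorem IsLinearFrame.frInv_mem (hT : T.IsFilteredManifold) {n : ℕ} {y : T.Q n}
    {ζ : L →ₗ[ℝ] T.V n} (h : T.IsLinearFrame n y ζ) {p : ℤ} (hp : p ≤ n) {v : T.V n}
    (hv : v ∈ T.tanFilt n p y) : frInv ζ v ∈ filt 𝒜 p := by
  rw [← h.mem_iff hp, h.apply_frInv hT]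
  exact hv

/-- A preimage under a frame is determined modulo `F^n`, so components of degree below `n` do not
see the choice made in `frInv`. -/
theorem IsLinearFrame.hc_frInv (hT : T.IsFilteredManifold) {n : ℕ} {y : T.Q n}
    {ζ : L →ₗ[ℝ] T.V n} (h : T.IsLinearFrame n y ζ) {i : ℤ} (hi : i < n) {v : T.V n} {u : L}
    (hu : ζ u = v) : hc 𝒜 i (frInv ζ v) = hc 𝒜 i u := by
  have h1 := mem_filt_iff.1 (h.frInv_apply_sub hT u) i hi
  rw [map_sub, hu] at h1
  exact _root_.sub_eq_zero.1 h1

variable [htr : Fact (IsTransitive 𝒜)]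

theorem IsLinearFrame.apply_eq_sum {n : ℕ} {y : T.Q n} {ζ : L →ₗ[ℝ] T.V n}
    (h : T.IsLinearFrame n y ζ) (β : HomBasis 𝒜 n) (x : L) : ζ x = ∑ j, β.c j x • ζ (β.b j) := by
  have h1 := h.apply_eq_zero_iff.2 (β.span x)
  rw [map_sub, map_sum, _root_.sub_eq_zero] at h1
  simpa using h1

theorem IsLinearFrame.linearIndependent {n : ℕ} {y : T.Q n} {ζ : L →ₗ[ℝ] T.V n}
    (h : T.IsLinearFrame n y ζ) (β : HomBasis 𝒜 n) :
    LinearIndependent ℝ fun j => ζ (β.b j) := by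
  rw [Fintype.linearIndependent_iff]
  intro a ha j
  have h1 : ζ (∑ j, a j • β.b j) = 0 := by rw [map_sum]; simpa using ha
  have h2 := β.c_eq_zero_of_filt (h.apply_eq_zero_iff.1 h1) (β.deg_lt j)
  rw [map_sum] at h2
  simpa [β.dual] using h2

theorem IsLinearFrame.span_eq {n : ℕ} {y : T.Q n} {ζ : L →ₗ[ℝ] T.V n}
    (h : T.IsLinearFrame n y ζ) (β : HomBasis 𝒜 n) (p : ℤ) :
    Submodule.span ℝ (Set.range fun j : {j // p ≤ β.deg j} => ζ (β.b j)) = T.tanFilt n p y := by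
  refine le_antisymm (Submodule.span_le.2 ?_) fun v hv => ?_
  · rintro _ ⟨j, rfl⟩
    exact h.apply_mem (mem_filt_of_mem j.2 (β.mem j))
  · rw [← h.map p] at hv
    obtain ⟨x, hx, rfl⟩ := hv
    rw [h.apply_eq_sum β]
    refine Submodule.sum_mem _ fun j _ => ?_
    by_cases hj : p ≤ β.deg j
    · exact Submodule.smul_mem _ _ (Submodule.subset_span ⟨⟨j, hj⟩, rfl⟩)
    · rw [β.c_eq_zero_of_filt hx (not_le.1 hj), zero_smul]; exact zero_mem _

theorem IsFrameField.smoothAt {n : ℕ} {U : Set (T.Q n)} {Z : T.Q n → L →ₗ[ℝ] T.V n}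
    (hZ : T.IsFrameField n U Z) (x : L) {y : T.Q n} (hy : y ∈ U) :
    SmoothFieldAt (F := T.V n) (fun y => Z y x) y :=
  (T.smoothFieldOn_iff hZ.isOpen).1 (hZ.smooth x) y hy

/-- The coefficients of a smooth vector field along a map with respect to a frame field. -/
theorem IsFrameField.smoothAt_coeff (hT : T.IsFilteredManifold) {n : ℕ} {U : Set (T.Q n)}
    {Z : T.Q n → L →ₗ[ℝ] T.V n} (hZ : T.IsFrameField n U Z) (β : HomBasis 𝒜 n)
    {F : Type*} [NormedAddCommGroup F] [NormedSpace ℝ F] {N : Type*} [TopologicalSpace N]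
    [ChartedSpace F N] {f : N → T.Q n} {v : N → T.V n} {w : N} (hw : f w ∈ U)
    (hv : SmoothAlongAt (E := T.V n) (F := F) f v w) (j : β.ι) :
    SmoothAt (E := ℝ) (F := F) (fun x => β.c j (frInv (Z (f x)) (v x))) w := by
  refine SmoothAlongAt.coeff (f := f) (A := fun j x => Z (f x) (β.b j)) (B := v)
    (c := fun j x => β.c j (frInv (Z (f x)) (v x))) (fun j => (hZ.smoothAt _ hw).comp hv.base) hv
    ((hZ.linear _ hw).linearIndependent β) ?_ j
  filter_upwards [hv.base.continuousAt.eventually (hZ.isOpen.mem_nhds hw)] with x hx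
  rw [← (hZ.linear _ hx).apply_eq_sum β, (hZ.linear _ hx).apply_frInv hT]

/-- The filtration consists of smooth subbundles. -/
theorem Geo.exists_local_basis {n : ℕ} (hT : T.Geo n) (p : ℤ) (y : T.Q n) :
    ∃ (ι : Type) (_ : Fintype ι) (U : Set (T.Q n)) (s : ι → T.Q n → T.V n), IsOpen U ∧ y ∈ U ∧
      (∀ i, ∀ y ∈ U, SmoothFieldAt (F := T.V n) (s i) y) ∧
      (∀ y ∈ U, LinearIndependent ℝ fun i => s i y) ∧
      ∀ y ∈ U, Submodule.span ℝ (Set.range fun i => s i y) = T.tanFilt n p y := by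
  cases n with
  | zero =>
    obtain ⟨U, r, s, hU, hy, hs, h⟩ := hT.filtered.subbundle p y
    exact ⟨Fin r, inferInstance, U, s, hU, hy, fun i => (T.smoothFieldOn_iff hU).1 (hs i),
      fun y hy => (h y hy).1, fun y hy => (h y hy).2⟩
  | succ m =>
    obtain ⟨U, Z, hZ, hy⟩ := hT.exists_isFrameField y
    let β := 𝒯.hb ((m + 1 : ℕ) : ℤ)
    classical
    refine ⟨{j : β.ι // p ≤ β.deg j}, inferInstance, U, fun j y => Z y (β.b j), hZ.isOpen, hy,
      fun j y hy => hZ.smoothAt _ hy, fun y hy => ?_, fun y hy => (hZ.linear y hy).span_eq β p⟩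
    exact ((hZ.linear y hy).linearIndependent β).comp _ Subtype.val_injective

/-! #### Brackets of frame fields -/

/-- Fields with values in the filtration, seen from a lower level. -/
theorem Geo.dpr_lieB_vertical {m n : ℕ} (hT : T.Geo n) (h : m ≤ n) {U : Set (T.Q n)} (hU : IsOpen U)
    {ξ η : T.Q n → T.V n} (hξ : ∀ y ∈ U, SmoothFieldAt (F := T.V n) ξ y)
    (hη : ∀ y ∈ U, SmoothFieldAt (F := T.V n) η y) (hv : ∀ y ∈ U, T.dpr h y (ξ y) = 0)
    {y : T.Q n} (hy : y ∈ U) :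
    T.dpr h y (lieB ξ η y) =
      (dAlong (T.pr h) (fun y => T.dpr h y (η y)) y : T.V n →L[ℝ] T.V m) (ξ y) := by
  have h1 := dmap_lieB_eq_dAlong (f := T.pr h) (fun z => hT.smoothAt_pr h z) (hξ y hy) (hη y hy)
  have h2 : (dAlong (T.pr h) (fun x => (dmap (T.pr h) x : T.V n →L[ℝ] T.V m) (ξ x)) y :
      T.V n →L[ℝ] T.V m) = 0 := by
    rw [dAlong_congr (v' := fun _ => 0), dAlong_zero]
    filter_upwards [hU.mem_nhds hy] with x hx using hv x hx
  rw [h2] at h1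
  refine h1.trans ?_
  rw [zero_apply, sub_zero]
  rfl

theorem Geo.smoothAlongAt_dpr {m n : ℕ} (hT : T.Geo n) (h : m ≤ n) {ξ : T.Q n → T.V n} {y : T.Q n}
    (hξ : SmoothFieldAt (F := T.V n) ξ y) :
    SmoothAlongAt (E := T.V m) (F := T.V n) (T.pr h) (fun y => T.dpr h y (ξ y)) y :=
  SmoothAlongAt.dmap_apply (f := fun y : T.Q n => y) isOpen_univ trivial
    (fun y _ => hT.smoothAt_pr h y) hξ

theorem dAlong_sum_comp {m n : ℕ} (hT : T.Geo n) (h : m ≤ n) {ι : Type} [Fintype ι]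
    {s : ι → T.Q m → T.V m} {c : ι → T.Q n → ℝ} {y : T.Q n}
    (hs : ∀ i, SmoothFieldAt (F := T.V m) (s i) (T.pr h y))
    (hc : ∀ i, SmoothAt (E := ℝ) (F := T.V n) (c i) y) (e : T.V n) :
    (dAlong (T.pr h) (fun x => ∑ i, c i x • s i (T.pr h x)) y : T.V n →L[ℝ] T.V m) e =
      ∑ i, c i y • (dAlong (fun x : T.Q m => x) (s i) (T.pr h y) : T.V m →L[ℝ] T.V m)
        (T.dpr h y e) + ∑ i, (dmap (c i) y : T.V n →L[ℝ] ℝ) e • s i (T.pr h y) := by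
  have hsm := hT.smoothAt_pr h y
  rw [dAlong_sum_smul (f := T.pr h) (v := fun i x => s i (T.pr h x)) Finset.univ hsm
    (fun i _ => hc i) (fun i _ => (hs i).comp hsm)]
  congr 1
  refine Finset.sum_congr rfl fun i _ => ?_
  rw [dAlong_comp hsm (hs i)]
  rfl

/-- The bracket of frame fields in negative degrees agrees with that of `𝔤₋` up to higher
filtration. -/
theorem IsFrameField.bracket_neg {n : ℕ} (hT : T.Geo n) {U : Set (T.Q n)}
    {Z : T.Q n → L →ₗ[ℝ] T.V n} (hZ : T.IsFrameField n U Z) {y : T.Q n} (hy : y ∈ U) {p q : ℤ}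
    (hp : p < 0) (hq : q < 0) {X Y : L} (hX : X ∈ 𝒜 p) (hY : Y ∈ 𝒜 q) :
    lieB (fun y => Z y X) (fun y => Z y Y) y - Z y ⁅X, Y⁆ ∈ T.tanFilt n (p + q + 1) y := by
  have h0 : 0 ≤ n := Nat.zero_le n
  -- As `p + q + 1` is negative, membership can be tested on the base manifold.
  rw [hT.mem_tanFilt_pr h0 (by push_cast; omega), map_sub]
  have key : ∀ (r : ℤ) (W : L), W ∈ 𝒜 r → ∃ (ι : Type) (_ : Fintype ι) (U' : Set (T.Q 0))
      (s : ι → T.Q 0 → T.V 0) (c : ι → T.Q n → ℝ), IsOpen U' ∧ T.pr h0 y ∈ U' ∧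
      (∀ i, ∀ x ∈ U', SmoothFieldAt (F := T.V 0) (s i) x) ∧ (∀ i, ∀ x ∈ U', s i x ∈ T.F r x) ∧
      (∀ i, SmoothAt (E := ℝ) (F := T.V n) (c i) y) ∧
      ∀ᶠ x in 𝓝 y, T.dpr h0 x (Z x W) = ∑ i, c i x • s i (T.pr h0 x) := by
    intro r W hW
    obtain ⟨ι, hι, U', s, hU', hyU', hs, hli, hsp⟩ := (hT.mono h0).exists_local_basis r (T.pr h0 y)
    have hO : IsOpen (U ∩ T.pr h0 ⁻¹' U') :=
      hZ.isOpen.inter (hU'.preimage (continuous_iff_continuousAt.2 fun x =>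
        (hT.smoothAt_pr h0 x).continuousAt))
    obtain ⟨c, hc, hcs⟩ := exists_smooth_coeff (f := T.pr h0) (v := fun x => T.dpr h0 x (Z x W))
      hs hli hO (fun x hx => hx.2) (fun x hx => hT.smoothAlongAt_dpr h0 (hZ.smoothAt W hx.1))
      (fun x hx => by
        rw [hsp _ hx.2]
        exact ((hZ.linear x hx.1).pr hT h0).apply_mem (mem_filt_of_mem le_rfl hW))
    refine ⟨ι, hι, U', s, c, hU', hyU', hs, fun i x hx => ?_, fun i => hc i y ⟨hy, hyU'⟩, ?_⟩
    · have : s i x ∈ T.tanFilt 0 r x := by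
        rw [← hsp x hx]; exact Submodule.subset_span ⟨i, rfl⟩
      exact this
    · filter_upwards [hO.mem_nhds ⟨hy, hyU'⟩] with x hx using hcs x hx
  obtain ⟨ι₁, _, U₁, s, a, hU₁, hy₁, hs, hsF, ha, has⟩ := key p X hX
  obtain ⟨ι₂, _, U₂, t, c, hU₂, hy₂, ht, htF, hc, hct⟩ := key q Y hY
  have hb := dmap_lieB_eq_dAlong (f := T.pr h0) (fun z => hT.smoothAt_pr h0 z) (hZ.smoothAt X hy)
    (hZ.smoothAt Y hy)
  have e1 := dAlong_congr (f := T.pr h0) (F := T.V n) has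
  have e2 := dAlong_congr (f := T.pr h0) (F := T.V n) hct
  have hb' : T.dpr h0 y (lieB (fun y => Z y X) (fun y => Z y Y) y) =
    (dAlong (T.pr h0) (fun x => T.dpr h0 x (Z x Y)) y : T.V n →L[ℝ] T.V 0) (Z y X) -
    (dAlong (T.pr h0) (fun x => T.dpr h0 x (Z x X)) y : T.V n →L[ℝ] T.V 0) (Z y Y) := hb
  rw [e1, e2, dAlong_sum_comp hT h0 (fun i => hs i _ hy₁) ha,
    dAlong_sum_comp hT h0 (fun i => ht i _ hy₂) hc] at hb'
  -- Freezing the coefficients at `y` gives fields on the base, to which the bracket condition on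
  -- frames at level `0` applies. Derivatives of the coefficients only multiply vectors of `F^p` or
  -- `F^q`, which lie in `F^{p+q+1}` because both degrees are negative.
  let s' : T.Q 0 → T.V 0 := fun x => ∑ i, a i y • s i x
  let t' : T.Q 0 → T.V 0 := fun x => ∑ i, c i y • t i x
  have hs' : ∀ x ∈ U₁ ∩ U₂, SmoothFieldAt (F := T.V 0) s' x := fun x hx =>
    SmoothAlongAt.sum _ contMDiffAt_id fun i _ => SmoothAlongAt.const_smul _ (hs i x hx.1)
  have ht' : ∀ x ∈ U₁ ∩ U₂, SmoothFieldAt (F := T.V 0) t' x := fun x hx =>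
    SmoothAlongAt.sum _ contMDiffAt_id fun i _ => SmoothAlongAt.const_smul _ (ht i x hx.2)
  have hO := hU₁.inter hU₂
  have hlin := (hZ.linear y hy).pr hT h0
  have hfin := hlin.2.2 p q hp hq X hX Y hY (U₁ ∩ U₂) s' t' hO ⟨hy₁, hy₂⟩
    ((T.smoothFieldOn_iff hO).2 hs') ((T.smoothFieldOn_iff hO).2 ht')
    (fun x hx => Submodule.sum_mem _ fun i _ => Submodule.smul_mem _ _ (hsF i x hx.1))
    (fun x hx => Submodule.sum_mem _ fun i _ => Submodule.smul_mem _ _ (htF i x hx.2))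
    has.self_of_nhds.symm hct.self_of_nhds.symm
  rw [bracket_eq, lieB_eq_dAlong (hs' _ ⟨hy₁, hy₂⟩) (ht' _ ⟨hy₁, hy₂⟩)] at hfin
  have d1 : ∀ e : T.V 0, (dAlong (fun x : T.Q 0 => x) s' (T.pr h0 y) : T.V 0 →L[ℝ] T.V 0) e =
      ∑ i, a i y • (dAlong (fun x : T.Q 0 => x) (s i) (T.pr h0 y) : T.V 0 →L[ℝ] T.V 0) e := by
    intro e
    have := dAlong_sum_smul (f := fun x : T.Q 0 => x) (v := s) (a := fun i _ => a i y) Finset.univ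
      (w := T.pr h0 y) contMDiffAt_id (fun i _ => contMDiffAt_const) (fun i _ => hs i _ hy₁) e
    refine this.trans ?_
    have h0 : ∀ i, (dmap (fun _ : T.Q 0 => a i y) (T.pr h0 y) : T.V 0 →L[ℝ] ℝ) = 0 :=
      fun i => mfderiv_const
    simp [h0]
  have d2 : ∀ e : T.V 0, (dAlong (fun x : T.Q 0 => x) t' (T.pr h0 y) : T.V 0 →L[ℝ] T.V 0) e =
      ∑ i, c i y • (dAlong (fun x : T.Q 0 => x) (t i) (T.pr h0 y) : T.V 0 →L[ℝ] T.V 0) e := by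
    intro e
    have := dAlong_sum_smul (f := fun x : T.Q 0 => x) (v := t) (a := fun i _ => c i y) Finset.univ
      (w := T.pr h0 y) contMDiffAt_id (fun i _ => contMDiffAt_const) (fun i _ => ht i _ hy₂) e
    refine this.trans ?_
    have h0 : ∀ i, (dmap (fun _ : T.Q 0 => c i y) (T.pr h0 y) : T.V 0 →L[ℝ] ℝ) = 0 :=
      fun i => mfderiv_const
    simp [h0]
  have ex : s' (T.pr h0 y) = T.dpr h0 y (Z y X) := has.self_of_nhds.symm
  have ey : t' (T.pr h0 y) = T.dpr h0 y (Z y Y) := hct.self_of_nhds.symm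
  rw [d1, d2, ex, ey] at hfin
  have m1 : ∑ i, (dmap (c i) y : T.V n →L[ℝ] ℝ) (Z y X) • t i (T.pr h0 y) ∈
      T.F (p + q + 1) (T.pr h0 y) := Submodule.sum_mem _ fun i _ =>
    Submodule.smul_mem _ _ (hT.filtered.anti _ (by omega) (htF i _ hy₂))
  have m2 : ∑ i, (dmap (a i) y : T.V n →L[ℝ] ℝ) (Z y Y) • s i (T.pr h0 y) ∈
      T.F (p + q + 1) (T.pr h0 y) := Submodule.sum_mem _ fun i _ =>
    Submodule.smul_mem _ _ (hT.filtered.anti _ (by omega) (hsF i _ hy₁))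
  have := add_mem hfin (_root_.sub_mem m1 m2)
  change _ ∈ T.F (p + q + 1) (T.pr h0 y)
  rw [hb']
  convert this using 1
  simp only [LinearMap.comp_apply]
  abel

end Tower
end NormalProlongation


/-! ### Brackets with fields of nonnegative degree, and tensoriality. -/

set_option linter.unusedSectionVars false

namespace NormalProlongation

variable {L : Type v} [LieRing L] [LieAlgebra ℝ L] {𝒜 : ℤ → Submodule ℝ L}
  [GradedLieAlgebra 𝒜] {k : ℕ}

namespace Tower

variable {𝒯 : StructureType.{u} 𝒜 k} {T : Tower 𝒯} [htr : Fact (IsTransitive 𝒜)]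

theorem Geo.frameEquiv_of_mem {n : ℕ} (hT : T.Geo (n + 1)) {z : T.Q (n + 1)} {ζ ζ' : L →ₗ[ℝ] T.V n}
    (h : ζ ∈ T.frames n z) (h' : ζ' ∈ T.frames n z) : T.FrameEquiv n (T.π n z) ζ ζ' :=
  ((hT.mem_frames_iff h).1 h').2

/-- The derivative of a smooth family of frames of the bundle `Q (b + 1) → Q b` along a
fundamental vector. -/
theorem Geo.deriv_frames_fundamental {b : ℕ} (hT : T.Geo (b + 1)) {z₀ : T.Q (b + 1)}
    {U : Set (T.Q (b + 1))} (hU : IsOpen U) (hz : z₀ ∈ U) {Z : T.Q (b + 1) → L →ₗ[ℝ] T.V b}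
    (hZ : ∀ z ∈ U, Z z ∈ T.frames b z) {p : ℤ} {X : L} (hX : X ∈ 𝒜 p)
    (hs : SmoothAlongAt (E := T.V b) (F := T.V (b + 1)) (T.π b) (fun z => Z z X) z₀)
    (B : 𝒜 (b : ℤ)) :
    (dmap (fun z => (dch (T.π b z₀) (T.π b z) : T.V b →L[ℝ] T.V b) (Z z X)) z₀ :
      T.V (b + 1) →L[ℝ] T.V b) (T.fundamental b B z₀) - Z z₀ ⁅(B : L), X⁆ ∈
      T.tanFilt b (p + b + 1) (T.π b z₀) := by
  have hred := hT.reduction b (Nat.lt_succ_self b)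
  set h : T.Q (b + 1) → T.V b := fun z => (dch (T.π b z₀) (T.π b z) : T.V b →L[ℝ] T.V b) (Z z X)
    with hh
  have hhs : SmoothAt (E := T.V b) (F := T.V (b + 1)) h z₀ := (smoothAlongAt_iff.1 hs).2
  have hact := hred.smoothAt_act_right z₀ 1
  have h1 : (dmap h z₀ : T.V (b + 1) →L[ℝ] T.V b) (T.fundamental b B z₀) =
      (dmap (fun a => h (T.act b z₀ a)) 1 : 𝒯.VG b →L[ℝ] T.V b) (𝒯.lam b B) := by
    rw [dmap_comp (g := h) (f := fun a => T.act b z₀ a) (by rw [hred.act_one]; exact hhs.mdiff)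
      hact.mdiff, hred.act_one]
    rfl
  -- The differential of `rho` is known only through functionals that kill the relevant step of the
  -- filtration, so membership is tested by annihilating functionals.
  rw [h1, ← Subspace.forall_mem_dualAnnihilator_apply_eq_zero_iff]
  intro φ hφ
  rw [Submodule.mem_dualAnnihilator] at hφ
  have hZ0 := hT.isLinearFrame_of_mem (hZ z₀ hz)
  have hf : ∀ y ∈ filt 𝒜 (min (p + b + 1) b), (φ ∘ₗ Z z₀) y = 0 := by
    intro y hy
    rcases le_total (p + b + 1 : ℤ) b with hle | hle
    · rw [min_eq_left hle] at hy
      exact hφ _ (hZ0.apply_mem hy)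
    · rw [min_eq_right hle] at hy
      rw [LinearMap.comp_apply, hZ0.apply_eq_zero_iff.2 hy, map_zero]
  have h2 := 𝒯.rho_deriv b p X (mem_filt_of_mem le_rfl hX) (φ ∘ₗ Z z₀) hf B
  have hcont : ContinuousAt (fun a => T.act b z₀ a) (1 : 𝒯.G b) := hact.continuousAt
  -- Along the orbit the base point is constant, and by equivariance the frame is `Z z₀ ∘ rho a` up
  -- to terms that `φ` kills.
  have h3 : (fun a => LinearMap.toContinuousLinearMap φ (h (T.act b z₀ a))) =ᶠ[𝓝 1]
      fun a => (φ ∘ₗ Z z₀) (𝒯.rho b a X) := by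
    filter_upwards [hcont.preimage_mem_nhds (by rw [hred.act_one]; exact hU.mem_nhds hz)] with a ha
    have e1 : h (T.act b z₀ a) = Z (T.act b z₀ a) X := by
      simp only [hh]
      rw [hred.π_act, dch_self]; rfl
    have e2 := hT.frameEquiv_of_mem (hred.frames_act z₀ a _ (hZ z₀ hz)) (hZ _ ha) p X
      (mem_filt_of_mem le_rfl hX)
    rw [hred.π_act] at e2
    have e3 := hφ _ e2
    rw [map_sub, _root_.sub_eq_zero] at e3
    rw [e1]
    exact e3
  have h4 : (dmap (fun a => LinearMap.toContinuousLinearMap φ (h (T.act b z₀ a))) 1 :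
      𝒯.VG b →L[ℝ] ℝ) = (LinearMap.toContinuousLinearMap φ).comp
      (dmap (fun a => h (T.act b z₀ a)) 1 : 𝒯.VG b →L[ℝ] T.V b) := by
    have hha : SmoothAt (E := T.V b) (F := 𝒯.VG b) (fun a => h (T.act b z₀ a)) 1 :=
      ContMDiffAt.comp (g := h) (f := fun a => T.act b z₀ a) 1 (by rw [hred.act_one]; exact hhs) hact
    rw [dmap_comp (g := LinearMap.toContinuousLinearMap φ) (f := fun a => h (T.act b z₀ a))
      (LinearMap.toContinuousLinearMap φ).mdifferentiableAt hha.mdiff]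
    congr 1
    exact mfderiv_eq_fderiv.trans (LinearMap.toContinuousLinearMap φ).fderiv
  rw [dmap_congr h3] at h4
  have h5 := congrArg (fun C : 𝒯.VG b →L[ℝ] ℝ => C (𝒯.lam b B)) h4
  have h6 : φ ((dmap (fun a => h (T.act b z₀ a)) 1 : 𝒯.VG b →L[ℝ] T.V b) (𝒯.lam b B)) =
    φ (Z z₀ ⁅(B : L), X⁆) := h5.symm.trans h2
  rw [map_sub, h6, sub_self]

/-- The bracket of a frame field with a frame field in nonnegative degree agrees with the bracket of
`𝔤` up to higher filtration. -/
theorem IsFrameField.bracket_nonneg {n : ℕ} (hT : T.Geo n) {U : Set (T.Q n)}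
    {Z : T.Q n → L →ₗ[ℝ] T.V n} (hZ : T.IsFrameField n U Z) {y : T.Q n} (hy : y ∈ U) {b : ℕ}
    (hb : b < n) {p : ℤ} {B X : L} (hB : B ∈ 𝒜 (b : ℤ)) (hX : X ∈ 𝒜 p) :
    lieB (fun y => Z y B) (fun y => Z y X) y - Z y ⁅B, X⁆ ∈ T.tanFilt n (min (p + b + 1) b) y := by
  have h1 : b + 1 ≤ n := hb
  have h0 : b ≤ n := hb.le
  have hTb := hT.mono h1
  have hred := hT.reduction b hb
  -- In degree `b` the frame field is vertical over level `b`. Seen from there, the bracket is just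
  -- a derivative of `Z X` in the direction of `Z B`.
  have hv : ∀ x ∈ U, T.dpr h0 x (Z x B) = 0 := fun x hx =>
    (hT.mem_tanFilt_iff_dpr h0).1 ((hZ.linear x hx).apply_mem (mem_filt_of_mem le_rfl hB))
  have hbr := hT.dpr_lieB_vertical h0 hZ.isOpen (fun x hx => hZ.smoothAt B hx)
    (fun x hx => hZ.smoothAt X hx) hv hy
  have hfun : T.pr h0 = fun x => T.π b (T.pr h1 x) := funext fun x => (T.π_pr h1 h0 x).symm
  suffices hmain : T.dpr h0 y (lieB (fun y => Z y B) (fun y => Z y X) y - Z y ⁅B, X⁆) ∈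
      T.tanFilt b (p + b + 1) (T.pr h0 y) by
    rw [hT.mem_tanFilt_pr h0 (min_le_right _ _)]
    rcases le_total (p + b + 1 : ℤ) b with hle | hle
    · rwa [min_eq_left hle]
    · rw [tanFilt_eq_bot hT.filtered _ hle, Submodule.mem_bot] at hmain
      rw [hmain]; exact zero_mem _
  obtain ⟨U₁, Zb, hU₁, hz₁, hZb, hZbs⟩ := hred.frames_smooth (T.pr h1 y)
  obtain ⟨ι, hι, U₂, s, hU₂, hy₂, hs, hli, hsp⟩ :=
    (hT.mono h0).exists_local_basis (p + b + 1) (T.pr h0 y)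
  have hcont : ∀ {m : ℕ} (h : m ≤ n), Continuous (T.pr h) := fun h =>
    continuous_iff_continuousAt.2 fun x => (hT.smoothAt_pr h x).continuousAt
  have hO : IsOpen (U ∩ (T.pr h1 ⁻¹' U₁ ∩ T.pr h0 ⁻¹' U₂)) :=
    hZ.isOpen.inter ((hU₁.preimage (hcont h1)).inter (hU₂.preimage (hcont h0)))
  have hyO : y ∈ U ∩ (T.pr h1 ⁻¹' U₁ ∩ T.pr h0 ⁻¹' U₂) := ⟨hy, hz₁, hy₂⟩
  have hZbs' : ∀ x ∈ U ∩ (T.pr h1 ⁻¹' U₁ ∩ T.pr h0 ⁻¹' U₂),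
      SmoothAlongAt (E := T.V b) (F := T.V n) (T.pr h0) (fun x => Zb (T.pr h1 x) X) x := by
    intro x hx
    have h2 : SmoothAlongAt (E := T.V b) (F := T.V (b + 1)) (T.π b) (fun z => Zb z X) (T.pr h1 x) :=
      (hZbs X).contMDiffAt (hU₁.mem_nhds hx.2.1)
    rw [hfun]
    exact h2.comp (hT.smoothAt_pr h1 x)
  -- The projected frame and the frame `Zb` pulled back from level `b + 1` belong to one class, so
  -- they differ by a section of `F^{p+b+1}`. A derivative of it along a vertical direction stays in
  -- that subbundle.
  obtain ⟨c, hc, hcs⟩ := exists_smooth_coeff (f := T.pr h0)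
    (v := fun x => T.dpr h0 x (Z x X) - Zb (T.pr h1 x) X) hs hli hO (fun x hx => hx.2.2)
    (fun x hx => (hT.smoothAlongAt_dpr h0 (hZ.smoothAt X hx.1)).sub (hZbs' x hx))
    (fun x hx => by
      rw [hsp _ hx.2.2]
      have h2 := hTb.frameEquiv_of_mem (hZb _ hx.2.1) ((hZ.linear x hx.1).pr_mem hT h1 h0) p X
        (mem_filt_of_mem le_rfl hX)
      rw [T.π_pr h1 h0] at h2
      exact h2)
  have e1 : (dAlong (T.pr h0) (fun x => T.dpr h0 x (Z x X)) y : T.V n →L[ℝ] T.V b) =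
      dAlong (T.pr h0) (fun x => Zb (T.pr h1 x) X + ∑ i, c i x • s i (T.pr h0 x)) y := by
    refine dAlong_congr ?_
    filter_upwards [hO.mem_nhds hyO] with x hx
    rw [← hcs x hx]; abel
  have e2 : SmoothAlongAt (E := T.V b) (F := T.V n) (T.pr h0)
      (fun x => ∑ i, c i x • s i (T.pr h0 x)) y :=
    SmoothAlongAt.sum _ (hT.smoothAt_pr h0 y) fun i _ =>
      SmoothAlongAt.smul (hc i y hyO) ((hs i _ hy₂).comp (hT.smoothAt_pr h0 y))
  rw [e1, dAlong_add (hZbs' y hyO) e2, add_apply,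
    dAlong_sum_comp hT h0 (fun i => hs i _ hy₂) (fun i => hc i y hyO), hv y hy] at hbr
  simp only [map_zero, smul_zero, Finset.sum_const_zero, zero_add] at hbr
  -- `Zb` depends only on the projection to level `b + 1`, where `Z B` becomes the fundamental
  -- vector of `B`.
  have e3 : (dAlong (T.pr h0) (fun x => Zb (T.pr h1 x) X) y : T.V n →L[ℝ] T.V b) (Z y B) =
      (dmap (fun z => (dch (T.π b (T.pr h1 y)) (T.π b z) : T.V b →L[ℝ] T.V b) (Zb z X))
        (T.pr h1 y) : T.V (b + 1) →L[ℝ] T.V b) (T.fundamental b ⟨B, hB⟩ (T.pr h1 y)) := by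
    have h2 : SmoothAlongAt (E := T.V b) (F := T.V (b + 1)) (T.π b) (fun z => Zb z X) (T.pr h1 y) :=
      (hZbs X).contMDiffAt (hU₁.mem_nhds hz₁)
    have h3 : (fun x => (dch (T.pr h0 y) (T.pr h0 x) : T.V b →L[ℝ] T.V b) (Zb (T.pr h1 x) X)) =
        fun x => (fun z => (dch (T.π b (T.pr h1 y)) (T.π b z) : T.V b →L[ℝ] T.V b) (Zb z X))
          (T.pr h1 x) := by
      funext x
      simp only [T.π_pr h1 h0]
    unfold dAlong
    rw [h3, dmap_comp (g := fun z => (dch (T.π b (T.pr h1 y)) (T.π b z) : T.V b →L[ℝ] T.V b)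
      (Zb z X)) (f := T.pr h1) (smoothAlongAt_iff.1 h2).2.mdiff (hT.smoothAt_pr h1 y).mdiff,
      ContinuousLinearMap.comp_apply]
    congr 1
    exact ((hZ.linear y hy).pr hT h1).2.2.1 ⟨B, hB⟩
  have hmain := hTb.deriv_frames_fundamental hU₁ hz₁ hZb hX
    ((hZbs X).contMDiffAt (hU₁.mem_nhds hz₁)) ⟨B, hB⟩
  rw [← e3, T.π_pr h1 h0] at hmain
  have hm2 : ∑ i, (dmap (c i) y : T.V n →L[ℝ] ℝ) (Z y B) • s i (T.pr h0 y) ∈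
      T.tanFilt b (p + b + 1) (T.pr h0 y) := by
    rw [← hsp _ hy₂]
    exact Submodule.sum_mem _ fun i _ => Submodule.smul_mem _ _ (Submodule.subset_span ⟨i, rfl⟩)
  have hm3 := hTb.frameEquiv_of_mem (hZb _ hz₁) ((hZ.linear y hy).pr_mem hT h1 h0) (p + b) ⁅B, X⁆
    (mem_filt_of_mem (by omega) (lie_mem_deg hB hX))
  rw [T.π_pr h1 h0] at hm3
  have hm4 := tanFilt_anti hT.filtered _ (by omega : p + b + 1 ≤ p + b + b + 1) hm3
  have := _root_.sub_mem (add_mem hmain hm2) hm4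
  rw [map_sub, hbr]
  convert this using 1
  simp only [LinearMap.comp_apply]
  abel

/-- Tensoriality of the bracket up to the filtration. -/
theorem IsFrameField.lieB_tensorial {n : ℕ} (hT : T.Geo n) {U : Set (T.Q n)}
    {Z : T.Q n → L →ₗ[ℝ] T.V n} (hZ : T.IsFrameField n U Z) {y : T.Q n} (hy : y ∈ U)
    {ξ η : T.Q n → T.V n} {a : ℤ} (ha : a ≤ n) (hξ : ∀ x ∈ U, SmoothFieldAt (F := T.V n) ξ x)
    (hξa : ∀ x ∈ U, ξ x ∈ T.tanFilt n a x) {R : Submodule ℝ (T.V n)} (hR : T.tanFilt n a y ≤ R)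
    {Λ : L →ₗ[ℝ] T.V n} (hΛ : ∀ x ∈ filt 𝒜 n, Λ x ∈ R)
    (h : ∀ i, a ≤ i → i < n → ∀ x ∈ 𝒜 i, lieB (fun y => Z y x) η y - Λ x ∈ R) :
    lieB ξ η y - Λ (frInv (Z y) (ξ y)) ∈ R := by
  let β := 𝒯.hb n
  -- Expanding `ξ` in the frame, coefficients of degree below `a` vanish identically. Derivatives of
  -- the others multiply vectors of `F^a`, which is contained in `R`.
  let c : β.ι → T.Q n → ℝ := fun j x => β.c j (frInv (Z x) (ξ x))
  have hc : ∀ j, ∀ x ∈ U, SmoothAt (E := ℝ) (F := T.V n) (c j) x := fun j x hx =>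
    hZ.smoothAt_coeff hT.filtered β (f := fun x => x) hx (hξ x hx) j
  have hc0 : ∀ j, β.deg j < a → ∀ x ∈ U, c j x = 0 := fun j hj x hx =>
    β.c_eq_zero_of_filt ((hZ.linear x hx).frInv_mem hT.filtered ha (hξa x hx)) hj
  have hsum : ∀ x ∈ U, ξ x = ∑ j, c j x • Z x (β.b j) := fun x hx => by
    rw [← (hZ.linear x hx).apply_eq_sum β, (hZ.linear x hx).apply_frInv hT.filtered]
  have e1 : lieB ξ η y = ∑ j, lieB (fun x => c j x • Z x (β.b j)) η y := by
    rw [← lieB_sum_left Finset.univ fun j _ => SmoothAlongAt.smul (hc j y hy) (hZ.smoothAt _ hy)]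
    refine lieB_congr ?_ (Filter.Eventually.of_forall fun _ => rfl)
    filter_upwards [hZ.isOpen.mem_nhds hy] with x hx using hsum x hx
  have e2 : Λ (frInv (Z y) (ξ y)) = Λ (frInv (Z y) (ξ y) - ∑ j, c j y • β.b j) +
      ∑ j, c j y • Λ (β.b j) := by
    rw [map_sub, map_sum]; simp
  have e3 : lieB ξ η y - Λ (frInv (Z y) (ξ y)) =
      ∑ j, (lieB (fun x => c j x • Z x (β.b j)) η y - c j y • Λ (β.b j)) -
      Λ (frInv (Z y) (ξ y) - ∑ j, c j y • β.b j) := by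
    rw [e1, e2, Finset.sum_sub_distrib]; abel
  rw [e3]
  refine _root_.sub_mem (Submodule.sum_mem _ fun j _ => ?_) (hΛ _ (β.span _))
  rw [lieB_smul_left (hc j y hy) (hZ.smoothAt _ hy)]
  by_cases hj : β.deg j < a
  · have h1 : (dmap (c j) y : T.V n →L[ℝ] ℝ) = 0 := by
      rw [dmap_congr (g := fun _ => (0 : ℝ))]
      · exact mfderiv_const
      · filter_upwards [hZ.isOpen.mem_nhds hy] with x hx using hc0 j hj x hx
    rw [h1, hc0 j hj y hy]
    simp
  · have h1 := h (β.deg j) (not_lt.1 hj) (β.deg_lt j) (β.b j) (β.mem j)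
    have h2 := hR ((hZ.linear y hy).apply_mem (mem_filt_of_mem (not_lt.1 hj) (β.mem j)))
    have := _root_.sub_mem (R.smul_mem (c j y) h1) (R.smul_mem ((dmap (c j) y : T.V n →L[ℝ] ℝ) (η y)) h2)
    convert this using 1
    rw [smul_sub]
    abel

/-- The term `min i j` is the price of nonnegative degrees, where brackets are controlled only
modulo `F^i` or `F^j`. -/
theorem IsFrameField.bracket_mem {n : ℕ} (hT : T.Geo n) {U : Set (T.Q n)}
    {Z : T.Q n → L →ₗ[ℝ] T.V n} (hZ : T.IsFrameField n U Z) {y : T.Q n} (hy : y ∈ U) {i j : ℤ}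
    (hi : i < n) (hj : j < n) {x x' : L} (hx : x ∈ 𝒜 i) (hx' : x' ∈ 𝒜 j) :
    lieB (fun y => Z y x) (fun y => Z y x') y ∈ T.tanFilt n (min (i + j) (min i j)) y := by
  have hlin := hZ.linear y hy
  have aux : ∀ {i j : ℤ} {x x' : L}, i < n → x ∈ 𝒜 i → x' ∈ 𝒜 j → 0 ≤ i →
      lieB (fun y => Z y x) (fun y => Z y x') y ∈ T.tanFilt n (min (i + j) (min i j)) y := by
    intro i j x x' hi hx hx' h0
    obtain ⟨b, rfl⟩ := Int.eq_ofNat_of_zero_le h0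
    have h1 := hZ.bracket_nonneg hT hy (by omega) hx hx'
    have h2 := hlin.apply_mem (mem_filt_of_mem le_rfl (lie_mem_deg hx hx'))
    have := add_mem (tanFilt_anti hT.filtered y (by omega) h1)
      (tanFilt_anti hT.filtered y (by omega : min ((b : ℤ) + j) (min (b : ℤ) j) ≤ _) h2)
    rwa [sub_add_cancel] at this
  rcases le_or_gt 0 i with h0 | h0
  · exact aux hi hx hx' h0
  · rcases le_or_gt 0 j with h0' | h0'
    · have := neg_mem (aux hj hx' hx h0')
      rw [← lieB_swap, add_comm, min_comm j i] at this
      exact this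
    · have h1 := hZ.bracket_neg hT hy h0 h0' hx hx'
      have h2 := hlin.apply_mem (mem_filt_of_mem le_rfl (lie_mem_deg hx hx'))
      have := add_mem (tanFilt_anti hT.filtered y (by omega) h1)
        (tanFilt_anti hT.filtered y (by omega : min (i + j) (min i j) ≤ _) h2)
      rwa [sub_add_cancel] at this

/-- The filtration is compatible with the bracket of vector fields. -/
theorem IsFrameField.lieB_mem {n : ℕ} (hT : T.Geo n) {U : Set (T.Q n)}
    {Z : T.Q n → L →ₗ[ℝ] T.V n} (hZ : T.IsFrameField n U Z) {y : T.Q n} (hy : y ∈ U)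
    {ξ η : T.Q n → T.V n} {a c : ℤ} (ha : a ≤ n) (hc : c ≤ n)
    (hξ : ∀ x ∈ U, SmoothFieldAt (F := T.V n) ξ x) (hη : ∀ x ∈ U, SmoothFieldAt (F := T.V n) η x)
    (hξa : ∀ x ∈ U, ξ x ∈ T.tanFilt n a x) (hηc : ∀ x ∈ U, η x ∈ T.tanFilt n c x) {r : ℤ}
    (hr : r ≤ min (a + c) (min a c)) : lieB ξ η y ∈ T.tanFilt n r y := by
  have anti := fun {p q : ℤ} (h : p ≤ q) => tanFilt_anti hT.filtered y h
  have := hZ.lieB_tensorial hT hy ha hξ hξa (R := T.tanFilt n r y) (anti (by omega))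
    (Λ := 0) (fun x _ => zero_mem _) (fun i hi hin x hx => by
      have := hZ.lieB_tensorial hT hy hc hη hηc (R := T.tanFilt n r y)
        (anti (by omega)) (Λ := 0) (fun x _ => zero_mem _) (fun j hj hjn x' hx' => by
          simpa using anti (by omega) (hZ.bracket_mem hT hy hjn hin hx' hx))
      rw [lieB_swap] at this
      simpa using this)
  simpa using this

/-! #### Change of the frame field -/

section Change

variable {m : ℕ} {U : Set (T.Q (m + 1))}
  {Z Z' : T.Q (m + 1) → L →ₗ[ℝ] T.V (m + 1)}

theorem IsFrameField.sub_mem (hT : T.Geo (m + 1)) (hZ : T.IsFrameField (m + 1) U Z)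
    (hZ' : T.IsFrameField (m + 1) U Z') {p r : ℤ} (hr : r ≤ min (p + m + 1) m) {X : L}
    (hX : X ∈ 𝒜 p) : ∀ y ∈ U, Z' y X - Z y X ∈ T.tanFilt (m + 1) r y := fun y hy =>
  tanFilt_anti hT.filtered y hr ((hZ.linear y hy).sub_mem hT (hZ'.linear y hy)
    (mem_filt_of_mem le_rfl hX))

theorem lieB_sub_expand {Z Z' : T.Q (m + 1) → L →ₗ[ℝ] T.V (m + 1)} {y : T.Q (m + 1)}
    (hZ : T.IsFrameField (m + 1) U Z) (hZ' : T.IsFrameField (m + 1) U Z') (hy : y ∈ U) (X Y : L) :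
    lieB (fun y => Z' y X) (fun y => Z' y Y) y = lieB (fun y => Z y X) (fun y => Z y Y) y +
      lieB (fun y => Z' y X - Z y X) (fun y => Z y Y) y -
      lieB (fun y => Z' y Y - Z y Y) (fun y => Z y X) y +
      lieB (fun y => Z' y X - Z y X) (fun y => Z' y Y - Z y Y) y := by
  have sX := hZ.smoothAt X hy
  have sY := hZ.smoothAt Y hy
  have dX := (hZ'.smoothAt X hy).sub sX
  have dY := (hZ'.smoothAt Y hy).sub sY
  have e : ∀ W : L, (fun y => Z' y W) = fun y => Z y W + (Z' y W - Z y W) := by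
    intro W; funext y; abel
  rw [e X, e Y, lieB_add_left sX dX, lieB_add_right sY dY, lieB_add_right sY dY]
  rw [lieB_swap (ξ := fun y => Z y X) (η := fun y => Z' y Y - Z y Y)]
  abel

/-- Put `D = Z' - Z`, so that `D X` lies in `F^{p+m+1}`. The bracket of `D X` with `Z Y` is
tensorial modulo `F^{p+q+m+2}` and given there by the bracket of 𝔤. The bracket of `D X` with `D Y`
falls into that step altogether. -/
theorem IsFrameField.change_neg (hT : T.Geo (m + 1)) (hZ : T.IsFrameField (m + 1) U Z)
    (hZ' : T.IsFrameField (m + 1) U Z') {y : T.Q (m + 1)} (hy : y ∈ U) {p q : ℤ} (hp : p < 0)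
    (hq : q < 0) {X Y : L} (hX : X ∈ 𝒜 p) (hY : Y ∈ 𝒜 q) :
    lieB (fun y => Z' y X) (fun y => Z' y Y) y - (lieB (fun y => Z y X) (fun y => Z y Y) y +
      Z y ⁅frInv (Z y) (Z' y X - Z y X), Y⁆ + Z y ⁅X, frInv (Z y) (Z' y Y - Z y Y)⁆) ∈
      T.tanFilt (m + 1) (p + q + m + 2) y := by
  have anti := fun {p q : ℤ} (h : p ≤ q) => tanFilt_anti hT.filtered y h
  have hD : ∀ W : L, ∀ x ∈ U, SmoothFieldAt (F := T.V (m + 1)) (fun y => Z' y W - Z y W) x :=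
    fun W x hx => (hZ'.smoothAt W hx).sub (hZ.smoothAt W hx)
  have hlin := hZ.linear y hy
  have aux : ∀ {p q : ℤ} {X Y : L}, p < 0 → q < 0 → X ∈ 𝒜 p → Y ∈ 𝒜 q →
      lieB (fun y => Z' y X - Z y X) (fun y => Z y Y) y - Z y ⁅frInv (Z y) (Z' y X - Z y X), Y⁆ ∈
        T.tanFilt (m + 1) (p + q + m + 2) y := by
    intro p q X Y hp hq hX hY
    have := hZ.lieB_tensorial hT hy (a := p + m + 1) (by push_cast; omega) (hD X)
      (hZ.sub_mem hT hZ' (by omega) hX) (R := T.tanFilt (m + 1) (p + q + m + 2) y) (anti (by omega))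
      (Λ := - (Z y ∘ₗ (LieAlgebra.ad ℝ L Y : L →ₗ[ℝ] L))) (fun x hx => by
        rw [LinearMap.neg_apply]
        refine neg_mem (anti ?_ (hlin.apply_mem (lie_mem_filt (mem_filt_of_mem le_rfl hY) hx)))
        push_cast; omega)
      (fun i hi hin x hx => by
        rw [LinearMap.neg_apply, LinearMap.comp_apply, LieAlgebra.ad_apply, ← map_neg, lie_skew]
        rcases le_or_gt 0 i with h0 | h0
        · obtain ⟨b, rfl⟩ := Int.eq_ofNat_of_zero_le h0
          exact anti (by omega) (hZ.bracket_nonneg hT hy (by omega) hx hY)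
        · exact anti (by omega) (hZ.bracket_neg hT hy h0 hq hx hY))
    rwa [LinearMap.neg_apply, LinearMap.comp_apply, LieAlgebra.ad_apply, ← map_neg, lie_skew] at this
  have h1 := aux hp hq hX hY
  have h2 := aux hq hp hY hX
  have h3 := hZ.lieB_mem hT hy (a := p + m + 1) (c := q + m + 1) (r := p + q + m + 2)
    (by push_cast; omega) (by push_cast; omega) (hD X) (hD Y) (hZ.sub_mem hT hZ' (by omega) hX)
    (hZ.sub_mem hT hZ' (by omega) hY) (by omega)
  rw [show q + p + m + 2 = p + q + m + 2 by ring] at h2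
  have := add_mem (_root_.sub_mem h1 h2) h3
  rw [lieB_sub_expand hZ hZ' hy, ← lie_skew X]
  convert this using 1
  simp only [map_neg]
  abel

/-- The two arguments behave differently. `D A` lies in `F^m`, and its bracket with `Z Y` is given
by 𝔤. `D Y` lies in `F^{q+m+1}`, and since `A` has nonnegative degree its bracket with `Z A` remains
there. So only the change of `A` is felt. -/
theorem IsFrameField.change_nonneg (hT : T.Geo (m + 1)) (hZ : T.IsFrameField (m + 1) U Z)
    (hZ' : T.IsFrameField (m + 1) U Z') {y : T.Q (m + 1)} (hy : y ∈ U) {α q : ℤ} (hα : 0 ≤ α)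
    (hα' : α < m + 1) (hq : q < 0) {A Y : L} (hA : A ∈ 𝒜 α) (hY : Y ∈ 𝒜 q) :
    lieB (fun y => Z' y A) (fun y => Z' y Y) y - (lieB (fun y => Z y A) (fun y => Z y Y) y +
      Z y ⁅frInv (Z y) (Z' y A - Z y A), Y⁆) ∈ T.tanFilt (m + 1) (q + m + 1) y := by
  have anti := fun {p q : ℤ} (h : p ≤ q) => tanFilt_anti hT.filtered y h
  have hD : ∀ W : L, ∀ x ∈ U, SmoothFieldAt (F := T.V (m + 1)) (fun y => Z' y W - Z y W) x :=
    fun W x hx => (hZ'.smoothAt W hx).sub (hZ.smoothAt W hx)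
  have hlin := hZ.linear y hy
  have h1 := hZ.lieB_tensorial hT hy (a := m) (by push_cast; omega) (hD A)
    (hZ.sub_mem hT hZ' (by omega) hA) (R := T.tanFilt (m + 1) (q + m + 1) y) (anti (by omega))
    (Λ := - (Z y ∘ₗ (LieAlgebra.ad ℝ L Y : L →ₗ[ℝ] L))) (fun x hx => by
      rw [LinearMap.neg_apply]
      refine neg_mem (anti ?_ (hlin.apply_mem (lie_mem_filt (mem_filt_of_mem le_rfl hY) hx)))
      push_cast; omega)
    (fun i hi hin x hx => by
      rw [LinearMap.neg_apply, LinearMap.comp_apply, LieAlgebra.ad_apply, ← map_neg, lie_skew]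
      obtain ⟨b, rfl⟩ := Int.eq_ofNat_of_zero_le (by omega : 0 ≤ i)
      exact anti (by omega) (hZ.bracket_nonneg hT hy (by omega) hx hY))
  rw [LinearMap.neg_apply, LinearMap.comp_apply, LieAlgebra.ad_apply, ← map_neg, lie_skew] at h1
  have h2 := hZ.lieB_tensorial hT hy (a := q + m + 1) (by push_cast; omega) (hD Y)
    (hZ.sub_mem hT hZ' (by omega) hY) (R := T.tanFilt (m + 1) (q + m + 1) y) le_rfl
    (Λ := 0) (fun x hx => zero_mem _) (fun i hi hin x hx => by
      have e : lieB (fun y => Z y x) (fun y => Z y A) y =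
        (lieB (fun y => Z y x) (fun y => Z y A) y - Z y ⁅x, A⁆) + Z y ⁅x, A⁆ := by abel
      rw [LinearMap.zero_apply, sub_zero, e]
      refine add_mem ?_ (anti (by omega) (hlin.apply_mem
        (mem_filt_of_mem (by omega : i ≤ i + α) (lie_mem_deg hx hA))))
      rcases le_or_gt 0 i with h0 | h0
      · obtain ⟨b, rfl⟩ := Int.eq_ofNat_of_zero_le h0
        exact anti (by omega) (hZ.bracket_nonneg hT hy (by omega) hx hA)
      · obtain ⟨b, rfl⟩ := Int.eq_ofNat_of_zero_le hα
        have e2 : lieB (fun y => Z y x) (fun y => Z y A) y - Z y ⁅x, A⁆ =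
            -(lieB (fun y => Z y A) (fun y => Z y x) y - Z y ⁅A, x⁆) := by
          rw [lieB_swap, ← lie_skew x A, map_neg]; abel
        rw [e2]
        exact neg_mem (anti (by omega) (hZ.bracket_nonneg hT hy (by omega) hA hx)))
  rw [LinearMap.zero_apply, sub_zero] at h2
  have h3 := hZ.lieB_mem hT hy (a := m) (c := q + m + 1) (r := q + m + 1)
    (by push_cast; omega) (by push_cast; omega) (hD A) (hD Y) (hZ.sub_mem hT hZ' (by omega) hA)
    (hZ.sub_mem hT hZ' (by omega) hY) (by omega)
  have := add_mem (_root_.sub_mem h1 h2) h3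
  rw [lieB_sub_expand hZ hZ' hy]
  convert this using 1
  abel

end Change

end Tower
end NormalProlongation


set_option linter.unusedSectionVars false

namespace NormalProlongation

open LieModule.Cohomology

variable {L : Type v} [LieRing L] [LieAlgebra ℝ L] {𝒜 : ℤ → Submodule ℝ L}
  [GradedLieAlgebra 𝒜] {k : ℕ} [htr : Fact (IsTransitive 𝒜)]

/-! ### Homogeneous parts of cochains -/

theorem gNeg_eq_zero {p : ℤ} (hp : 0 ≤ p) {v : gNeg 𝒜} (hv : (v : L) ∈ 𝒜 p) : v = 0 := by
  have h1 := mem_gNeg_iff.1 v.2 p hp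
  rw [hc_of_mem hv] at h1
  exact Subtype.ext h1

theorem gNeg_eq_zero_of_lt {p : ℤ} (hp : p < -(depth 𝒜 : ℤ)) {v : gNeg 𝒜} (hv : (v : L) ∈ 𝒜 p) :
    v = 0 := by
  rw [depth_spec p hp, Submodule.mem_bot] at hv
  exact Subtype.ext hv

variable (𝒜) in
/-- The inclusion of `𝔤₋`. -/
def negIncl : gNeg 𝒜 →ₗ[ℝ] L := (gNeg 𝒜).toSubmodule.subtype

@[simp]
theorem negIncl_apply (v : gNeg 𝒜) : negIncl 𝒜 v = (v : L) := rfl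

variable (𝒜) in
/-- The part of degree `r` of a linear map, restricted to `𝔤₋`. -/
noncomputable def homPart1 (r : ℤ) (g : L →ₗ[ℝ] L) : oneCochain ℝ (gNeg 𝒜) L :=
  ∑ p ∈ Finset.Ico (-(depth 𝒜 : ℤ)) 0, hc 𝒜 (p + r) ∘ₗ g ∘ₗ hc 𝒜 p ∘ₗ negIncl 𝒜

theorem homPart1_apply {r p : ℤ} {g : L →ₗ[ℝ] L} {v : gNeg 𝒜} (hv : (v : L) ∈ 𝒜 p) :
    homPart1 𝒜 r g v = hc 𝒜 (p + r) (g v) := by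
  by_cases hp : p ∈ Finset.Ico (-(depth 𝒜 : ℤ)) 0
  · unfold homPart1
    rw [LinearMap.sum_apply, Finset.sum_eq_single p]
    · simp [hc_of_mem hv]
    · intro q _ hq
      simp [hc_of_mem_ne hv hq.symm]
    · exact fun h => absurd hp h
  · have : v = 0 := by
      rw [Finset.mem_Ico, not_and_or, not_le, not_lt] at hp
      rcases hp with hp | hp
      · exact gNeg_eq_zero_of_lt hp hv
      · exact gNeg_eq_zero hp hv
    subst this
    simp

theorem homPart1_mem (r : ℤ) (g : L →ₗ[ℝ] L) : homPart1 𝒜 r g ∈ hom1 𝒜 r := fun p v hv => by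
  rw [homPart1_apply hv]; exact hc_mem 𝒜 _ _

theorem homPart1_add (r : ℤ) (g g' : L →ₗ[ℝ] L) :
    homPart1 𝒜 r (g + g') = homPart1 𝒜 r g + homPart1 𝒜 r g' := by
  unfold homPart1
  rw [← Finset.sum_add_distrib]
  exact Finset.sum_congr rfl fun p _ => by ext; simp

variable (𝒜) in
/-- The part of degree `r` of a bilinear map, restricted to `𝔤₋`. -/
noncomputable def homPart2 (r : ℤ) (B : L →ₗ[ℝ] L →ₗ[ℝ] L) : gNeg 𝒜 →ₗ[ℝ] gNeg 𝒜 →ₗ[ℝ] L :=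
  ∑ p ∈ Finset.Ico (-(depth 𝒜 : ℤ)) 0, ∑ q ∈ Finset.Ico (-(depth 𝒜 : ℤ)) 0,
    (B.compl₁₂ (hc 𝒜 p ∘ₗ negIncl 𝒜)
      (hc 𝒜 q ∘ₗ negIncl 𝒜)).compr₂ (hc 𝒜 (p + q + r))

theorem homPart2_apply {r p q : ℤ} {B : L →ₗ[ℝ] L →ₗ[ℝ] L} {v w : gNeg 𝒜} (hv : (v : L) ∈ 𝒜 p)
    (hw : (w : L) ∈ 𝒜 q) : homPart2 𝒜 r B v w = hc 𝒜 (p + q + r) (B v w) := by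
  have key : ∀ {p : ℤ} {v : gNeg 𝒜}, (v : L) ∈ 𝒜 p → p ∉ Finset.Ico (-(depth 𝒜 : ℤ)) 0 → v = 0 := by
    intro p v hv hp
    rw [Finset.mem_Ico, not_and_or, not_le, not_lt] at hp
    rcases hp with hp | hp
    · exact gNeg_eq_zero_of_lt hp hv
    · exact gNeg_eq_zero hp hv
  by_cases hp : p ∈ Finset.Ico (-(depth 𝒜 : ℤ)) 0
  · by_cases hq : q ∈ Finset.Ico (-(depth 𝒜 : ℤ)) 0
    · unfold homPart2
      simp only [LinearMap.sum_apply]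
      rw [Finset.sum_eq_single p, Finset.sum_eq_single q]
      · simp [hc_of_mem hv, hc_of_mem hw]
      · intro q' _ hq'
        simp [hc_of_mem_ne hw hq'.symm]
      · exact fun h => absurd hq h
      · intro p' _ hp'
        simp [hc_of_mem_ne hv hp'.symm]
      · exact fun h => absurd hp h
    · rw [key hw hq]; simp
  · rw [key hv hp]; simp

theorem homPart2_self {r : ℤ} {B : L →ₗ[ℝ] L →ₗ[ℝ] L} (hB : ∀ x y, B x y = - B y x) (v : gNeg 𝒜) :
    homPart2 𝒜 r B v v = 0 := by
  have h : homPart2 𝒜 r B v v = - homPart2 𝒜 r B v v := by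
    conv_lhs => unfold homPart2
    conv_rhs => unfold homPart2
    simp only [LinearMap.sum_apply, LinearMap.compr₂_apply, LinearMap.compl₁₂_apply]
    conv_lhs => rw [Finset.sum_comm]
    rw [← Finset.sum_neg_distrib]
    refine Finset.sum_congr rfl fun p _ => ?_
    rw [← Finset.sum_neg_distrib]
    refine Finset.sum_congr rfl fun q _ => ?_
    rw [hB ((hc 𝒜 q ∘ₗ negIncl 𝒜) v) ((hc 𝒜 p ∘ₗ negIncl 𝒜) v), map_neg, add_comm q p]
  have h2 : (2 : ℝ) • homPart2 𝒜 r B v v = 0 := by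
    rw [two_smul]; nth_rewrite 1 [h]; exact neg_add_cancel _
  exact (smul_eq_zero.1 h2).resolve_left two_ne_zero

theorem oneCochain_ext {f g : oneCochain ℝ (gNeg 𝒜) L}
    (h : ∀ p : ℤ, p < 0 → ∀ v : gNeg 𝒜, (v : L) ∈ 𝒜 p → f v = g v) : f = g := by
  have key : ∀ v : gNeg 𝒜, v = ∑ p ∈ Finset.Ico (-(depth 𝒜 : ℤ)) 0,
      if hp : p < 0 then (⟨hc 𝒜 p v, mem_gNeg_of_mem hp (hc_mem 𝒜 p v)⟩ : gNeg 𝒜) else 0 := by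
    intro v
    apply Subtype.ext
    have e : ((∑ p ∈ Finset.Ico (-(depth 𝒜 : ℤ)) 0, if hp : p < 0 then
        (⟨hc 𝒜 p v, mem_gNeg_of_mem hp (hc_mem 𝒜 p v)⟩ : gNeg 𝒜) else 0 : gNeg 𝒜) : L) =
        ∑ p ∈ Finset.Ico (-(depth 𝒜 : ℤ)) 0, hc 𝒜 p v := by
      have := map_sum (negIncl 𝒜) (fun p : ℤ => if hp : p < 0 then
        (⟨hc 𝒜 p v, mem_gNeg_of_mem hp (hc_mem 𝒜 p v)⟩ : gNeg 𝒜) else 0)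
        (Finset.Ico (-(depth 𝒜 : ℤ)) 0)
      refine this.trans (Finset.sum_congr rfl fun p hp => ?_)
      rw [dif_pos (Finset.mem_Ico.1 hp).2]; rfl
    rw [e]
    refine hc_ext (𝒜 := 𝒜) fun i => ?_
    rw [map_sum]
    by_cases hi : i ∈ Finset.Ico (-(depth 𝒜 : ℤ)) 0
    · rw [Finset.sum_eq_single i, hc_of_mem (hc_mem 𝒜 i _)]
      · intro q _ hq
        exact hc_of_mem_ne (hc_mem 𝒜 q _) hq
      · exact fun h => absurd hi h
    · rw [Finset.sum_eq_zero]
      · rw [Finset.mem_Ico, not_and_or, not_le, not_lt] at hi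
        rcases hi with hi | hi
        · have := hc_mem 𝒜 i (v : L)
          rwa [depth_spec i hi, Submodule.mem_bot] at this
        · exact mem_gNeg_iff.1 v.2 i hi
      · intro q hq
        exact hc_of_mem_ne (hc_mem 𝒜 q _) (by rintro rfl; exact hi hq)
  refine LinearMap.ext fun v => ?_
  rw [key v, map_sum, map_sum]
  refine Finset.sum_congr rfl fun p hp => ?_
  rw [dif_pos (Finset.mem_Ico.1 hp).2]
  exact h p (Finset.mem_Ico.1 hp).2 _ (hc_mem 𝒜 p _)

theorem twoCochain_ext {f g : twoCochain ℝ (gNeg 𝒜) L}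
    (h : ∀ p q : ℤ, p < 0 → q < 0 → ∀ v w : gNeg 𝒜, (v : L) ∈ 𝒜 p → (w : L) ∈ 𝒜 q →
      f v w = g v w) : f = g := by
  apply Subtype.ext
  refine LinearMap.ext fun v => ?_
  refine oneCochain_ext fun q hq w hw => ?_
  have : f.1.flip w = g.1.flip w := oneCochain_ext fun p hp v hv => h p q hp hq v w hv hw
  exact congrArg (fun A : gNeg 𝒜 →ₗ[ℝ] L => A v) this

theorem hc_lie_right {i j : ℤ} {x y : L} (hy : y ∈ 𝒜 j) : hc 𝒜 (i + j) ⁅x, y⁆ = ⁅hc 𝒜 i x, y⁆ := by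
  induction x using DirectSum.Decomposition.inductionOn 𝒜 with
  | zero => simp
  | @homogeneous l x =>
    have hxy := lie_mem_deg x.2 hy
    by_cases h : l = i
    · subst h
      rw [hc_of_mem hxy, hc_of_mem x.2]
    · rw [hc_of_mem_ne hxy (by omega), hc_of_mem_ne x.2 h, zero_lie]
  | add x x' h h' => rw [add_lie, map_add, h, h', map_add, add_lie]

theorem hc_lie_left {i j : ℤ} {x y : L} (hx : x ∈ 𝒜 i) : hc 𝒜 (i + j) ⁅x, y⁆ = ⁅x, hc 𝒜 j y⁆ := by
  rw [← lie_skew, map_neg, add_comm, hc_lie_right hx, lie_skew]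

namespace Tower

variable {𝒯 : StructureType.{u} 𝒜 k} {T : Tower 𝒯}

/-- Because `i < n`, all preimages under the frame have the same component, and testing the one
given by `frInv` is enough. -/
theorem isGammaComponent_iff (hT : T.IsFilteredManifold) {n : ℕ} {y : T.Q n}
    {Z : T.Q n → L →ₗ[ℝ] T.V n} (h : T.IsLinearFrame n y (Z y)) {i : ℤ} (hi : i < n) {X Y c : L} :
    T.IsGammaComponent n y Z X Y i c ↔
      hc 𝒜 i (frInv (Z y) (lieB (fun x => Z x X) (fun x => Z x Y) y)) = c := by
  constructor
  · intro hg
    exact hg _ (h.apply_frInv hT _)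
  · intro hg u hu
    rw [← hg]; exact (h.hc_frInv hT hi hu).symm

theorem IsFrameField.mono {n : ℕ} {U U' : Set (T.Q n)} {Z : T.Q n → L →ₗ[ℝ] T.V n}
    (hZ : T.IsFrameField n U Z) (hU' : IsOpen U') (h : U' ⊆ U) : T.IsFrameField n U' Z :=
  ⟨hU', fun y hy => hZ.linear y (h hy), fun x => ContMDiffOn.mono (hZ.smooth x) h⟩

/-- The structure function `γ` of a frame field at a point. -/
noncomputable def gam {n : ℕ} {U : Set (T.Q n)} {Z : T.Q n → L →ₗ[ℝ] T.V n}
    (hZ : T.IsFrameField n U Z) {y : T.Q n} (hy : y ∈ U) : L →ₗ[ℝ] L →ₗ[ℝ] L :=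
  LinearMap.mk₂ ℝ (fun X Y => frInv (Z y) (lieB (fun x => Z x X) (fun x => Z x Y) y))
    (fun X X' Y => by
      rw [← map_add, ← lieB_add_left (hZ.smoothAt X hy) (hZ.smoothAt X' hy)]; simp only [map_add])
    (fun a X Y => by
      rw [← map_smul, ← lieB_const_smul_left a (hZ.smoothAt X hy)]; simp only [map_smul])
    (fun X Y Y' => by
      rw [← map_add, ← lieB_add_right (hZ.smoothAt Y hy) (hZ.smoothAt Y' hy)]; simp only [map_add])
    (fun a X Y => by
      rw [← map_smul, ← lieB_const_smul_right a (hZ.smoothAt Y hy)]; simp only [map_smul])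

theorem gam_apply {n : ℕ} {U : Set (T.Q n)} {Z : T.Q n → L →ₗ[ℝ] T.V n}
    (hZ : T.IsFrameField n U Z) {y : T.Q n} (hy : y ∈ U) (X Y : L) :
    gam hZ hy X Y = frInv (Z y) (lieB (fun x => Z x X) (fun x => Z x Y) y) := rfl

/-- The structure function `κ` of degree `n`. -/
noncomputable def kap {n : ℕ} {U : Set (T.Q n)} {Z : T.Q n → L →ₗ[ℝ] T.V n}
    (hZ : T.IsFrameField n U Z) {y : T.Q n} (hy : y ∈ U) : twoCochain ℝ (gNeg 𝒜) L :=
  ⟨homPart2 𝒜 n (gam hZ hy), homPart2_self fun X Y => by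
    rw [gam_apply, gam_apply, lieB_swap, map_neg]⟩

/-- The structure function `τ` of modified degree `n`. -/
noncomputable def tau {n : ℕ} {U : Set (T.Q n)} {Z : T.Q n → L →ₗ[ℝ] T.V n}
    (hZ : T.IsFrameField n U Z) {y : T.Q n} (hy : y ∈ U) (A : L) : oneCochain ℝ (gNeg 𝒜) L :=
  homPart1 𝒜 (n - 1) (gam hZ hy A)

section

variable {n : ℕ} {U : Set (T.Q n)} {Z : T.Q n → L →ₗ[ℝ] T.V n}

theorem kap_apply (hZ : T.IsFrameField n U Z) {y : T.Q n} (hy : y ∈ U) {p q : ℤ} {X Y : gNeg 𝒜}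
    (hX : (X : L) ∈ 𝒜 p) (hY : (Y : L) ∈ 𝒜 q) :
    kap hZ hy X Y = hc 𝒜 (p + q + n) (gam hZ hy X Y) := homPart2_apply hX hY

theorem tau_apply (hZ : T.IsFrameField n U Z) {y : T.Q n} (hy : y ∈ U) (A : L) {q : ℤ}
    {Y : gNeg 𝒜} (hY : (Y : L) ∈ 𝒜 q) :
    tau hZ hy A Y = hc 𝒜 (q + n - 1) (gam hZ hy A Y) := by
  rw [add_sub_assoc]; exact homPart1_apply hY

theorem kap_mem (hZ : T.IsFrameField n U Z) {y : T.Q n} (hy : y ∈ U) :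
    kap hZ hy ∈ hom2 𝒜 n := fun p q v w hv hw => by
  rw [kap_apply hZ hy hv hw]; exact hc_mem 𝒜 _ _

theorem tau_mem (hZ : T.IsFrameField n U Z) {y : T.Q n} (hy : y ∈ U) (A : L) :
    tau hZ hy A ∈ hom1 𝒜 ((n : ℤ) - 1) := homPart1_mem _ _

theorem isKappa_iff (hT : T.IsFilteredManifold) (hZ : T.IsFrameField n U Z) {y : T.Q n} (hy : y ∈ U)
    {K : twoCochain ℝ (gNeg 𝒜) L} : T.IsKappa n y Z K ↔ K = kap hZ hy := by
  constructor
  · intro h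
    refine twoCochain_ext fun p q hp hq X Y hX hY => ?_
    rw [kap_apply hZ hy hX hY]
    exact ((isGammaComponent_iff hT (hZ.linear y hy) (by omega)).1 (h p q hp hq X Y hX hY)).symm
  · rintro rfl p q hp hq X Y hX hY
    rw [isGammaComponent_iff hT (hZ.linear y hy) (by omega), kap_apply hZ hy hX hY]
    rfl

theorem isTau_iff (hT : T.IsFilteredManifold) (hZ : T.IsFrameField n U Z) {y : T.Q n} (hy : y ∈ U)
    {A : L} {t : oneCochain ℝ (gNeg 𝒜) L} : T.IsTau n y Z A t ↔ t = tau hZ hy A := by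
  constructor
  · intro h
    refine oneCochain_ext fun q hq Y hY => ?_
    rw [tau_apply hZ hy A hY]
    exact ((isGammaComponent_iff hT (hZ.linear y hy) (by omega)).1 (h q hq Y hY)).symm
  · rintro rfl q hq Y hY
    rw [isGammaComponent_iff hT (hZ.linear y hy) (by omega), tau_apply hZ hy A hY]
    rfl

theorem tau_add (hZ : T.IsFrameField n U Z) {y : T.Q n} (hy : y ∈ U) (A A' : L) :
    tau hZ hy (A + A') = tau hZ hy A + tau hZ hy A' := by
  unfold tau
  rw [map_add, homPart1_add]

end

/-! #### Dependence on the frame -/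

/-- The part of degree `n` of the difference of two linear frames, on `𝔤₋`. -/
noncomputable def fpart (n : ℕ) {V : Type*} [AddCommGroup V] [Module ℝ V] (ζ ζ' : L →ₗ[ℝ] V) :
    oneCochain ℝ (gNeg 𝒜) L := homPart1 𝒜 n (frInv ζ ∘ₗ (ζ' - ζ))

/-- The part in `𝔤_{n-1}` of the difference of two linear frames. -/
noncomputable def gpart (𝒜 : ℤ → Submodule ℝ L) [GradedLieAlgebra 𝒜] (n : ℕ) {V : Type*}
    [AddCommGroup V] [Module ℝ V] (ζ ζ' : L →ₗ[ℝ] V) : L →ₗ[ℝ] L :=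
  hc 𝒜 ((n : ℤ) - 1) ∘ₗ frInv ζ ∘ₗ (ζ' - ζ)

section Change

variable {m : ℕ} {U : Set (T.Q (m + 1))} {Z Z' : T.Q (m + 1) → L →ₗ[ℝ] T.V (m + 1)}

theorem IsLinearFrame.frInv_sub_mem (hT : T.Geo (m + 1)) {y : T.Q (m + 1)}
    {ζ ζ' : L →ₗ[ℝ] T.V (m + 1)} (h : T.IsLinearFrame (m + 1) y ζ)
    (h' : T.IsLinearFrame (m + 1) y ζ') {p : ℤ} {x : L} (hx : x ∈ filt 𝒜 p) :
    frInv ζ (ζ' x - ζ x) ∈ filt 𝒜 (min (p + m + 1) m) :=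
  h.frInv_mem hT.filtered (by push_cast; omega) (h.sub_mem hT h' hx)

/-- Two effects combine. The bracket changes by the terms of `change_neg`, which give the two outer
terms of the coboundary. The result is also read in another frame, and since the leading part of
`γ(X, Y)` is `[X, Y]`, this contributes the term `f([X, Y])`. -/
theorem kap_change (hT : T.Geo (m + 1)) (hZ : T.IsFrameField (m + 1) U Z)
    (hZ' : T.IsFrameField (m + 1) U Z') {y : T.Q (m + 1)} (hy : y ∈ U) :
    kap hZ' hy = kap hZ hy + d₁₂ ℝ (gNeg 𝒜) L (fpart (m + 1) (Z y) (Z' y)) := by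
  have hl := hZ.linear y hy
  have hl' := hZ'.linear y hy
  refine twoCochain_ext fun p q hp hq X Y hX hY => ?_
  have hXY : ((⁅X, Y⁆ : gNeg 𝒜) : L) ∈ 𝒜 (p + q) := lie_mem_deg hX hY
  rw [add_apply_apply, d₁₂_apply_apply, kap_apply hZ hy hX hY, kap_apply hZ' hy hX hY]
  simp only [fpart]
  rw [homPart1_apply hX, homPart1_apply hY, homPart1_apply hXY]
  simp only [LinearMap.comp_apply, LinearMap.sub_apply]
  set N : ℤ := ((m + 1 : ℕ) : ℤ) with hN
  set w' := gam hZ' hy X Y with hw'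
  set w := gam hZ hy X Y with hw
  have e1 : Z' y w' = lieB (fun x => Z' x X) (fun x => Z' x Y) y := hl'.apply_frInv hT.filtered _
  have e2 : Z y w = lieB (fun x => Z x X) (fun x => Z x Y) y := hl.apply_frInv hT.filtered _
  have h1 := hZ.change_neg hT hZ' hy hp hq hX hY
  rw [← e1, ← e2] at h1
  have e3 : Z' y w' = Z y (w' + frInv (Z y) (Z' y w' - Z y w')) := by
    rw [map_add, hl.apply_frInv hT.filtered]; abel
  rw [e3, ← map_add, ← map_add, ← map_sub, hl.mem_iff (by push_cast; omega)] at h1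
  have h2 := mem_filt_iff.1 h1 (p + q + N) (by omega)
  -- `γ'(X, Y)` equals `[X, Y]` modulo `F^{p+q+1}`. In degree `p + q + m + 1` the difference of the
  -- frames therefore sees only `[X, Y]`.
  have h3 := hZ'.bracket_neg hT hy hp hq hX hY
  rw [← e1, ← map_sub, hl'.mem_iff (by push_cast; omega)] at h3
  have h4 := mem_filt_iff.1 (hl.frInv_sub_mem hT hl' h3) (p + q + N) (by omega)
  have e5 : Z' y (w' - ⁅(X : L), (Y : L)⁆) - Z y (w' - ⁅(X : L), (Y : L)⁆) =
      (Z' y w' - Z y w') - (Z' y ⁅(X : L), (Y : L)⁆ - Z y ⁅(X : L), (Y : L)⁆) := by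
    rw [map_sub, map_sub]; abel
  rw [e5, map_sub, map_sub, _root_.sub_eq_zero] at h4
  simp only [map_sub, map_add] at h2
  have h5 : hc 𝒜 (p + q + N) ⁅frInv (Z y) (Z' y X - Z y X), (Y : L)⁆ =
      ⁅hc 𝒜 (p + N) (frInv (Z y) (Z' y X - Z y X)), (Y : L)⁆ := by
    rw [show p + q + N = (p + N) + q by ring, hc_lie_right hY]
  have h6 : hc 𝒜 (p + q + N) ⁅(X : L), frInv (Z y) (Z' y Y - Z y Y)⁆ =
      ⁅(X : L), hc 𝒜 (q + N) (frInv (Z y) (Z' y Y - Z y Y))⁆ := by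
    rw [add_assoc, hc_lie_left hX]
  simp only [map_sub] at h4 h5 h6 ⊢
  rw [h4, h5, h6] at h2
  have h7 := _root_.sub_eq_zero.1 h2
  rw [LieSubalgebra.coe_bracket_of_module, LieSubalgebra.coe_bracket_of_module,
    ← lie_skew (Y : L), LieSubalgebra.coe_bracket, sub_neg_eq_add]
  rw [eq_sub_of_add_eq h7]
  abel

/-- `γ(A, Y)` lies in `F^q`, so reading it in the other frame changes it only from degree `q + m +
1` on, above the degree `q + m` of τ. The change of `A` in 𝔤_m remains. The sign comes from the
convention that ∂B sends `v` to `[v, B]`. -/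
theorem tau_change (hT : T.Geo (m + 1)) (hZ : T.IsFrameField (m + 1) U Z)
    (hZ' : T.IsFrameField (m + 1) U Z') {y : T.Q (m + 1)} (hy : y ∈ U) {A : L}
    (hA : A ∈ Eplus 𝒜 (((m + 1 : ℕ) : ℤ) - 2)) :
    tau hZ' hy A = tau hZ hy A - d₀ 𝒜 (gpart 𝒜 (m + 1) (Z y) (Z' y) A) := by
  have hl := hZ.linear y hy
  have hl' := hZ'.linear y hy
  unfold Eplus at hA
  induction hA using Submodule.iSup_induction' with
  | zero => simp [tau, homPart1]
  | add A A' _ _ h h' => rw [tau_add, tau_add, h, h', map_add, map_add]; abel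
  | mem α A hA =>
    by_cases hα : 0 ≤ α ∧ α ≤ ((m + 1 : ℕ) : ℤ) - 2
    swap
    · rw [iSup_neg hα, Submodule.mem_bot] at hA
      subst hA
      simp [tau, homPart1]
    rw [iSup_pos hα] at hA
    refine oneCochain_ext fun q hq Y hY => ?_
    rw [LinearMap.sub_apply, tau_apply hZ hy A hY, tau_apply hZ' hy A hY]
    change _ = _ - ⁅(Y : L), gpart 𝒜 (m + 1) (Z y) (Z' y) A⁆
    simp only [gpart, LinearMap.comp_apply, LinearMap.sub_apply]
    set N : ℤ := ((m + 1 : ℕ) : ℤ) with hN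
    set w' := gam hZ' hy A Y with hw'
    set w := gam hZ hy A Y with hw
    have e1 : Z' y w' = lieB (fun x => Z' x A) (fun x => Z' x Y) y := hl'.apply_frInv hT.filtered _
    have e2 : Z y w = lieB (fun x => Z x A) (fun x => Z x Y) y := hl.apply_frInv hT.filtered _
    have h1 := hZ.change_nonneg hT hZ' hy hα.1 (by omega) hq hA hY
    rw [← e1, ← e2] at h1
    have e3 : Z' y w' = Z y (w' + frInv (Z y) (Z' y w' - Z y w')) := by
      rw [map_add, hl.apply_frInv hT.filtered]; abel
    rw [e3, ← map_add, ← map_sub, hl.mem_iff (by push_cast; omega)] at h1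
    have h2 := mem_filt_iff.1 h1 (q + N - 1) (by omega)
    have h3 := hZ'.bracket_mem hT hy (by omega) (by omega) hA hY
    rw [← e1, hl'.mem_iff (by push_cast; omega)] at h3
    have h4 := mem_filt_iff.1 (hl.frInv_sub_mem hT hl' (filt_anti (by omega : q ≤ _) h3))
      (q + N - 1) (by omega)
    have h5 : hc 𝒜 (q + N - 1) ⁅frInv (Z y) (Z' y A - Z y A), (Y : L)⁆ =
        ⁅hc 𝒜 (N - 1) (frInv (Z y) (Z' y A - Z y A)), (Y : L)⁆ := by
      rw [show q + N - 1 = (N - 1) + q by ring, hc_lie_right hY]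
    rw [map_sub, map_add, map_add, h4, h5, add_zero, _root_.sub_eq_zero] at h2
    rw [h2, ← lie_skew (Y : L), sub_neg_eq_add]

theorem fpart_eq_of_frameEquiv (hT : T.Geo (m + 1)) {y : T.Q (m + 1)}
    {ζ₀ ζ ζ' : L →ₗ[ℝ] T.V (m + 1)} (h : T.IsLinearFrame (m + 1) y ζ₀)
    (he : T.FrameEquiv (m + 1) y ζ ζ') :
    (fpart (m + 1) ζ₀ ζ : oneCochain ℝ (gNeg 𝒜) L) = fpart (m + 1) ζ₀ ζ' := by
  refine oneCochain_ext fun p hp X hX => ?_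
  unfold fpart
  rw [homPart1_apply hX, homPart1_apply hX]
  have h1 := h.frInv_mem hT.filtered (by push_cast; omega) (he p X (mem_filt_of_mem le_rfl hX))
  have h2 := mem_filt_iff.1 h1 (p + ((m + 1 : ℕ) : ℤ)) (by omega)
  simp only [LinearMap.comp_apply, LinearMap.sub_apply]
  rw [show ζ' X - ζ X = (ζ' X - ζ₀ X) - (ζ X - ζ₀ X) by abel, map_sub, map_sub,
    _root_.sub_eq_zero] at h2
  exact h2.symm

theorem eplus_le_filt (j : ℤ) : Eplus 𝒜 j ≤ filt 𝒜 0 := by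
  refine iSup_le fun i => iSup_le fun hi => fun x hx => mem_filt_of_mem hi.1 hx

theorem gpart_eq_of_frameEquiv (hT : T.Geo (m + 1)) {y : T.Q (m + 1)}
    {ζ₀ ζ ζ' : L →ₗ[ℝ] T.V (m + 1)} (he : T.FrameEquiv (m + 1) y ζ ζ') {A : L}
    (hA : A ∈ filt 𝒜 0) :
    gpart 𝒜 (m + 1) ζ₀ ζ A = gpart 𝒜 (m + 1) ζ₀ ζ' A := by
  have h1 := he 0 A hA
  rw [tanFilt_eq_bot hT.filtered _ (by push_cast; omega), Submodule.mem_bot, _root_.sub_eq_zero] at h1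
  simp only [gpart, LinearMap.comp_apply, LinearMap.sub_apply, h1]

/-- A frame field through a given linear frame, obtained by a constant change of a given one. -/
theorem IsFrameField.through (hT : T.Geo (m + 1)) (hZ : T.IsFrameField (m + 1) U Z)
    {y : T.Q (m + 1)} (hy : y ∈ U) {ζ : L →ₗ[ℝ] T.V (m + 1)} (hζ : T.IsLinearFrame (m + 1) y ζ) :
    ∃ Z', T.IsFrameField (m + 1) U Z' ∧ Z' y = ζ := by
  have hl := hZ.linear y hy
  -- The difference at `y` is expressed as an endomorphism of `L` raising the filtration, and this
  -- constant endomorphism is used at all points.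
  refine ⟨fun x => Z x + Z x ∘ₗ frInv (Z y) ∘ₗ (ζ - Z y), ⟨hZ.isOpen, fun x hx => ?_, fun X => ?_⟩, ?_⟩
  · refine (hZ.linear x hx).add_of_raising hT (fun p X hX => ?_) (fun p X hX => ?_)
    · rw [LinearMap.comp_apply, LinearMap.comp_apply]
      by_cases hp : (p + 1 : ℤ) ≤ ((m + 1 : ℕ) : ℤ)
      · exact (hZ.linear x hx).apply_mem (hl.frInv_mem hT.filtered hp (hl.sub_mem_succ hT hζ hX))
      · have := hl.sub_mem_succ hT hζ hX
        rw [tanFilt_eq_bot hT.filtered _ (by omega), Submodule.mem_bot] at this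
        rw [LinearMap.sub_apply, this, map_zero, map_zero]
        exact zero_mem _
    · exact (hZ.linear x hx).apply_mem (hl.frInv_sub_mem hT hζ hX)
  · rw [T.smoothFieldOn_iff hZ.isOpen]
    intro x hx
    exact (hZ.smoothAt X hx).add (hZ.smoothAt (frInv (Z y) ((ζ - Z y) X)) hx)
  · refine LinearMap.ext fun X => ?_
    rw [LinearMap.add_apply, LinearMap.comp_apply, LinearMap.comp_apply, hl.apply_frInv hT.filtered,
      LinearMap.sub_apply, add_sub_cancel]

/-- Relative to a field through `ζ`, any other field through the same class has `fpart` zero and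
`gpart` zero on E_+, so the change formulas leave κ and τ fixed. -/
theorem Geo.structureFunctionsWellDefined (hT : T.Geo (m + 1)) :
    T.StructureFunctionsWellDefined (m + 1) := by
  intro y ζ hζ
  obtain ⟨U, Z₀, hZ₀, hy⟩ := hT.exists_isFrameField y
  obtain ⟨Z, hZ, hZy⟩ := hZ₀.through hT hy hζ
  refine ⟨⟨Z, ⟨⟨U, hZ, hy⟩, by rw [hZy]; exact FrameEquiv.refl y ζ⟩, hZy⟩,
    ⟨kap hZ hy, kap_mem hZ hy, ?_⟩, fun A hA => ⟨tau hZ hy A, tau_mem hZ hy A, ?_⟩⟩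
  all_goals
    rintro Z' ⟨⟨U', hZ', hy'⟩, he⟩
    have hO := hZ.isOpen.inter hZ'.isOpen
    have r := hZ.mono hO Set.inter_subset_left
    have r' := hZ'.mono hO Set.inter_subset_right
    have hyO : y ∈ U ∩ U' := ⟨hy, hy'⟩
    rw [← hZy] at he
  · rw [isKappa_iff hT.filtered r' hyO]
    have h1 : kap hZ hy = kap r hyO := rfl
    have h2 := fpart_eq_of_frameEquiv hT (hZ.linear y hy) he
    have h3 : (fpart (m + 1) (Z y) (Z y) : oneCochain ℝ (gNeg 𝒜) L) = 0 := by
      simp [fpart, homPart1]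
    rw [kap_change hT r r' hyO, ← h2, h3, map_zero, add_zero, h1]
  · rw [isTau_iff hT.filtered r' hyO]
    have h1 : tau hZ hy A = tau r hyO A := rfl
    have h2 := gpart_eq_of_frameEquiv (ζ₀ := Z y) hT he (eplus_le_filt _ hA)
    have h3 : gpart 𝒜 (m + 1) (Z y) (Z y) A = 0 := by
      simp [gpart]
    rw [tau_change hT r r' hyO hA, ← h2, h3, map_zero, sub_zero, h1]

/-- Normality of a frame in terms of a frame field. -/
theorem isWNormal_iff (hT : T.Geo (m + 1)) (hZ : T.IsFrameField (m + 1) U Z)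
    {y : T.Q (m + 1)} (hy : y ∈ U) {ζ : L →ₗ[ℝ] T.V (m + 1)} (hζ : T.IsLinearFrame (m + 1) y ζ)
    {W1 : ℤ → Submodule ℝ (oneCochain ℝ (gNeg 𝒜) L)}
    {W2 : ℤ → Submodule ℝ (twoCochain ℝ (gNeg 𝒜) L)} :
    T.IsWNormal W1 W2 (m + 1) y ζ ↔
      kap hZ hy + d₁₂ ℝ (gNeg 𝒜) L (fpart (m + 1) (Z y) ζ) ∈ W2 ((m + 1 : ℕ) : ℤ) ∧
      ∀ A ∈ Eplus 𝒜 (((m + 1 : ℕ) : ℤ) - 2),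
        tau hZ hy A - d₀ 𝒜 (gpart 𝒜 (m + 1) (Z y) ζ A) ∈ W1 (((m + 1 : ℕ) : ℤ) - 1) := by
  constructor
  · intro h
    obtain ⟨Z', hZ', hZy'⟩ := hZ.through hT hy hζ
    obtain ⟨⟨K, hK, hKk⟩, h2⟩ := h Z' ⟨⟨U, hZ', hy⟩, by rw [hZy']; exact FrameEquiv.refl y ζ⟩
    rw [isKappa_iff hT.filtered hZ' hy, kap_change hT hZ hZ' hy, hZy'] at hKk
    refine ⟨hKk ▸ hK, fun A hA => ?_⟩
    obtain ⟨t, ht, htt⟩ := h2 A hA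
    rw [isTau_iff hT.filtered hZ' hy, tau_change hT hZ hZ' hy hA, hZy'] at htt
    exact htt ▸ ht
  · rintro ⟨h1, h2⟩ Z' ⟨⟨U', hZ', hy'⟩, he⟩
    have hO := hZ.isOpen.inter hZ'.isOpen
    have r := hZ.mono hO Set.inter_subset_left
    have r' := hZ'.mono hO Set.inter_subset_right
    have hyO : y ∈ U ∩ U' := ⟨hy, hy'⟩
    refine ⟨⟨_, h1, (isKappa_iff hT.filtered r' hyO).2 ?_⟩, fun A hA => ⟨_, h2 A hA,
      (isTau_iff hT.filtered r' hyO).2 ?_⟩⟩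
    · have e : kap hZ hy = kap r hyO := rfl
      rw [kap_change hT r r' hyO, e, fpart_eq_of_frameEquiv hT (hZ.linear y hy) he]
    · have e : tau hZ hy A = tau r hyO A := rfl
      rw [tau_change hT r r' hyO hA, e,
        gpart_eq_of_frameEquiv (ζ₀ := Z y) hT he (eplus_le_filt _ hA)]

end Change

end Tower
end NormalProlongation


set_option linter.unusedSectionVars false

namespace NormalProlongation

open LieModule.Cohomology

/-! ### Linear algebra of the corrections -/

/-- A linear section of `W × S → W + d S` decomposes elements linearly. Linearity of the correction
is what makes corrected frames smooth in the base point. -/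
theorem exists_linear_correction {A B : Type*} [AddCommGroup A] [Module ℝ A] [AddCommGroup B]
    [Module ℝ B] (d : A →ₗ[ℝ] B) (W H : Submodule ℝ B) (S : Submodule ℝ A)
    (h : H ≤ W ⊔ S.map d) : ∃ P : B →ₗ[ℝ] A, ∀ b ∈ H, P b ∈ S ∧ b + d (P b) ∈ W := by
  let φ : (W × S) →ₗ[ℝ] B := (W.subtype).coprod (-(d ∘ₗ S.subtype))
  obtain ⟨g, hg⟩ := LinearMap.exists_rightInverse_of_surjective φ.rangeRestrict
    (LinearMap.range_eq_top.2 φ.surjective_rangeRestrict)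
  obtain ⟨P, hP⟩ := LinearMap.exists_extend (S.subtype ∘ₗ LinearMap.snd ℝ W S ∘ₗ g)
  refine ⟨P, fun b hb => ?_⟩
  have hb' : b ∈ LinearMap.range φ := by
    obtain ⟨w, hw, e, he, rfl⟩ := Submodule.mem_sup.1 (h hb)
    obtain ⟨s, hs, rfl⟩ := he
    exact ⟨(⟨w, hw⟩, -⟨s, hs⟩), by simp [φ]⟩
  have h1 : P b = ((g ⟨b, hb'⟩).2 : A) :=
    congrArg (fun F : LinearMap.range φ →ₗ[ℝ] A => F ⟨b, hb'⟩) hP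
  have h2 : φ (g ⟨b, hb'⟩) = b := congrArg Subtype.val
    (congrArg (fun F : LinearMap.range φ →ₗ[ℝ] LinearMap.range φ => F ⟨b, hb'⟩) hg)
  rw [h1]
  refine ⟨(g ⟨b, hb'⟩).2.2, ?_⟩
  have h3 : b + d ((g ⟨b, hb'⟩).2 : A) = ((g ⟨b, hb'⟩).1 : B) := by
    have h4 : φ (g ⟨b, hb'⟩) = ((g ⟨b, hb'⟩).1 : B) - d ((g ⟨b, hb'⟩).2 : A) := by
      simp [φ, LinearMap.coprod_apply, sub_eq_add_neg]
    rw [h4] at h2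
    nth_rewrite 1 [← h2]
    abel
  rw [h3]
  exact (g ⟨b, hb'⟩).1.2

/-- A linear functional on a subspace separated by finitely many functionals is a combination of
these. -/
theorem exists_functional_eq_sum {B : Type*} [AddCommGroup B] [Module ℝ B] {I : Type*} [Fintype I]
    (H : Submodule ℝ B) (J : I → B →ₗ[ℝ] ℝ) (hJ : ∀ b ∈ H, (∀ i, J i b = 0) → b = 0)
    (φ : B →ₗ[ℝ] ℝ) : ∃ a : I → ℝ, ∀ b ∈ H, φ b = ∑ i, a i * J i b := by
  classical
  let J' : H →ₗ[ℝ] (I → ℝ) := (LinearMap.pi J) ∘ₗ H.subtype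
  have hker : LinearMap.ker J' = ⊥ := by
    rw [LinearMap.ker_eq_bot']
    intro b hb
    exact Subtype.ext (hJ b b.2 fun i => congrFun hb i)
  obtain ⟨g, hg⟩ := LinearMap.exists_leftInverse_of_injective J' hker
  refine ⟨fun i => φ (g (Pi.single i 1)), fun b hb => ?_⟩
  have h1 : g (J' ⟨b, hb⟩) = ⟨b, hb⟩ := congrArg (fun F : H →ₗ[ℝ] H => F ⟨b, hb⟩) hg
  have h2 : J' ⟨b, hb⟩ = ∑ i, J i b • (Pi.single i 1 : I → ℝ) := by
    funext i
    simp [J', Finset.sum_apply, Pi.single_apply]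
  calc φ b = φ (g (J' ⟨b, hb⟩)) := by rw [h1]
    _ = _ := by
      rw [h2]
      simp only [map_sum, map_smul, Submodule.coe_sum, Submodule.coe_smul, smul_eq_mul]
      exact Finset.sum_congr rfl fun i _ => mul_comm _ _

variable {L : Type v} [LieRing L] [LieAlgebra ℝ L] {𝒜 : ℤ → Submodule ℝ L}
  [GradedLieAlgebra 𝒜] {k : ℕ} [htr : Fact (IsTransitive 𝒜)]

theorem eq_zero_of_d₀_eq_zero {i : ℤ} (hi : 0 ≤ i) {A : L} (hA : A ∈ 𝒜 i) (h : d₀ 𝒜 A = 0) : A = 0 := by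
  refine htr.out.trans i hi A hA fun v => ?_
  have h1 : ⁅(v : L), A⁆ = 0 := congrArg (fun F : oneCochain ℝ (gNeg 𝒜) L => F v) h
  rw [← lie_skew, h1, neg_zero]

namespace Tower

variable {𝒯 : StructureType.{u} 𝒜 k} {T : Tower 𝒯}

theorem frameEquiv_of_homogeneous {n : ℕ} (hT : T.IsFilteredManifold) {y : T.Q n}
    {ζ ζ' : L →ₗ[ℝ] T.V n} (h : ∀ i : ℤ, ∀ x ∈ 𝒜 i, ζ' x - ζ x ∈ T.tanFilt n (i + n + 1) y) :
    T.FrameEquiv n y ζ ζ' := by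
  intro p x hx
  have : filt 𝒜 p ≤ (T.tanFilt n (p + n + 1) y).comap (ζ' - ζ) := filt_induction fun i hi x hx =>
    tanFilt_anti hT y (by omega) (h i x hx)
  exact this hx

theorem IsLinearFrame.frameEquiv_comp {n : ℕ} {y : T.Q n}
    {ζ : L →ₗ[ℝ] T.V n} (h : T.IsLinearFrame n y ζ) {α β : L →ₗ[ℝ] L} (hab : RepEquiv 𝒜 n α β) :
    T.FrameEquiv n y (ζ ∘ₗ α) (ζ ∘ₗ β) := by
  intro p x hx
  have h1 := neg_mem (hab p x hx)
  rw [LinearMap.comp_apply, LinearMap.comp_apply, ← map_sub, ← neg_sub]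
  rcases le_total (p + n + 1 : ℤ) n with hle | hle
  · rw [min_eq_left hle] at h1
    exact h.apply_mem h1
  · rw [min_eq_right hle] at h1
    rw [h.apply_eq_zero_iff.2 h1]; exact zero_mem _

theorem IsLinearFrame.repEquiv_of_frameEquiv {n : ℕ} (hT : T.IsFilteredManifold) {y : T.Q n}
    {ζ : L →ₗ[ℝ] T.V n} (h : T.IsLinearFrame n y ζ) {α β : L →ₗ[ℝ] L}
    (hab : T.FrameEquiv n y (ζ ∘ₗ α) (ζ ∘ₗ β)) : RepEquiv 𝒜 n α β := by
  intro p x hx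
  have h1 := hab.symm p x hx
  rw [LinearMap.comp_apply, LinearMap.comp_apply, ← map_sub] at h1
  rcases le_total (p + n + 1 : ℤ) n with hle | hle
  · rw [min_eq_left hle]
    exact (h.mem_iff hle).1 h1
  · rw [min_eq_right hle]
    rw [tanFilt_eq_bot hT _ hle, Submodule.mem_bot] at h1
    exact h.apply_eq_zero_iff.1 h1

/-- A point of `Q (n + 1)` is determined by its class of frames. -/
theorem Geo.eq_of_mem_frames {n : ℕ} (hT : T.Geo (n + 1)) {z z' : T.Q (n + 1)}
    (hπ : T.π n z = T.π n z') {ζ : L →ₗ[ℝ] T.V n} (h : ζ ∈ T.frames n z) (h' : ζ ∈ T.frames n z') :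
    z = z' := by
  have hred := hT.reduction n (Nat.lt_succ_self n)
  obtain ⟨a, rfl⟩ := hred.transitive z z' hπ
  have h1 := hT.frameEquiv_of_mem (hred.frames_act z a ζ h) h'
  rw [hred.π_act] at h1
  have h2 : RepEquiv 𝒜 n (𝒯.rho n a) LinearMap.id :=
    (hT.isLinearFrame_of_mem h).repEquiv_of_frameEquiv hT.filtered h1
  rw [𝒯.rho_inj n a h2, hred.act_one]

/-! #### Normal frames -/

theorem IsLinearFrame.comp_one_add_ad {m : ℕ} (hT : T.Geo (m + 1)) {y : T.Q (m + 1)}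
    {ζ : L →ₗ[ℝ] T.V (m + 1)} (h : T.IsLinearFrame (m + 1) y ζ) {A : L}
    (hA : A ∈ 𝒜 ((m + 1 : ℕ) : ℤ)) :
    T.IsLinearFrame (m + 1) y (ζ ∘ₗ (LinearMap.id + (LieAlgebra.ad ℝ L A : L →ₗ[ℝ] L))) := by
  have e : ζ ∘ₗ (LinearMap.id + (LieAlgebra.ad ℝ L A : L →ₗ[ℝ] L)) =
      ζ + ζ ∘ₗ (LieAlgebra.ad ℝ L A : L →ₗ[ℝ] L) := by
    rw [LinearMap.comp_add, LinearMap.comp_id]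
  rw [e]
  have key : ∀ p : ℤ, ∀ x ∈ filt 𝒜 p, (ζ ∘ₗ (LieAlgebra.ad ℝ L A : L →ₗ[ℝ] L)) x ∈
      T.tanFilt (m + 1) (((m + 1 : ℕ) : ℤ) + p) y := fun p x hx =>
    h.apply_mem (lie_mem_filt (mem_filt_of_mem le_rfl hA) hx)
  exact h.add_of_raising hT
    (fun p x hx => tanFilt_anti hT.filtered y (by push_cast; omega) (key p x hx))
    (fun p x hx => tanFilt_anti hT.filtered y (by push_cast; omega) (key p x hx))

variable {W1 : ℤ → Submodule ℝ (oneCochain ℝ (gNeg 𝒜) L)}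
  {W2 : ℤ → Submodule ℝ (twoCochain ℝ (gNeg 𝒜) L)}

theorem fpart_comp_one_add_ad {m : ℕ} (hT : T.Geo (m + 1)) {y : T.Q (m + 1)}
    {ζ : L →ₗ[ℝ] T.V (m + 1)} (h : T.IsLinearFrame (m + 1) y ζ) {A : L}
    (hA : A ∈ 𝒜 ((m + 1 : ℕ) : ℤ)) {p : ℤ} (hp : p < 0) {v : gNeg 𝒜} (hv : (v : L) ∈ 𝒜 p) :
    (fpart (m + 1) ζ (ζ ∘ₗ (LinearMap.id + (LieAlgebra.ad ℝ L A : L →ₗ[ℝ] L))) :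
      oneCochain ℝ (gNeg 𝒜) L) v = ⁅A, (v : L)⁆ := by
  unfold fpart
  rw [homPart1_apply hv]
  have e : (frInv ζ ∘ₗ (ζ ∘ₗ (LinearMap.id + (LieAlgebra.ad ℝ L A : L →ₗ[ℝ] L)) - ζ)) (v : L) =
      frInv ζ (ζ ⁅A, (v : L)⁆) := by
    simp
  rw [e, h.hc_frInv hT.filtered (by omega) rfl, add_comm, hc_of_mem (lie_mem_deg hA hv)]

/-- The normal frames at a point form a torsor under `𝔤_n`. -/
theorem isWNormal_iff_of_isWNormal (hprol : IsProlongation 𝒜 k)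
    (hW : IsComplementSystem 𝒜 k W1 W2) {m : ℕ} (hk : k ≤ m) (hT : T.Geo (m + 1)) {y : T.Q (m + 1)}
    {ζ₀ ζ : L →ₗ[ℝ] T.V (m + 1)} (h₀ : T.IsLinearFrame (m + 1) y ζ₀)
    (hn₀ : T.IsWNormal W1 W2 (m + 1) y ζ₀) (h : T.IsLinearFrame (m + 1) y ζ) :
    T.IsWNormal W1 W2 (m + 1) y ζ ↔ ∃ A ∈ 𝒜 ((m + 1 : ℕ) : ℤ), T.FrameEquiv (m + 1) y
      (ζ₀ ∘ₗ (LinearMap.id + (LieAlgebra.ad ℝ L A : L →ₗ[ℝ] L))) ζ := by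
  obtain ⟨U, Z₀, hZ₀, hy⟩ := hT.exists_isFrameField y
  obtain ⟨Z, hZ, hZy⟩ := hZ₀.through hT hy h₀
  rw [isWNormal_iff hT hZ hy h₀, hZy] at hn₀
  have hf0 : (fpart (m + 1) ζ₀ ζ₀ : oneCochain ℝ (gNeg 𝒜) L) = 0 := by simp [fpart, homPart1]
  have hg0 : ∀ A, gpart 𝒜 (m + 1) ζ₀ ζ₀ A = 0 := fun A => by simp [gpart]
  simp only [hf0, hg0, map_zero, add_zero, sub_zero] at hn₀
  rw [isWNormal_iff hT hZ hy h, hZy]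
  constructor
  · rintro ⟨h1, h2⟩
    have hfm : (fpart (m + 1) ζ₀ ζ : oneCochain ℝ (gNeg 𝒜) L) ∈ hom1 𝒜 ((m + 1 : ℕ) : ℤ) :=
      homPart1_mem _ _
    -- Both values of κ lie in W², hence so does their difference ∂f, which also lies in the
    -- complement of W².
    have hdf : d₁₂ ℝ (gNeg 𝒜) L (fpart (m + 1) ζ₀ ζ) = 0 := by
      have h3 : d₁₂ ℝ (gNeg 𝒜) L (fpart (m + 1) ζ₀ ζ) ∈ W2 ((m + 1 : ℕ) : ℤ) := by
        have h4 := Submodule.add_mem _ h1 (Submodule.smul_mem _ (-1 : ℝ) hn₀.1)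
        have e : kap hZ hy + d₁₂ ℝ (gNeg 𝒜) L (fpart (m + 1) ζ₀ ζ) + (-1 : ℝ) • kap hZ hy =
            d₁₂ ℝ (gNeg 𝒜) L (fpart (m + 1) ζ₀ ζ) := twoCochain_ext fun p q _ _ v w _ _ => by
          change kap hZ hy v w + d₁₂ ℝ (gNeg 𝒜) L (fpart (m + 1) ζ₀ ζ) v w +
            (-1 : ℝ) • kap hZ hy v w = _
          module
        rwa [e] at h4
      have h4 := hW.inf2 m (by exact_mod_cast hk)
      have h5 : d₁₂ ℝ (gNeg 𝒜) L (fpart (m + 1) ζ₀ ζ) ∈ W2 ((m : ℤ) + 1) ⊓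
          (hom1 𝒜 ((m : ℤ) + 1)).map (d₁₂ ℝ (gNeg 𝒜) L) := by
        refine ⟨by exact_mod_cast h3, ⟨_, by exact_mod_cast hfm, rfl⟩⟩
      rwa [h4, Submodule.mem_bot] at h5
    -- The same argument with W¹ gives ∂(g(A)) = 0, and ∂ is injective on 𝔤_m by transitivity.
    have hgz : ∀ A ∈ Eplus 𝒜 (((m + 1 : ℕ) : ℤ) - 2), gpart 𝒜 (m + 1) ζ₀ ζ A = 0 := by
      intro A hA
      have hgm : gpart 𝒜 (m + 1) ζ₀ ζ A ∈ 𝒜 (((m + 1 : ℕ) : ℤ) - 1) := hc_mem 𝒜 _ _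
      have h3 : d₀ 𝒜 (gpart 𝒜 (m + 1) ζ₀ ζ A) ∈ W1 (((m + 1 : ℕ) : ℤ) - 1) := by
        have := _root_.sub_mem (hn₀.2 A hA) (h2 A hA)
        rwa [sub_sub_cancel] at this
      have h4 := hW.inf1 (((m + 1 : ℕ) : ℤ) - 1) (by push_cast; omega)
      have h5 : d₀ 𝒜 (gpart 𝒜 (m + 1) ζ₀ ζ A) ∈ W1 (((m + 1 : ℕ) : ℤ) - 1) ⊓
          (𝒜 (((m + 1 : ℕ) : ℤ) - 1)).map (d₀ 𝒜) := ⟨h3, ⟨_, hgm, rfl⟩⟩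
      rw [h4, Submodule.mem_bot] at h5
      exact eq_zero_of_d₀_eq_zero (by push_cast; omega) hgm h5
    -- A cocycle is a derivation; in degree `m + 1 > k` the prolongation property makes it `ad A`.
    obtain ⟨A, hA, hfA⟩ := hprol ((m + 1 : ℕ) : ℤ) (by push_cast; omega) _ hfm (fun a b => by
      have h3 := congrArg (fun F : twoCochain ℝ (gNeg 𝒜) L => F a b) hdf
      have h4 : d₁₂ ℝ (gNeg 𝒜) L (fpart (m + 1) ζ₀ ζ) a b = 0 := h3
      rw [d₁₂_apply_apply, LieSubalgebra.coe_bracket_of_module,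
        LieSubalgebra.coe_bracket_of_module, _root_.sub_eq_zero] at h4
      rw [← h4, ← lie_skew (b : L)]
      abel)
    -- Congruence is checked degree by degree. Negative degrees are settled by `f = ad A`, degrees
    -- `0` to `m - 1` by `g = 0`, and from degree `m` on the frames agree anyway.
    refine ⟨A, hA, frameEquiv_of_homogeneous hT.filtered fun i x hx => ?_⟩
    have e : ζ x - (ζ₀ ∘ₗ (LinearMap.id + (LieAlgebra.ad ℝ L A : L →ₗ[ℝ] L))) x =
        ζ₀ (frInv ζ₀ (ζ x - ζ₀ x) - ⁅A, x⁆) := by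
      rw [map_sub, h₀.apply_frInv hT.filtered]
      simp only [LinearMap.comp_apply, LinearMap.add_apply, LinearMap.id_apply, map_add,
        LieAlgebra.ad_apply]
      abel
    rw [e]
    have hu := h₀.frInv_sub_mem hT h (mem_filt_of_mem le_rfl hx)
    rcases lt_or_ge i 0 with hi | hi
    · refine h₀.apply_mem ?_
      let v : gNeg 𝒜 := ⟨x, mem_gNeg_of_mem hi hx⟩
      have h3 := hfA v
      have h4 : (fpart (m + 1) ζ₀ ζ : oneCochain ℝ (gNeg 𝒜) L) v =
          hc 𝒜 (i + ((m + 1 : ℕ) : ℤ)) (frInv ζ₀ (ζ x - ζ₀ x)) := homPart1_apply (v := v) hx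
      rw [h3] at h4
      have h5 := sub_hc_mem_filt (p := i + ((m + 1 : ℕ) : ℤ)) (filt_anti (by push_cast; omega) hu)
      rw [← h4] at h5
      exact h5
    · have hz : ζ₀ ⁅A, x⁆ = 0 := h₀.apply_eq_zero_iff.2
        (mem_filt_of_mem (by omega) (lie_mem_deg hA hx))
      have hz2 : ζ₀ (frInv ζ₀ (ζ x - ζ₀ x)) = 0 := by
        rcases lt_or_ge i m with him | him
        · rw [h₀.apply_eq_zero_iff]
          have h3 : x ∈ Eplus 𝒜 (((m + 1 : ℕ) : ℤ) - 2) :=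
            Submodule.mem_iSup_of_mem i (Submodule.mem_iSup_of_mem ⟨hi, by push_cast; omega⟩ hx)
          have h4 := hgz x h3
          have h5 := sub_hc_mem_filt (p := (m : ℤ)) (filt_anti (by omega) hu)
          have h6 : hc 𝒜 (((m + 1 : ℕ) : ℤ) - 1) (frInv ζ₀ (ζ x - ζ₀ x)) = 0 := h4
          rw [show ((m + 1 : ℕ) : ℤ) - 1 = m by push_cast; ring] at h6
          rw [h6, sub_zero] at h5
          exact_mod_cast h5
        · rw [h₀.apply_frInv hT.filtered]
          exact h₀.sub_eq_zero hT h (mem_filt_of_mem him hx)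
      rw [map_sub, hz, hz2, sub_zero]
      exact zero_mem _
  · rintro ⟨A, hA, he⟩
    -- Conversely, `ad A` is a cocycle by the Jacobi identity, and it sends E_+ into `F^{m+1}`,
    -- which the frame kills.
    have hf : d₁₂ ℝ (gNeg 𝒜) L (fpart (m + 1) ζ₀ ζ) = 0 := by
      rw [← fpart_eq_of_frameEquiv hT h₀ he]
      refine twoCochain_ext fun p q hp hq X Y hX hY => ?_
      have hXY : ((⁅X, Y⁆ : gNeg 𝒜) : L) ∈ 𝒜 (p + q) := lie_mem_deg hX hY
      rw [d₁₂_apply_apply, fpart_comp_one_add_ad hT h₀ hA hp hX,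
        fpart_comp_one_add_ad hT h₀ hA hq hY, fpart_comp_one_add_ad hT h₀ hA (by omega) hXY,
        LieSubalgebra.coe_bracket_of_module, LieSubalgebra.coe_bracket_of_module,
        LieSubalgebra.coe_bracket, leibniz_lie A, ← lie_skew (Y : L)]
      change _ = (0 : L)
      abel
    refine ⟨by rw [hf, add_zero]; exact hn₀.1, fun B hB => ?_⟩
    have hg : gpart 𝒜 (m + 1) ζ₀ ζ B = 0 := by
      have hB0 := eplus_le_filt _ hB
      rw [← gpart_eq_of_frameEquiv hT he hB0]
      have h1 : ζ₀ ⁅A, B⁆ = 0 := h₀.apply_eq_zero_iff.2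
        (filt_anti (by omega) (lie_mem_filt (mem_filt_of_mem le_rfl hA) hB0))
      simp only [gpart, LinearMap.comp_apply, LinearMap.sub_apply, LinearMap.add_apply,
        LinearMap.id_apply, map_add, LieAlgebra.ad_apply, h1, add_zero, sub_self, map_zero]
    rw [hg, map_zero, sub_zero]
    exact hn₀.2 B hB

theorem IsFrameReduction.exists_π_eq {n : ℕ} (h : T.IsFrameReduction n) (y : T.Q n) :
    ∃ z, T.π n z = y := by
  obtain ⟨U, s, δ, -, hy, -, hs, -⟩ := h.locallyTrivial y
  exact ⟨s y, hs y hy⟩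

/-- The `W`-normal frames are exactly those of the bundle. -/
theorem isWNormal_iff_exists_mem_frames (hprol : IsProlongation 𝒜 k)
    (hW : IsComplementSystem 𝒜 k W1 W2) {m : ℕ} (hk : k ≤ m) (hT : T.Geo (m + 1 + 1))
    (hn : ∀ z : T.Q (m + 1 + 1), ∀ ζ ∈ T.frames (m + 1) z,
      T.IsWNormal W1 W2 (m + 1) (T.π (m + 1) z) ζ)
    {y : T.Q (m + 1)} {ζ : L →ₗ[ℝ] T.V (m + 1)} (h : T.IsLinearFrame (m + 1) y ζ) :
    T.IsWNormal W1 W2 (m + 1) y ζ ↔ ∃ z, T.π (m + 1) z = y ∧ ζ ∈ T.frames (m + 1) z := by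
  constructor
  swap
  · rintro ⟨z, rfl, hz⟩
    exact hn z ζ hz
  intro hζ
  have hred := hT.reduction (m + 1) (Nat.lt_succ_self _)
  obtain ⟨z₀, rfl⟩ := hred.exists_π_eq y
  obtain ⟨ζ₀, hζ₀⟩ := hred.frames_nonempty z₀
  have hl := hT.isLinearFrame_of_mem hζ₀
  obtain ⟨A, hA, he⟩ := (isWNormal_iff_of_isWNormal hprol hW hk (hT.mono (by omega)) hl
    (hn z₀ ζ₀ hζ₀) h).1 hζ
  obtain ⟨e, he1, -⟩ := 𝒯.vector (m + 1) (by omega)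
  refine ⟨T.act (m + 1) z₀ (e ⟨A, hA⟩).toMul, hred.π_act _ _, ?_⟩
  refine hT.mem_frames_of_frameEquiv (hred.frames_act z₀ (e ⟨A, hA⟩).toMul ζ₀ hζ₀) ?_
  rw [hred.π_act]
  exact (hl.frameEquiv_comp (he1 ⟨A, hA⟩)).trans he

end Tower
end NormalProlongation


set_option linter.unusedSectionVars false

namespace NormalProlongation

open LieModule.Cohomology

/-- The same with a subtype as target, the form in which two-cochains occur. -/
theorem exists_linear_correction_subtype {A B : Type*} [AddCommGroup A] [Module ℝ A]
    [AddCommGroup B] [Module ℝ B] (C : Submodule ℝ B) (d : A →ₗ[ℝ] C) (W H : Submodule ℝ C)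
    (S : Submodule ℝ A) (h : H ≤ W ⊔ S.map d) :
    ∃ P : C →ₗ[ℝ] A, ∀ b ∈ H, P b ∈ S ∧ b + d (P b) ∈ W :=
  exists_linear_correction d W H S h

theorem exists_functional_eq_sum_subtype {B : Type*} [AddCommGroup B] [Module ℝ B] {I : Type*}
    [Fintype I] (C : Submodule ℝ B) (H : Submodule ℝ C) (J : I → C →ₗ[ℝ] ℝ)
    (hJ : ∀ b ∈ H, (∀ i, J i b = 0) → (b : B) = 0) (φ : C →ₗ[ℝ] ℝ) :
    ∃ a : I → ℝ, ∀ b ∈ H, φ b = ∑ i, a i * J i b :=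
  exists_functional_eq_sum H J (fun b hb h => Subtype.ext (hJ b hb h)) φ

variable {L : Type v} [LieRing L] [LieAlgebra ℝ L] {𝒜 : ℤ → Submodule ℝ L}
  [GradedLieAlgebra 𝒜] {k : ℕ} [htr : Fact (IsTransitive 𝒜)]

/-! ### Local normal frame fields -/

namespace HomBasis

variable {n : ℤ} (β : HomBasis 𝒜 n)

open Classical in
/-- The element of `𝔤₋` given by a basis vector of negative degree. -/
noncomputable def nb (j : β.ι) : gNeg 𝒜 :=
  if h : β.deg j < 0 then ⟨β.b j, mem_gNeg_of_mem h (β.mem j)⟩ else 0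

theorem nb_coe {j : β.ι} (h : β.deg j < 0) : (β.nb j : L) = β.b j := by
  rw [nb, dif_pos h]

theorem nb_mem (j : β.ι) : (β.nb j : L) ∈ 𝒜 (β.deg j) := by
  unfold nb
  split_ifs
  · exact β.mem j
  · exact zero_mem _

theorem sum_nb {p : ℤ} (hp : p < 0) (hpn : p < n) {v : gNeg 𝒜} (hv : (v : L) ∈ 𝒜 p) :
    ∑ j, β.c j v • β.nb j = v := by
  have h : negIncl 𝒜 (∑ j, β.c j v • β.nb j) = negIncl 𝒜 v := by
    rw [map_sum]
    conv_rhs => rw [negIncl_apply, β.eq_sum_of_mem hpn hv]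
    refine Finset.sum_congr rfl fun j _ => ?_
    rw [map_smul, negIncl_apply]
    by_cases hj : β.deg j = p
    · rw [β.nb_coe (by omega)]
    · rw [β.c_eq_zero_of_mem hv hj, zero_smul, zero_smul]
  exact Subtype.ext h

end HomBasis

namespace Tower

variable {𝒯 : StructureType.{u} 𝒜 k} {T : Tower 𝒯}
  {W1 : ℤ → Submodule ℝ (oneCochain ℝ (gNeg 𝒜) L)}
  {W2 : ℤ → Submodule ℝ (twoCochain ℝ (gNeg 𝒜) L)}

/-- The linear map with prescribed values `ζ (u j)` on a homogeneous basis. -/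
noncomputable def corr {n : ℤ} (β : HomBasis 𝒜 n) {V : Type*} [AddCommGroup V] [Module ℝ V]
    (ζ : L →ₗ[ℝ] V) (u : β.ι → L) : L →ₗ[ℝ] V :=
  ∑ j, (β.c j).smulRight (ζ (u j))

theorem corr_apply {n : ℤ} (β : HomBasis 𝒜 n) {V : Type*} [AddCommGroup V] [Module ℝ V]
    (ζ : L →ₗ[ℝ] V) (u : β.ι → L) (x : L) : corr β ζ u x = ζ (∑ j, β.c j x • u j) := by
  simp [corr, map_sum]

section

variable {m : ℕ} {U : Set (T.Q (m + 1))} {Z : T.Q (m + 1) → L →ₗ[ℝ] T.V (m + 1)}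

theorem IsLinearFrame.add_corr (hT : T.Geo (m + 1)) {y : T.Q (m + 1)}
    {ζ : L →ₗ[ℝ] T.V (m + 1)} (h : T.IsLinearFrame (m + 1) y ζ)
    (β : HomBasis 𝒜 ((m + 1 : ℕ) : ℤ)) {u : β.ι → L} (h1 : ∀ j, u j ∈ filt 𝒜 (β.deg j + 1))
    (h2 : ∀ j, u j ∈ filt 𝒜 (min (β.deg j + m + 1) m)) :
    T.IsLinearFrame (m + 1) y (ζ + corr β ζ u) := by
  -- On `F^p` the coordinates of degree below `p` vanish, so any monotone degree bound passes from
  -- the basis to the whole map. Both bounds of `add_of_raising` are obtained in this way.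
  have key : ∀ (g : ℤ → ℤ), Monotone g → (∀ j, u j ∈ filt 𝒜 (g (β.deg j))) → ∀ p : ℤ,
      ∀ x ∈ filt 𝒜 p, corr β ζ u x ∈ T.tanFilt (m + 1) (g p) y := by
    intro g hg hu p x hx
    rw [corr_apply]
    refine h.apply_mem (Submodule.sum_mem _ fun j _ => ?_)
    by_cases hj : β.deg j < p
    · rw [β.c_eq_zero_of_filt hx hj, zero_smul]; exact zero_mem _
    · exact Submodule.smul_mem _ _ (filt_anti (hg (not_lt.1 hj)) (hu j))
  exact h.add_of_raising hT (key (fun p => p + 1) (fun a b hab => by dsimp; omega) h1)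
    (key (fun p => min (p + m + 1) m) (fun a b hab => by dsimp; omega) h2)

theorem IsFrameField.add_corr (hT : T.Geo (m + 1)) (hZ : T.IsFrameField (m + 1) U Z)
    (β : HomBasis 𝒜 ((m + 1 : ℕ) : ℤ)) {u : β.ι → T.Q (m + 1) → L}
    (h1 : ∀ j, ∀ y ∈ U, u j y ∈ filt 𝒜 (β.deg j + 1))
    (h2 : ∀ j, ∀ y ∈ U, u j y ∈ filt 𝒜 (min (β.deg j + m + 1) m))
    (hs : ∀ j i, ∀ y ∈ U, SmoothAt (E := ℝ) (F := T.V (m + 1)) (fun y => β.c i (u j y)) y) :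
    T.IsFrameField (m + 1) U (fun y => Z y + corr β (Z y) fun j => u j y) := by
  refine ⟨hZ.isOpen, fun y hy => (hZ.linear y hy).add_corr hT β (fun j => h1 j y hy)
    (fun j => h2 j y hy), fun x => (smoothFieldOn_iff T hZ.isOpen).2 fun y hy => ?_⟩
  refine (hZ.smoothAt x hy).add ?_
  refine SmoothAlongAt.congr (v := fun y => ∑ j, β.c j x • ∑ i, β.c i (u j y) • Z y (β.b i)) ?_ ?_
  · exact SmoothAlongAt.sum _ contMDiffAt_id fun j _ => SmoothAlongAt.const_smul _
      (SmoothAlongAt.sum _ contMDiffAt_id fun i _ => SmoothAlongAt.smul (hs j i y hy)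
        (hZ.smoothAt _ hy))
  · filter_upwards [hZ.isOpen.mem_nhds hy] with z hz
    rw [corr_apply, map_sum]
    refine Finset.sum_congr rfl fun j _ => ?_
    rw [map_smul, ← (hZ.linear z hz).apply_eq_sum β]

-- On cochains of a fixed degree, every functional is a finite combination of matrix coefficients.
-- Those of κ are frame coefficients of brackets of smooth frame fields, or zero for reasons of
-- degree. The value `0` outside `U` is only a default.
open Classical in
theorem smoothAt_functional_kap (hT : T.Geo (m + 1)) (hZ : T.IsFrameField (m + 1) U Z)
    (β : HomBasis 𝒜 ((m + 1 : ℕ) : ℤ)) (φ : twoCochain ℝ (gNeg 𝒜) L →ₗ[ℝ] ℝ)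
    {y : T.Q (m + 1)} (hy : y ∈ U) : SmoothAt (E := ℝ) (F := T.V (m + 1))
      (fun x => φ (if h : x ∈ U then kap hZ h else 0)) y := by
  let J : β.ι × β.ι × β.ι → twoCochain ℝ (gNeg 𝒜) L →ₗ[ℝ] ℝ := fun t =>
    { toFun := fun K => β.c t.2.2 (K (β.nb t.1) (β.nb t.2.1))
      map_add' := fun K K' => map_add (β.c t.2.2) _ _
      map_smul' := fun a K => map_smul (β.c t.2.2) _ _ }
  obtain ⟨a, ha⟩ := exists_functional_eq_sum_subtype _ (hom2 𝒜 ((m + 1 : ℕ) : ℤ)) J (fun K hK hJ => by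
    refine congrArg Subtype.val (?_ : K = 0)
    refine twoCochain_ext fun p q hp hq v w hv hw => ?_
    have h0 : ∀ i j, K (β.nb i) (β.nb j) = 0 := by
      intro i j
      by_cases hi : 0 ≤ β.deg i
      · rw [gNeg_eq_zero hi (β.nb_mem i)]; exact congrArg (fun f : gNeg 𝒜 →ₗ[ℝ] L => f _) (map_zero K.1)
      by_cases hj : 0 ≤ β.deg j
      · rw [gNeg_eq_zero hj (β.nb_mem j)]; exact map_zero (K.1 _)
      rw [β.eq_sum_of_mem (by omega) (hK _ _ _ _ (β.nb_mem i) (β.nb_mem j))]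
      exact Finset.sum_eq_zero fun l _ => by
        have : β.c l (K (β.nb i) (β.nb j)) = 0 := hJ (i, j, l)
        rw [this, zero_smul]
    have h1 : (K.1 v) w = 0 := by
      rw [← β.sum_nb hp (by omega) hv, ← β.sum_nb hq (by omega) hw]
      simp only [map_sum, LinearMap.sum_apply, map_smul, LinearMap.smul_apply]
      refine Finset.sum_eq_zero fun j _ => ?_
      rw [Finset.sum_eq_zero fun i _ => ?_, smul_zero]
      have h2 : (K.1 (β.nb i)) (β.nb j) = 0 := h0 i j
      rw [h2, smul_zero]
    exact h1) φ
  have hsm : SmoothAt (E := ℝ) (F := T.V (m + 1)) (fun x => ∑ t, a t *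
      (if β.deg t.2.2 = β.deg t.1 + β.deg t.2.1 + ((m + 1 : ℕ) : ℤ) then
        β.c t.2.2 (frInv (Z x) (lieB (fun x => Z x (β.nb t.1 : L)) (fun x => Z x (β.nb t.2.1 : L)) x))
        else 0)) y := by
    refine ContMDiffAt.sum fun t _ => contMDiffAt_const.mul ?_
    split_ifs
    · exact hZ.smoothAt_coeff hT.filtered β (f := fun x => x) hy
        (smoothFieldAt_lieB (hZ.smoothAt _ hy) (hZ.smoothAt _ hy)) _
    · exact contMDiffAt_const
  refine hsm.congr_of_eventuallyEq ?_
  filter_upwards [hZ.isOpen.mem_nhds hy] with x hx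
  rw [dif_pos hx, ha _ (kap_mem hZ hx)]
  refine Finset.sum_congr rfl fun t _ => congrArg _ ?_
  change β.c t.2.2 (kap hZ hx (β.nb t.1) (β.nb t.2.1)) = _
  rw [kap_apply hZ hx (β.nb_mem t.1) (β.nb_mem t.2.1)]
  split_ifs with hd
  · rw [← gam_apply hZ hx, β.c_hc t.2.2 (gam hZ hx _ _), hd]
  · exact β.c_eq_zero_of_mem (hc_mem 𝒜 _ _) hd

open Classical in
theorem smoothAt_functional_tau (hT : T.Geo (m + 1)) (hZ : T.IsFrameField (m + 1) U Z)
    (β : HomBasis 𝒜 ((m + 1 : ℕ) : ℤ)) (φ : oneCochain ℝ (gNeg 𝒜) L →ₗ[ℝ] ℝ) (A : L)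
    {y : T.Q (m + 1)} (hy : y ∈ U) : SmoothAt (E := ℝ) (F := T.V (m + 1))
      (fun x => φ (if h : x ∈ U then tau hZ h A else 0)) y := by
  let J : β.ι × β.ι → oneCochain ℝ (gNeg 𝒜) L →ₗ[ℝ] ℝ := fun t =>
    { toFun := fun K => β.c t.2 (K (β.nb t.1))
      map_add' := fun K K' => map_add (β.c t.2) _ _
      map_smul' := fun a K => map_smul (β.c t.2) _ _ }
  obtain ⟨a, ha⟩ := exists_functional_eq_sum (hom1 𝒜 (((m + 1 : ℕ) : ℤ) - 1)) J (fun K hK hJ => by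
    refine oneCochain_ext fun p hp v hv => ?_
    have h0 : ∀ i, K (β.nb i) = 0 := by
      intro i
      by_cases hi : 0 ≤ β.deg i
      · rw [gNeg_eq_zero hi (β.nb_mem i), map_zero]
      rw [β.eq_sum_of_mem (by omega) (hK _ _ (β.nb_mem i))]
      exact Finset.sum_eq_zero fun l _ => by
        have : β.c l (K (β.nb i)) = 0 := hJ (i, l)
        rw [this, zero_smul]
    change K v = (0 : L)
    rw [← β.sum_nb hp (by omega) hv]
    simp only [map_sum, map_smul, h0, smul_zero, Finset.sum_const_zero]) φ
  have hsm : SmoothAt (E := ℝ) (F := T.V (m + 1)) (fun x => ∑ t, a t *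
      (if β.deg t.2 = β.deg t.1 + ((m + 1 : ℕ) : ℤ) - 1 then
        β.c t.2 (frInv (Z x) (lieB (fun x => Z x A) (fun x => Z x (β.nb t.1 : L)) x))
        else 0)) y := by
    refine ContMDiffAt.sum fun t _ => contMDiffAt_const.mul ?_
    split_ifs
    · exact hZ.smoothAt_coeff hT.filtered β (f := fun x => x) hy
        (smoothFieldAt_lieB (hZ.smoothAt _ hy) (hZ.smoothAt _ hy)) _
    · exact contMDiffAt_const
  refine hsm.congr_of_eventuallyEq ?_
  filter_upwards [hZ.isOpen.mem_nhds hy] with x hx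
  rw [dif_pos hx, ha _ (tau_mem hZ hx A)]
  refine Finset.sum_congr rfl fun t _ => congrArg _ ?_
  change β.c t.2 (tau hZ hx A (β.nb t.1)) = _
  rw [tau_apply hZ hx A (β.nb_mem t.1)]
  split_ifs with hd
  · rw [← gam_apply hZ hx, β.c_hc t.2 (gam hZ hx _ _), hd]
  · exact β.c_eq_zero_of_mem (hc_mem 𝒜 _ _) hd

theorem tau_sum_smul (hZ : T.IsFrameField (m + 1) U Z) {y : T.Q (m + 1)} (hy : y ∈ U) {ι : Type*}
    (s : Finset ι) (a : ι → ℝ) (x : ι → L) :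
    tau hZ hy (∑ i ∈ s, a i • x i) = ∑ i ∈ s, a i • tau hZ hy (x i) := by
  refine oneCochain_ext fun p _ v hv => ?_
  rw [tau_apply hZ hy _ hv, LinearMap.sum_apply, map_sum, LinearMap.sum_apply, map_sum]
  refine Finset.sum_congr rfl fun i _ => ?_
  rw [LinearMap.smul_apply, tau_apply hZ hy _ hv, map_smul, LinearMap.smul_apply, map_smul]

-- Any smooth frame field is corrected by linear solutions of κ + ∂f ∈ W² and τ - ∂g ∈ W¹, and the
-- change formulas say that the result is normal. Smoothness is inherited from κ and τ because the
-- solution operators `P2` and `P1` are linear.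
open Classical in
theorem Geo.exists_local_normal (hW : IsComplementSystem 𝒜 k W1 W2) (hk : k ≤ m)
    (hT : T.Geo (m + 1)) (y : T.Q (m + 1)) : ∃ U Z, T.IsFrameField (m + 1) U Z ∧ y ∈ U ∧
      ∀ x ∈ U, T.IsWNormal W1 W2 (m + 1) x (Z x) := by
  obtain ⟨U, Z, hZ, hyU⟩ := hT.exists_isFrameField y
  obtain ⟨P2, hP2⟩ := exists_linear_correction_subtype _ (d₁₂ ℝ (gNeg 𝒜) L) (W2 ((m + 1 : ℕ) : ℤ))
    (hom2 𝒜 ((m + 1 : ℕ) : ℤ)) (hom1 𝒜 ((m + 1 : ℕ) : ℤ)) (by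
      have := hW.sup2 m (by exact_mod_cast hk)
      push_cast
      exact this.ge)
  have em : ((m + 1 : ℕ) : ℤ) - 1 = m := by push_cast; ring
  obtain ⟨P1, hP1⟩ := exists_linear_correction (d₀ 𝒜) (W1 (((m + 1 : ℕ) : ℤ) - 1))
    (hom1 𝒜 (((m + 1 : ℕ) : ℤ) - 1)) (𝒜 (((m + 1 : ℕ) : ℤ) - 1)) (by
      rw [em]
      exact (hW.sup1 m (by exact_mod_cast hk)).ge)
  let β := 𝒯.hb ((m + 1 : ℕ) : ℤ)
  let K : T.Q (m + 1) → twoCochain ℝ (gNeg 𝒜) L := fun x => if h : x ∈ U then kap hZ h else 0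
  let t : L → T.Q (m + 1) → oneCochain ℝ (gNeg 𝒜) L :=
    fun A x => if h : x ∈ U then tau hZ h A else 0
  have hK : ∀ x (hx : x ∈ U), K x = kap hZ hx := fun x hx => dif_pos hx
  have ht : ∀ A x (hx : x ∈ U), t A x = tau hZ hx A := fun A x hx => dif_pos hx
  -- On 𝔤₋ the correction is `P2 κ`. In degrees `0` to `m - 1` it is `-P1 τ`, the sign matching that
  -- in `tau_change`. On 𝔤_m, where the frame is prescribed, it is zero.
  let u : β.ι → T.Q (m + 1) → L := fun j x => if β.deg j < 0 then P2 (K x) (β.nb j) else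
    if β.deg j < m then - P1 (t (β.b j) x) else 0
  have hu1 : ∀ j, ∀ x ∈ U, β.deg j < 0 → u j x ∈ 𝒜 (β.deg j + ((m + 1 : ℕ) : ℤ)) := by
    intro j x hx hj
    simp only [u, if_pos hj]
    rw [hK x hx]
    exact (hP2 _ (kap_mem hZ hx)).1 _ _ (β.nb_mem j)
  have hu2 : ∀ j, ∀ x ∈ U, 0 ≤ β.deg j → u j x ∈ 𝒜 (((m + 1 : ℕ) : ℤ) - 1) := by
    intro j x hx hj
    simp only [u, if_neg (not_lt.2 hj)]
    split_ifs
    · rw [ht _ x hx]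
      exact neg_mem (hP1 _ (tau_mem hZ hx _)).1
    · exact zero_mem _
  have hfilt : ∀ j, ∀ x ∈ U, u j x ∈ filt 𝒜 (β.deg j + 1) ∧
      u j x ∈ filt 𝒜 (min (β.deg j + m + 1) m) := by
    intro j x hx
    rcases lt_or_ge (β.deg j) 0 with hj | hj
    · have := hu1 j x hx hj
      exact ⟨mem_filt_of_mem (by push_cast; omega) this, mem_filt_of_mem (by push_cast; omega) this⟩
    · have := hu2 j x hx hj
      rcases lt_or_ge (β.deg j) m with hj' | hj'
      · exact ⟨mem_filt_of_mem (by push_cast; omega) this,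
          mem_filt_of_mem (by push_cast; omega) this⟩
      · have h0 : u j x = 0 := by simp only [u, if_neg (not_lt.2 hj), if_neg (not_lt.2 hj')]
        rw [h0]; exact ⟨zero_mem _, zero_mem _⟩
  have hZ' := hZ.add_corr hT β (fun j y hy => (hfilt j y hy).1) (fun j y hy => (hfilt j y hy).2)
    (fun j i x hx => by
      simp only [u]
      split_ifs
      · exact smoothAt_functional_kap hT hZ β ((β.c i) ∘ₗ (LinearMap.applyₗ (β.nb j)) ∘ₗ P2) hx
      · exact smoothAt_functional_tau hT hZ β (-((β.c i) ∘ₗ P1)) (β.b j) hx |>.congr_of_eventuallyEq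
          (Filter.Eventually.of_forall fun x => by simp [t])
      · exact contMDiffAt_const)
  refine ⟨U, _, hZ', hyU, fun x hx => ?_⟩
  rw [isWNormal_iff hT hZ hx (hZ'.linear x hx)]
  have hdiff : ∀ A, (Z x + corr β (Z x) fun j => u j x) A - Z x A = Z x (∑ j, β.c j A • u j x) := by
    intro A
    rw [LinearMap.add_apply, add_sub_cancel_left, corr_apply]
  have hf : fpart (m + 1) (Z x) (Z x + corr β (Z x) fun j => u j x) = P2 (kap hZ hx) := by
    refine oneCochain_ext fun p hp v hv => ?_
    unfold fpart
    rw [homPart1_apply hv, LinearMap.comp_apply, LinearMap.sub_apply, hdiff,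
      (hZ.linear x hx).hc_frInv hT.filtered (by omega) rfl]
    have e : ∑ j, β.c j v • u j x = P2 (kap hZ hx) v := by
      conv_rhs => rw [← β.sum_nb hp (by omega) hv, map_sum]
      refine Finset.sum_congr rfl fun j _ => ?_
      rw [map_smul]
      by_cases hj : β.deg j = p
      · simp only [u, if_pos (show β.deg j < 0 by omega), hK x hx]
      · rw [β.c_eq_zero_of_mem hv hj, zero_smul, zero_smul]
    rw [e, hc_of_mem ((hP2 _ (kap_mem hZ hx)).1 p v hv)]
  refine ⟨by rw [hf]; exact (hP2 _ (kap_mem hZ hx)).2, fun A hA => ?_⟩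
  have hg : gpart 𝒜 (m + 1) (Z x) (Z x + corr β (Z x) fun j => u j x) A = - P1 (tau hZ hx A) := by
    simp only [gpart, LinearMap.comp_apply, LinearMap.sub_apply]
    rw [hdiff, (hZ.linear x hx).hc_frInv hT.filtered (by omega) rfl]
    have e : ∑ j, β.c j A • u j x = - P1 (tau hZ hx A) := by
      let τ : L →ₗ[ℝ] oneCochain ℝ (gNeg 𝒜) L :=
        { toFun := tau hZ hx
          map_add' := tau_add hZ hx
          map_smul' := fun a B => by
            have := tau_sum_smul hZ hx (Finset.univ : Finset Unit) (fun _ => a) (fun _ => B)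
            simpa using this }
      have hle : Eplus 𝒜 (((m + 1 : ℕ) : ℤ) - 2) ≤ LinearMap.eqLocus
          (∑ j, (β.c j).smulRight (u j x))
          (-(P1 ∘ₗ τ)) := by
        refine iSup_le fun i => iSup_le fun hi B hB => ?_
        rw [LinearMap.mem_eqLocus]
        simp only [LinearMap.sum_apply, LinearMap.smulRight_apply, LinearMap.neg_apply,
          LinearMap.comp_apply]
        change _ = - P1 (tau hZ hx B)
        conv_rhs => rw [β.eq_sum_of_mem (by push_cast at hi ⊢; omega) hB, tau_sum_smul, map_sum]
        rw [← Finset.sum_neg_distrib]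
        refine Finset.sum_congr rfl fun j _ => ?_
        rw [map_smul]
        by_cases hj : β.deg j = i
        · simp only [u, if_neg (show ¬ β.deg j < 0 by omega),
            if_pos (show β.deg j < m by push_cast at hi; omega), ht _ x hx, smul_neg]
        · rw [β.c_eq_zero_of_mem hB hj, zero_smul, zero_smul, neg_zero]
      have := hle hA
      rw [LinearMap.mem_eqLocus] at this
      simp only [LinearMap.sum_apply, LinearMap.smulRight_apply] at this
      exact this
    rw [e, hc_of_mem (neg_mem (hP1 _ (tau_mem hZ hx A)).1)]
  rw [hg, map_neg, sub_neg_eq_add]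
  exact (hP1 _ (tau_mem hZ hx A)).2

end

end Tower
end NormalProlongation


set_option linter.unusedSectionVars false

namespace NormalProlongation

open LieModule.Cohomology

variable {L : Type v} [LieRing L] [LieAlgebra ℝ L] {𝒜 : ℤ → Submodule ℝ L}
  [GradedLieAlgebra 𝒜] {k : ℕ} [htr : Fact (IsTransitive 𝒜)]

/-! ### Vector groups -/

namespace StructureType

variable (𝒯 : StructureType.{u} 𝒜 k) {n : ℕ}

/-- The identification of `𝔤_n` with the vector group `G_n`, `n > k`. -/
noncomputable def vexp (hn : k < n) : 𝒜 (n : ℤ) ≃+ Additive (𝒯.G n) := (𝒯.vector n hn).choose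

theorem vexp_rho (hn : k < n) (A : 𝒜 (n : ℤ)) : RepEquiv 𝒜 n (𝒯.rho n (𝒯.vexp hn A).toMul)
    (LinearMap.id + (LieAlgebra.ad ℝ L (A : L) : L →ₗ[ℝ] L)) :=
  (𝒯.vector n hn).choose_spec.1 A

theorem smooth_vlog (hn : k < n) (f : 𝒜 (n : ℤ) →ₗ[ℝ] ℝ) :
    ContMDiff 𝓘(ℝ, 𝒯.VG n) 𝓘(ℝ, ℝ) ∞
      (fun a : 𝒯.G n => f ((𝒯.vexp hn).symm (Additive.ofMul a))) :=
  (𝒯.vector n hn).choose_spec.2.2 f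

section

variable {F : Type*} [NormedAddCommGroup F] [NormedSpace ℝ F] {N : Type*} [TopologicalSpace N]
  [ChartedSpace F N]

/-- The identification of `𝔤_n` with the model space of `G_n`. -/
noncomputable def lamMap (n : ℕ) : 𝒜 (n : ℤ) →ₗ[ℝ] 𝒯.VG n := (𝒯.lam n).toLinearMap

theorem smoothAt_lam {A : N → 𝒜 (n : ℤ)} {w : N}
    (h : ∀ f : 𝒜 (n : ℤ) →ₗ[ℝ] ℝ, SmoothAt (E := ℝ) (F := F) (fun x => f (A x)) w) :
    SmoothAt (E := 𝒯.VG n) (F := F) (fun x => 𝒯.lamMap n (A x)) w := by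
  let b := Module.finBasis ℝ (𝒯.VG n)
  have h1 : SmoothAt (E := 𝒯.VG n) (F := F) (fun x => ∑ i, (b.coord i ∘ₗ 𝒯.lamMap n) (A x) • b i) w :=
    ContMDiffAt.sum fun i _ => ContMDiffAt.smul (h _) contMDiffAt_const
  refine h1.congr_of_eventuallyEq (Filter.Eventually.of_forall fun x => ?_)
  exact (b.sum_repr (𝒯.lamMap n (A x))).symm

/-- Smoothness of the identification with `G_n` is given on the model space; `lam` carries it to
maps into 𝔤_n. -/
theorem smoothAt_vexp (hn : k < n) {A : N → 𝒜 (n : ℤ)} {w : N}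
    (h : ∀ f : 𝒜 (n : ℤ) →ₗ[ℝ] ℝ, SmoothAt (E := ℝ) (F := F) (fun x => f (A x)) w) :
    SmoothAt (E := 𝒯.VG n) (F := F) (fun x => (𝒯.vexp hn (A x)).toMul) w := by
  let l : 𝒯.VG n →ₗ[ℝ] 𝒜 (n : ℤ) := (𝒯.lam n).symm.toLinearMap
  have h1 : ContMDiff 𝓘(ℝ, 𝒯.VG n) 𝓘(ℝ, 𝒯.VG n) ∞ (fun x : 𝒯.VG n => (𝒯.vexp hn (l x)).toMul) :=
    (𝒯.vector n hn).choose_spec.2.1 l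
  have h2 := ContMDiffAt.comp w (h1.contMDiffAt (x := 𝒯.lamMap n (A w))) (𝒯.smoothAt_lam h)
  refine h2.congr_of_eventuallyEq (Filter.Eventually.of_forall fun x => ?_)
  have e : l (𝒯.lamMap n (A x)) = A x := (𝒯.lam n).symm_apply_apply (A x)
  exact congrArg (fun B => (𝒯.vexp hn B).toMul) e.symm

end

end StructureType

namespace Tower

variable {𝒯 : StructureType.{u} 𝒜 k} {T : Tower 𝒯}
  {W1 : ℤ → Submodule ℝ (oneCochain ℝ (gNeg 𝒜) L)}
  {W2 : ℤ → Submodule ℝ (twoCochain ℝ (gNeg 𝒜) L)} {m : ℕ}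

/-! ### Global normal frame fields -/

/-- If `ζ'` is congruent to `ζ ∘ (1 + ad A)`, then the point of the segment with weight `b` at `ζ'`
is congruent to `ζ ∘ (1 + ad (b • A))`, hence normal. -/
theorem convex_isWNormal (hprol : IsProlongation 𝒜 k) (hW : IsComplementSystem 𝒜 k W1 W2)
    (hk : k ≤ m) (hT : T.Geo (m + 1)) (y : T.Q (m + 1)) :
    Convex ℝ {ζ | T.IsLinearFrame (m + 1) y ζ ∧ T.IsWNormal W1 W2 (m + 1) y ζ} := by
  rintro ζ ⟨hζ, hn⟩ ζ' ⟨hζ', hn'⟩ a b ha hb hab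
  obtain ⟨A, hA, he⟩ := (isWNormal_iff_of_isWNormal hprol hW hk hT hζ hn hζ').1 hn'
  have e : a • ζ + b • ζ' = ζ + b • (ζ' - ζ) := by
    rw [← eq_sub_iff_add_eq] at hab
    rw [hab]; module
  rw [Set.mem_ofPred_eq, e]
  have hl : T.IsLinearFrame (m + 1) y (ζ + b • (ζ' - ζ)) := hζ.add_of_raising hT
    (fun p x hx => Submodule.smul_mem _ _ (hζ.sub_mem_succ hT hζ' hx))
    (fun p x hx => Submodule.smul_mem _ _ (hζ.sub_mem hT hζ' hx))
  refine ⟨hl, (isWNormal_iff_of_isWNormal hprol hW hk hT hζ hn hl).2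
    ⟨b • A, Submodule.smul_mem _ _ hA, fun p x hx => ?_⟩⟩
  have h1 := Submodule.smul_mem _ b (he p x hx)
  convert h1 using 1
  simp only [LinearMap.comp_apply, LinearMap.add_apply, LinearMap.id_apply, map_add, map_smul,
    LieAlgebra.ad_apply, LinearMap.smul_apply, LinearMap.sub_apply]
  module

/-- Local normal fields are averaged by a partition of unity. The bundle of normal frames thus has a
global section, and the next level can be taken to be a product. -/
theorem Geo.exists_global_normal (hprol : IsProlongation 𝒜 k)
    (hW : IsComplementSystem 𝒜 k W1 W2) (hk : k ≤ m) (hT : T.Geo (m + 1)) :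
    ∃ Z, T.IsFrameField (m + 1) Set.univ Z ∧ ∀ y, T.IsWNormal W1 W2 (m + 1) y (Z y) := by
  choose U Z hZ hyU hn using fun y => hT.exists_local_normal hW hk y
  have : LocallyCompactSpace (T.Q (m + 1)) :=
    Manifold.locallyCompact_of_finiteDimensional 𝓘(ℝ, T.V (m + 1))
  obtain ⟨ρ, hρ⟩ := SmoothPartitionOfUnity.exists_isSubordinate 𝓘(ℝ, T.V (m + 1)) isClosed_univ U
    (fun c => (hZ c).isOpen) (fun y _ => Set.mem_iUnion.2 ⟨y, hyU y⟩)
  have hmem : ∀ y, (∑ᶠ c, ρ c y • Z c y) ∈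
      {ζ | T.IsLinearFrame (m + 1) y ζ ∧ T.IsWNormal W1 W2 (m + 1) y ζ} := fun y =>
    (convex_isWNormal hprol hW hk hT y).finsum_mem (fun c => ρ.nonneg c y)
      (ρ.sum_eq_one (Set.mem_univ y)) fun c hc => by
        have hy : y ∈ U c := hρ c (subset_tsupport _ hc)
        exact ⟨(hZ c).linear y hy, hn c y hy⟩
  refine ⟨fun y => ∑ᶠ c, ρ c y • Z c y, ⟨isOpen_univ, fun y _ => (hmem y).1, fun x =>
    (smoothFieldOn_iff T isOpen_univ).2 fun y _ => ?_⟩, fun y => (hmem y).2⟩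
  obtain ⟨is, n, hn, hnU, hns⟩ := ρ.locallyFinite.exists_finset_nhds_support_subset hρ
    (fun c => (hZ c).isOpen) y
  refine SmoothAlongAt.congr (v := fun z => ∑ c ∈ is, ρ c z • Z c z x) ?_ ?_
  · refine SmoothAlongAt.sum _ contMDiffAt_id fun c hc => SmoothAlongAt.smul
      ((ρ c).contMDiff.contMDiffAt) ((hZ c).smoothAt x ?_)
    exact Set.mem_iInter₂.1 (hnU (mem_of_mem_nhds hn)) c hc
  · filter_upwards [hn] with z hz
    rw [finsum_eq_sum_of_support_subset (s := is) _ (fun c hc => hns z hz fun h0 => hc (by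
      simp only [h0, zero_smul])), LinearMap.sum_apply]
    rfl

/-! ### Normal frame fields as sections -/

/-- If two smooth frame fields differ by `1 + ad A`, then `A` is smooth. -/
theorem IsFrameField.smoothAt_of_ad (hT : T.Geo (m + 1)) {U : Set (T.Q (m + 1))}
    {Z Z' : T.Q (m + 1) → L →ₗ[ℝ] T.V (m + 1)} (hZ : T.IsFrameField (m + 1) U Z)
    {y : T.Q (m + 1)} (hy : y ∈ U)
    (hZ' : ∀ x, SmoothFieldAt (F := T.V (m + 1)) (fun y => Z' y x) y)
    {A : T.Q (m + 1) → 𝒜 ((m + 1 : ℕ) : ℤ)}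
    (hA : ∀ y ∈ U, T.FrameEquiv (m + 1) y
      (Z y ∘ₗ (LinearMap.id + (LieAlgebra.ad ℝ L (A y : L) : L →ₗ[ℝ] L))) (Z' y))
    (f : 𝒜 ((m + 1 : ℕ) : ℤ) →ₗ[ℝ] ℝ) :
    SmoothAt (E := ℝ) (F := T.V (m + 1)) (fun y => f (A y)) y := by
  let β := 𝒯.hb ((m + 1 : ℕ) : ℤ)
  -- By transitivity `A` is determined by its brackets with a basis of 𝔤₋, so every functional of
  -- `A` is a combination of their coefficients. These can be read off the difference of the two
  -- frames.
  obtain ⟨a, ha⟩ := exists_functional_eq_sum (I := β.ι × β.ι) (⊤ : Submodule ℝ (𝒜 ((m + 1 : ℕ) : ℤ)))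
    (fun t => β.c t.2 ∘ₗ (LieAlgebra.ad ℝ L (β.nb t.1 : L) : L →ₗ[ℝ] L) ∘ₗ (𝒜 ((m + 1 : ℕ) : ℤ)).subtype)
    (fun B _ hB => by
      refine Subtype.ext (eq_zero_of_d₀_eq_zero (i := ((m + 1 : ℕ) : ℤ)) (by omega) B.2
        (oneCochain_ext fun p hp v hv => ?_))
      change ⁅(v : L), (B : L)⁆ = 0
      have hv' : (v : L) = ∑ j, β.c j v • (β.nb j : L) := by
        have := congrArg (negIncl 𝒜) (β.sum_nb hp (by omega) hv)
        rw [map_sum] at this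
        simpa [negIncl_apply] using this.symm
      rw [hv', sum_lie]
      refine Finset.sum_eq_zero fun j _ => ?_
      rw [smul_lie]
      by_cases hj : β.deg j < 0
      · rw [β.eq_sum_of_mem (by push_cast; omega) (lie_mem_deg (β.nb_mem j) B.2),
          Finset.sum_eq_zero fun i _ => ?_, smul_zero]
        have : β.c i ⁅(β.nb j : L), (B : L)⁆ = 0 := hB (j, i)
        rw [this, zero_smul]
      · rw [gNeg_eq_zero (not_lt.1 hj) (β.nb_mem j)]; simp) f
  have hsm : SmoothAt (E := ℝ) (F := T.V (m + 1)) (fun x => ∑ t : β.ι × β.ι, a t *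
      (if β.deg t.2 = β.deg t.1 + ((m + 1 : ℕ) : ℤ) ∧ β.deg t.1 < 0 then
        - β.c t.2 (frInv (Z x) (Z' x (β.nb t.1) - Z x (β.nb t.1))) else 0)) y := by
    refine ContMDiffAt.sum fun t _ => contMDiffAt_const.mul ?_
    split_ifs
    · exact (hZ.smoothAt_coeff hT.filtered β (f := fun x => x) hy
        ((hZ' _).sub (hZ.smoothAt _ hy)) _).neg
    · exact contMDiffAt_const
  refine hsm.congr_of_eventuallyEq ?_
  filter_upwards [hZ.isOpen.mem_nhds hy] with x hx
  rw [ha _ trivial]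
  refine Finset.sum_congr rfl fun t _ => congrArg _ ?_
  change β.c t.2 ⁅(β.nb t.1 : L), (A x : L)⁆ = _
  split_ifs with hd
  · have hl := hZ.linear x hx
    have h1 := hA x hx _ _ (mem_filt_of_mem le_rfl (β.nb_mem t.1))
    have h2 : frInv (Z x) (Z' x (β.nb t.1 : L) -
        (Z x ∘ₗ (LinearMap.id + (LieAlgebra.ad ℝ L (A x : L) : L →ₗ[ℝ] L))) (β.nb t.1 : L)) ∈
        filt 𝒜 (β.deg t.1 + ((m + 1 : ℕ) : ℤ) + 1) :=
      hl.frInv_mem hT.filtered (by omega) h1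
    have h3 : Z' x (β.nb t.1 : L) -
        (Z x ∘ₗ (LinearMap.id + (LieAlgebra.ad ℝ L (A x : L) : L →ₗ[ℝ] L))) (β.nb t.1 : L) =
        (Z' x (β.nb t.1 : L) - Z x (β.nb t.1 : L)) - Z x ⁅(A x : L), (β.nb t.1 : L)⁆ := by
      simp only [LinearMap.comp_apply, LinearMap.add_apply, LinearMap.id_apply, map_add,
        LieAlgebra.ad_apply]
      abel
    rw [h3, map_sub] at h2
    have h4 := β.c_eq_zero_of_filt h2 (j := t.2) (by omega)
    have h5 := β.c_eq_zero_of_filt (hl.frInv_apply_sub hT.filtered ⁅(A x : L), (β.nb t.1 : L)⁆)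
      (j := t.2) (β.deg_lt _)
    rw [map_sub, _root_.sub_eq_zero] at h4 h5
    rw [h4, h5, ← lie_skew, map_neg]
  · by_cases hj : β.deg t.1 < 0
    · exact β.c_eq_zero_of_mem (lie_mem_deg (β.nb_mem t.1) (A x).2) (fun h => hd ⟨h, hj⟩)
    · rw [gNeg_eq_zero (not_lt.1 hj) (β.nb_mem t.1)]; simp

/-- The frames of a bundle along a smooth local section. -/
theorem Geo.exists_section_frameField (hT : T.Geo (m + 1 + 1)) (z₀ : T.Q (m + 1 + 1)) :
    ∃ U s δ Z, T.π (m + 1) z₀ ∈ U ∧ T.IsFrameField (m + 1) U Z ∧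
    (∀ y ∈ U, Z y ∈ T.frames (m + 1) (s y)) ∧
    s (T.π (m + 1) z₀) = z₀ ∧
    (∀ y ∈ U, SmoothAt (E := T.V (m + 1 + 1)) (F := T.V (m + 1)) s y) ∧
    (∀ y ∈ U, T.π (m + 1) (s y) = y) ∧
    (∀ z, T.π (m + 1) z ∈ U → SmoothAt (E := 𝒯.VG (m + 1)) (F := T.V (m + 1 + 1)) δ z) ∧
    (∀ z, T.π (m + 1) z ∈ U → T.act (m + 1) (s (T.π (m + 1) z)) (δ z) = z) := by
  have hred := hT.reduction (m + 1) (Nat.lt_succ_self _)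
  obtain ⟨U, s, δ, hU, hyU, hsz, -, hs, hsπ, hδ, hsδ, -⟩ := hred.exists_trivialization z₀
  obtain ⟨U', Z, hU', hz, hZ, hZs⟩ := hred.frames_smooth z₀
  have hcs : ContinuousOn s U := fun y hy => (hs y hy).continuousAt.continuousWithinAt
  have hO : IsOpen (U ∩ s ⁻¹' U') := hcs.isOpen_inter_preimage hU hU'
  have hfr : ∀ y ∈ U ∩ s ⁻¹' U', Z (s y) ∈ T.frames (m + 1) (s y) := fun y hy => hZ _ hy.2
  refine ⟨U ∩ s ⁻¹' U', s, δ, fun y => Z (s y), ⟨hyU, by rw [Set.mem_preimage, hsz]; exact hz⟩,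
    ⟨hO, fun y hy => ?_, fun x => (smoothFieldOn_iff T hO).2 fun y hy => ?_⟩, hfr, hsz,
    fun y hy => hs y hy.1, fun y hy => hsπ y hy.1, fun z hz => hδ z hz.1, fun z hz => hsδ z hz.1⟩
  · have := hT.isLinearFrame_of_mem (hfr y hy)
    rwa [hsπ y hy.1] at this
  · have h1 : SmoothAlongAt (E := T.V (m + 1)) (F := T.V (m + 1 + 1)) (T.π (m + 1))
        (fun z => Z z x) (s y) := (hZs x).contMDiffAt (hU'.mem_nhds hy.2)
    have h2 := h1.comp (hs y hy.1)
    refine ContMDiffAt.congr_of_eventuallyEq h2 ?_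
    filter_upwards [hU.mem_nhds hy.1] with z hz
    rw [hsπ z hz]

/-- A normal frame field is a smooth section of the bundle of normal frames. -/
theorem Geo.exists_section (hprol : IsProlongation 𝒜 k) (hW : IsComplementSystem 𝒜 k W1 W2)
    (hk : k ≤ m) (hT : T.Geo (m + 1 + 1))
    (hn : ∀ z : T.Q (m + 1 + 1), ∀ ζ ∈ T.frames (m + 1) z,
      T.IsWNormal W1 W2 (m + 1) (T.π (m + 1) z) ζ)
    {U : Set (T.Q (m + 1))} {Z : T.Q (m + 1) → L →ₗ[ℝ] T.V (m + 1)}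
    (hZ : T.IsFrameField (m + 1) U Z) (hZn : ∀ y ∈ U, T.IsWNormal W1 W2 (m + 1) y (Z y)) :
    ∃ σ : T.Q (m + 1) → T.Q (m + 1 + 1), ∀ y ∈ U, T.π (m + 1) (σ y) = y ∧
      Z y ∈ T.frames (m + 1) (σ y) ∧ SmoothAt (E := T.V (m + 1 + 1)) (F := T.V (m + 1)) σ y := by
  have hred := hT.reduction (m + 1) (Nat.lt_succ_self _)
  have hT' : T.Geo (m + 1) := hT.mono (by omega)
  have hex : ∀ y, ∃ z, T.π (m + 1) z = y ∧ (y ∈ U → Z y ∈ T.frames (m + 1) z) := by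
    intro y
    by_cases hy : y ∈ U
    · obtain ⟨z, hz, hz'⟩ := (isWNormal_iff_exists_mem_frames hprol hW hk hT hn (hZ.linear y hy)).1
        (hZn y hy)
      exact ⟨z, hz, fun _ => hz'⟩
    · obtain ⟨z, hz⟩ := hred.exists_π_eq y
      exact ⟨z, hz, fun h => absurd h hy⟩
  choose σ hσ hσZ using hex
  refine ⟨σ, fun y₀ hy₀ => ⟨hσ y₀, hσZ y₀ hy₀, ?_⟩⟩
  obtain ⟨U', s, δ, Z', hyU', hZ', hfr, -, hs, hsπ, -⟩ := hT.exists_section_frameField (σ y₀)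
  rw [hσ] at hyU'
  have hex : ∀ y, ∃ A : 𝒜 ((m + 1 : ℕ) : ℤ), y ∈ U' ∩ U → T.FrameEquiv (m + 1) y
      (Z' y ∘ₗ (LinearMap.id + (LieAlgebra.ad ℝ L (A : L) : L →ₗ[ℝ] L))) (Z y) := by
    intro y
    by_cases hy : y ∈ U' ∩ U
    · have h1 := hn _ _ (hfr y hy.1)
      rw [hsπ y hy.1] at h1
      obtain ⟨A, hA, he⟩ := (isWNormal_iff_of_isWNormal hprol hW hk hT' (hZ'.linear y hy.1) h1
        (hZ.linear y hy.2)).1 (hZn y hy.2)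
      exact ⟨⟨A, hA⟩, fun _ => he⟩
    · exact ⟨0, fun h => absurd h hy⟩
  choose A hA using hex
  have hZ'' := hZ'.mono (hZ'.isOpen.inter hZ.isOpen) Set.inter_subset_left
  have hAs := fun f => hZ''.smoothAt_of_ad hT' ⟨hyU', hy₀⟩ (fun x => hZ.smoothAt x hy₀) hA f
  have hkm : k < m + 1 := by omega
  have h1 := 𝒯.smoothAt_vexp hkm hAs
  -- Near `y₀` the section is the smooth section `s` translated by the group element of `A y`; the
  -- two agree because a point is determined by its frames.
  have h2 : SmoothAt (E := T.V (m + 1 + 1)) (F := T.V (m + 1))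
      (fun y => T.act (m + 1) (s y) (𝒯.vexp hkm (A y)).toMul) y₀ :=
    ContMDiffAt.comp (g := fun p : T.Q (m + 1 + 1) × 𝒯.G (m + 1) => T.act (m + 1) p.1 p.2) y₀
      hred.smooth_act.contMDiffAt ((hs y₀ hyU').prodMk h1)
  refine h2.congr_of_eventuallyEq ?_
  filter_upwards [(hZ'.isOpen.inter hZ.isOpen).mem_nhds ⟨hyU', hy₀⟩] with y hy
  refine hT.eq_of_mem_frames (by rw [hσ, hred.π_act, hsπ y hy.1]) (hσZ y hy.2) ?_
  refine hT.mem_frames_of_frameEquiv (hred.frames_act (s y) (𝒯.vexp hkm (A y)).toMul _ (hfr y hy.1)) ?_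
  rw [hred.π_act, hsπ y hy.1]
  exact ((hZ'.linear y hy.1).frameEquiv_comp (𝒯.vexp_rho hkm (A y))).trans (hA y hy)

end Tower
end NormalProlongation


set_option linter.unusedSectionVars false

namespace NormalProlongation

open LieModule.Cohomology

variable {L : Type v} [LieRing L] [LieAlgebra ℝ L] {𝒜 : ℤ → Submodule ℝ L}
  [GradedLieAlgebra 𝒜] {k : ℕ} {𝒯 : StructureType.{u} 𝒜 k} {S T R : Tower 𝒯} {n : ℕ}

/-! ### Differentials of diffeomorphisms of levels -/

namespace LevelDiffeo

/-- The inverse diffeomorphism. -/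
noncomputable abbrev inv (φ : LevelDiffeo S T n) : LevelDiffeo T S n := φ.symm

theorem smoothAt (φ : LevelDiffeo S T n) (y : S.Q n) :
    SmoothAt (E := T.V n) (F := S.V n) φ y := φ.contMDiff.contMDiffAt

theorem d_trans (φ : LevelDiffeo S T n) (ψ : LevelDiffeo T R n) (y : S.Q n) :
    LevelDiffeo.d (φ.trans ψ) y = ψ.d (φ y) ∘ₗ φ.d y :=
  congrArg ContinuousLinearMap.toLinearMap
    (dmap_comp (g := ψ) (f := φ) (ψ.smoothAt _).mdiff (φ.smoothAt y).mdiff)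

theorem d_refl (y : S.Q n) : LevelDiffeo.d (Diffeomorph.refl 𝓘(ℝ, S.V n) (S.Q n) ∞) y =
    LinearMap.id :=
  congrArg ContinuousLinearMap.toLinearMap (mfderiv_id (I := 𝓘(ℝ, S.V n)) (x := y))

theorem inv_d_d (φ : LevelDiffeo S T n) (y : S.Q n) (v : S.V n) : φ.inv.d (φ y) (φ.d y v) = v := by
  have h := d_trans φ φ.inv y
  have e : φ.trans φ.inv = Diffeomorph.refl 𝓘(ℝ, S.V n) (S.Q n) ∞ :=
    Diffeomorph.ext fun x => φ.symm_apply_apply x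
  rw [e, d_refl] at h
  exact (congrArg (fun B : S.V n →ₗ[ℝ] S.V n => B v) h).symm

theorem d_inv_d (φ : LevelDiffeo S T n) (y : T.Q n) (v : T.V n) :
    φ.d (φ.inv y) (φ.inv.d y v) = v := inv_d_d φ.inv y v

theorem d_inv_d' (φ : LevelDiffeo S T n) (y : S.Q n) (v : T.V n) :
    φ.d y (φ.inv.d (φ y) v) = v := by
  have h := d_inv_d φ (φ y) v
  rwa [show φ.inv (φ y) = y from φ.symm_apply_apply y] at h

theorem d_injective (φ : LevelDiffeo S T n) (y : S.Q n) : Function.Injective (φ.d y) :=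
  Function.LeftInverse.injective (inv_d_d φ y)

theorem d_surjective (φ : LevelDiffeo S T n) (y : S.Q n) : Function.Surjective (φ.d y) :=
  Function.RightInverse.surjective (d_inv_d' φ y)

theorem smoothFieldAt_pull (φ : LevelDiffeo S T n) {ξ : T.Q n → T.V n} {y : S.Q n}
    (h : SmoothFieldAt (F := T.V n) ξ (φ y)) :
    SmoothFieldAt (F := S.V n) (fun x => φ.inv.d (φ x) (ξ (φ x))) y := by
  have h1 := (h.dmap_apply (g := φ.inv) isOpen_univ trivial fun y _ => φ.inv.smoothAt y).comp
    (φ.smoothAt y)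
  refine ContMDiffAt.congr_of_eventuallyEq h1 (Filter.Eventually.of_forall fun x => ?_)
  change (⟨x, _⟩ : TangentBundle 𝓘(ℝ, S.V n) (S.Q n)) = ⟨φ.inv (φ x), _⟩
  rw [show φ.inv (φ x) = x from φ.symm_apply_apply x]
  rfl

theorem d_lieB (φ : LevelDiffeo S T n) {ξ η : T.Q n → T.V n} {y : S.Q n}
    (hξ : SmoothFieldAt (F := T.V n) ξ (φ y)) (hη : SmoothFieldAt (F := T.V n) η (φ y)) :
    φ.d y (lieB (fun x => φ.inv.d (φ x) (ξ (φ x))) (fun x => φ.inv.d (φ x) (η (φ x))) y) =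
      lieB ξ η (φ y) :=
  dmap_lieB_related (Filter.Eventually.of_forall fun x => φ.smoothAt x)
    (φ.smoothFieldAt_pull hξ) (φ.smoothFieldAt_pull hη) hξ hη
    (Filter.Eventually.of_forall fun x => d_inv_d' φ x _)
    (Filter.Eventually.of_forall fun x => d_inv_d' φ x _)

/-- `Φ` covers `φ`. -/
def Covers (Φ : LevelDiffeo S T (n + 1)) (φ : LevelDiffeo S T n) : Prop :=
  ∀ z, T.π n (Φ z) = φ (S.π n z)

theorem Covers.inv {Φ : LevelDiffeo S T (n + 1)} {φ : LevelDiffeo S T n} (h : Φ.Covers φ) :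
    Covers Φ.inv φ.inv := fun z => by
  have h1 := h (Φ.inv z)
  rw [show Φ (Φ.inv z) = z from Φ.apply_symm_apply z] at h1
  rw [h1]
  exact (φ.symm_apply_apply _).symm

theorem Covers.π_eq {Φ : LevelDiffeo S T (n + 1)} {φ : LevelDiffeo S T n} (h : Φ.Covers φ) :
    S.π n = fun z => φ.inv (T.π n (Φ z)) := funext fun z => by
  rw [h z]; exact (φ.symm_apply_apply _).symm

theorem Covers.smooth_π {Φ : LevelDiffeo S T (n + 1)} {φ : LevelDiffeo S T n} (h : Φ.Covers φ)
    (hT : T.IsFrameReduction n) : ContMDiff 𝓘(ℝ, S.V (n + 1)) 𝓘(ℝ, S.V n) ∞ (S.π n) := by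
  rw [h.π_eq]
  exact φ.symm.contMDiff.comp (hT.smooth_π.comp Φ.contMDiff)

theorem Covers.dπ_d {Φ : LevelDiffeo S T (n + 1)} {φ : LevelDiffeo S T n} (h : Φ.Covers φ)
    (hT : T.IsFrameReduction n) (z : S.Q (n + 1)) :
    T.dπ n (Φ z) ∘ₗ Φ.d z = φ.d (S.π n z) ∘ₗ S.dπ n z := by
  have h1 : (dmap (fun z => T.π n (Φ z)) z : S.V (n + 1) →L[ℝ] T.V n) =
      dmap (fun z => φ (S.π n z)) z := by
    rw [show (fun z => T.π n (Φ z)) = fun z => φ (S.π n z) from funext h]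
  rw [dmap_comp (g := T.π n) (f := Φ) (hT.smoothAt_π _).mdiff (Φ.smoothAt z).mdiff,
    dmap_comp (g := φ) (f := S.π n) (φ.smoothAt _).mdiff
      ((h.smooth_π hT).contMDiffAt.mdifferentiableAt (by simp))] at h1
  exact congrArg ContinuousLinearMap.toLinearMap h1

theorem Covers.dπ_d_apply {Φ : LevelDiffeo S T (n + 1)} {φ : LevelDiffeo S T n} (h : Φ.Covers φ)
    (hT : T.IsFrameReduction n) (z : S.Q (n + 1)) (v : S.V (n + 1)) :
    T.dπ n (Φ z) (Φ.d z v) = φ.d (S.π n z) (S.dπ n z v) :=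
  congrArg (fun B : S.V (n + 1) →ₗ[ℝ] T.V n => B v) (h.dπ_d hT z)

end LevelDiffeo

/-! ### Isomorphisms -/

theorem IsIso.refl (S : Tower 𝒯) : ∀ n, IsIso S S n (Diffeomorph.refl 𝓘(ℝ, S.V n) (S.Q n) ∞)
  | 0 => fun p x => by rw [LevelDiffeo.d_refl]; exact Submodule.map_id _
  | n + 1 => ⟨_, IsIso.refl S n, fun z => ⟨rfl, by
      rw [LevelDiffeo.d_refl]; simp only [LinearMap.id_comp, Set.image_id']; rfl⟩⟩

theorem IsIso.trans : ∀ {n : ℕ} {φ : LevelDiffeo S T n} {ψ : LevelDiffeo T R n},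
    IsIso S T n φ → IsIso T R n ψ → IsIso S R n (φ.trans ψ)
  | 0, φ, ψ, h, h' => fun p x => by
    rw [LevelDiffeo.d_trans, Submodule.map_comp, h p x, h' p (φ x)]; rfl
  | n + 1, Φ, Ψ, ⟨φ, h, hΦ⟩, ⟨ψ, h', hΨ⟩ => ⟨_, IsIso.trans h h', fun z => ⟨by
      change R.π n (Ψ (Φ z)) = ψ (φ _); rw [(hΨ _).1, (hΦ z).1], by
      change R.frames n (Ψ (Φ z)) = _
      rw [(hΨ _).2, (hΦ z).2, (hΦ z).1, Set.image_image, LevelDiffeo.d_trans]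
      rfl⟩⟩

theorem IsIso.symm : ∀ {n : ℕ} {φ : LevelDiffeo S T n}, IsIso S T n φ → IsIso T S n φ.inv
  | 0, φ, h => fun p x => by
    have h1 := h p (φ.inv x)
    rw [show φ (φ.inv x) = x from φ.apply_symm_apply x] at h1
    rw [← h1, ← Submodule.map_comp]
    convert Submodule.map_id _
    ext v
    have := φ.inv_d_d (φ.inv x) v
    rwa [show φ (φ.inv x) = x from φ.apply_symm_apply x] at this
  | n + 1, Φ, ⟨φ, h, hΦ⟩ => ⟨_, IsIso.symm h, fun z => ⟨LevelDiffeo.Covers.inv (fun z => (hΦ z).1) z, by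
      have h1 := (hΦ (Φ.inv z)).2
      have h2 := (hΦ (Φ.inv z)).1
      rw [show Φ (Φ.inv z) = z from Φ.apply_symm_apply z] at h1 h2
      rw [h1, Set.image_image, h2]
      convert (Set.image_id _).symm using 2
      ext ζ : 2
      exact φ.inv_d_d _ _⟩⟩

/-- Isomorphisms that are equivariant on every level. -/
def IsEquivariantIso (S T : Tower 𝒯) : (n : ℕ) → LevelDiffeo S T n → Prop
  | 0, φ => IsIso S T 0 φ
  | n + 1, Φ => ∃ φ : LevelDiffeo S T n, IsEquivariantIso S T n φ ∧ Φ.Covers φ ∧ ∀ z,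
      T.frames n (Φ z) = (fun ζ => φ.d (S.π n z) ∘ₗ ζ) '' S.frames n z ∧
      ∀ a, Φ (S.act n z a) = T.act n (Φ z) a

namespace IsEquivariantIso

open LevelDiffeo

theorem isIso : ∀ {n : ℕ} {φ : LevelDiffeo S T n}, IsEquivariantIso S T n φ → IsIso S T n φ
  | 0, _, h => h
  | _ + 1, _, ⟨φ, h, hc, hΦ⟩ => ⟨φ, h.isIso, fun z => ⟨hc z, (hΦ z).1⟩⟩

theorem mem_tanFilt_iff : ∀ {n : ℕ} (_ : T.Geo n) {φ : LevelDiffeo S T n}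
    (_ : IsEquivariantIso S T n φ) {y : S.Q n} {p : ℤ} {v : S.V n},
    φ.d y v ∈ T.tanFilt n p (φ y) ↔ v ∈ S.tanFilt n p y
  | 0, _, φ, h, y, p, v => by
    change φ.d y v ∈ T.F p (φ y) ↔ v ∈ S.F p y
    rw [← h p y]
    exact (φ.d_injective y).mem_set_image
  | n + 1, hT, Φ, ⟨φ, h, hc, hΦ⟩, z, p, v => by
    rcases le_or_gt p n with hp | hp
    · rw [Tower.tanFilt_succ_of_le hp, Tower.tanFilt_succ_of_le hp, Submodule.mem_comap,
        Submodule.mem_comap, hc.dπ_d_apply (hT.reduction n (Nat.lt_succ_self n)), hc z]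
      exact mem_tanFilt_iff (hT.mono (Nat.le_succ n)) h
    · rw [Tower.tanFilt_succ_of_lt hp, Tower.tanFilt_succ_of_lt hp, Submodule.mem_bot,
        Submodule.mem_bot]
      exact map_eq_zero_iff (Φ.d z) (Φ.d_injective z)

theorem map_tanFilt (hT : T.Geo n) {φ : LevelDiffeo S T n} (h : IsEquivariantIso S T n φ)
    (y : S.Q n) (p : ℤ) : (S.tanFilt n p y).map (φ.d y) = T.tanFilt n p (φ y) := by
  ext v
  obtain ⟨w, rfl⟩ := φ.d_surjective y v
  rw [h.mem_tanFilt_iff hT]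
  exact (φ.d_injective y).mem_set_image

theorem frameEquiv_iff (hT : T.Geo n) {φ : LevelDiffeo S T n} (h : IsEquivariantIso S T n φ)
    {y : S.Q n} {ζ ζ' : L →ₗ[ℝ] S.V n} :
    T.FrameEquiv n (φ y) (φ.d y ∘ₗ ζ) (φ.d y ∘ₗ ζ') ↔ S.FrameEquiv n y ζ ζ' := by
  refine forall_congr' fun p => forall₂_congr fun x hx => ?_
  rw [← h.mem_tanFilt_iff hT, map_sub]
  rfl

theorem d_fundamental (hT : T.IsFrameReduction n) {Φ : LevelDiffeo S T (n + 1)}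
    (h : ∀ z a, Φ (S.act n z a) = T.act n (Φ z) a) (A : 𝒜 (n : ℤ)) (z : S.Q (n + 1)) :
    Φ.d z (S.fundamental n A z) = T.fundamental n A (Φ z) := by
  -- The orbit map in `S` is written through the inverse of `Φ`, since smoothness of the action is
  -- known only in `T`.
  have e : (fun a => S.act n z a) = fun a => Φ.inv (T.act n (Φ z) a) := funext fun a => by
    rw [← h z a]; exact (Φ.symm_apply_apply _).symm
  have h1 : (dmap (fun a => S.act n z a) 1 : 𝒯.VG n →L[ℝ] S.V (n + 1)) =
      (dmap Φ.inv (T.act n (Φ z) 1) : T.V (n + 1) →L[ℝ] S.V (n + 1)).comp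
        (dmap (fun a => T.act n (Φ z) a) 1 : 𝒯.VG n →L[ℝ] T.V (n + 1)) := by
    rw [e]
    exact dmap_comp (g := Φ.inv) (Φ.inv.smoothAt _).mdiff (hT.smoothAt_act_right _ _).mdiff
  rw [hT.act_one] at h1
  have h2 : S.fundamental n A z = Φ.inv.d (Φ z) (T.fundamental n A (Φ z)) :=
    congrArg (fun B : 𝒯.VG n →L[ℝ] S.V (n + 1) => B (𝒯.lam n A)) h1
  rw [h2, Φ.d_inv_d']

end IsEquivariantIso

/-- Test fields on the target are pulled back along the diffeomorphism, which preserves the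
filtration and brackets. -/
theorem IsIso.isLinearFrame_zero {φ : LevelDiffeo S T 0} (h : IsIso S T 0 φ) {y : S.Q 0}
    {ζ : L →ₗ[ℝ] S.V 0} (hl : S.IsLinearFrame 0 y ζ) :
    T.IsLinearFrame 0 (φ y) (φ.d y ∘ₗ ζ) := by
  refine ⟨?_, fun p => ?_, ?_⟩
  · rw [LinearMap.ker_comp_of_ker_eq_bot _ (LinearMap.ker_eq_bot.2 (φ.d_injective y))]
    exact hl.1
  · rw [Submodule.map_comp, hl.2.1 p]; exact h p y
  · intro p q hp hq X hX Y hY U ξ η hU hyU hξ hη hξF hηF hξy hηy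
    have hξ' := (Tower.smoothFieldOn_iff T hU).1 hξ
    have hη' := (Tower.smoothFieldOn_iff T hU).1 hη
    have hU' : IsOpen (φ ⁻¹' U) := hU.preimage φ.continuous
    have hF : ∀ (r : ℤ) (x : S.Q 0) (v : T.V 0), v ∈ T.F r (φ x) → φ.inv.d (φ x) v ∈ S.F r x := by
      intro r x v hv
      rw [← h r x] at hv
      obtain ⟨w, hw, rfl⟩ := hv
      rw [φ.inv_d_d]; exact hw
    have h1 := hl.2.2 p q hp hq X hX Y hY (φ ⁻¹' U) (fun x => φ.inv.d (φ x) (ξ (φ x)))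
      (fun x => φ.inv.d (φ x) (η (φ x))) hU' hyU
      ((Tower.smoothFieldOn_iff S hU').2 fun x hx => φ.smoothFieldAt_pull (hξ' _ hx))
      ((Tower.smoothFieldOn_iff S hU').2 fun x hx => φ.smoothFieldAt_pull (hη' _ hx))
      (fun x hx => hF p x _ (hξF _ hx)) (fun x hx => hF q x _ (hηF _ hx))
      (by rw [hξy]; exact φ.inv_d_d _ _) (by rw [hηy]; exact φ.inv_d_d _ _)
    have h2 := Submodule.mem_map_of_mem (f := φ.d y) h1
    rw [h, map_sub] at h2
    have h3 := φ.d_lieB (hξ' _ hyU) (hη' _ hyU)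
    rw [Tower.bracket_eq] at h2 ⊢
    rw [← h3]
    exact h2

namespace IsEquivariantIso

open LevelDiffeo

theorem isLinearFrame_iff : ∀ {n : ℕ} (_ : T.Geo n) {φ : LevelDiffeo S T n}
    (_ : IsEquivariantIso S T n φ) {y : S.Q n} {ζ : L →ₗ[ℝ] S.V n},
    T.IsLinearFrame n (φ y) (φ.d y ∘ₗ ζ) ↔ S.IsLinearFrame n y ζ
  | 0, hT, φ, h, y, ζ => by
    refine ⟨fun hl => ?_, h.isLinearFrame_zero⟩
    have h1 := (IsIso.symm (n := 0) h).isLinearFrame_zero hl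
    rw [show φ.inv (φ y) = y from φ.symm_apply_apply y, ← LinearMap.comp_assoc] at h1
    convert h1 using 1
    ext x
    exact (φ.inv_d_d y _).symm
  | n + 1, hT, Φ, hh, z, ζ => by
    obtain ⟨φ, h, hc, hΦ⟩ := id hh
    have hred := hT.reduction n (Nat.lt_succ_self n)
    refine and_congr ?_ (and_congr (forall_congr' fun p => ?_) (and_congr (forall_congr' fun A => ?_) ?_))
    · rw [LinearMap.ker_comp_of_ker_eq_bot _ (LinearMap.ker_eq_bot.2 (Φ.d_injective z))]
    · rw [Submodule.map_comp, ← hh.map_tanFilt hT]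
      exact (Submodule.map_injective_of_injective (Φ.d_injective z)).eq_iff
    · rw [← d_fundamental hred (fun z a => (hΦ z).2 a)]
      exact (Φ.d_injective z).eq_iff
    · rw [(hΦ z).1, ← LinearMap.comp_assoc, hc.dπ_d hred, LinearMap.comp_assoc]
      refine Function.Injective.mem_set_image (f := fun ζ => φ.d (S.π n z) ∘ₗ ζ) fun a b hab => ?_
      ext x
      exact φ.d_injective _ (congrArg (fun B : L →ₗ[ℝ] T.V n => B x) hab)

theorem push (hT : T.Geo n) {φ : LevelDiffeo S T n} (h : IsEquivariantIso S T n φ)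
    {U : Set (S.Q n)} {Z : S.Q n → L →ₗ[ℝ] S.V n} (hZ : S.IsFrameField n U Z) :
    T.IsFrameField n (φ.inv ⁻¹' U) (fun y => φ.d (φ.inv y) ∘ₗ Z (φ.inv y)) := by
  have hU : IsOpen (φ.inv ⁻¹' U) := hZ.isOpen.preimage φ.symm.continuous
  refine ⟨hU, fun y hy => ?_, fun x => (Tower.smoothFieldOn_iff T hU).2 fun y hy => ?_⟩
  · have := (h.isLinearFrame_iff hT).2 (hZ.linear _ hy)
    rwa [show φ (φ.inv y) = y from φ.apply_symm_apply y] at this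
  · exact φ.inv.smoothFieldAt_pull ((Tower.smoothFieldOn_iff S hZ.isOpen).1 (hZ.smooth x) _ hy)

end IsEquivariantIso

variable [htr : Fact (IsTransitive 𝒜)]

/-- The group acts on frames by composition on the right and an isomorphism by composition on the
left. These commute, and points are determined by frames, so equivariance is automatic once both
towers are geometric. -/
theorem IsIso.equivariant : ∀ {n : ℕ} (_ : S.Geo n) (_ : T.Geo n) {φ : LevelDiffeo S T n}
    (_ : IsIso S T n φ), IsEquivariantIso S T n φ
  | 0, _, _, _, h => h
  | n + 1, hS, hT, Φ, ⟨φ, h, hΦ⟩ => by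
    refine ⟨φ, h.equivariant (hS.mono (Nat.le_succ n)) (hT.mono (Nat.le_succ n)),
      fun z => (hΦ z).1, fun z => ⟨(hΦ z).2, fun a => ?_⟩⟩
    have hS' := hS.reduction n (Nat.lt_succ_self n)
    have hT' := hT.reduction n (Nat.lt_succ_self n)
    obtain ⟨ζ, hζ⟩ := hS'.frames_nonempty z
    refine hT.eq_of_mem_frames (ζ := φ.d (S.π n z) ∘ₗ (ζ ∘ₗ 𝒯.rho n a)) ?_ ?_ ?_
    · rw [hT'.π_act, (hΦ _).1, (hΦ z).1, hS'.π_act]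
    · rw [(hΦ _).2, hS'.π_act]
      exact ⟨_, hS'.frames_act z a ζ hζ, rfl⟩
    · rw [← LinearMap.comp_assoc]
      refine hT'.frames_act _ a _ ?_
      rw [(hΦ z).2]
      exact ⟨ζ, hζ, rfl⟩

/-- Structure functions are natural: a frame field through the image of `ζ` pulls back to one
through `ζ` with the same `γ`. -/
theorem IsIso.isWNormal (hS : S.Geo n) (hT : T.Geo n) {φ : LevelDiffeo S T n} (h : IsIso S T n φ)
    {W1 : ℤ → Submodule ℝ (oneCochain ℝ (gNeg 𝒜) L)} {W2 : ℤ → Submodule ℝ (twoCochain ℝ (gNeg 𝒜) L)}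
    {y : S.Q n} {ζ : L →ₗ[ℝ] S.V n} (hn : S.IsWNormal W1 W2 n y ζ) :
    T.IsWNormal W1 W2 n (φ y) (φ.d y ∘ₗ ζ) := by
  rintro Z ⟨⟨U, hZ, hyU⟩, he⟩
  have hi := h.equivariant hS hT
  have hi' := h.symm.equivariant hT hS
  have hZ' : S.IsFrameField n (φ ⁻¹' U) (fun y => φ.inv.d (φ y) ∘ₗ Z (φ y)) := hi'.push hS hZ
  have hγ : ∀ (X Y : L) (i : ℤ) (c : L), S.IsGammaComponent n y
      (fun y => φ.inv.d (φ y) ∘ₗ Z (φ y)) X Y i c → T.IsGammaComponent n (φ y) Z X Y i c := by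
    intro X Y i c hc u hu
    refine hc u ?_
    rw [LinearMap.comp_apply, hu, Tower.bracket_eq, Tower.bracket_eq,
      ← φ.d_lieB (hZ.smoothAt X hyU) (hZ.smoothAt Y hyU), φ.inv_d_d]
    rfl
  obtain ⟨⟨K, hK, hK'⟩, ht⟩ := hn (fun y => φ.inv.d (φ y) ∘ₗ Z (φ y)) ⟨⟨_, hZ', hyU⟩, by
    rw [← hi.frameEquiv_iff hT]
    convert he using 1
    ext x
    exact φ.d_inv_d' y _⟩
  refine ⟨⟨K, hK, fun p q hp hq X Y hX hY => hγ _ _ _ _ (hK' p q hp hq X Y hX hY)⟩, fun A hA => ?_⟩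
  obtain ⟨t, ht1, ht2⟩ := ht A hA
  exact ⟨t, ht1, fun q hq Y hY => hγ _ _ _ _ (ht2 q hq Y hY)⟩

/-- Frame classes correspond if they have corresponding members. -/
theorem IsIso.frames_eq (hS : S.Geo (n + 1)) (hT : T.Geo (n + 1)) {φ : LevelDiffeo S T n}
    (h : IsIso S T n φ) {z : S.Q (n + 1)} {z' : T.Q (n + 1)} (hz : T.π n z' = φ (S.π n z))
    {ζ : L →ₗ[ℝ] S.V n} (hζ : ζ ∈ S.frames n z) (hζ' : φ.d (S.π n z) ∘ₗ ζ ∈ T.frames n z') :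
    T.frames n z' = (fun ζ => φ.d (S.π n z) ∘ₗ ζ) '' S.frames n z := by
  have hT' := hT.mono (Nat.le_succ n)
  have hi := h.equivariant (hS.mono (Nat.le_succ n)) hT'
  have key : ∀ ξ, φ.d (S.π n z) ∘ₗ ξ ∈ T.frames n z' ↔ ξ ∈ S.frames n z := fun ξ => by
    rw [hT.mem_frames_iff hζ', hS.mem_frames_iff hζ, hz, hi.isLinearFrame_iff hT',
      hi.frameEquiv_iff hT']
  ext ξ
  constructor
  · intro hξ
    have e : φ.d (S.π n z) ∘ₗ (φ.inv.d (φ (S.π n z)) ∘ₗ ξ) = ξ := by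
      ext x; exact φ.d_inv_d' _ _
    exact ⟨_, (key _).1 (by rw [e]; exact hξ), e⟩
  · rintro ⟨ξ, hξ, rfl⟩
    exact (key ξ).2 hξ

/-! ### Lifting isomorphisms -/

section Lift

variable {W1 : ℤ → Submodule ℝ (oneCochain ℝ (gNeg 𝒜) L)}
  {W2 : ℤ → Submodule ℝ (twoCochain ℝ (gNeg 𝒜) L)} {m : ℕ}

/-- The image of a normal frame is normal, hence belongs to a point of the target; this defines the
lift. For smoothness, a local frame field of `S` is pushed forward. It is normal, so it is a smooth
section of the target, and in the fibre coordinate `δ` the lift is translation along this section.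
-/
theorem IsIso.exists_lift_map (hprol : IsProlongation 𝒜 k) (hW : IsComplementSystem 𝒜 k W1 W2)
    (hk : k ≤ m) (hS : S.Geo (m + 1 + 1)) (hT : T.Geo (m + 1 + 1))
    (hnS : ∀ z : S.Q (m + 1 + 1), ∀ ζ ∈ S.frames (m + 1) z,
      S.IsWNormal W1 W2 (m + 1) (S.π (m + 1) z) ζ)
    (hnT : ∀ z : T.Q (m + 1 + 1), ∀ ζ ∈ T.frames (m + 1) z,
      T.IsWNormal W1 W2 (m + 1) (T.π (m + 1) z) ζ)
    {φ : LevelDiffeo S T (m + 1)} (h : IsIso S T (m + 1) φ) :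
    ∃ Φ : S.Q (m + 1 + 1) → T.Q (m + 1 + 1),
      ContMDiff 𝓘(ℝ, S.V (m + 1 + 1)) 𝓘(ℝ, T.V (m + 1 + 1)) ∞ Φ ∧
      ∀ z, T.π (m + 1) (Φ z) = φ (S.π (m + 1) z) ∧
        T.frames (m + 1) (Φ z) = (fun ζ => φ.d (S.π (m + 1) z) ∘ₗ ζ) '' S.frames (m + 1) z := by
  have hS' : S.Geo (m + 1) := hS.mono (by omega)
  have hT' : T.Geo (m + 1) := hT.mono (by omega)
  have hrS := hS.reduction (m + 1) (Nat.lt_succ_self _)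
  have hrT := hT.reduction (m + 1) (Nat.lt_succ_self _)
  have hi := h.equivariant hS' hT'
  have hex : ∀ z : S.Q (m + 1 + 1), ∃ z' : T.Q (m + 1 + 1), T.π (m + 1) z' = φ (S.π (m + 1) z) ∧
      T.frames (m + 1) z' = (fun ζ => φ.d (S.π (m + 1) z) ∘ₗ ζ) '' S.frames (m + 1) z := by
    intro z
    obtain ⟨ζ, hζ⟩ := hrS.frames_nonempty z
    obtain ⟨z', hz', hζ'⟩ := (Tower.isWNormal_iff_exists_mem_frames hprol hW hk hT hnT
      ((hi.isLinearFrame_iff hT').2 (hS.isLinearFrame_of_mem hζ))).1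
      (h.isWNormal hS' hT' (hnS z ζ hζ))
    exact ⟨z', hz', h.frames_eq hS hT hz' hζ hζ'⟩
  choose Φ hΦ hΦf using hex
  refine ⟨Φ, fun z₀ => ?_, fun z => ⟨hΦ z, hΦf z⟩⟩
  obtain ⟨U, s, δ, Z, hU, hZ, hfr, hs0, hs, hsπ, hδ, hsδ⟩ := hS.exists_section_frameField z₀
  have hin : ∀ y, φ.inv (φ y) = y := fun y => φ.symm_apply_apply y
  obtain ⟨σ, hσ⟩ := hT.exists_section hprol hW hk hnT (hi.push hT' hZ) (fun y hy => by
    have h1 := hnS _ _ (hfr _ hy)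
    rw [hsπ _ hy] at h1
    have h2 := h.isWNormal hS' hT' h1
    rwa [show φ (φ.inv y) = y from φ.apply_symm_apply y] at h2)
  have hmem : ∀ y ∈ U, φ y ∈ φ.inv ⁻¹' U := fun y hy => by
    rw [Set.mem_preimage, hin]; exact hy
  have h1 : SmoothAt (E := T.V (m + 1 + 1)) (F := S.V (m + 1 + 1))
      (fun z => T.act (m + 1) (σ (φ (S.π (m + 1) z))) (δ z)) z₀ := by
    refine ContMDiffAt.comp (g := fun p : T.Q (m + 1 + 1) × 𝒯.G (m + 1) => T.act (m + 1) p.1 p.2) z₀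
      hrT.smooth_act.contMDiffAt (ContMDiffAt.prodMk ?_ (hδ z₀ hU))
    exact ContMDiffAt.comp (g := σ) z₀ (hσ _ (hmem _ hU)).2.2
      (ContMDiffAt.comp (g := φ) z₀ (φ.smoothAt _) (hrS.smoothAt_π z₀))
  refine h1.congr_of_eventuallyEq ?_
  filter_upwards [(hZ.isOpen.preimage hrS.smooth_π.continuous).mem_nhds hU] with z hz
  have hz' : S.π (m + 1) z ∈ U := hz
  obtain ⟨hσ1, hσ2, -⟩ := hσ _ (hmem _ hz')
  refine hT.eq_of_mem_frames (ζ := φ.d (S.π (m + 1) z) ∘ₗ (Z (S.π (m + 1) z) ∘ₗ 𝒯.rho (m + 1) (δ z)))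
    (by rw [hΦ, hrT.π_act, hσ1]) ?_ ?_
  · rw [hΦf]
    refine ⟨_, ?_, rfl⟩
    have h2 := hrS.frames_act _ (δ z) _ (hfr _ hz')
    rwa [hsδ z hz'] at h2
  · rw [← LinearMap.comp_assoc]
    refine hrT.frames_act _ _ _ ?_
    rw [hin] at hσ2
    exact hσ2

/-- Points of `Q (n + 1)` are determined by their frames. -/
theorem eq_of_frames_eq (hT : T.Geo (n + 1)) {z z' : T.Q (n + 1)} (hπ : T.π n z = T.π n z')
    (h : T.frames n z = T.frames n z') : z = z' := by
  obtain ⟨ζ, hζ⟩ := (hT.reduction n (Nat.lt_succ_self n)).frames_nonempty z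
  exact hT.eq_of_mem_frames hπ hζ (h ▸ hζ)

/-- The lifts of an isomorphism and of its inverse are mutually inverse, because the frames of a
point determine it. -/
theorem IsIso.exists_lift (hprol : IsProlongation 𝒜 k) (hW : IsComplementSystem 𝒜 k W1 W2)
    (hk : k < n) (hS : S.Geo (n + 1)) (hT : T.Geo (n + 1))
    (hnS : ∀ z : S.Q (n + 1), ∀ ζ ∈ S.frames n z, S.IsWNormal W1 W2 n (S.π n z) ζ)
    (hnT : ∀ z : T.Q (n + 1), ∀ ζ ∈ T.frames n z, T.IsWNormal W1 W2 n (T.π n z) ζ)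
    {φ : LevelDiffeo S T n} (h : IsIso S T n φ) :
    ∃ Φ : LevelDiffeo S T (n + 1), IsIso S T (n + 1) Φ ∧ Φ.Covers φ := by
  obtain ⟨m, rfl⟩ : ∃ m, n = m + 1 := ⟨n - 1, by omega⟩
  obtain ⟨Φ, hΦ, hΦ'⟩ := h.exists_lift_map hprol hW (by omega) hS hT hnS hnT
  obtain ⟨Ψ, hΨ, hΨ'⟩ := h.symm.exists_lift_map hprol hW (by omega) hT hS hnT hnS
  have hin : ∀ y, φ.inv (φ y) = y := fun y => φ.symm_apply_apply y
  have hni : ∀ y, φ (φ.inv y) = y := fun y => φ.apply_symm_apply y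
  refine ⟨⟨⟨Φ, Ψ, fun z => eq_of_frames_eq hS ?_ ?_, fun z => eq_of_frames_eq hT ?_ ?_⟩, hΦ, hΨ⟩,
    ⟨φ, h, hΦ'⟩, fun z => (hΦ' z).1⟩
  · rw [(hΨ' _).1, (hΦ' z).1, hin]
  · rw [(hΨ' _).2, (hΦ' z).2, (hΦ' z).1, Set.image_image]
    convert Set.image_id _ using 2
    ext ζ : 2
    exact φ.inv_d_d _ _
  · rw [(hΦ' _).1, (hΨ' z).1, hni]
  · rw [(hΦ' _).2, (hΨ' z).2, (hΨ' z).1, Set.image_image]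
    convert Set.image_id _ using 2
    ext ζ : 2
    exact φ.d_inv_d _ _

/-- The map downstairs prescribes the frames of the image point, and these determine the point. -/
theorem IsIso.eq_of_covers (hS : S.Geo (n + 1)) (hT : T.Geo (n + 1)) {Φ Φ' : LevelDiffeo S T (n + 1)}
    (h : IsIso S T (n + 1) Φ) (h' : IsIso S T (n + 1) Φ') {φ : LevelDiffeo S T n}
    (hc : Φ.Covers φ) (hc' : Φ'.Covers φ) : Φ = Φ' := by
  have hr := hS.reduction n (Nat.lt_succ_self n)
  have key : ∀ {Φ : LevelDiffeo S T (n + 1)}, IsIso S T (n + 1) Φ → Φ.Covers φ →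
      ∀ z, T.frames n (Φ z) = (fun ζ => φ.d (S.π n z) ∘ₗ ζ) '' S.frames n z := by
    rintro Φ ⟨ψ, -, hψ⟩ hc z
    have e : ψ = φ := Diffeomorph.ext fun y => by
      obtain ⟨w, rfl⟩ := hr.exists_π_eq y
      rw [← hc w, (hψ w).1]
    rw [← e]
    exact (hψ z).2
  refine Diffeomorph.ext fun z => eq_of_frames_eq hT ?_ ?_
  · rw [hc, hc']
  · rw [key h hc, key h' hc']

end Lift

end NormalProlongation


set_option linter.unusedSectionVars false

namespace NormalProlongation

open LieModule.Cohomology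

variable {L : Type v} [LieRing L] [LieAlgebra ℝ L] {𝒜 : ℤ → Submodule ℝ L}
  [GradedLieAlgebra 𝒜] {k : ℕ} {𝒯 : StructureType.{u} 𝒜 k} {S T R : Tower 𝒯} {n : ℕ}
  [htr : Fact (IsTransitive 𝒜)]
  {W1 : ℤ → Submodule ℝ (oneCochain ℝ (gNeg 𝒜) L)}
  {W2 : ℤ → Submodule ℝ (twoCochain ℝ (gNeg 𝒜) L)}

/-! ### Normal towers -/

/-- A geometric structure of order `l` whose frames of order `> k` are `W`-normal. -/
structure WNormalTo (W1 : ℤ → Submodule ℝ (oneCochain ℝ (gNeg 𝒜) L))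
    (W2 : ℤ → Submodule ℝ (twoCochain ℝ (gNeg 𝒜) L)) (S : Tower 𝒯) (l : ℕ) : Prop where
  geo : S.Geo (l + 1)
  normal : ∀ n, k < n → n ≤ l → ∀ z : S.Q (n + 1), ∀ ζ ∈ S.frames n z,
    S.IsWNormal W1 W2 n (S.π n z) ζ

theorem WNormalTo.mono {l l' : ℕ} (h : WNormalTo W1 W2 S l) (hl : l' ≤ l) : WNormalTo W1 W2 S l' :=
  ⟨h.geo.mono (by omega), fun n hn hn' => h.normal n hn (hn'.trans hl)⟩

theorem IsWProlongation.wNormalTo {Q : Tower 𝒯} {ι : LevelDiffeo S Q (k + 1)} {l : ℕ}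
    (h : IsWProlongation W1 W2 Q S ι l) : WNormalTo W1 W2 S l :=
  ⟨h.geometric.geo le_rfl, h.normal⟩

theorem IsIso.exists_covers {Φ : LevelDiffeo S T (n + 1)} (h : IsIso S T (n + 1) Φ) :
    ∃ φ : LevelDiffeo S T n, IsIso S T n φ ∧ Φ.Covers φ :=
  let ⟨φ, hφ, hΦ⟩ := h
  ⟨φ, hφ, fun z => (hΦ z).1⟩

theorem exists_lift_pr (hprol : IsProlongation 𝒜 k) (hW : IsComplementSystem 𝒜 k W1 W2)
    {ψ : LevelDiffeo S T (k + 1)} (h : IsIso S T (k + 1) ψ) {n : ℕ} (hn : k + 1 ≤ n)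
    (hS : ∀ l, l < n → WNormalTo W1 W2 S l) (hT : ∀ l, l < n → WNormalTo W1 W2 T l) :
    ∃ Φ : LevelDiffeo S T n, IsIso S T n Φ ∧ ∀ z, T.pr hn (Φ z) = ψ (S.pr hn z) := by
  induction n, hn using Nat.le_induction with
  | base => exact ⟨ψ, h, fun z => by rw [T.pr_self, S.pr_self]⟩
  | succ n hn ih =>
    obtain ⟨φ, hφ, hp⟩ := ih (fun l hl => hS l (by omega)) (fun l hl => hT l (by omega))
    obtain ⟨Φ, hΦ, hc⟩ := hφ.exists_lift hprol hW (n := n) (by omega) (hS n (by omega)).geo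
      (hT n (by omega)).geo ((hS n (by omega)).normal _ (by omega) le_rfl)
      ((hT n (by omega)).normal _ (by omega) le_rfl)
    exact ⟨Φ, hΦ, fun z => by rw [T.pr_succ hn, S.pr_succ hn, hc z, hp]⟩

theorem IsIso.eq_of_pr {m n : ℕ} (hmn : m ≤ n) (hS : S.Geo n) (hT : T.Geo n)
    {Φ Φ' : LevelDiffeo S T n} (hi : IsIso S T n Φ) (hi' : IsIso S T n Φ')
    (h : ∀ z, T.pr hmn (Φ z) = T.pr hmn (Φ' z)) : Φ = Φ' := by
  induction n, hmn using Nat.le_induction with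
  | base => exact Diffeomorph.ext fun z => by have := h z; rwa [T.pr_self, T.pr_self] at this
  | succ n hmn ih =>
    obtain ⟨φ, hφ, hΦ⟩ := hi.exists_covers
    obtain ⟨φ', hφ', hΦ'⟩ := hi'.exists_covers
    have e : φ = φ' := ih (hS.mono (by omega)) (hT.mono (by omega)) hφ hφ' fun y => by
      obtain ⟨z, rfl⟩ := (hS.reduction n (by omega)).exists_π_eq y
      rw [← hΦ z, ← hΦ' z, ← T.pr_succ hmn (by omega), ← T.pr_succ hmn (by omega), h z]
    subst e
    exact IsIso.eq_of_covers hS hT hi hi' hΦ hΦ'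

/-- Conjugating with `ι` and `j` turns `φ` into an isomorphism of levels of `S` and `T`, which is
then lifted one level at a time. -/
theorem existsUnique_lift (hprol : IsProlongation 𝒜 k) (hW : IsComplementSystem 𝒜 k W1 W2)
    {P Q : Tower 𝒯} {ι : LevelDiffeo S P (k + 1)} {j : LevelDiffeo T Q (k + 1)} {d : ℕ}
    (hS : IsWProlongation W1 W2 P S ι (k + d)) (hT : IsWProlongation W1 W2 Q T j (k + d))
    {φ : LevelDiffeo P Q (k + 1)} (hφ : IsIso P Q (k + 1) φ) :
    ∃! Φ : LevelDiffeo S T (k + 1 + d), IsIso S T (k + 1 + d) Φ ∧ Prolongs ι j φ d Φ := by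
  obtain ⟨Φ, hΦ, hp⟩ := exists_lift_pr hprol hW ((hS.base.trans hφ).trans hT.base.symm)
    (Nat.le_add_right (k + 1) d) (fun l hl => hS.wNormalTo.mono (by omega))
    (fun l hl => hT.wNormalTo.mono (by omega))
  have hΦp : Prolongs ι j φ d Φ := fun z => by
    rw [T.proj_eq_pr, S.proj_eq_pr, hp z]
    exact j.apply_symm_apply _
  refine ⟨Φ, ⟨hΦ, hΦp⟩, fun Φ' hΦ' => hΦ'.1.eq_of_pr (Nat.le_add_right (k + 1) d) (hS.wNormalTo.geo.mono (by omega))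
    (hT.wNormalTo.geo.mono (by omega)) hΦ fun z => j.injective ?_⟩
  rw [← T.proj_eq_pr, ← T.proj_eq_pr]
  exact (hΦ'.2 z).trans (hΦp z).symm

theorem IsIso.exists_pr {m n : ℕ} (hmn : m ≤ n) {Φ : LevelDiffeo S T n} (hi : IsIso S T n Φ) :
    ∃ ψ : LevelDiffeo S T m, IsIso S T m ψ ∧ ∀ z, T.pr hmn (Φ z) = ψ (S.pr hmn z) := by
  induction n, hmn using Nat.le_induction with
  | base => exact ⟨Φ, hi, fun z => by rw [T.pr_self, S.pr_self]⟩
  | succ n hmn ih =>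
    obtain ⟨φ, hφ, hΦ⟩ := hi.exists_covers
    obtain ⟨ψ, hψ, hp⟩ := ih hφ
    exact ⟨ψ, hψ, fun z => by rw [T.pr_succ hmn, S.pr_succ hmn, hΦ z, hp]⟩

/-! ### Descent along connected structure groups -/

/-- Above `k` the group is a continuous image of a vector space, so connectedness has to be assumed
only up to `k`. -/
theorem StructureType.preconnectedSpace (𝒯 : StructureType.{u} 𝒜 k)
    (hG : ∀ n, n ≤ k → ConnectedSpace (𝒯.G n)) (n : ℕ) : PreconnectedSpace (𝒯.G n) := by
  rcases le_or_gt n k with h | h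
  · exact (hG n h).toPreconnectedSpace
  · let w : 𝒯.VG n →ₗ[ℝ] 𝒜 (n : ℤ) := (𝒯.lam n).symm.toLinearMap
    have h1 := (𝒯.vector n h).choose_spec.2.1 w
    have hsurj : Function.Surjective fun x : 𝒯.VG n => (𝒯.vexp h (w x)).toMul := fun a => by
      refine ⟨𝒯.lamMap n ((𝒯.vexp h).symm (Additive.ofMul a)), ?_⟩
      have e : w (𝒯.lamMap n ((𝒯.vexp h).symm (Additive.ofMul a))) =
          (𝒯.vexp h).symm (Additive.ofMul a) := (𝒯.lam n).symm_apply_apply _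
      dsimp only
      rw [e, AddEquiv.apply_symm_apply]
      rfl
    exact ⟨hsurj.range_eq ▸ isPreconnected_range h1.continuous⟩

/-- A smooth map that kills the vertical vectors is constant along the fibres. -/
theorem Tower.IsFrameReduction.eq_of_vertical {E : Type*} [NormedAddCommGroup E] [NormedSpace ℝ E]
    {M : Type*} [TopologicalSpace M] [ChartedSpace E M] [IsManifold 𝓘(ℝ, E) ∞ M]
    (h : S.IsFrameReduction n) [PreconnectedSpace (𝒯.G n)] {f : S.Q (n + 1) → M}
    (hf : ∀ z, SmoothAt (E := E) (F := S.V (n + 1)) f z)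
    (h0 : ∀ z v, S.dπ n z v = 0 → (dmap f z : S.V (n + 1) →L[ℝ] E) v = 0) {z z' : S.Q (n + 1)}
    (hz : S.π n z = S.π n z') : f z = f z' := by
  obtain ⟨a, rfl⟩ := h.transitive z z' hz
  have h1 := constant_of_dmap_eq_zero (E := E) (f := fun a => f (S.act n z a))
    (fun a => ContMDiffAt.comp (g := f) a (hf _) (h.smoothAt_act_right z a)) (fun a => by
      ext v
      rw [dmap_comp (g := f) (hf _).mdiff (h.smoothAt_act_right z a).mdiff]
      refine h0 _ _ ?_
      have h2 : (dmap (fun a => S.π n (S.act n z a)) a : 𝒯.VG n →L[ℝ] S.V n) = 0 := by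
        rw [show (fun a => S.π n (S.act n z a)) = fun _ => S.π n z from funext fun a => h.π_act z a]
        exact mfderiv_const
      rw [dmap_comp (h.smoothAt_π _).mdiff (h.smoothAt_act_right _ _).mdiff] at h2
      exact congrArg (fun B : 𝒯.VG n →L[ℝ] S.V n => B v) h2) 1 a
  simpa only [h.act_one] using h1

/-- A smooth map that kills the vertical vectors descends. -/
theorem Tower.IsFrameReduction.exists_factor {E : Type*} [NormedAddCommGroup E] [NormedSpace ℝ E]
    {M : Type*} [TopologicalSpace M] [ChartedSpace E M] [IsManifold 𝓘(ℝ, E) ∞ M]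
    (h : S.IsFrameReduction n) [PreconnectedSpace (𝒯.G n)] {f : S.Q (n + 1) → M}
    (hf : ∀ z, SmoothAt (E := E) (F := S.V (n + 1)) f z)
    (h0 : ∀ z v, S.dπ n z v = 0 → (dmap f z : S.V (n + 1) →L[ℝ] E) v = 0) :
    ∃ g : S.Q n → M, (∀ y, SmoothAt (E := E) (F := S.V n) g y) ∧ ∀ z, f z = g (S.π n z) := by
  have hc : ∀ z z', S.π n z = S.π n z' → f z = f z' := fun z z' => h.eq_of_vertical hf h0
  choose r hr using h.exists_π_eq
  refine ⟨fun y => f (r y), fun y => ?_, fun z => hc _ _ (hr _).symm⟩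
  obtain ⟨U, s, δ, hU, hyU, hs, hsπ, -⟩ := h.locallyTrivial y
  have h1 := ContMDiffAt.comp (g := f) y (hf (s y)) (hs.contMDiffAt (hU.mem_nhds hyU))
  refine h1.congr_of_eventuallyEq ?_
  filter_upwards [hU.mem_nhds hyU] with x hx
  exact hc _ _ (by rw [hr, hsπ x hx])

/-- The condition makes both the diffeomorphism and its inverse respect vertical vectors. Both
descend along the connected fibres, to mutually inverse maps. -/
theorem LevelDiffeo.exists_descent (hS : S.IsFrameReduction n) (hT : T.IsFrameReduction n)
    [PreconnectedSpace (𝒯.G n)] (Φ : LevelDiffeo S T (n + 1))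
    (h : ∀ z v, T.dπ n (Φ z) (Φ.d z v) = 0 ↔ S.dπ n z v = 0) :
    ∃ φ : LevelDiffeo S T n, Φ.Covers φ := by
  have key : ∀ {S T : Tower 𝒯} (_ : S.IsFrameReduction n) (_ : T.IsFrameReduction n)
      (Φ : LevelDiffeo S T (n + 1)) (_ : ∀ z v, S.dπ n z v = 0 → T.dπ n (Φ z) (Φ.d z v) = 0),
      ∃ f : S.Q n → T.Q n, ContMDiff 𝓘(ℝ, S.V n) 𝓘(ℝ, T.V n) ∞ f ∧
        ∀ z, T.π n (Φ z) = f (S.π n z) := fun {S T} hS hT Φ h =>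
    hS.exists_factor (f := fun z => T.π n (Φ z))
      (fun z => ContMDiffAt.comp (g := T.π n) z (hT.smoothAt_π _) (Φ.smoothAt z)) fun z v hv => by
        rw [dmap_comp (g := T.π n) (f := Φ) (hT.smoothAt_π _).mdiff (Φ.smoothAt z).mdiff]
        exact h z v hv
  obtain ⟨f, hf, hf'⟩ := key hS hT Φ fun z v => (h z v).2
  obtain ⟨g, hg, hg'⟩ := key hT hS Φ.inv fun z v hv => by
    rw [← h, Φ.d_inv_d, show Φ (Φ.inv z) = z from Φ.apply_symm_apply z]
    exact hv
  refine ⟨⟨⟨f, g, fun y => ?_, fun y => ?_⟩, hf, hg⟩, hf'⟩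
  · obtain ⟨z, rfl⟩ := hS.exists_π_eq y
    rw [← hf', ← hg']
    exact congrArg _ (Φ.symm_apply_apply z)
  · obtain ⟨z, rfl⟩ := hT.exists_π_eq y
    rw [← hg', ← hf']
    exact congrArg _ (Φ.apply_symm_apply z)

theorem Tower.IsLinearFrame.dπ_apply_eq_zero_iff (hS : S.Geo (n + 1)) {y : S.Q (n + 1)}
    {ζ : L →ₗ[ℝ] S.V (n + 1)} (h : S.IsLinearFrame (n + 1) y ζ) {x : L} :
    S.dπ n y (ζ x) = 0 ↔ x ∈ filt 𝒜 n :=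
  (h.trunc hS).apply_eq_zero_iff (x := x)

/-- A diffeomorphism that maps some linear frame at every point to a linear frame is an isomorphism. -/
theorem isIso_of_frames (hG : ∀ n, PreconnectedSpace (𝒯.G n)) : ∀ {n : ℕ}, S.Geo n → T.Geo n →
    ∀ {φ : LevelDiffeo S T n}, (∀ y, ∃ ζ, S.IsLinearFrame n y ζ ∧
      T.IsLinearFrame n (φ y) (φ.d y ∘ₗ ζ)) → IsIso S T n φ
  | 0, _, _, φ, h => fun p y => by
    obtain ⟨ζ, h1, h2⟩ := h y
    have h3 := h1.map p
    have h4 := h2.map p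
    rw [Submodule.map_comp, h3] at h4
    exact h4
  | n + 1, hS, hT, Φ, h => by
    have hrS := hS.reduction n (Nat.lt_succ_self n)
    have hrT := hT.reduction n (Nat.lt_succ_self n)
    have := hG n
    -- In a linear frame the vertical vectors are the images of `F^n`, on either side. So the
    -- diffeomorphism respects them and descends, and truncated frames feed the induction.
    obtain ⟨φ, hφ⟩ := Φ.exists_descent hrS hrT fun z v => by
      obtain ⟨ζ, h1, h2⟩ := h z
      obtain ⟨x, rfl⟩ := h1.surjective hS.filtered v
      have h3 := h2.dπ_apply_eq_zero_iff hT (x := x)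
      rw [LinearMap.comp_apply] at h3
      rw [h3, h1.dπ_apply_eq_zero_iff hS]
    have key : ∀ z, ∃ ζ ∈ S.frames n z, φ.d (S.π n z) ∘ₗ ζ ∈ T.frames n (Φ z) := by
      intro z
      obtain ⟨ζ, h1, h2⟩ := h z
      refine ⟨_, h1.trunc_mem, ?_⟩
      have h3 := h2.trunc_mem
      rwa [← LinearMap.comp_assoc, hφ.dπ_d hrT, LinearMap.comp_assoc] at h3
    have hi : IsIso S T n φ := isIso_of_frames hG (hS.mono (Nat.le_succ n)) (hT.mono (Nat.le_succ n))
      fun y => by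
        obtain ⟨z, rfl⟩ := hrS.exists_π_eq y
        obtain ⟨ζ, h1, h2⟩ := key z
        refine ⟨ζ, hS.isLinearFrame_of_mem h1, ?_⟩
        rw [← hφ z]
        exact hT.isLinearFrame_of_mem h2
    refine ⟨φ, hi, fun z => ⟨hφ z, ?_⟩⟩
    obtain ⟨ζ, h1, h2⟩ := key z
    exact hi.frames_eq hS hT (hφ z) h1 h2

/-- The kernel of every form in the Pfaff class is the vertical space, so the diffeomorphism
descends to some `φ`. Corresponding forms belong to frames `ζ` and `ζ'` with `ζ'` the image of `ζ`
under `φ`, and `isIso_of_frames` applies one level lower. -/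
theorem isIso_of_preservesPfaffClass (hG : ∀ n, PreconnectedSpace (𝒯.G n)) (hS : S.Geo (n + 1))
    (hT : T.Geo (n + 1)) {Φ : LevelDiffeo S T (n + 1)} (h : PreservesPfaffClass S T n Φ) :
    IsIso S T (n + 1) Φ := by
  have hrS := hS.reduction n (Nat.lt_succ_self n)
  have hrT := hT.reduction n (Nat.lt_succ_self n)
  have key : ∀ z, ∃ ζ ∈ S.frames n z, ∃ ζ' ∈ T.frames n (Φ z), ∀ v u,
      ζ u = S.dπ n z v ↔ ζ' u = T.dπ n (Φ z) (Φ.d z v) := by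
    intro z
    obtain ⟨ζ', hζ'⟩ := hrT.frames_nonempty (Φ z)
    have hl := hT.isLinearFrame_of_mem hζ'
    let η : T.V (n + 1) →ₗ[ℝ] L ⧸ filt 𝒜 (n : ℤ) :=
      (filt 𝒜 (n : ℤ)).mkQ ∘ₗ Tower.frInv ζ' ∘ₗ T.dπ n (Φ z)
    have hη : ∀ w u, η w = Submodule.Quotient.mk u ↔ ζ' u = T.dπ n (Φ z) w := by
      intro w u
      change Submodule.Quotient.mk (Tower.frInv ζ' (T.dπ n (Φ z) w)) = _ ↔ _
      rw [Submodule.Quotient.eq, ← hl.apply_eq_zero_iff, map_sub, hl.apply_frInv hT.filtered,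
        sub_eq_zero, eq_comm]
    obtain ⟨ζ, hζ, hζη⟩ : η ∘ₗ Φ.d z ∈ pfaffClass S n z := by
      rw [← h z]; exact ⟨η, ⟨ζ', hζ', hη⟩, rfl⟩
    exact ⟨ζ, hζ, ζ', hζ', fun v u => by rw [← hζη, ← hη]; rfl⟩
  have := hG n
  obtain ⟨φ, hφ⟩ := Φ.exists_descent hrS hrT fun z v => by
    obtain ⟨ζ, -, ζ', -, h1⟩ := key z
    have h2 := h1 v 0
    rw [map_zero, map_zero] at h2
    rw [eq_comm, ← h2, eq_comm]
  have hd : ∀ z, ∃ ζ ∈ S.frames n z, φ.d (S.π n z) ∘ₗ ζ ∈ T.frames n (Φ z) := by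
    intro z
    obtain ⟨ζ, hζ, ζ', hζ', h1⟩ := key z
    refine ⟨ζ, hζ, ?_⟩
    convert hζ' using 1
    ext u
    obtain ⟨v, hv⟩ := hrS.dπ_surjective z (ζ u)
    rw [(h1 v u).1 hv.symm, hφ.dπ_d_apply hrT, hv]
    rfl
  have hi : IsIso S T n φ := isIso_of_frames hG (hS.mono (Nat.le_succ n)) (hT.mono (Nat.le_succ n))
    fun y => by
      obtain ⟨z, rfl⟩ := hrS.exists_π_eq y
      obtain ⟨ζ, h1, h2⟩ := hd z
      refine ⟨ζ, hS.isLinearFrame_of_mem h1, ?_⟩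
      rw [← hφ z]
      exact hT.isLinearFrame_of_mem h2
  refine ⟨φ, hi, fun z => ⟨hφ z, ?_⟩⟩
  obtain ⟨ζ, h1, h2⟩ := hd z
  exact hi.frames_eq hS hT (hφ z) h1 h2

theorem exists_isIso_of_preservesPfaffClass (hG : ∀ n, n ≤ k → ConnectedSpace (𝒯.G n))
    {P Q : Tower 𝒯} {ι : LevelDiffeo S P (k + 1)} {j : LevelDiffeo T Q (k + 1)} {d : ℕ}
    (hS : IsWProlongation W1 W2 P S ι (k + 1 + d)) (hT : IsWProlongation W1 W2 Q T j (k + 1 + d))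
    {Φ : LevelDiffeo S T (k + 1 + (d + 1))} (h : PreservesPfaffClass S T (k + 1 + d) Φ) :
    ∃ φ : LevelDiffeo P Q (k + 1), IsIso P Q (k + 1) φ ∧
      IsIso S T (k + 1 + (d + 1)) Φ ∧ Prolongs ι j φ (d + 1) Φ := by
  have hi : IsIso S T (k + 1 + d + 1) Φ := isIso_of_preservesPfaffClass (𝒯.preconnectedSpace hG)
    hS.wNormalTo.geo hT.wNormalTo.geo h
  obtain ⟨ψ, hψ, hp⟩ := IsIso.exists_pr (Nat.le_add_right (k + 1) (d + 1)) hi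
  refine ⟨_, (hS.base.symm.trans hψ).trans hT.base, hi, fun z => ?_⟩
  rw [T.proj_eq_pr, S.proj_eq_pr, hp z]
  change _ = j (ψ (ι.symm (ι _)))
  rw [ι.symm_apply_apply]

end NormalProlongation


set_option linter.unusedSectionVars false

namespace NormalProlongation

variable {L : Type v} [LieRing L] [LieAlgebra ℝ L] {𝒜 : ℤ → Submodule ℝ L}
  [GradedLieAlgebra 𝒜] {k : ℕ} {𝒯 : StructureType.{u} 𝒜 k} {S T : Tower 𝒯} {m n : ℕ}
  [htr : Fact (IsTransitive 𝒜)]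

/-! ### The canonical form of the projective limit -/

theorem Lim.pr_eq (p : Lim S) (h : m ≤ n) : S.pr h (p.1 n) = p.1 m := by
  induction n, h using Nat.le_induction with
  | base => exact S.pr_self _ _
  | succ n h ih => rw [S.pr_succ h, p.2 n, ih]

theorem limTangent.dpr_eq (hS : ∀ n, S.Geo n) {p : Lim S} {w : ∀ n, S.V n}
    (hw : w ∈ limTangent S p) (h : m ≤ n) : S.dpr h (p.1 n) (w n) = w m := by
  induction n, h using Nat.le_induction with
  | base => rw [Tower.dpr_self]; rfl
  | succ n h ih => rw [(hS (n + 1)).dpr_succ h, p.2 n, LinearMap.comp_apply, hw n, ih]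

open Classical in
/-- The frame at level `m` determined by a point of the projective limit. -/
noncomputable def limFrame (m : ℕ) (p : Lim S) : L →ₗ[ℝ] S.V m :=
  if h : (S.frames (m + depth 𝒜) (p.1 (m + depth 𝒜 + 1))).Nonempty then
    S.dpr (Nat.le_add_right m (depth 𝒜)) (p.1 (m + depth 𝒜)) ∘ₗ h.some else 0

/-- Frames in one class at level `N` differ on `L = F^{-μ}` by vectors of `F^{N-μ+1}`. For `N ≥ m +
μ` these are vertical over level `m`. A class at a high level thus gives a genuine frame at level
`m`. -/
theorem dpr_comp_eq (hS : ∀ n, S.Geo n) {p : Lim S} {N : ℕ} (hN : m + depth 𝒜 ≤ N) (h : m ≤ N)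
    {ζ ζ' : L →ₗ[ℝ] S.V N} (hζ : ζ ∈ S.frames N (p.1 (N + 1)))
    (hζ' : ζ' ∈ S.frames N (p.1 (N + 1))) :
    S.dpr h (p.1 N) ∘ₗ ζ = S.dpr h (p.1 N) ∘ₗ ζ' := by
  ext x
  have h1 := (hS (N + 1)).frameEquiv_of_mem hζ' hζ (-(depth 𝒜 : ℤ)) x
    (by rw [filt_depth le_rfl]; trivial)
  rw [p.2 N] at h1
  have h2 := ((hS N).mem_tanFilt_iff_dpr h).1
    (Tower.tanFilt_anti (hS 0).filtered (p.1 N) (p := (m : ℤ)) (by omega) h1)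
  rwa [map_sub, sub_eq_zero] at h2

theorem isLinearFrame_of_lim (hS : ∀ n, S.Geo n) {p : Lim S} {ζ : L →ₗ[ℝ] S.V n}
    (hζ : ζ ∈ S.frames n (p.1 (n + 1))) : S.IsLinearFrame n (p.1 n) ζ := by
  have := (hS (n + 1)).isLinearFrame_of_mem hζ
  rwa [p.2 n] at this

theorem limFrame_eq (hS : ∀ n, S.Geo n) {p : Lim S} {N : ℕ} (hN : m + depth 𝒜 ≤ N) (h : m ≤ N)
    {ζ : L →ₗ[ℝ] S.V N} (hζ : ζ ∈ S.frames N (p.1 (N + 1))) :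
    limFrame m p = S.dpr h (p.1 N) ∘ₗ ζ := by
  induction N, hN using Nat.le_induction with
  | base =>
    have hne : (S.frames (m + depth 𝒜) (p.1 (m + depth 𝒜 + 1))).Nonempty := ⟨ζ, hζ⟩
    rw [limFrame, dif_pos hne]
    exact dpr_comp_eq hS le_rfl _ hne.some_mem hζ
  | succ N hN ih =>
    have h1 := (isLinearFrame_of_lim hS hζ).trunc_mem
    rw [ih (by omega) h1, (hS (N + 1)).dpr_succ (by omega), p.2 N, LinearMap.comp_assoc]

theorem exists_mem_frames (hS : ∀ n, S.Geo n) (p : Lim S) (N : ℕ) :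
    ∃ ζ, ζ ∈ S.frames N (p.1 (N + 1)) :=
  ((hS (N + 1)).reduction N (Nat.lt_succ_self N)).frames_nonempty _

theorem isLinearFrame_limFrame (hS : ∀ n, S.Geo n) (m : ℕ) (p : Lim S) :
    S.IsLinearFrame m (p.1 m) (limFrame m p) := by
  obtain ⟨ζ, hζ⟩ := exists_mem_frames hS p (m + depth 𝒜)
  have h1 := (isLinearFrame_of_lim hS hζ).pr (hS _) (Nat.le_add_right m (depth 𝒜))
  rwa [← limFrame_eq hS le_rfl _ hζ, p.pr_eq] at h1

theorem dπ_limFrame (hS : ∀ n, S.Geo n) (m : ℕ) (p : Lim S) :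
    S.dπ m (p.1 (m + 1)) ∘ₗ limFrame (m + 1) p = limFrame m p := by
  obtain ⟨ζ, hζ⟩ := exists_mem_frames hS p (m + 1 + depth 𝒜)
  have h := (hS (m + 1 + depth 𝒜)).dπ_dpr (Nat.le_add_right (m + 1) (depth 𝒜))
    (by omega : m ≤ m + 1 + depth 𝒜) (p.1 _)
  rw [p.pr_eq] at h
  rw [limFrame_eq hS le_rfl (Nat.le_add_right (m + 1) (depth 𝒜)) hζ, ← LinearMap.comp_assoc, h,
    limFrame_eq hS (by omega) (by omega) hζ]

/-- The truncation of an element of `∏ 𝔤_i` in degrees `< m`. -/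
noncomputable def truncL (e : ∀ i : ℤ, 𝒜 i) (m : ℕ) : L :=
  ∑ i ∈ Finset.Ico (-(depth 𝒜 : ℤ)) m, (e i : L)

theorem hc_truncL (e : ∀ i : ℤ, 𝒜 i) {m : ℕ} {i : ℤ} (hi : i < m) : hc 𝒜 i (truncL e m) = e i := by
  rw [truncL, map_sum, Finset.sum_eq_single i]
  · exact hc_of_mem (e i).2
  · intro j _ hj
    exact hc_of_mem_ne (e j).2 hj
  · intro h
    have h0 : 𝒜 i = ⊥ := depth_spec i (by simp at h; omega)
    rw [(Submodule.eq_bot_iff _).1 h0 _ (e i).2, map_zero]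

theorem truncL_sub_mem (e : ∀ i : ℤ, 𝒜 i) {m : ℕ} {u : L} (h : ∀ i : ℤ, i < m → hc 𝒜 i u = e i) :
    u - truncL e m ∈ filt 𝒜 m :=
  mem_filt_iff.2 fun i hi => by rw [map_sub, h i hi, hc_truncL e hi, sub_self]

/-- Removes the limit from the definition of θ: for each level there is a single equation in terms
of the stable frame. -/
theorem isTheta_iff (hS : ∀ n, S.Geo n) {p : Lim S} {w : ∀ n, S.V n} (hw : w ∈ limTangent S p)
    {e : ∀ i : ℤ, 𝒜 i} : IsTheta S p w e ↔ ∀ m, w m = limFrame m p (truncL e m) := by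
  constructor
  · intro h m
    choose N hN using h
    -- From this level on, the components in all of the finitely many degrees below `m` have
    -- stabilised, and frames project to `limFrame m`.
    let M := m + depth 𝒜 + ∑ i ∈ Finset.Ico (-(depth 𝒜 : ℤ)) m, N i
    obtain ⟨ζ, hζ⟩ := exists_mem_frames hS p M
    have hl := isLinearFrame_of_lim hS hζ
    obtain ⟨u, hu⟩ := hl.surjective (hS 0).filtered (w M)
    have h1 : u - truncL e m ∈ filt 𝒜 m := truncL_sub_mem e fun i hi => by
      rcases lt_or_ge i (-(depth 𝒜 : ℤ)) with hd | hd
      · have h2 := (Submodule.eq_bot_iff _).1 (depth_spec (𝒜 := 𝒜) i hd)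
        rw [h2 _ (hc_mem 𝒜 i u), h2 _ (e i).2]
      · have hle : N i ≤ M := (Finset.single_le_sum (f := N) (fun _ _ => Nat.zero_le _)
          (Finset.mem_Ico.2 ⟨hd, hi⟩)).trans (Nat.le_add_left _ _)
        exact congrArg Subtype.val (hN i M hle ζ hζ u hu)
    have hlf := isLinearFrame_limFrame hS m p
    rw [← hlf.apply_eq_zero_iff, map_sub, sub_eq_zero] at h1
    rw [← h1, limFrame_eq hS (N := M) (by omega) (by omega) hζ, LinearMap.comp_apply, hu,
      limTangent.dpr_eq hS hw]
  · intro h i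
    let m := (i + 1).toNat
    refine ⟨m + depth 𝒜, fun n hn ζ hζ u hu => Subtype.ext ?_⟩
    have hlf := isLinearFrame_limFrame hS m p
    have h1 : limFrame m p u = w m := by
      rw [limFrame_eq hS hn (by omega) hζ, LinearMap.comp_apply, hu, limTangent.dpr_eq hS hw]
    rw [h m, ← sub_eq_zero, ← map_sub, hlf.apply_eq_zero_iff, mem_filt_iff] at h1
    have h2 := h1 i (by omega)
    rw [map_sub, sub_eq_zero, hc_truncL e (by omega)] at h2
    exact h2

/-- The tangent vector with given components with respect to the canonical form. -/
noncomputable def limVector (hS : ∀ n, S.Geo n) (p : Lim S) :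
    (∀ i : ℤ, 𝒜 i) →ₗ[ℝ] limTangent S p where
  toFun e := ⟨fun m => limFrame m p (truncL e m), fun m => by
    have h1 := congrArg (fun B : L →ₗ[ℝ] S.V m => B (truncL e (m + 1))) (dπ_limFrame hS m p)
    refine h1.trans ?_
    rw [← sub_eq_zero]
    refine (map_sub (limFrame m p) _ _).symm.trans
      ((isLinearFrame_limFrame hS m p).apply_eq_zero_iff.2 (truncL_sub_mem e fun i hi => ?_))
    exact hc_truncL e (by push_cast; omega)⟩
  map_add' e e' := Subtype.ext (funext fun m => by
    simp [truncL, Finset.sum_add_distrib])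
  map_smul' a e := Subtype.ext (funext fun m => by
    simp [truncL, ← Finset.smul_sum])

/-- A component of degree `i` is visible as soon as the level exceeds `i`, whence injectivity. For
surjectivity, preimages of the `w m` under the stable frames cohere modulo `F^m`, so their
components of degree `i` no longer change beyond that level. -/
theorem limVector_bijective (hS : ∀ n, S.Geo n) (p : Lim S) :
    Function.Bijective (limVector hS p) := by
  constructor
  · rw [← LinearMap.ker_eq_bot, LinearMap.ker_eq_bot']
    intro e he
    funext i
    have h1 : limFrame (i + 1).toNat p (truncL e (i + 1).toNat) = 0 :=
      congrFun (congrArg Subtype.val he) (i + 1).toNat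
    rw [(isLinearFrame_limFrame hS _ p).apply_eq_zero_iff, mem_filt_iff] at h1
    have h2 := h1 i (by omega)
    rw [hc_truncL e (by omega)] at h2
    exact Subtype.ext h2
  · rintro ⟨w, hw⟩
    choose u hu using fun m =>
      (isLinearFrame_limFrame hS m p).surjective (hS 0).filtered (w m)
    have hstep : ∀ m n : ℕ, m ≤ n → u n - u m ∈ filt 𝒜 m := by
      intro m n hmn
      rw [← (isLinearFrame_limFrame hS m p).apply_eq_zero_iff, map_sub, hu, sub_eq_zero]
      induction n, hmn using Nat.le_induction with
      | base => exact hu m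
      | succ n hmn ih =>
        have h1 : limFrame n p (u (n + 1)) = w n := by
          rw [← dπ_limFrame hS n p, LinearMap.comp_apply, hu]
          exact hw n
        rw [← hu n, ← sub_eq_zero, ← map_sub, (isLinearFrame_limFrame hS n p).apply_eq_zero_iff] at h1
        have h2 := (isLinearFrame_limFrame hS m p).apply_eq_zero_iff.2
          (filt_anti (by exact_mod_cast hmn) h1)
        rw [map_sub, sub_eq_zero] at h2
        rw [h2, ih]
    -- `(i + 1).toNat` is the first level above `i`, namely `0` for negative `i`.
    refine ⟨fun i => ⟨hc 𝒜 i (u (i + 1).toNat), hc_mem 𝒜 _ _⟩, Subtype.ext (funext fun m => ?_)⟩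
    refine Eq.trans ?_ (hu m)
    rw [eq_comm, ← sub_eq_zero]
    refine (map_sub (limFrame m p) _ _).symm.trans
      ((isLinearFrame_limFrame hS m p).apply_eq_zero_iff.2 (truncL_sub_mem _ fun i hi => ?_))
    have h1 := mem_filt_iff.1 (hstep (i + 1).toNat m (by omega)) i (by omega)
    rwa [map_sub, sub_eq_zero] at h1

/-- θ is the inverse of `limVector`. At level `m` a θ-constant field is the stable frame applied to
a fixed vector, and this frame is a projection of a smooth field of frames over level `m + μ + 1`.
-/
theorem isAbsoluteParallelism (hS : ∀ n, S.Geo n) : IsAbsoluteParallelism S where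
  iso p := by
    refine ⟨(LinearEquiv.ofBijective _ (limVector_bijective hS p)).symm, fun w e => ?_⟩
    rw [isTheta_iff hS w.2, LinearEquiv.symm_apply_eq, Subtype.ext_iff, funext_iff]
    rfl
  smooth e m p := by
    obtain ⟨U, Z, hU, hpU, hZ, hZs⟩ := ((hS (m + depth 𝒜 + 1)).reduction (m + depth 𝒜)
      (Nat.lt_succ_self _)).frames_smooth (p.1 (m + depth 𝒜 + 1))
    have hle := Nat.le_add_right m (depth 𝒜)
    refine ⟨m + depth 𝒜 + 1, U, fun z => ⟨S.pr hle (S.π (m + depth 𝒜) z),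
      S.dpr hle (S.π (m + depth 𝒜) z) (Z z (truncL e m))⟩, hU.mem_nhds hpU, fun z hz => ?_, ?_⟩
    · have h1 : SmoothAlongAt (E := S.V (m + depth 𝒜)) (F := S.V (m + depth 𝒜 + 1))
          (S.π (m + depth 𝒜)) (fun z => Z z (truncL e m)) z :=
        (hZs (truncL e m)).contMDiffAt (hU.mem_nhds hz)
      exact (h1.dmap_apply isOpen_univ trivial fun y _ =>
        (hS (m + depth 𝒜)).smoothAt_pr hle y).contMDiffWithinAt
    · intro q hq w hw hθ
      have h1 := (isTheta_iff hS hw).1 hθ m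
      rw [limFrame_eq hS le_rfl hle (hZ _ hq)] at h1
      dsimp only
      rw [q.2, q.pr_eq, h1]
      rfl

/-! ### Finite type -/

theorem eq_bot_of_finiteDimensional [FiniteDimensional ℝ L] : ∃ N : ℕ, ∀ i : ℤ, N ≤ i → 𝒜 i = ⊥ := by
  classical
  let b := Module.finBasis ℝ L
  let s : Finset ℤ := Finset.univ.biUnion fun j => (DirectSum.decompose 𝒜 (b j)).support
  refine ⟨∑ i ∈ s, i.natAbs + 1, fun i hi => ?_⟩
  rw [Submodule.eq_bot_iff]
  intro x hx
  have h0 : hc 𝒜 i = 0 := b.ext fun j => by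
    by_contra hne
    have h1 : i ∈ s := by
      refine Finset.mem_biUnion.2 ⟨j, Finset.mem_univ _, DFinsupp.mem_support_iff.2 fun h => hne ?_⟩
      rw [hc_apply, h]; rfl
    have h2 := Finset.single_le_sum (f := fun i : ℤ => i.natAbs) (fun _ _ => Nat.zero_le _) h1
    omega
  rw [← hc_of_mem hx, h0]
  rfl

theorem finrank_eq_of_bot (hS : ∀ n, S.Geo n) (hn : filt 𝒜 n = ⊥) (y : S.Q n) :
    Module.finrank ℝ (S.V n) = Module.finrank ℝ L := by
  have hr := (hS (n + 1)).reduction n (Nat.lt_succ_self n)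
  obtain ⟨z, rfl⟩ := hr.exists_π_eq y
  obtain ⟨ζ, hζ⟩ := hr.frames_nonempty z
  have hl := (hS (n + 1)).isLinearFrame_of_mem hζ
  exact (LinearEquiv.ofBijective ζ ⟨LinearMap.ker_eq_bot.1 (hl.ker.trans hn),
    hl.surjective (hS 0).filtered⟩).finrank_eq.symm

/-- With 𝔤_n = 0 and `n > k` the structure group is trivial. The projection is then injective, and
local sections show that its inverse is smooth. -/
theorem exists_diffeo_π (hr : S.IsFrameReduction n) (hn : k < n) (h : 𝒜 (n : ℤ) = ⊥) :
    ∃ Ψ : Diffeomorph 𝓘(ℝ, S.V (n + 1)) 𝓘(ℝ, S.V n) (S.Q (n + 1)) (S.Q n) ∞, ∀ z, Ψ z = S.π n z := by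
  have hG : ∀ a : 𝒯.G n, a = 1 := fun a => by
    have h1 : (𝒯.vexp hn).symm (Additive.ofMul a) = 0 := Subtype.ext
      ((Submodule.eq_bot_iff _).1 h _ ((𝒯.vexp hn).symm (Additive.ofMul a)).2)
    rw [AddEquiv.symm_apply_eq, map_zero] at h1
    exact Additive.ofMul.injective h1
  have hinj : Function.Injective (S.π n) := fun z w hzw => by
    obtain ⟨a, rfl⟩ := hr.transitive z w hzw
    rw [hG a, hr.act_one]
  choose r hrπ using hr.exists_π_eq
  refine ⟨⟨⟨S.π n, r, fun z => hinj (hrπ _), hrπ⟩, hr.smooth_π, fun y => ?_⟩, fun z => rfl⟩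
  obtain ⟨U, s, δ, hU, hyU, hs, hsπ, -⟩ := hr.locallyTrivial y
  refine (hs.contMDiffAt (hU.mem_nhds hyU)).congr_of_eventuallyEq ?_
  filter_upwards [hU.mem_nhds hyU] with x hx
  exact hinj ((hrπ x).trans (hsπ x hx).symm)

theorem finite_type (hS : ∀ n, S.Geo n) [FiniteDimensional ℝ L] :
    (∃ N : ℕ, ∀ n, N ≤ n →
      (∃ Ψ : Diffeomorph 𝓘(ℝ, S.V (n + 1)) 𝓘(ℝ, S.V n) (S.Q (n + 1)) (S.Q n) ∞,
        ∀ z, Ψ z = S.π n z) ∧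
      (Nonempty (S.Q n) → Module.finrank ℝ (S.V n) = Module.finrank ℝ L)) ∧
    ∀ p : Lim S, FiniteDimensional ℝ (limTangent S p) ∧
      Module.finrank ℝ (limTangent S p) = Module.finrank ℝ L := by
  obtain ⟨N, hN⟩ := eq_bot_of_finiteDimensional (𝒜 := 𝒜)
  constructor
  -- Beyond `N` the components of 𝔤 vanish, and beyond `k` the group is the corresponding vector
  -- group.
  · refine ⟨N + k + 1, fun n hn => ⟨exists_diffeo_π ((hS (n + 1)).reduction n (Nat.lt_succ_self n))
      (by omega) (hN n (by omega)), fun ⟨y⟩ => finrank_eq_of_bot hS ?_ y⟩⟩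
    rw [eq_bot_iff]
    exact filt_induction fun i hi => (hN i (by omega)).le
  · intro p
    let f : L →ₗ[ℝ] (∀ i : ℤ, 𝒜 i) := LinearMap.pi fun i =>
      (hc 𝒜 i).codRestrict (𝒜 i) (hc_mem 𝒜 i)
    have hf : Function.Bijective f := by
      constructor
      · intro x y hxy
        exact hc_ext fun i => congrArg Subtype.val (congrFun hxy i)
      · intro e
        refine ⟨truncL e N, funext fun i => Subtype.ext ?_⟩
        change hc 𝒜 i (truncL e N) = e i
        rcases lt_or_ge i N with hi | hi
        · exact hc_truncL e hi
        · have h2 := (Submodule.eq_bot_iff _).1 (hN i hi)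
          rw [h2 _ (hc_mem 𝒜 i _), h2 _ (e i).2]
    let E := (LinearEquiv.ofBijective f hf).trans
      (LinearEquiv.ofBijective _ (limVector_bijective hS p))
    exact ⟨Module.Finite.equiv E, E.finrank_eq.symm⟩

end NormalProlongation


set_option linter.unusedSectionVars false

namespace NormalProlongation

open LieModule.Cohomology

variable {L : Type v} [LieRing L] [LieAlgebra ℝ L] {𝒜 : ℤ → Submodule ℝ L}
  [GradedLieAlgebra 𝒜] {k : ℕ} {𝒯 : StructureType.{u} 𝒜 k} {S T : Tower 𝒯} {m n : ℕ}
  [htr : Fact (IsTransitive 𝒜)]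
  {W1 : ℤ → Submodule ℝ (oneCochain ℝ (gNeg 𝒜) L)}
  {W2 : ℤ → Submodule ℝ (twoCochain ℝ (gNeg 𝒜) L)}

/-! ### Sections of the projective limit -/

theorem Tower.pr_pr (S : Tower 𝒯) {l : ℕ} (h : l ≤ m) (h' : m ≤ n) (h'' : l ≤ n) (z : S.Q n) :
    S.pr h (S.pr h' z) = S.pr h'' z := by
  induction n, h' using Nat.le_induction with
  | base => rw [S.pr_self]
  | succ n h' ih => rw [S.pr_succ h', S.pr_succ (h.trans h'), ih]

/-- Global sections of all projections of a tower, smooth in the levels `> k`. -/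
structure Sections (S : Tower 𝒯) where
  r : ∀ n, S.Q n → S.Q (n + 1)
  π_r : ∀ n y, S.π n (r n y) = y
  smooth : ∀ n, k < n → ∀ y, SmoothAt (E := S.V (n + 1)) (F := S.V n) (r n) y

/-- Sections carry finite levels into the limit, so that maps of limits can be studied by calculus
on manifolds. Above `k`, global normal frame fields make them smooth; at lower levels any right
inverse of the projection serves. -/
theorem nonempty_sections (hprol : IsProlongation 𝒜 k) (hW : IsComplementSystem 𝒜 k W1 W2)
    (hS : ∀ l, WNormalTo W1 W2 S l) : Nonempty (Sections S) := by
  have : ∀ n, ∃ r : S.Q n → S.Q (n + 1), (∀ y, S.π n (r y) = y) ∧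
      (k < n → ∀ y, SmoothAt (E := S.V (n + 1)) (F := S.V n) r y) := by
    intro n
    by_cases hn : k < n
    · obtain ⟨m, rfl⟩ : ∃ m, n = m + 1 := ⟨n - 1, by omega⟩
      obtain ⟨Z, hZ, hZn⟩ := (hS m).geo.exists_global_normal hprol hW (by omega)
      obtain ⟨σ, hσ⟩ := (hS (m + 1)).geo.exists_section hprol hW (by omega)
        ((hS (m + 1)).normal _ hn le_rfl) hZ (fun y _ => hZn y)
      exact ⟨σ, fun y => (hσ y trivial).1, fun _ y => (hσ y trivial).2.2⟩
    · choose r hr using ((hS n).geo.reduction n (Nat.lt_succ_self n)).exists_π_eq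
      exact ⟨r, hr, fun h => absurd h hn⟩
  choose r hr hr' using this
  exact ⟨⟨r, hr, hr'⟩⟩

namespace Sections

variable (r : Sections S)

/-- The composed section from level `m` to level `n`. -/
def up (h : m ≤ n) : S.Q m → S.Q n :=
  Nat.leRec (motive := fun n _ => S.Q m → S.Q n) (fun z => z) (fun n _ f z => r.r n (f z)) h

theorem up_self (h : m ≤ m) (z : S.Q m) : r.up h z = z := by
  unfold up; rw [Nat.leRec_self]

theorem up_succ (h : m ≤ n) (h' : m ≤ n + 1) (z : S.Q m) : r.up h' z = r.r n (r.up h z) := by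
  unfold up; rw [Nat.leRec_succ]

theorem smoothAt_up (hm : k < m) (h : m ≤ n) (z : S.Q m) :
    SmoothAt (E := S.V n) (F := S.V m) (r.up h) z := by
  induction n, h using Nat.le_induction with
  | base =>
    rw [show r.up (le_refl m) = fun z => z from funext (r.up_self _)]
    exact contMDiffAt_id
  | succ n h ih =>
    rw [show r.up (Nat.le_succ_of_le h) = fun z => r.r n (r.up h z) from funext (r.up_succ h _)]
    exact ContMDiffAt.comp (g := r.r n) z (r.smooth n (by omega) _) ih

/-- The point of the projective limit that extends a point of level `n` by the sections. -/
def lift (n : ℕ) (y : S.Q n) : Lim S :=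
  ⟨fun j => if h : j ≤ n then S.pr h y else r.up (le_of_not_ge h) y, fun j => by
    dsimp only
    rcases lt_trichotomy j n with h | rfl | h
    · rw [dif_pos (show j + 1 ≤ n from h), dif_pos h.le, S.π_pr]
    · rw [dif_neg (by omega), dif_pos le_rfl, r.up_succ le_rfl, r.π_r, r.up_self, S.pr_self]
    · rw [dif_neg (by omega), dif_neg (by omega), r.up_succ h.le, r.π_r]⟩

theorem lift_of_le (h : m ≤ n) (y : S.Q n) : (r.lift n y).1 m = S.pr h y := dif_pos h

theorem lift_self (n : ℕ) (y : S.Q n) : (r.lift n y).1 n = y := by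
  rw [r.lift_of_le le_rfl, S.pr_self]

theorem smoothAt_lift (hS : ∀ n, S.Geo n) (hn : k < n) (m : ℕ) (y : S.Q n) :
    SmoothAt (E := S.V m) (F := S.V n) (fun y => (r.lift n y).1 m) y := by
  by_cases h : m ≤ n
  · rw [show (fun y => (r.lift n y).1 m) = S.pr h from funext (r.lift_of_le h)]
    exact (hS n).smoothAt_pr h y
  · rw [show (fun y => (r.lift n y).1 m) = r.up (le_of_not_ge h) from funext fun y => dif_neg h]
    exact r.smoothAt_up hn _ y

/-- The image of a tangent vector under the section of the projective limit. -/
noncomputable def dlift (n : ℕ) (y : S.Q n) (v : S.V n) : ∀ m, S.V m :=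
  fun m => (dmap (fun y => (r.lift n y).1 m) y : S.V n →L[ℝ] S.V m) v

theorem dlift_mem (hS : ∀ n, S.Geo n) (hn : k < n) (y : S.Q n) (v : S.V n) :
    r.dlift n y v ∈ limTangent S (r.lift n y) := fun m => by
  have h := dmap_comp (g := S.π m) (f := fun y => (r.lift n y).1 (m + 1)) (w := y)
    (((hS (m + 1)).reduction m (Nat.lt_succ_self m)).smoothAt_π _).mdiff
    (r.smoothAt_lift hS hn (m + 1) y).mdiff
  rw [show (fun y => S.π m ((r.lift n y).1 (m + 1))) = fun y => (r.lift n y).1 m from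
    funext fun y => (r.lift n y).2 m] at h
  exact (congrArg (fun B : S.V n →L[ℝ] S.V m => B v) h).symm

theorem dlift_self (n : ℕ) (y : S.Q n) (v : S.V n) : r.dlift n y v n = v := by
  unfold dlift
  rw [show (fun y => (r.lift n y).1 n) = fun y => y from funext (r.lift_self n)]
  exact congrArg (fun B : S.V n →L[ℝ] S.V n => B v) mfderiv_id

end Sections

/-! ### Maps between projective limits -/

/-- Representatives at two levels are comparable only through points of the limit. Every point of
level `n + n'` extends to such a point, so the pulled back representatives agree locally there and
have equal differentials. -/
theorem Represents.eq_dmap (r : Sections S) (hS : ∀ n, S.Geo n) {Φ : Lim S → Lim T} {p : Lim S}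
    {n' : ℕ} {f : S.Q n → T.Q m} {f' : S.Q n' → T.Q m} {U : Set (S.Q n)} {U' : Set (S.Q n')}
    (h : Represents Φ p m n f U) (h' : Represents Φ p m n' f' U') {w : ∀ n, S.V n}
    (hw : w ∈ limTangent S p) :
    (dmap f (p.1 n) : S.V n →L[ℝ] T.V m) (w n) = (dmap f' (p.1 n') : S.V n' →L[ℝ] T.V m) (w n') := by
  have hn : n ≤ n + n' := Nat.le_add_right _ _
  have hn' : n' ≤ n + n' := Nat.le_add_left _ _
  have key : ∀ {l : ℕ} (hl : l ≤ n + n') {f : S.Q l → T.Q m} {U : Set (S.Q l)},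
      Represents Φ p m l f U →
      ((fun x => (Φ (r.lift (n + n') x)).1 m) =ᶠ[𝓝 (p.1 (n + n'))] fun x => f (S.pr hl x)) ∧
      (dmap (fun x => f (S.pr hl x)) (p.1 (n + n')) : S.V (n + n') →L[ℝ] T.V m) (w (n + n')) =
        (dmap f (p.1 l) : S.V l →L[ℝ] T.V m) (w l) := by
    intro l hl f U hf
    have hs := (hS (n + n')).smoothAt_pr hl (p.1 (n + n'))
    have hp := p.pr_eq hl
    constructor
    · have h1 := hs.continuousAt.eventually (p := fun x => x ∈ U) (by rw [hp]; exact hf.1)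
      filter_upwards [h1] with x hx
      rw [hf.2.2 _ (by rwa [r.lift_of_le hl]), r.lift_of_le hl]
    · have h2 : SmoothAt (E := T.V m) (F := S.V l) f (S.pr hl (p.1 (n + n'))) := by
        rw [hp]; exact hf.2.1.contMDiffAt hf.1
      rw [dmap_comp (g := f) (f := S.pr hl) h2.mdiff hs.mdiff, hp]
      exact congrArg (dmap f (p.1 l) : S.V l →L[ℝ] T.V m) (limTangent.dpr_eq hS hw hl)
  obtain ⟨e1, e2⟩ := key hn h
  obtain ⟨e1', e2'⟩ := key hn' h'
  rw [← e2, ← e2', dmap_congr (e1.symm.trans e1')]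

theorem Represents.π_comp (hT : ∀ n, T.Geo n) {Φ : Lim S → Lim T} {p : Lim S}
    {f : S.Q n → T.Q (m + 1)} {U : Set (S.Q n)} (h : Represents Φ p (m + 1) n f U) :
    Represents Φ p m n (fun x => T.π m (f x)) U :=
  ⟨h.1, ((hT (m + 1)).reduction m (Nat.lt_succ_self m)).smooth_π.comp_contMDiffOn h.2.1,
    fun q hq => ((Φ q).2 m).symm.trans (congrArg (T.π m) (h.2.2 q hq))⟩

theorem Represents.smoothAt {Φ : Lim S → Lim T} {p : Lim S} {f : S.Q n → T.Q m} {U : Set (S.Q n)}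
    (h : Represents Φ p m n f U) : SmoothAt (E := T.V m) (F := S.V n) f (p.1 n) :=
  h.2.1.contMDiffAt h.1

theorem IsPushforward.eq_dmap (r : Sections S) (hS : ∀ n, S.Geo n) {Φ : Lim S → Lim T} {p : Lim S}
    {f : S.Q n → T.Q m} {U : Set (S.Q n)} (h : Represents Φ p m n f U) {w : ∀ n, S.V n}
    (hw : w ∈ limTangent S p) {w' : ∀ n, T.V n} (hw' : IsPushforward Φ p w w') :
    w' m = (dmap f (p.1 n) : S.V n →L[ℝ] T.V m) (w n) := by
  obtain ⟨n', f', U', h', e⟩ := hw' m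
  exact e.trans (h'.eq_dmap r hS h hw)

theorem IsPushforward.mem_limTangent (r : Sections S) (hS : ∀ n, S.Geo n) (hT : ∀ n, T.Geo n)
    {Φ : Lim S → Lim T} {p : Lim S} {w : ∀ n, S.V n} (hw : w ∈ limTangent S p) {w' : ∀ n, T.V n}
    (h : IsPushforward Φ p w w') : w' ∈ limTangent T (Φ p) := fun m => by
  obtain ⟨n, f, U, hf, e⟩ := h (m + 1)
  rw [h.eq_dmap r hS (hf.π_comp hT) hw, dmap_comp (g := T.π m) (f := f)
    (((hT (m + 1)).reduction m (Nat.lt_succ_self m)).smoothAt_π _).mdiff hf.smoothAt.mdiff,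
    e, hf.2.2 p (mem_of_mem_nhds hf.1)]
  rfl

theorem IsLimSmooth.exists_pushforward {Φ : Lim S → Lim T} (h : IsLimSmooth Φ) (p : Lim S)
    (w : ∀ n, S.V n) : ∃ w', IsPushforward Φ p w w' := by
  choose n f U hf using h p
  exact ⟨fun m => (dmap (f m) (p.1 (n m)) : S.V (n m) →L[ℝ] T.V m) (w (n m)),
    fun m => ⟨n m, f m, U m, hf m, rfl⟩⟩

/-- By the chain rule for representatives, pushing a vector forward by the inverse and then by the
map returns it; the identity for θ can then be read backwards. -/
theorem IsParallelismIso.symm (r' : Sections T) (hS : ∀ n, S.Geo n)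
    (hT : ∀ n, T.Geo n) {Φ : Lim S ≃ Lim T} (h : IsParallelismIso Φ) : IsParallelismIso Φ.symm := by
  refine ⟨h.smooth_symm, h.smooth, fun p w hw w' hw' e => ?_⟩
  have hm := hw'.mem_limTangent r' hT hS hw
  obtain ⟨w'', hw''⟩ := h.smooth.exists_pushforward (Φ.symm p) w'
  have e2 : w'' = w := funext fun m => by
    obtain ⟨n, f, U, hf, e1⟩ := hw'' m
    obtain ⟨l, g, V, hg, e2⟩ := hw' n
    have hgp : (Φ.symm p).1 n = g (p.1 l) := hg.2.2 p (mem_of_mem_nhds hg.1)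
    have hs : SmoothAt (E := T.V m) (F := S.V n) f (g (p.1 l)) := by
      rw [← hgp]; exact hf.smoothAt
    have h1 : Represents (fun q : Lim T => q) p m l (fun x => f (g x))
        (V ∩ g ⁻¹' U) := by
      refine ⟨Filter.inter_mem hg.1 (hg.smoothAt.continuousAt.preimage_mem_nhds (hgp ▸ hf.1)),
        hf.2.1.comp (hg.2.1.mono Set.inter_subset_left) fun x hx => hx.2, fun q hq => ?_⟩
      have hq2 := hg.2.2 q hq.1
      have h5 := hf.2.2 (Φ.symm q) (by rw [hq2]; exact hq.2)
      rw [Φ.apply_symm_apply] at h5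
      exact h5.trans (congrArg f hq2)
    have h2 : Represents (fun q : Lim T => q) p m m (fun x => x) Set.univ :=
      ⟨Filter.univ_mem, contMDiffOn_id, fun _ _ => rfl⟩
    have h3 := h1.eq_dmap r' hT h2 hw
    rw [dmap_comp (g := f) (f := g) hs.mdiff hg.smoothAt.mdiff] at h3
    rw [e1, hgp, e2]
    exact h3.trans (congrArg (fun B : T.V m →L[ℝ] T.V m => B (w m)) mfderiv_id)
  have h4 := h.theta (Φ.symm p) w' hm w'' hw'' e
  rw [Φ.apply_symm_apply, e2] at h4
  exact h4.symm

/-! ### Isomorphisms of parallelisms come from isomorphisms of all finite orders -/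

theorem IsParallelismIso.dmap_apply (r : Sections S) (hS : ∀ n, S.Geo n) (hT : ∀ n, T.Geo n)
    {Φ : Lim S ≃ Lim T} (h : IsParallelismIso Φ) {p : Lim S} {f : S.Q n → T.Q m} {U : Set (S.Q n)}
    (hf : Represents Φ p m n f U) (e : ∀ i : ℤ, 𝒜 i) :
    (dmap f (p.1 n) : S.V n →L[ℝ] T.V m) ((limVector hS p e).1 n) =
      limFrame m (Φ p) (truncL e m) := by
  obtain ⟨w', hw'⟩ := h.smooth.exists_pushforward p (limVector hS p e).1
  have hw := (limVector hS p e).2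
  rw [← hw'.eq_dmap r hS hf hw]
  exact (isTheta_iff hT (hw'.mem_limTangent r hS hT hw)).1
    ((h.theta p _ hw w' hw' e).2 ((isTheta_iff hS hw).2 fun _ => rfl)) m

theorem exists_factor_pr {E : Type*} [NormedAddCommGroup E] [NormedSpace ℝ E]
    {M : Type*} [TopologicalSpace M] [ChartedSpace E M] [IsManifold 𝓘(ℝ, E) ∞ M]
    (hG : ∀ n, PreconnectedSpace (𝒯.G n)) (hmn : m ≤ n) (hS : S.Geo n) {f : S.Q n → M}
    (hf : ∀ z, SmoothAt (E := E) (F := S.V n) f z)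
    (h0 : ∀ z v, S.dpr hmn z v = 0 → (dmap f z : S.V n →L[ℝ] E) v = 0) :
    ∃ g : S.Q m → M, (∀ y, SmoothAt (E := E) (F := S.V m) g y) ∧ ∀ z, f z = g (S.pr hmn z) := by
  induction n, hmn using Nat.le_induction with
  | base => exact ⟨f, hf, fun z => by rw [S.pr_self]⟩
  | succ n hmn ih =>
    have := hG n
    have hr := hS.reduction n (Nat.lt_succ_self n)
    obtain ⟨g, hg, hfg⟩ := hr.exists_factor hf fun z v hv => h0 z v (by
      rw [hS.dpr_succ hmn, LinearMap.comp_apply, hv, map_zero])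
    obtain ⟨g', hg', hgg'⟩ := ih (hS.mono (Nat.le_succ n)) hg fun y v hv => by
      obtain ⟨z, rfl⟩ := hr.exists_π_eq y
      obtain ⟨v, rfl⟩ := hr.dπ_surjective z v
      have h1 := h0 z v (by rw [hS.dpr_succ hmn]; exact hv)
      rw [show f = fun z => g (S.π n z) from funext hfg,
        dmap_comp (g := g) (f := S.π n) (hg _).mdiff (hr.smoothAt_π z).mdiff] at h1
      exact h1
    exact ⟨g', hg', fun z => by rw [hfg, hgg', S.pr_succ hmn]⟩

/-- The component at level `m` is composed with a smooth section of the limit over some level `n >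
k`. Vectors vertical over level `m` are those with θ in `F^m`. Preservation of θ shows that the
composite kills them, so by connectedness it factors through level `m`. -/
theorem IsParallelismIso.exists_component (hG : ∀ n, PreconnectedSpace (𝒯.G n)) (r : Sections S)
    (hS : ∀ n, S.Geo n) (hT : ∀ n, T.Geo n) {Φ : Lim S ≃ Lim T} (h : IsParallelismIso Φ) (m : ℕ) :
    ∃ g : S.Q m → T.Q m, ContMDiff 𝓘(ℝ, S.V m) 𝓘(ℝ, T.V m) ∞ g ∧ ∀ q, (Φ q).1 m = g (q.1 m) := by
  have key : ∀ n, k < n → ∀ hmn : m ≤ n, ∃ g : S.Q m → T.Q m,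
      (∀ y, SmoothAt (E := T.V m) (F := S.V m) g y) ∧
      ∀ y : S.Q n, (Φ (r.lift n y)).1 m = g (S.pr hmn y) := by
    intro n hn hmn
    have hloc : ∀ y : S.Q n, ∃ (l : ℕ) (f : S.Q l → T.Q m) (U : Set (S.Q l)),
        Represents Φ (r.lift n y) m l f U ∧
        (fun y => (Φ (r.lift n y)).1 m) =ᶠ[𝓝 y] fun y => f ((r.lift n y).1 l) := by
      intro y
      obtain ⟨l, f, U, hf⟩ := h.smooth (r.lift n y) m
      refine ⟨l, f, U, hf, ?_⟩
      filter_upwards [(r.smoothAt_lift hS hn l y).continuousAt.preimage_mem_nhds hf.1] with x hx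
      exact hf.2.2 _ hx
    refine exists_factor_pr hG hmn (hS n) (fun y => ?_) fun y v hv => ?_
    · obtain ⟨l, f, U, hf, he⟩ := hloc y
      exact (ContMDiffAt.comp (g := f) y hf.smoothAt
        (r.smoothAt_lift hS hn l y)).congr_of_eventuallyEq he
    · obtain ⟨l, f, U, hf, he⟩ := hloc y
      obtain ⟨e, he'⟩ := (limVector_bijective hS _).2 ⟨_, r.dlift_mem hS hn y v⟩
      have hw : ∀ j, limFrame j (r.lift n y) (truncL e j) = r.dlift n y v j := fun j =>
        congrFun (congrArg Subtype.val he') j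
      have h1 := h.dmap_apply r hS hT hf e
      rw [he'] at h1
      rw [dmap_congr he, dmap_comp (g := f) (f := fun y => (r.lift n y).1 l) hf.smoothAt.mdiff
        (r.smoothAt_lift hS hn l y).mdiff]
      refine h1.trans ?_
      rw [(isLinearFrame_limFrame hT m _).apply_eq_zero_iff,
        ← (isLinearFrame_limFrame hS m (r.lift n y)).apply_eq_zero_iff, hw m,
        ← limTangent.dpr_eq hS (r.dlift_mem hS hn y v) hmn, r.lift_self, r.dlift_self]
      exact hv
  -- Near `q` the component factors through some level `l`, and `lift n (q n)` agrees with `q` up to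
  -- level `n`. Hence the values at these approximations are eventually the value at `q`.
  have hlift : ∀ q : Lim S, ∃ N, ∀ n, N ≤ n → (Φ (r.lift n (q.1 n))).1 m = (Φ q).1 m := by
    intro q
    obtain ⟨l, f, U, hf⟩ := h.smooth q m
    refine ⟨l, fun n hn => ?_⟩
    have h1 : (r.lift n (q.1 n)).1 l = q.1 l := by rw [r.lift_of_le hn, q.pr_eq]
    rw [hf.2.2 q (mem_of_mem_nhds hf.1), hf.2.2 _ (h1 ▸ mem_of_mem_nhds hf.1), h1]
  have hdep : ∀ q q' : Lim S, q.1 m = q'.1 m → (Φ q).1 m = (Φ q').1 m := by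
    intro q q' hq
    obtain ⟨N, hN⟩ := hlift q
    obtain ⟨N', hN'⟩ := hlift q'
    obtain ⟨g, -, hg⟩ := key (N + N' + k + m + 1) (by omega) (by omega)
    rw [← hN (N + N' + k + m + 1) (by omega), ← hN' (N + N' + k + m + 1) (by omega), hg, hg, q.pr_eq,
      q'.pr_eq, hq]
  obtain ⟨g, hgs, hg⟩ := key (m + k + 1) (by omega) (by omega)
  refine ⟨g, hgs, fun q => ?_⟩
  have h1 := hg (q.1 (m + k + 1))
  rw [q.pr_eq] at h1
  rw [← h1]
  exact hdep _ _ (by rw [r.lift_of_le (by omega), q.pr_eq])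

/-- The components of the map and of its inverse are inverse diffeomorphisms at every level. They
carry stable frames to stable frames, which suffices by `isIso_of_frames`. -/
theorem IsParallelismIso.isLimIso (hG : ∀ n, PreconnectedSpace (𝒯.G n)) (r : Sections S)
    (r' : Sections T) (hS : ∀ n, S.Geo n) (hT : ∀ n, T.Geo n) {Φ : Lim S ≃ Lim T}
    (h : IsParallelismIso Φ) : IsLimIso Φ := by
  choose f hfs hf using h.exists_component hG r hS hT
  choose g hgs hg using (h.symm r' hS hT).exists_component hG r' hT hS
  refine ⟨fun n => ⟨⟨f n, g n, fun y => ?_, fun y => ?_⟩, hfs n, hgs n⟩, fun n => ?_,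
    fun p n => hf n p⟩
  · rw [← r.lift_self n y, ← hf, ← hg, Φ.symm_apply_apply]
  · rw [← r'.lift_self n y, ← hg, ← hf, Φ.apply_symm_apply]
  · refine isIso_of_frames hG (hS n) (hT n) fun y => ?_
    let p := r.lift n y
    have hp : p.1 n = y := r.lift_self n y
    refine ⟨limFrame n p, hp ▸ isLinearFrame_limFrame hS n p, ?_⟩
    have hrep : Represents Φ p n n (f n) Set.univ :=
      ⟨Filter.univ_mem, (hfs n).contMDiffOn, fun q _ => hf n q⟩
    have h1 : ((dmap (f n) y : S.V n →L[ℝ] T.V n).toLinearMap ∘ₗ limFrame n p) =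
        limFrame n (Φ p) := by
      ext u
      let e : ∀ i : ℤ, 𝒜 i := fun i => ⟨hc 𝒜 i u, hc_mem 𝒜 i u⟩
      have hu : u - truncL e n ∈ filt 𝒜 n := truncL_sub_mem e fun _ _ => rfl
      have h2 := (isLinearFrame_limFrame hS n p).apply_eq_zero_iff.2 hu
      have h3 := (isLinearFrame_limFrame hT n (Φ p)).apply_eq_zero_iff.2 hu
      rw [map_sub, sub_eq_zero] at h2 h3
      rw [LinearMap.comp_apply, h2, h3, ← h.dmap_apply r hS hT hrep e, hp]
      rfl
    have h4 := isLinearFrame_limFrame hT n (Φ p)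
    rw [← h1, hf, hp] at h4
    exact h4

/-! ### Isomorphisms of order `∞` -/

/-- At every level the frames that define θ correspond under the isomorphism, and its differential
is injective. -/
theorem IsLimIso.isParallelismIso (r : Sections S) (hS : ∀ n, S.Geo n) {Φ : Lim S ≃ Lim T}
    (h : IsLimIso Φ) : IsParallelismIso Φ := by
  obtain ⟨φ, hφ, hΦ⟩ := h
  have hrep : ∀ p m, Represents Φ p m m (φ m) Set.univ := fun p m =>
    ⟨Filter.univ_mem, (φ m).contMDiff.contMDiffOn, fun q _ => hΦ q m⟩
  refine ⟨fun p m => ⟨m, _, _, hrep p m⟩, fun p m => ⟨m, (φ m).symm, Set.univ, Filter.univ_mem,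
    (φ m).symm.contMDiff.contMDiffOn, fun q _ => ?_⟩, fun p w hw w' hw' e => ?_⟩
  · have h1 := hΦ (Φ.symm q) m
    rw [Φ.apply_symm_apply] at h1
    rw [h1]
    exact ((φ m).symm_apply_apply _).symm
  · have hw1 : ∀ m, w' m = (φ m).d (p.1 m) (w m) := fun m => hw'.eq_dmap r hS (hrep p m) hw
    have hfr : ∀ n, T.frames n ((Φ p).1 (n + 1)) =
        (fun ζ => (φ n).d (p.1 n) ∘ₗ ζ) '' S.frames n (p.1 (n + 1)) := by
      intro n
      obtain ⟨χ, -, hχ'⟩ := hφ (n + 1)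
      have e1 : χ = φ n := Diffeomorph.ext fun y => by
        have h1 := (hχ' ((r.lift n y).1 (n + 1))).1
        rw [← hΦ, (Φ _).2, (r.lift n y).2, hΦ, r.lift_self] at h1
        exact h1.symm
      have h2 := (hχ' (p.1 (n + 1))).2
      rwa [e1, p.2, ← hΦ] at h2
    refine forall_congr' fun i => exists_congr fun N => forall_congr' fun n => imp_congr_right fun _ => ?_
    rw [hfr n, Set.forall_mem_image]
    refine forall_congr' fun ζ => imp_congr_right fun _ => forall_congr' fun u => ?_
    rw [hw1 n, LinearMap.comp_apply, ((φ n).d_injective (p.1 n)).eq_iff]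

/-- Lifts to different levels are compatible by uniqueness, although they are chosen independently.
-/
theorem IsIso.pr_eq_of_pr (r : Sections S) {N M : ℕ} (hkN : m ≤ N) (hNM : N ≤ M) (hkM : m ≤ M)
    (hS : S.Geo M) (hT : T.Geo M) {ψ : LevelDiffeo S T m} {Ψ : LevelDiffeo S T N}
    (hΨ : IsIso S T N Ψ) (hΨψ : ∀ z, T.pr hkN (Ψ z) = ψ (S.pr hkN z)) {Ξ : LevelDiffeo S T M}
    (hΞ : IsIso S T M Ξ) (hΞψ : ∀ z, T.pr hkM (Ξ z) = ψ (S.pr hkM z)) (p : Lim S) :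
    T.pr hNM (Ξ (p.1 M)) = Ψ (p.1 N) := by
  obtain ⟨χ, hχ, hχΞ⟩ := hΞ.exists_pr hNM
  have e : χ = Ψ := hχ.eq_of_pr hkN (hS.mono hNM) (hT.mono hNM) hΨ fun y => by
    have h1 := hχΞ ((r.lift N y).1 M)
    rw [Lim.pr_eq, r.lift_self] at h1
    rw [← h1, T.pr_pr hkN hNM hkM, hΞψ, hΨψ, Lim.pr_eq, r.lift_of_le hkN]
  rw [hχΞ, Lim.pr_eq, e]

/-- The map at level `n` is the truncation of any lift to a higher level. That this does not depend
on the higher level makes the maps commute with the projections, including the levels below `k + 1`.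
-/
theorem exists_isLimIso (hprol : IsProlongation 𝒜 k) (hW : IsComplementSystem 𝒜 k W1 W2)
    (hS : ∀ l, WNormalTo W1 W2 S l) (hT : ∀ l, WNormalTo W1 W2 T l)
    {ψ : LevelDiffeo S T (k + 1)} (h : IsIso S T (k + 1) ψ) :
    ∃ Φ : Lim S ≃ Lim T, IsLimIso Φ ∧ ∀ p, (Φ p).1 (k + 1) = ψ (p.1 (k + 1)) := by
  obtain ⟨r⟩ := nonempty_sections hprol hW hS
  have hgS : ∀ n, S.Geo n := fun n => (hS n).geo.mono (Nat.le_succ n)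
  have hgT : ∀ n, T.Geo n := fun n => (hT n).geo.mono (Nat.le_succ n)
  have hlift : ∀ {N : ℕ} (hN : k + 1 ≤ N), ∃ Φ : LevelDiffeo S T N, IsIso S T N Φ ∧
      ∀ z, T.pr hN (Φ z) = ψ (S.pr hN z) := fun hN =>
    exists_lift_pr hprol hW h hN (fun l _ => hS l) fun l _ => hT l
  have key : ∀ n, ∃ φ : LevelDiffeo S T n, IsIso S T n φ ∧ ∀ N (hn : n ≤ N) (hN : k + 1 ≤ N)
      (Ψ : LevelDiffeo S T N), IsIso S T N Ψ → (∀ z, T.pr hN (Ψ z) = ψ (S.pr hN z)) →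
      ∀ p : Lim S, T.pr hn (Ψ (p.1 N)) = φ (p.1 n) := by
    intro n
    have hk : k + 1 ≤ n + (k + 1) := Nat.le_add_left _ _
    have hn : n ≤ n + (k + 1) := Nat.le_add_right _ _
    obtain ⟨Θ, hΘ, hΘψ⟩ := hlift hk
    obtain ⟨φ, hφ, hφΘ⟩ := hΘ.exists_pr hn
    refine ⟨φ, hφ, fun N hnN hN Ψ hΨ hΨψ p => ?_⟩
    -- A common higher level at which both lifts are compared.
    have hM : k + 1 ≤ N + (n + (k + 1)) := by omega
    obtain ⟨Ξ, hΞ, hΞψ⟩ := hlift hM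
    have h1 := hΨ.pr_eq_of_pr r hN (Nat.le_add_right _ _) hM (hgS _) (hgT _) hΨψ hΞ hΞψ p
    have h2 := hΘ.pr_eq_of_pr r hk (Nat.le_add_left _ _) hM (hgS _) (hgT _) hΘψ hΞ hΞψ p
    rw [← h1, T.pr_pr hnN _ (by omega), ← T.pr_pr hn (Nat.le_add_left _ _), h2, hφΘ, p.pr_eq]
  choose φ hφ hφψ using key
  have hc : ∀ n, (φ (n + 1)).Covers (φ n) := fun n y => by
    have hN : k + 1 ≤ n + 1 + (k + 1) := Nat.le_add_left _ _
    obtain ⟨Ψ, hΨ, hΨψ⟩ := hlift hN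
    have h1 := hφψ (n + 1) _ (Nat.le_add_right _ _) hN Ψ hΨ hΨψ (r.lift (n + 1) y)
    have h2 := hφψ n _ (by omega) hN Ψ hΨ hΨψ (r.lift (n + 1) y)
    rw [r.lift_self] at h1
    rw [← h1, T.π_pr _ (by omega), h2, ← (r.lift (n + 1) y).2, r.lift_self]
  refine ⟨⟨fun p => ⟨fun n => φ n (p.1 n), fun n => ?_⟩, fun q => ⟨fun n => (φ n).symm (q.1 n),
    fun n => ?_⟩, fun p => Subtype.ext (funext fun n => (φ n).symm_apply_apply _),
    fun q => Subtype.ext (funext fun n => (φ n).apply_symm_apply _)⟩, ⟨φ, hφ, fun p n => rfl⟩,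
    fun p => ?_⟩
  · rw [hc n, p.2]
  · have h1 := (hc n).inv (q.1 (n + 1))
    rw [q.2] at h1
    exact h1
  · have h1 := hφψ (k + 1) (k + 1) le_rfl le_rfl ψ h (fun z => by rw [T.pr_self, S.pr_self]) p
    rw [T.pr_self] at h1
    exact h1.symm

theorem IsLimIso.eq_of_eq (r : Sections S) (hS : ∀ n, S.Geo n) (hT : ∀ n, T.Geo n)
    {Φ Φ' : Lim S ≃ Lim T} (h : IsLimIso Φ) (h' : IsLimIso Φ')
    (he : ∀ p, (Φ p).1 m = (Φ' p).1 m) : Φ = Φ' := by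
  obtain ⟨φ, hφ, hΦ⟩ := h
  obtain ⟨φ', hφ', hΦ'⟩ := h'
  refine Equiv.ext fun p => Subtype.ext (funext fun n => ?_)
  have hm : m ≤ n + m := Nat.le_add_left _ _
  have e : φ (n + m) = φ' (n + m) := (hφ _).eq_of_pr hm (hS _) (hT _) (hφ' _) fun y => by
    rw [← r.lift_self _ y, ← hΦ, ← hΦ', Lim.pr_eq, Lim.pr_eq, he]
  rw [← Lim.pr_eq (Φ p) (Nat.le_add_right n m), ← Lim.pr_eq (Φ' p) (Nat.le_add_right n m), hΦ, hΦ', e]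

/-- Isomorphisms of order `k` lift uniquely to order `∞`. -/
theorem existsUnique_limIso (hprol : IsProlongation 𝒜 k) (hW : IsComplementSystem 𝒜 k W1 W2)
    {P Q : Tower 𝒯} {ι : LevelDiffeo S P (k + 1)} {j : LevelDiffeo T Q (k + 1)}
    (hS : ∀ l, IsWProlongation W1 W2 P S ι l) (hT : ∀ l, IsWProlongation W1 W2 Q T j l)
    {φ : LevelDiffeo P Q (k + 1)} (hφ : IsIso P Q (k + 1) φ) :
    ∃! Φ : Lim S ≃ Lim T, IsLimIso Φ ∧ LimProlongs ι j φ Φ := by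
  obtain ⟨r⟩ := nonempty_sections hprol hW fun l => (hS l).wNormalTo
  obtain ⟨Φ, hΦ, hp⟩ := exists_isLimIso hprol hW (fun l => (hS l).wNormalTo)
    (fun l => (hT l).wNormalTo) (((hS 0).base.trans hφ).trans (hT 0).base.symm)
  have hΦp : LimProlongs ι j φ Φ := fun p => by rw [hp p]; exact j.apply_symm_apply _
  exact ⟨Φ, ⟨hΦ, hΦp⟩, fun Φ' hΦ' => hΦ'.1.eq_of_eq r
    (fun n => (hS n).wNormalTo.geo.mono (Nat.le_succ n))
    (fun n => (hT n).wNormalTo.geo.mono (Nat.le_succ n)) hΦ (m := k + 1) fun p =>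
      j.injective ((hΦ'.2 p).trans (hΦp p).symm)⟩

theorem exists_isIso_of_isParallelismIso (hprol : IsProlongation 𝒜 k)
    (hW : IsComplementSystem 𝒜 k W1 W2) (hG : ∀ n, n ≤ k → ConnectedSpace (𝒯.G n))
    {P Q : Tower 𝒯} {ι : LevelDiffeo S P (k + 1)} {j : LevelDiffeo T Q (k + 1)}
    (hS : ∀ l, IsWProlongation W1 W2 P S ι l) (hT : ∀ l, IsWProlongation W1 W2 Q T j l)
    {Φ : Lim S ≃ Lim T} (h : IsParallelismIso Φ) :
    ∃ φ : LevelDiffeo P Q (k + 1), IsIso P Q (k + 1) φ ∧ IsLimIso Φ ∧ LimProlongs ι j φ Φ := by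
  obtain ⟨r⟩ := nonempty_sections hprol hW fun l => (hS l).wNormalTo
  obtain ⟨r'⟩ := nonempty_sections hprol hW fun l => (hT l).wNormalTo
  have hi := h.isLimIso (𝒯.preconnectedSpace hG) r r'
    (fun n => (hS n).wNormalTo.geo.mono (Nat.le_succ n))
    (fun n => (hT n).wNormalTo.geo.mono (Nat.le_succ n))
  obtain ⟨ψ, hψ, hΦ⟩ := id hi
  refine ⟨_, ((hS 0).base.symm.trans (hψ (k + 1))).trans (hT 0).base, hi, fun p => ?_⟩
  rw [hΦ]
  change _ = j (ψ (k + 1) (ι.symm (ι _)))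
  rw [ι.symm_apply_apply]

end NormalProlongation


set_option linter.unusedSectionVars false

namespace NormalProlongation

open LieModule.Cohomology

variable {L : Type v} [LieRing L] [LieAlgebra ℝ L] {𝒜 : ℤ → Submodule ℝ L}
  [GradedLieAlgebra 𝒜] {k : ℕ} {𝒯 : StructureType.{u} 𝒜 k} {S T : Tower 𝒯} {m n : ℕ}
  [htr : Fact (IsTransitive 𝒜)]
  {W1 : ℤ → Submodule ℝ (oneCochain ℝ (gNeg 𝒜) L)}
  {W2 : ℤ → Submodule ℝ (twoCochain ℝ (gNeg 𝒜) L)}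

/-! ### Transport of structure -/

/-- Each law of the bundle is conjugated through `Φ`. Equivariance is assumed because it is
automatic only after the source is known to be geometric. -/
theorem IsEquivariantIso.isFrameReduction {Φ : LevelDiffeo S T (n + 1)}
    (h : IsEquivariantIso S T (n + 1) Φ) (hT : T.Geo (n + 1)) : S.IsFrameReduction n := by
  obtain ⟨φ, hφ, hc, hΦ⟩ := h
  have hr := hT.reduction n (Nat.lt_succ_self n)
  have hT' := hT.mono (Nat.le_succ n)
  have hinv : ∀ z, Φ.inv (Φ z) = z := fun z => Φ.symm_apply_apply z
  have hinv' : ∀ z, Φ (Φ.inv z) = z := fun z => Φ.apply_symm_apply z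
  have hmem : ∀ z ζ, ζ ∈ S.frames n z ↔ φ.d (S.π n z) ∘ₗ ζ ∈ T.frames n (Φ z) := fun z ζ => by
    rw [(hΦ z).1]
    exact (Function.Injective.mem_set_image fun ζ ζ' he => LinearMap.ext fun x =>
      φ.d_injective _ (LinearMap.congr_fun he x)).symm
  have hmem' : ∀ z ζ, ζ ∈ T.frames n (Φ z) → φ.inv.d (T.π n (Φ z)) ∘ₗ ζ ∈ S.frames n z := by
    intro z ζ hζ
    rw [hmem, hc z]
    convert hζ using 1
    ext x
    exact φ.d_inv_d' _ _
  have hact : ∀ z a, S.act n z a = Φ.inv (T.act n (Φ z) a) := fun z a => by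
    rw [← (hΦ z).2 a, hinv]
  have hπ : ∀ z a, S.π n (S.act n z a) = S.π n z := fun z a => by
    rw [hc.π_eq]
    dsimp only
    rw [(hΦ z).2, hr.π_act]
  refine ⟨hc.smooth_π hr, ?_, ?_, ?_, ?_, ?_, ?_, ?_, ?_, ?_, ?_, ?_⟩
  · rw [show (fun p : S.Q (n + 1) × 𝒯.G n => S.act n p.1 p.2) =
      fun p => Φ.inv (T.act n (Φ p.1) p.2) from funext fun p => hact p.1 p.2]
    exact Φ.symm.contMDiff.comp (hr.smooth_act.comp
      ((Φ.contMDiff.comp contMDiff_fst).prodMk contMDiff_snd))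
  · intro z; rw [hact, hr.act_one, hinv]
  · intro z a b; rw [hact, hact z a, hact, hinv', hr.act_mul]
  · exact hπ
  · intro z a he
    refine hr.free (Φ z) a ?_
    rw [← (hΦ z).2, he]
  · intro z w he
    obtain ⟨a, ha⟩ := hr.transitive (Φ z) (Φ w) (by rw [hc, hc, he])
    exact ⟨a, by rw [hact, ha, hinv]⟩
  · intro y
    obtain ⟨U, s, δ, hU, hy, hs, hsπ, hδ, hδs⟩ := hr.locallyTrivial (φ y)
    refine ⟨φ ⁻¹' U, fun x => Φ.inv (s (φ x)), fun z => δ (Φ z), hU.preimage φ.continuous, hy,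
      Φ.symm.contMDiff.comp_contMDiffOn (hs.comp φ.contMDiff.contMDiffOn fun x hx => hx),
      fun x hx => ?_, hδ.comp Φ.contMDiff.contMDiffOn fun z hz => ?_, fun z hz => ?_⟩
    · rw [hc.inv, hsπ _ hx]; exact φ.symm_apply_apply x
    · change T.π n (Φ z) ∈ U; rw [hc z]; exact hz
    · rw [hact, hinv', ← hc z, hδs _ (by rw [hc z]; exact hz), hinv]
  · intro z
    obtain ⟨ζ, hζ⟩ := hr.frames_nonempty (Φ z)
    exact ⟨_, hmem' z ζ hζ⟩
  · intro z ζ hζ ζ'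
    rw [hmem] at hζ ⊢
    rw [hr.frames_class _ _ hζ, hc z, hφ.isLinearFrame_iff hT', hφ.frameEquiv_iff hT']
  · intro z a ζ hζ
    rw [hmem] at hζ ⊢
    rw [(hΦ z).2]
    have h1 := hr.frames_act _ a _ hζ
    rw [hπ]
    exact h1
  · intro z
    obtain ⟨U, Z, hU, hz, hZ, hZs⟩ := hr.frames_smooth (Φ z)
    refine ⟨Φ ⁻¹' U, fun z => φ.inv.d (T.π n (Φ z)) ∘ₗ Z (Φ z), hU.preimage Φ.continuous, hz,
      fun z hz => hmem' z _ (hZ _ hz), fun x z hz => ?_⟩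
    have h1 : SmoothAlongAt (E := T.V n) (F := T.V (n + 1)) (T.π n) (fun z => Z z x) (Φ z) :=
      (hZs x).contMDiffAt (hU.mem_nhds hz)
    have h2 := (h1.comp (Φ.smoothAt z)).dmap_apply isOpen_univ trivial fun y _ => φ.inv.smoothAt y
    rw [hc.π_eq]
    exact h2.contMDiffWithinAt

theorem WNormalTo.transport {l : ℕ} {Φ : LevelDiffeo S T (l + 1)} (h : IsIso S T (l + 1) Φ)
    (hS : S.Geo (l + 1)) (hT : WNormalTo W1 W2 T l) : WNormalTo W1 W2 S l := by
  refine ⟨hS, fun n hn hl z ζ hζ => ?_⟩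
  obtain ⟨Ψ, ⟨φ, hφ, hΨ⟩, -⟩ := h.exists_pr (Nat.succ_le_succ hl)
  have h1 : φ.d (S.π n z) ∘ₗ ζ ∈ T.frames n (Ψ z) := by rw [(hΨ z).2]; exact ⟨ζ, hζ, rfl⟩
  have h2 := hφ.symm.isWNormal (hT.geo.mono (by omega)) (hS.mono (by omega))
    (hT.normal n hn hl _ _ h1)
  rw [(hΨ z).1, show φ.inv (φ (S.π n z)) = S.π n z from φ.symm_apply_apply _,
    ← LinearMap.comp_assoc] at h2
  convert h2 using 1
  ext x
  exact (φ.inv_d_d _ _).symm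

/-! ### Trivial bundles of frames -/

theorem Tower.IsFrameField.smoothAlongAt_comp_ad {U : Set (T.Q n)} {Z : T.Q n → (L →ₗ[ℝ] T.V n)}
    (hZ : T.IsFrameField n U Z) {F N : Type*} [NormedAddCommGroup F] [NormedSpace ℝ F]
    [TopologicalSpace N] [ChartedSpace F N] [IsManifold 𝓘(ℝ, F) ∞ N] {b : N → T.Q n}
    {A : N → 𝒜 (n : ℤ)} {w : N} (hw : b w ∈ U) (hb : SmoothAt (E := T.V n) (F := F) b w)
    (hA : ∀ f : 𝒜 (n : ℤ) →ₗ[ℝ] ℝ, SmoothAt (E := ℝ) (F := F) (fun x => f (A x)) w) (x : L) :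
    SmoothAlongAt (E := T.V n) (F := F) b (fun z => (Z (b z) ∘ₗ
      (LinearMap.id + (LieAlgebra.ad ℝ L (A z : L) : L →ₗ[ℝ] L))) x) w := by
  have := 𝒯.finiteDimensional (n : ℤ) (by positivity)
  let β := Module.finBasis ℝ (𝒜 (n : ℤ))
  have hZx : ∀ x, SmoothAlongAt (E := T.V n) (F := F) b (fun z => Z (b z) x) w := fun x =>
    SmoothAlongAt.comp (f := fun y => y) (v := fun y => Z y x) (hZ.smoothAt x hw) hb
  have h1 := (hZx x).add (SmoothAlongAt.sum Finset.univ hb fun j _ =>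
    SmoothAlongAt.smul (hA (β.coord j)) (hZx ⁅(β j : L), x⁆))
  refine h1.congr (Filter.Eventually.of_forall fun z => ?_)
  have h2 : ((A z : 𝒜 (n : ℤ)) : L) = ∑ j, β.coord j (A z) • (β j : L) := by
    conv_lhs => rw [← β.sum_repr (A z)]
    rw [Submodule.coe_sum]
    rfl
  rw [LinearMap.comp_apply, LinearMap.add_apply, LinearMap.id_apply, map_add]
  congr 1
  change Z (b z) ⁅((A z : 𝒜 (n : ℤ)) : L), x⁆ = _
  rw [h2, sum_lie, map_sum]
  exact Finset.sum_congr rfl fun j _ => by rw [smul_lie, map_smul]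

theorem Tower.FrameEquiv.comp_right (hT : T.IsFilteredManifold) {y : T.Q n} {ζ ζ' : L →ₗ[ℝ] T.V n}
    (h : T.FrameEquiv n y ζ ζ') (a : 𝒯.G n) :
    T.FrameEquiv n y (ζ ∘ₗ 𝒯.rho n a) (ζ' ∘ₗ 𝒯.rho n a) := by
  have hmap : ∀ p : ℤ, p ≤ n → ∀ x ∈ filt 𝒜 p, 𝒯.rho n a x ∈ filt 𝒜 p := by
    intro p hp x hx
    have h1 := 𝒯.rho_mem n a
    have h2 : (filt 𝒜 p).map (𝒯.rho n a) ⊔ filt 𝒜 (n : ℤ) = filt 𝒜 p := by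
      cases n with
      | zero => exact h1.1 p hp
      | succ n => exact h1.1 p hp
    rw [← h2]
    exact Submodule.mem_sup_left (Submodule.mem_map_of_mem hx)
  intro p x hx
  rcases le_or_gt p n with hp | hp
  · exact h p _ (hmap p hp x hx)
  -- For `p > n` nothing is known about `rho n a` on `F^p` itself, but its values lie in `F^n`,
  -- where the two frames agree.
  · have h1 := h n _ (hmap n le_rfl x (filt_anti hp.le hx))
    rw [Tower.tanFilt_eq_bot hT y (by omega)] at h1
    rw [show (ζ' ∘ₗ 𝒯.rho n a) x - (ζ ∘ₗ 𝒯.rho n a) x = 0 from h1]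
    exact zero_mem _

/-- A tower whose level `n + 1` is the product of level `n` with `G_n`. -/
structure TrivialExtension (S T : Tower 𝒯) (n : ℕ) where
  c : LevelDiffeo S T n
  iso : IsEquivariantIso S T n c
  Z : T.Q n → (L →ₗ[ℝ] T.V n)
  b : S.Q (n + 1) → T.Q n
  g : S.Q (n + 1) → 𝒯.G n
  pt : T.Q n × 𝒯.G n → S.Q (n + 1)
  b_pt : ∀ y a, b (pt (y, a)) = y
  g_pt : ∀ y a, g (pt (y, a)) = a
  pt_eq : ∀ z, pt (b z, g z) = z
  smooth_b : ContMDiff 𝓘(ℝ, S.V (n + 1)) 𝓘(ℝ, T.V n) ∞ b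
  smooth_g : ContMDiff 𝓘(ℝ, S.V (n + 1)) 𝓘(ℝ, 𝒯.VG n) ∞ g
  smooth_pt : ContMDiff (𝓘(ℝ, T.V n).prod 𝓘(ℝ, 𝒯.VG n)) 𝓘(ℝ, S.V (n + 1)) ∞ pt
  π_eq : ∀ z, c (S.π n z) = b z
  act_eq : ∀ z a, S.act n z a = pt (b z, g z * a)
  mem_frames : ∀ z ζ, ζ ∈ S.frames n z ↔
    T.FrameEquiv n (b z) (Z (b z) ∘ₗ 𝒯.rho n (g z)) (c.d (S.π n z) ∘ₗ ζ)

namespace TrivialExtension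

theorem isFrameReduction (X : TrivialExtension S T (m + 1)) (hT : T.Geo (m + 1)) (hk : k ≤ m)
    (hZ : T.IsFrameField (m + 1) Set.univ X.Z) : S.IsFrameReduction (m + 1) := by
  have hn : k < m + 1 := by omega
  let A : S.Q (m + 2) → 𝒜 ((m + 1 : ℕ) : ℤ) := fun z => (𝒯.vexp hn).symm (Additive.ofMul (X.g z))
  -- The maps `rho` are smooth in the group element only modulo a step of the filtration. The
  -- equivalent representatives `1 + ad A` are affine in `A` and give smooth frames.
  let ad : S.Q (m + 2) → (L →ₗ[ℝ] L) := fun z =>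
    LinearMap.id + (LieAlgebra.ad ℝ L (A z : L) : L →ₗ[ℝ] L)
  have hA : ∀ z, RepEquiv 𝒜 (m + 1) (𝒯.rho (m + 1) (X.g z)) (ad z) := fun z => by
    have h1 := 𝒯.vexp_rho hn (A z)
    rwa [AddEquiv.apply_symm_apply] at h1
  have hl : ∀ z, T.IsLinearFrame (m + 1) (X.b z) (X.Z (X.b z) ∘ₗ ad z) := fun z =>
    (hZ.linear _ trivial).comp_one_add_ad hT (A z).2
  have he : ∀ z, T.FrameEquiv (m + 1) (X.b z) (X.Z (X.b z) ∘ₗ 𝒯.rho (m + 1) (X.g z))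
      (X.Z (X.b z) ∘ₗ ad z) := fun z => (hZ.linear _ trivial).frameEquiv_comp (hA z)
  have hπ : S.π (m + 1) = fun z => X.c.inv (X.b z) := funext fun z => by
    rw [← X.π_eq]; exact (X.c.symm_apply_apply _).symm
  have hπ' : ∀ z, X.c (S.π (m + 1) z) = X.b z := X.π_eq
  have hmem : ∀ z, X.c.inv.d (X.b z) ∘ₗ X.Z (X.b z) ∘ₗ ad z ∈ S.frames (m + 1) z := fun z => by
    rw [X.mem_frames]
    convert he z using 1
    ext x
    rw [← X.π_eq]
    exact X.c.d_inv_d' _ _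
  have hlin : ∀ {z ζ}, ζ ∈ S.frames (m + 1) z → S.IsLinearFrame (m + 1) (S.π (m + 1) z) ζ := by
    intro z ζ h
    rw [X.mem_frames] at h
    rw [← X.iso.isLinearFrame_iff hT, X.π_eq]
    exact ((hl z).of_frameEquiv hT (he z).symm).of_frameEquiv hT h
  refine ⟨?_, ?_, ?_, ?_, ?_, ?_, ?_, ?_, fun z => ⟨_, hmem z⟩, ?_, ?_, ?_⟩
  · rw [hπ]
    exact X.c.symm.contMDiff.comp X.smooth_b
  · rw [show (fun p : S.Q (m + 2) × 𝒯.G (m + 1) => S.act (m + 1) p.1 p.2) =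
      fun p => X.pt (X.b p.1, X.g p.1 * p.2) from funext fun p => X.act_eq _ _]
    exact X.smooth_pt.comp ((X.smooth_b.comp contMDiff_fst).prodMk
      ((X.smooth_g.comp contMDiff_fst).mul contMDiff_snd))
  · intro z; rw [X.act_eq, mul_one, X.pt_eq]
  · intro z a b; rw [X.act_eq, X.act_eq z, X.act_eq, X.b_pt, X.g_pt, mul_assoc]
  · intro z a; rw [hπ]; dsimp only; rw [X.act_eq, X.b_pt]
  · intro z a h
    have h1 := congrArg X.g h
    rw [X.act_eq, X.g_pt] at h1
    exact mul_eq_left.1 h1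
  · intro z w h
    have h1 : X.b z = X.b w := by rw [← X.π_eq, ← X.π_eq, h]
    exact ⟨(X.g z)⁻¹ * X.g w, by rw [X.act_eq, mul_inv_cancel_left, h1, X.pt_eq]⟩
  · intro y
    refine ⟨Set.univ, fun y => X.pt (X.c y, 1), X.g, isOpen_univ, trivial,
      (X.smooth_pt.comp (X.c.contMDiff.prodMk contMDiff_const)).contMDiffOn, fun y _ => ?_,
      X.smooth_g.contMDiffOn, fun z _ => ?_⟩
    · rw [hπ]; dsimp only; rw [X.b_pt]; exact X.c.symm_apply_apply y
    · rw [X.act_eq, X.b_pt, X.g_pt, one_mul, X.π_eq, X.pt_eq]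
  · intro z ζ hζ ζ'
    have hζ1 := (X.mem_frames _ _).1 hζ
    rw [X.mem_frames, ← X.iso.frameEquiv_iff hT, X.π_eq]
    refine ⟨fun h => ⟨hlin ((X.mem_frames _ _).2 h), hζ1.symm.trans h⟩, fun h => hζ1.trans h.2⟩
  · intro z a ζ hζ
    rw [X.mem_frames] at hζ ⊢
    have hπa : S.π (m + 1) (S.act (m + 1) z a) = S.π (m + 1) z := by
      rw [hπ]; dsimp only; rw [X.act_eq, X.b_pt]
    rw [hπa, X.act_eq, X.b_pt, X.g_pt]
    exact ((hZ.linear _ trivial).frameEquiv_comp (𝒯.rho_mul _ _ _)).trans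
      (hζ.comp_right hT.filtered a)
  · intro z
    refine ⟨Set.univ, fun z => X.c.inv.d (X.b z) ∘ₗ X.Z (X.b z) ∘ₗ ad z, isOpen_univ, trivial,
      fun z _ => hmem z, fun x z _ => ?_⟩
    have h1 := hZ.smoothAlongAt_comp_ad (b := X.b) (A := A) (w := z) trivial X.smooth_b.contMDiffAt
      (fun f => ((𝒯.smooth_vlog hn f).comp X.smooth_g).contMDiffAt) x
    have h2 := h1.dmap_apply isOpen_univ trivial fun y _ => X.c.inv.smoothAt y
    rw [hπ]
    exact h2.contMDiffWithinAt

/-- Seen in `T`, the frames over a point are congruent to the normal frame `Z` composed with `1 + ad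
A`. Naturality takes them back to `S`. -/
theorem isWNormal (X : TrivialExtension S T (m + 1)) (hprol : IsProlongation 𝒜 k)
    (hW : IsComplementSystem 𝒜 k W1 W2) (hS : S.Geo (m + 1)) (hT : T.Geo (m + 1)) (hk : k ≤ m)
    (hZ : T.IsFrameField (m + 1) Set.univ X.Z)
    (hZn : ∀ y, T.IsWNormal W1 W2 (m + 1) y (X.Z y)) {z : S.Q (m + 2)} {ζ : L →ₗ[ℝ] S.V (m + 1)}
    (h : ζ ∈ S.frames (m + 1) z) : S.IsWNormal W1 W2 (m + 1) (S.π (m + 1) z) ζ := by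
  have hn : k < m + 1 := by omega
  rw [X.mem_frames] at h
  let A := (𝒯.vexp hn).symm (Additive.ofMul (X.g z))
  have hA := 𝒯.vexp_rho hn A
  rw [AddEquiv.apply_symm_apply] at hA
  have hl := hZ.linear (X.b z) trivial
  have h1 := (hl.frameEquiv_comp hA).symm.trans h
  have h2 := (Tower.isWNormal_iff_of_isWNormal hprol hW hk hT hl (hZn _)
    ((hl.comp_one_add_ad hT A.2).of_frameEquiv hT h1)).2 ⟨A, A.2, h1⟩
  have h3 := X.iso.isIso.symm.isWNormal hT hS h2
  rw [← X.π_eq, show X.c.inv (X.c (S.π (m + 1) z)) = S.π (m + 1) z from X.c.symm_apply_apply _,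
    ← LinearMap.comp_assoc] at h3
  convert h3 using 1
  ext x
  exact (X.c.inv_d_d _ _).symm

end TrivialExtension

end NormalProlongation


set_option linter.unusedSectionVars false

namespace NormalProlongation

open LieModule.Cohomology

variable {L : Type v} [LieRing L] [LieAlgebra ℝ L] {𝒜 : ℤ → Submodule ℝ L}
  [GradedLieAlgebra 𝒜] {k : ℕ} {𝒯 : StructureType.{u} 𝒜 k} {m n : ℕ}
  [htr : Fact (IsTransitive 𝒜)]
  {W1 : ℤ → Submodule ℝ (oneCochain ℝ (gNeg 𝒜) L)}
  {W2 : ℤ → Submodule ℝ (twoCochain ℝ (gNeg 𝒜) L)}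

/-! ### The extension of a tower by a trivial bundle -/

/-- A bundled manifold. -/
structure Level : Type (u + 1) where
  Q : Type u
  V : Type u
  [normed : NormedAddCommGroup V]
  [space : NormedSpace ℝ V]
  [fd : FiniteDimensional ℝ V]
  [top : TopologicalSpace Q]
  [t2 : T2Space Q]
  [sc : SecondCountableTopology Q]
  [charted : ChartedSpace V Q]
  [mfd : IsManifold 𝓘(ℝ, V) ∞ Q]

attribute [instance] Level.normed Level.space Level.fd Level.top Level.t2 Level.sc Level.charted
  Level.mfd

namespace Tower

variable (T : Tower 𝒯)

/-- The `n`-th level of a tower. -/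
def level (n : ℕ) : Level.{u} := ⟨T.Q n, T.V n⟩

/-- The product of the `n`-th level with `G_n`. -/
noncomputable def prodLevel (n : ℕ) : Level.{u} where
  Q := T.Q n × 𝒯.G n
  V := T.V n × 𝒯.VG n
  charted := inferInstanceAs (ChartedSpace (ModelProd (T.V n) (𝒯.VG n)) (T.Q n × 𝒯.G n))
  mfd := by
    rw [modelWithCornersSelf_prod]
    exact IsManifold.prod (T.Q n) (𝒯.G n)

/-- The level `n` of the extension; the flag says whether it is the given one. -/
noncomputable def extLevel (n : ℕ) (β : Bool) : Level.{u} :=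
  match β with
  | true => T.level n
  | false =>
    match n with
    | 0 => T.level 0
    | n + 1 => T.prodLevel n

/-- A map of the given level to the level of the extension, the identity where it is kept. -/
def extIn (n : ℕ) (β : Bool) : T.Q n → (T.extLevel n β).Q :=
  match β with
  | true => fun z => z
  | false =>
    match n with
    | 0 => fun z => z
    | n + 1 => fun z => (T.π n z, 1)

/-- The projections of the extension. -/
def extπ (n : ℕ) (β β' : Bool) : (T.extLevel (n + 1) β').Q → (T.extLevel n β).Q :=
  match β' with
  | true => fun z => T.extIn n β (T.π n z)
  | false => fun z => T.extIn n β z.1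

/-- The actions on the extension. -/
def extAct (n : ℕ) (β' : Bool) : (T.extLevel (n + 1) β').Q → 𝒯.G n → (T.extLevel (n + 1) β').Q :=
  match β' with
  | true => T.act n
  | false => fun z a => (z.1, z.2 * a)

/-- The frames of the extension. -/
def extFrames (Z : ∀ n, T.Q n → (L →ₗ[ℝ] T.V n)) (n : ℕ) (β β' : Bool) :
    (T.extLevel (n + 1) β').Q → Set (L →ₗ[ℝ] (T.extLevel n β).V) :=
  match β with
  | true =>
    match β' with
    | true => T.frames n
    | false => fun z => {ζ | T.FrameEquiv n z.1 (Z n z.1 ∘ₗ 𝒯.rho n z.2) ζ}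
  | false => fun _ => ∅

/-- The levels `n ≤ m + 1` are kept. -/
def keep (m : ℕ) : ℕ → Bool
  | 0 => true
  | n + 1 => decide (n ≤ m)

theorem keep_of_le (h : n ≤ m + 1) : keep m n = true := by
  cases n with
  | zero => rfl
  | succ n => exact decide_eq_true (by omega)

theorem keep_succ : keep m (m + 2) = false := decide_eq_false (by omega)

/-- The extension of the levels `≤ m + 1` of `T` by the bundle of frames through `Z (m + 1)`. -/
noncomputable def ext (m : ℕ) (Z : ∀ n, T.Q n → (L →ₗ[ℝ] T.V n)) : Tower 𝒯 where
  Q n := (T.extLevel n (keep m n)).Q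
  V n := (T.extLevel n (keep m n)).V
  F := T.F
  π n := T.extπ n (keep m n) (keep m (n + 1))
  act n := T.extAct n (keep m (n + 1))
  frames n := T.extFrames Z n (keep m n) (keep m (n + 1))

/-- The identification of the levels that are kept. -/
noncomputable def extDiffeo (n : ℕ) (β : Bool) (h : β = true) : Diffeomorph 𝓘(ℝ, (T.extLevel n β).V)
    𝓘(ℝ, T.V n) (T.extLevel n β).Q (T.Q n) ∞ :=
  match β, h with
  | true, _ => Diffeomorph.refl 𝓘(ℝ, T.V n) (T.Q n) ∞

/-- The differential of `extDiffeo`. -/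
noncomputable def dext (n : ℕ) (β : Bool) (h : β = true) (y : (T.extLevel n β).Q) :
    (T.extLevel n β).V →ₗ[ℝ] T.V n :=
  (mfderiv 𝓘(ℝ, (T.extLevel n β).V) 𝓘(ℝ, T.V n) (T.extDiffeo n β h) y :
    (T.extLevel n β).V →L[ℝ] T.V n).toLinearMap

theorem dext_comp (n : ℕ) (y : T.Q n) (ζ : L →ₗ[ℝ] T.V n) : T.dext n true rfl y ∘ₗ ζ = ζ :=
  LinearMap.ext fun x => LinearMap.congr_fun (LevelDiffeo.d_refl (S := T) y) (ζ x)

/-- With the flags as variables, the equations saying which levels are kept can be substituted away.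
The identities then hold by definition, without transport between types of levels. -/
theorem ext_covers {β β' : Bool} (h : β = true) (h' : β' = true) (z : (T.extLevel (n + 1) β').Q) :
    T.π n (T.extDiffeo (n + 1) β' h' z) = T.extDiffeo n β h (T.extπ n β β' z) := by
  subst h h'; rfl

theorem ext_act {β' : Bool} (h' : β' = true) (z : (T.extLevel (n + 1) β').Q) (a : 𝒯.G n) :
    T.extDiffeo (n + 1) β' h' (T.extAct n β' z a) = T.act n (T.extDiffeo (n + 1) β' h' z) a := by
  subst h'; rfl

theorem ext_frames {Z : ∀ n, T.Q n → (L →ₗ[ℝ] T.V n)} {β β' : Bool} (h : β = true) (h' : β' = true)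
    (z : (T.extLevel (n + 1) β').Q) : T.frames n (T.extDiffeo (n + 1) β' h' z) =
      (fun ζ => T.dext n β h (T.extπ n β β' z) ∘ₗ ζ) '' T.extFrames Z n β β' z := by
  subst h h'
  refine (Set.image_id _).symm.trans (congrArg (fun f => f '' T.frames n z) ?_)
  funext ζ
  exact (T.dext_comp n _ ζ).symm

theorem ext_isEquivariantIso (Z : ∀ n, T.Q n → (L →ₗ[ℝ] T.V n)) : ∀ (n : ℕ) (hn : n ≤ m + 1),
    IsEquivariantIso (T.ext m Z) T n (T.extDiffeo n (keep m n) (keep_of_le hn))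
  | 0, _ => IsIso.refl T 0
  | n + 1, hn => ⟨T.extDiffeo n (keep m n) (keep_of_le (by omega)),
      ext_isEquivariantIso Z n (by omega), T.ext_covers _ _, fun z =>
        ⟨T.ext_frames _ _ z, T.ext_act _ z⟩⟩

theorem exists_ext_data (Z : ∀ n, T.Q n → (L →ₗ[ℝ] T.V n)) {β β' : Bool} (h : β = true)
    (h' : β' = false) : ∃ (b : (T.extLevel (n + 1) β').Q → T.Q n)
      (g : (T.extLevel (n + 1) β').Q → 𝒯.G n) (pt : T.Q n × 𝒯.G n → (T.extLevel (n + 1) β').Q),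
      (∀ y a, b (pt (y, a)) = y) ∧ (∀ y a, g (pt (y, a)) = a) ∧ (∀ z, pt (b z, g z) = z) ∧
      ContMDiff 𝓘(ℝ, (T.extLevel (n + 1) β').V) 𝓘(ℝ, T.V n) ∞ b ∧
      ContMDiff 𝓘(ℝ, (T.extLevel (n + 1) β').V) 𝓘(ℝ, 𝒯.VG n) ∞ g ∧
      ContMDiff (𝓘(ℝ, T.V n).prod 𝓘(ℝ, 𝒯.VG n)) 𝓘(ℝ, (T.extLevel (n + 1) β').V) ∞ pt ∧
      (∀ z, T.extDiffeo n β h (T.extπ n β β' z) = b z) ∧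
      (∀ z a, T.extAct n β' z a = pt (b z, g z * a)) ∧
      (∀ z ζ, ζ ∈ T.extFrames Z n β β' z ↔ T.FrameEquiv n (b z) (Z n (b z) ∘ₗ 𝒯.rho n (g z))
        (T.dext n β h (T.extπ n β β' z) ∘ₗ ζ)) := by
  subst h h'
  refine ⟨Prod.fst, Prod.snd, fun p => p, fun _ _ => rfl, fun _ _ => rfl, fun _ => rfl, ?_, ?_, ?_,
    fun _ => rfl, fun _ _ => rfl, fun z ζ => ?_⟩
  · have h := contMDiff_fst (I := 𝓘(ℝ, T.V n)) (J := 𝓘(ℝ, 𝒯.VG n)) (M := T.Q n) (N := 𝒯.G n) (n := ∞)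
    rw [← modelWithCornersSelf_prod] at h
    exact h
  · have h := contMDiff_snd (I := 𝓘(ℝ, T.V n)) (J := 𝓘(ℝ, 𝒯.VG n)) (M := T.Q n) (N := 𝒯.G n) (n := ∞)
    rw [← modelWithCornersSelf_prod] at h
    exact h
  · have h := contMDiff_id (I := 𝓘(ℝ, T.V n).prod 𝓘(ℝ, 𝒯.VG n)) (M := T.Q n × 𝒯.G n) (n := ∞)
    rw [← modelWithCornersSelf_prod] at h ⊢
    exact h
  · exact iff_of_eq (congrArg (T.FrameEquiv n z.1 (Z n z.1 ∘ₗ 𝒯.rho n z.2))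
      (T.dext_comp n z.1 ζ).symm)

theorem nonempty_trivialExtension (Z : ∀ n, T.Q n → (L →ₗ[ℝ] T.V n)) :
    ∃ X : TrivialExtension (T.ext m Z) T (m + 1), X.Z = Z (m + 1) := by
  obtain ⟨b, g, pt, h1, h2, h3, h4, h5, h6, h7, h8, h9⟩ :=
    T.exists_ext_data (n := m + 1) Z (keep_of_le (m := m) le_rfl) keep_succ
  exact ⟨⟨_, T.ext_isEquivariantIso Z (m + 1) le_rfl, Z (m + 1), b, g, pt, h1, h2, h3, h4, h5, h6,
    h7, h8, h9⟩, rfl⟩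

end Tower

/-- Levels up to `m + 1` are kept, and level `m + 2` becomes the product with `G_{m+1}`, whose
frames are the translates of a global normal frame field. The levels above are filler about which
nothing is claimed. -/
theorem exists_extension (hprol : IsProlongation 𝒜 k) (hW : IsComplementSystem 𝒜 k W1 W2)
    {T : Tower 𝒯} (hk : k ≤ m) (hT : WNormalTo W1 W2 T m) : ∃ T' : Tower 𝒯,
      (∃ c : LevelDiffeo T' T (m + 1), IsIso T' T (m + 1) c) ∧ WNormalTo W1 W2 T' (m + 1) := by
  obtain ⟨Z, hZ, hZn⟩ := hT.geo.exists_global_normal hprol hW hk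
  -- `ext` takes fields on all levels, but only the one on level `m + 1` matters.
  obtain ⟨Zs, rfl⟩ : ∃ Zs : ∀ n, T.Q n → (L →ₗ[ℝ] T.V n), Zs (m + 1) = Z :=
    ⟨Function.update (fun _ _ => 0) (m + 1) Z, Function.update_self ..⟩
  obtain ⟨X, hX⟩ := T.nonempty_trivialExtension (m := m) Zs
  rw [← hX] at hZ hZn
  have hf : (T.ext m Zs).IsFilteredManifold := by
    have h := hT.geo.filtered
    exact ⟨h.antitone, h.zero, h.exhaustive, h.subbundle, h.bracket_mem, h.symbol⟩
  have hg : (T.ext m Zs).Geo (m + 1) := ⟨hf, fun n hn =>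
    (T.ext_isEquivariantIso Zs (n + 1) (by omega)).isFrameReduction (hT.geo.mono (by omega))⟩
  have hg' : (T.ext m Zs).Geo (m + 1 + 1) := ⟨hf, fun n hn => by
    rcases Nat.lt_succ_iff_lt_or_eq.1 hn with h | rfl
    · exact hg.reduction n h
    · exact X.isFrameReduction hT.geo hk hZ⟩
  have hi := (T.ext_isEquivariantIso (m := m) Zs (m + 1) le_rfl).isIso
  refine ⟨T.ext m Zs, ⟨_, hi⟩, hg', fun n hn hl z ζ hζ => ?_⟩
  rcases Nat.le_succ_iff.1 hl with h | rfl
  · exact (WNormalTo.transport hi hg hT).normal n hn h z ζ hζ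
  · exact X.isWNormal hprol hW hg hT.geo hk hZ hZn hζ

/-! ### The diagonal of a sequence of towers -/

/-- The tower with level `n` taken from the `n`-th tower of a sequence. -/
noncomputable def diagonal (T : ℕ → Tower 𝒯) (c : ∀ n, LevelDiffeo (T (n + 1)) (T n) n) :
    Tower 𝒯 where
  Q n := (T n).Q n
  V n := (T n).V n
  F := (T 0).F
  π n z := c n ((T (n + 1)).π n z)
  act n := (T (n + 1)).act n
  frames n z := (fun ζ => (c n).d ((T (n + 1)).π n z) ∘ₗ ζ) '' (T (n + 1)).frames n z

/-- Inductively, the identity of level `n` is an isomorphism onto level `n` of the `n`-th tower. The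
next projection and its frames are corrected by `c n`, so the laws are transported from the tower `n
+ 1`. -/
theorem diagonal_geo {T : ℕ → Tower 𝒯} {c : ∀ n, LevelDiffeo (T (n + 1)) (T n) n}
    (hT : ∀ n, (T n).Geo n) (hc : ∀ n, IsIso (T (n + 1)) (T n) n (c n)) : ∀ n,
    (diagonal T c).Geo n ∧
      IsIso (diagonal T c) (T n) n (Diffeomorph.refl 𝓘(ℝ, (T n).V n) ((T n).Q n) ∞)
  | 0 => by
    have h := (hT 0).filtered
    exact ⟨⟨⟨h.antitone, h.zero, h.exhaustive, h.subbundle, h.bracket_mem, h.symbol⟩,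
      fun n hn => absurd hn (Nat.not_lt_zero n)⟩, IsIso.refl (T 0) 0⟩
  | n + 1 => by
    obtain ⟨hg, hi⟩ := diagonal_geo hT hc n
    let φ : LevelDiffeo (diagonal T c) (T (n + 1)) n := (c n).inv
    have hφ : IsIso (diagonal T c) (T (n + 1)) n φ := hi.trans (hc n).symm
    have he : IsEquivariantIso (diagonal T c) (T (n + 1)) (n + 1)
        (Diffeomorph.refl 𝓘(ℝ, (T (n + 1)).V (n + 1)) ((T (n + 1)).Q (n + 1)) ∞) := by
      refine ⟨φ, hφ.equivariant hg ((hT (n + 1)).mono (Nat.le_succ n)),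
        fun z => ((c n).symm_apply_apply _).symm, fun z => ⟨?_, fun a => rfl⟩⟩
      refine Eq.trans ?_ (Set.image_image _ _ _).symm
      refine (Set.image_id _).symm.trans (congrArg (fun f => f '' (T (n + 1)).frames n z) ?_)
      funext ζ
      exact LinearMap.ext fun x => ((c n).inv_d_d _ _).symm
    exact ⟨⟨hg.filtered, fun j hj => (Nat.lt_succ_iff_lt_or_eq.1 hj).elim (hg.reduction j) (by
      rintro rfl; exact he.isFrameReduction (hT (j + 1)))⟩, he.isIso⟩

/-- Each extension is a new tower that agrees with the old one only up to isomorphism of the kept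
levels. Iteration gives towers normal to order `k + d`, and the diagonal is normal to all orders. -/
theorem exists_isWProlongation (hprol : IsProlongation 𝒜 k) (hW : IsComplementSystem 𝒜 k W1 W2)
    (Q : Tower 𝒯) (hQ : Q.IsGeometric k) : ∃ (S : Tower 𝒯) (ι : LevelDiffeo S Q (k + 1)),
      ∀ l, IsWProlongation W1 W2 Q S ι l := by
  choose E hE hEn using fun (d : ℕ) (x : {T : Tower 𝒯 // WNormalTo W1 W2 T (k + d)}) =>
    exists_extension hprol hW (Nat.le_add_right k d) x.2
  let X : ∀ d, {T : Tower 𝒯 // WNormalTo W1 W2 T (k + d)} := fun d =>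
    Nat.rec ⟨Q, hQ.geo le_rfl, fun n hn hn' => absurd hn (not_lt.2 hn')⟩ (fun d x => ⟨E d x, hEn d x⟩) d
  have hX : ∀ d, ∃ c : LevelDiffeo (X (d + 1)).1 (X d).1 (k + d + 1),
      IsIso (X (d + 1)).1 (X d).1 (k + d + 1) c := fun d => hE d (X d)
  choose c hc using hX
  choose c' hc' hcc' using fun d => (hc d).exists_pr (by omega : d ≤ k + d + 1)
  have hQi : ∀ d, ∃ φ : LevelDiffeo (X d).1 Q (k + 1), IsIso (X d).1 Q (k + 1) φ := by
    intro d
    induction d with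
    | zero => exact ⟨_, IsIso.refl Q (k + 1)⟩
    | succ d ih =>
      obtain ⟨φ, hφ⟩ := ih
      obtain ⟨ψ, hψ, -⟩ := (hc d).exists_pr (by omega : k + 1 ≤ k + d + 1)
      exact ⟨_, hψ.trans hφ⟩
  have hd := diagonal_geo (T := fun d => (X d).1) (fun d => (X d).2.geo.mono (by omega)) hc'
  -- Level `k + 1` of the diagonal is that of the tower with index `k + 1`, which is compared with
  -- `Q` through the intermediate ones.
  obtain ⟨φ, hφ⟩ := hQi (k + 1)
  refine ⟨diagonal (fun d => (X d).1) c', φ, fun l => ?_⟩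
  have hn := WNormalTo.transport (hd (l + 1)).2 (hd (l + 1)).1 ((X (l + 1)).2.mono (by omega))
  exact ⟨⟨hn.geo.filtered, fun n hn' => hn.geo.reduction n (by omega)⟩,
    (hd (k + 1)).2.trans hφ, hn.normal⟩

end NormalProlongation
open NormalProlongation in
theorem theoremA {L : Type v} [LieRing L] [LieAlgebra ℝ L]
    (𝒜 : ℤ → Submodule ℝ L) [GradedLieAlgebra 𝒜] (htrans : IsTransitive 𝒜)
    (k : ℕ) (hprol : IsProlongation 𝒜 k)
    (W1 : ℤ → Submodule ℝ (LieModule.Cohomology.oneCochain ℝ (gNeg 𝒜) L))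
    (W2 : ℤ → Submodule ℝ (LieModule.Cohomology.twoCochain ℝ (gNeg 𝒜) L))
    (hW : IsComplementSystem 𝒜 k W1 W2)
    (𝒯 : StructureType.{u} 𝒜 k) :
    -- existence of the tower of `W`-normal step prolongations
    (∀ Q : Tower 𝒯, Q.IsGeometric k →
      ∃ (S : Tower 𝒯) (ι : LevelDiffeo S Q (k + 1)), ∀ l, IsWProlongation W1 W2 Q S ι l) ∧
    -- it is cut out by the conditions on `κ` and `τ`, which are well-defined, and it is maximal
    (∀ (Q S : Tower 𝒯) (ι : LevelDiffeo S Q (k + 1)) (l : ℕ), Q.IsGeometric k →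
      IsWProlongation W1 W2 Q S ι l → ∀ n, k < n → n ≤ l →
        S.StructureFunctionsWellDefined n ∧
        ∀ (y : S.Q n) (ζ : L →ₗ[ℝ] S.V n), S.IsLinearFrame n y ζ →
          (S.IsWNormal W1 W2 n y ζ ↔ ∃ z, S.π n z = y ∧ ζ ∈ S.frames n z)) ∧
    -- isomorphisms lift uniquely (with `P = Q`, `φ = id`: uniqueness of the prolongation)
    (∀ (P Q S T : Tower 𝒯) (ι : LevelDiffeo S P (k + 1)) (j : LevelDiffeo T Q (k + 1)) (d : ℕ),
      P.IsGeometric k → Q.IsGeometric k →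
      IsWProlongation W1 W2 P S ι (k + d) → IsWProlongation W1 W2 Q T j (k + d) →
      ∀ φ : LevelDiffeo P Q (k + 1), IsIso P Q (k + 1) φ →
        ∃! Φ : LevelDiffeo S T (k + 1 + d),
          IsIso S T (k + 1 + d) Φ ∧ Prolongs ι j φ d Φ) ∧
    -- the converse for connected structure groups
    ((∀ n, n ≤ k → ConnectedSpace (𝒯.G n)) →
      ∀ (P Q S T : Tower 𝒯) (ι : LevelDiffeo S P (k + 1)) (j : LevelDiffeo T Q (k + 1)) (d : ℕ),
      P.IsGeometric k → Q.IsGeometric k →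
      IsWProlongation W1 W2 P S ι (k + 1 + d) → IsWProlongation W1 W2 Q T j (k + 1 + d) →
      ∀ Φ : LevelDiffeo S T (k + 1 + (d + 1)), PreservesPfaffClass S T (k + 1 + d) Φ →
        ∃ φ : LevelDiffeo P Q (k + 1), IsIso P Q (k + 1) φ ∧
          IsIso S T (k + 1 + (d + 1)) Φ ∧ Prolongs ι j φ (d + 1) Φ) ∧
    -- the projective limit carries the absolute parallelism `θ`; finite type
    (∀ (Q S : Tower 𝒯) (ι : LevelDiffeo S Q (k + 1)), Q.IsGeometric k →
      (∀ l, IsWProlongation W1 W2 Q S ι l) →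
        IsAbsoluteParallelism S ∧
        (FiniteDimensional ℝ L →
          (∃ N : ℕ, ∀ n, N ≤ n →
            (∃ Ψ : Diffeomorph 𝓘(ℝ, S.V (n + 1)) 𝓘(ℝ, S.V n) (S.Q (n + 1)) (S.Q n) ∞,
              ∀ z, Ψ z = S.π n z) ∧
            (Nonempty (S.Q n) → Module.finrank ℝ (S.V n) = Module.finrank ℝ L)) ∧
          ∀ p : Lim S, FiniteDimensional ℝ (limTangent S p) ∧
            Module.finrank ℝ (limTangent S p) = Module.finrank ℝ L)) ∧
    -- order `∞`: lifting, its converse, and reduction of the equivalence problem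
    (∀ (P Q S T : Tower 𝒯) (ι : LevelDiffeo S P (k + 1)) (j : LevelDiffeo T Q (k + 1)),
      P.IsGeometric k → Q.IsGeometric k →
      (∀ l, IsWProlongation W1 W2 P S ι l) → (∀ l, IsWProlongation W1 W2 Q T j l) →
        (∀ φ : LevelDiffeo P Q (k + 1), IsIso P Q (k + 1) φ →
          (∃! Φ : Lim S ≃ Lim T, IsLimIso Φ ∧ LimProlongs ι j φ Φ) ∧
          ∀ Φ : Lim S ≃ Lim T, IsLimIso Φ → LimProlongs ι j φ Φ → IsParallelismIso Φ) ∧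
        ((∀ n, n ≤ k → ConnectedSpace (𝒯.G n)) →
          (∀ Φ : Lim S ≃ Lim T, IsParallelismIso Φ →
            ∃ φ : LevelDiffeo P Q (k + 1), IsIso P Q (k + 1) φ ∧
              IsLimIso Φ ∧ LimProlongs ι j φ Φ) ∧
          ((∃ φ : LevelDiffeo P Q (k + 1), IsIso P Q (k + 1) φ) ↔
            ∃ Φ : Lim S ≃ Lim T, IsParallelismIso Φ))) := by
  have : Fact (IsTransitive 𝒜) := ⟨htrans⟩
  refine ⟨fun Q hQ => exists_isWProlongation hprol hW Q hQ, ?_, ?_, ?_, ?_, ?_⟩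
  · intro Q S ι l _ h n hkn hnl
    obtain ⟨m, rfl⟩ : ∃ m, n = m + 1 := ⟨n - 1, by omega⟩
    have hS := h.wNormalTo
    exact ⟨(hS.geo.mono (by omega)).structureFunctionsWellDefined, fun y ζ hζ =>
      Tower.isWNormal_iff_exists_mem_frames hprol hW (by omega) (hS.geo.mono (by omega))
        (hS.normal _ hkn hnl) hζ⟩
  · intro P Q S T ι j d _ _ hS hT φ hφ
    exact existsUnique_lift hprol hW hS hT hφ
  · intro hG P Q S T ι j d _ _ hS hT Φ h
    exact exists_isIso_of_preservesPfaffClass hG hS hT h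
  · intro Q S ι _ hS
    have hg : ∀ n, S.Geo n := fun n => (hS n).wNormalTo.geo.mono (Nat.le_succ n)
    exact ⟨isAbsoluteParallelism hg, fun _ => finite_type hg⟩
  · intro P Q S T ι j _ _ hS hT
    obtain ⟨r⟩ := nonempty_sections hprol hW fun l => (hS l).wNormalTo
    have hg : ∀ n, S.Geo n := fun n => (hS n).wNormalTo.geo.mono (Nat.le_succ n)
    refine ⟨fun φ hφ => ⟨existsUnique_limIso hprol hW hS hT hφ, fun Φ hΦ _ =>
      hΦ.isParallelismIso r hg⟩, fun hG => ⟨fun Φ h =>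
        exists_isIso_of_isParallelismIso hprol hW hG hS hT h, ?_, ?_⟩⟩
    · rintro ⟨φ, hφ⟩
      obtain ⟨Φ, ⟨hΦ, -⟩, -⟩ := existsUnique_limIso hprol hW hS hT hφ
      exact ⟨Φ, hΦ.isParallelismIso r hg⟩
    · rintro ⟨Φ, h⟩
      obtain ⟨φ, hφ, -⟩ := exists_isIso_of_isParallelismIso hprol hW hG hS hT h
      exact ⟨φ, hφ⟩
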